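/- **Theorem 3.1 (Local existence with singular initial condition).** Let $N,k\ge1$ be integers, and write $z=(x,y)\in\mathbb R^{N}\times\mathbb R^{k}=\mathbb R^{N+k}$. Let $\gamma<1$, $k_1,k_2\in\mathbb R$, $p_1,p_2>1$ and $1\le q<\infty$. Consider $$u_t-\tfrac12\left(\Delta_x+|x|^2\Delta_y\right)u=k_1\int_0^t(t-s)^{-\gamma}|u|^{p_1-1}u(s)\,ds+k_2|u|^{p_2-1}u,\qquad u(0)=u_0. \tag{P}$$ Let $S(t)$, $t\ge 0$, be the heat semigroup of the Grushin operator: $S(0)\varphi=\varphi$ and, for $t>0$, $$S(t)\varphi(x,y)=\int_{\mathbb R^{N+k}}K(x,x_0,y-y_0;t)\,\varphi(x_0,y_0)\,dx_0\,dy_0,$$ $$K(x,x_0,y;t)=\frac1{(2\pi)^{\frac{N+2k}2}}\int_{\mathbb R^k}\Big(\frac{|\xi|}{\sinh(|\xi|t)}\Big)^{\frac N2}e^{\,i\xi\cdot y-\frac{|\xi|}2\left((|x|^2+|x_0|^2)\coth(|\xi|t)-2x\cdot x_0\,\mathrm{csch}(|\xi|t)\right)}\,d\xi .$$ An $L^q$-mild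 solution of (P) on $[0,T]$ is a function $u\in L^\infty([0,T];L^q(\mathbb R^{N+k}))$ such that, for every $t\in[0,T]$, $$u(t)=S(t)u_0+k_1\int_0^tS(t-s)\int_0^s(s-\tau)^{-\gamma}|u(\tau)|^{p_1-1}u(\tau)\,d\tau\,ds+k_2\int_0^tS(t-s)|u(s)|^{p_2-1}u(s)\,ds$$ almost everywhere, where the integrals converge absolutely for almost every $z$. Put $r_i=p_iq$ and $\alpha_i=\frac{N+2k}{2p_iq}(p_i-1)$ for $i=1,2$, and let $X_T$ be the space of measurable functions $u$ on $(0,T)\times\mathbb R^{N+k}$ with $$\|u\|_{X_T}=\sup_{0<t<T}\|u(t)\|_{L^q}+\max_{i=1,2}\ \sup_{0<t<T}t^{\alpha_i}\|u(t)\|_{L^{r_i}}<\infty .$$ Assume that $q>\max_{i=1,2}\frac{N+2k}2(p_i-1)$. Then there are a constant $C>0$, depending only on $N,k,\gamma,k_1,k_2,p_1,p_2,q$, and for every $u_0\in L^q(\mathbb R^{N+k})$ a time $T(u_0)>0$, such that for every $u_0\in L^q(\mathbb R^{N+k})$, with $T=T(u_0)$, problem (P) has an $L^q$-mild solution $u\in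 X_T$ on $[0,T]$, which is the only $L^q$-mild solution on $[0,T]$ in $X_T$. Moreover: (i) (Continuous dependence) If $u_0,v_0\in L^q(\mathbb R^{N+k})$, $T=\min\{T(u_0),T(v_0)\}$, and $u,v\in X_T$ are $L^q$-mild solutions on $[0,T]$ with initial data $u_0$ and $v_0$, then $$\sup_{t\in[0,T]}\|u(t)-v(t)\|_{L^q}+\max_{i=1,2}\ \sup_{t\in(0,T)}t^{\alpha_i}\|u(t)-v(t)\|_{L^{r_i}}\le C\|u_0-v_0\|_{L^q}.$$ (ii) (Decay) $\lim_{t\to0^+}t^{\alpha_i}\|u(t)\|_{L^{r_i}}=0$ for $i=1,2$. (iii) If in addition $q\ge\max\{p_1,p_2\}$, then $u\in C([0,T];L^q(\mathbb R^{N+k}))$, and $u$ is the only $L^q$-mild solution on $[0,T]$ in this space. In this case there are $T_{\max}=T_{\max}(u_0)\in(0,\infty]$ and a maximal mild solution $w\in C([0,T_{\max});L^q(\mathbb R^{N+k}))$ with $w(0)=u_0$: $w$ is an $L^q$-mild solution on $[0,T']$ for every $0<T'<T_{\max}$, and every $L^q$-mild solution in $C([0,T'];L^q(\mathbb R^{N+k}))$,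 $T'>0$, has $T'<T_{\max}$ and is the restriction of $w$ to $[0,T']$. Furthermore, either $T_{\max}=\infty$, or else $T_{\max}<\infty$ and $$\lim_{t\to T_{\max}^-}\|w\|_{L^\infty((0,t);L^q(\mathbb R^{N+k}))}=+\infty .$$ (iv) If $u_0\ge0$ and $k_1,k_2\ge0$, then $u(t)\ge0$ almost everywhere for all $t\in[0,T]$. -/

import Mathlib

open MeasureTheory Set Filter Topology
open scoped ENNReal

namespace Grushin

noncomputable section

/-- The space `ℝ^{N+k}`, with points `z = (x, y)`, `x ∈ ℝ^N`, `y ∈ ℝ^k`, and Lebesgue measure. -/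
abbrev Space (N k : ℕ) : Type := EuclideanSpace ℝ (Fin N) × EuclideanSpace ℝ (Fin k)

/-- The heat kernel `K(x, x₀, y; t)` of the Grushin operator `½ (Δ_x + |x|² Δ_y)`, for `t > 0`.
The integral is a real number (the integrand at `-ξ` is the conjugate of the integrand at `ξ`), so
taking the real part only changes the type. -/
def heatKernel {N k : ℕ} (x x₀ : EuclideanSpace ℝ (Fin N)) (y : EuclideanSpace ℝ (Fin k))
    (t : ℝ) : ℝ :=
  1 / (2 * Real.pi) ^ (((N : ℝ) + 2 * k) / 2) *
    (∫ ξ : EuclideanSpace ℝ (Fin k),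
      (((‖ξ‖ / Real.sinh (‖ξ‖ * t)) ^ ((N : ℝ) / 2) : ℝ) : ℂ) *
        Complex.exp (Complex.I * ((inner ℝ ξ y : ℝ) : ℂ) -
          ((‖ξ‖ / 2 * ((‖x‖ ^ 2 + ‖x₀‖ ^ 2) * (Real.cosh (‖ξ‖ * t) / Real.sinh (‖ξ‖ * t))
            - 2 * (inner ℝ x x₀ : ℝ) * (1 / Real.sinh (‖ξ‖ * t))) : ℝ) : ℂ))).re

/-- The heat semigroup `S(t)` of the Grushin operator: convolution-type integral against the heat
kernel for `t > 0`, and the identity at `t = 0`. -/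
def semigroup {N k : ℕ} (t : ℝ) (φ : Space N k → ℝ) (z : Space N k) : ℝ :=
  if t = 0 then φ z else ∫ w : Space N k, heatKernel z.1 w.1 (z.2 - w.2) t * φ w

/-- The nonlinearity `a ↦ |a|^{p-1} a`. -/
def power (p a : ℝ) : ℝ := |a| ^ (p - 1) * a

/-- The memory term `∫₀ˢ (s-τ)^{-γ} |u(τ)|^{p-1} u(τ) dτ`. -/
def memory {N k : ℕ} (γ p : ℝ) (u : ℝ → Space N k → ℝ) (s : ℝ) (w : Space N k) : ℝ :=
  ∫ τ in (0 : ℝ)..s, (s - τ) ^ (-γ) * power p (u τ w)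

/-- `u` is an `L^q`-mild solution on `[0, T]`, with initial condition `u₀`, of
`u_t - ½(Δ_x + |x|²Δ_y) u = κ₁ ∫₀ᵗ (t-s)^{-γ} |u|^{p₁-1} u(s) ds + κ₂ |u|^{p₂-1} u`.
An element of `L^∞([0,T], L^q)` is given by a jointly measurable function of `(t, z)`, and the
integral equation holds for every `t ∈ [0, T]`, as an equality of elements of `L^q`. That the
iterated integrals in the equation converge (absolutely) is part of the definition. -/
structure IsMildSolution {N k : ℕ} (γ κ₁ κ₂ p₁ p₂ q T : ℝ) (u₀ : Space N k → ℝ)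
    (u : ℝ → Space N k → ℝ) : Prop where
  aestronglyMeasurable : AEStronglyMeasurable (fun a : ℝ × Space N k => u a.1 a.2)
    ((volume.restrict (Icc 0 T)).prod volume)
  memLp : ∀ t ∈ Icc 0 T, MemLp (u t) (ENNReal.ofReal q) volume
  bounded : ⨆ t ∈ Icc 0 T, eLpNorm (u t) (ENNReal.ofReal q) volume < ∞
  integrable_memory : ∀ t ∈ Icc 0 T, ∀ᵐ z : Space N k,
    IntegrableOn (fun a : (ℝ × ℝ) × Space N k =>
      heatKernel z.1 a.2.1 (z.2 - a.2.2) (t - a.1.1) *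
        ((a.1.1 - a.1.2) ^ (-γ) * power p₁ (u a.1.2 a.2)))
      {a | 0 < a.1.2 ∧ a.1.2 < a.1.1 ∧ a.1.1 < t} volume
  integrable_local : ∀ t ∈ Icc 0 T, ∀ᵐ z : Space N k,
    IntegrableOn (fun a : ℝ × Space N k =>
      heatKernel z.1 a.2.1 (z.2 - a.2.2) (t - a.1) * power p₂ (u a.1 a.2))
      {a | 0 < a.1 ∧ a.1 < t} volume
  equation : ∀ t ∈ Icc 0 T, ∀ᵐ z : Space N k,
    u t z = semigroup t u₀ z
      + κ₁ * (∫ s in (0 : ℝ)..t, semigroup (t - s) (memory γ p₁ u s) z)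
      + κ₂ * (∫ s in (0 : ℝ)..t, semigroup (t - s) (fun w => power p₂ (u s w)) z)

/-- The exponent `α = (N+2k)(p-1) / (2 p q)`. -/
def alpha (N k : ℕ) (p q : ℝ) : ℝ := ((N : ℝ) + 2 * k) / (2 * p * q) * (p - 1)

/-- The weighted norm `t^α ‖f‖_{L^r}` with `r = p q`, with values in `[0, ∞]`. -/
def weightedNorm {N k : ℕ} (p q t : ℝ) (f : Space N k → ℝ) : ℝ≥0∞ :=
  ENNReal.ofReal (t ^ alpha N k p q) * eLpNorm f (ENNReal.ofReal (p * q)) volume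

/-- The norm of `X_T`, with values in `[0, ∞]`. -/
def normX {N k : ℕ} (p₁ p₂ q T : ℝ) (u : ℝ → Space N k → ℝ) : ℝ≥0∞ :=
  (⨆ t ∈ Ioo 0 T, eLpNorm (u t) (ENNReal.ofReal q) volume) +
    max (⨆ t ∈ Ioo 0 T, weightedNorm p₁ q t (u t)) (⨆ t ∈ Ioo 0 T, weightedNorm p₂ q t (u t))

/-- Membership in `X_T`. Finiteness of the norm contains that `u` is bounded in `L^q` on `(0, T)`
and locally bounded in `L^{p₁ q}` and in `L^{p₂ q}` there. -/
structure MemX {N k : ℕ} (p₁ p₂ q T : ℝ) (u : ℝ → Space N k → ℝ) : Prop where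
  aestronglyMeasurable : AEStronglyMeasurable (fun a : ℝ × Space N k => u a.1 a.2)
    ((volume.restrict (Ioo 0 T)).prod volume)
  aestronglyMeasurable_slice : ∀ t ∈ Ioo 0 T, AEStronglyMeasurable (u t) volume
  normX_lt_top : normX p₁ p₂ q T u < ∞

/-- `u ∈ C(I; L^q)`. -/
def ContinuousInLq {N k : ℕ} (q : ℝ) (I : Set ℝ) (u : ℝ → Space N k → ℝ) : Prop :=
  ∀ t ∈ I, MemLp (u t) (ENNReal.ofReal q) volume ∧
    Tendsto (fun s => eLpNorm (u s - u t) (ENNReal.ofReal q) volume) (𝓝[I] t) (𝓝 0)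

/-- `w` is the maximal mild solution in `C([0, Tmax); L^q)` with `w(0) = u₀`, `0 < Tmax ≤ ∞`: it is
a mild solution on every `[0, T]` with `T < Tmax`, and every mild solution in `C([0, T]; L^q)`
satisfies `T < Tmax` and is a restriction of `w`. -/
structure IsMaximalSolution {N k : ℕ} (γ κ₁ κ₂ p₁ p₂ q : ℝ) (u₀ : Space N k → ℝ)
    (Tmax : ℝ≥0∞) (w : ℝ → Space N k → ℝ) : Prop where
  pos : 0 < Tmax
  initial : w 0 =ᵐ[volume] u₀
  continuous : ContinuousInLq q {t | 0 ≤ t ∧ ENNReal.ofReal t < Tmax} w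
  mild : ∀ T : ℝ, 0 < T → ENNReal.ofReal T < Tmax → IsMildSolution γ κ₁ κ₂ p₁ p₂ q T u₀ w
  maximal : ∀ (T : ℝ) (v : ℝ → Space N k → ℝ), 0 < T →
    IsMildSolution γ κ₁ κ₂ p₁ p₂ q T u₀ v → ContinuousInLq q (Icc 0 T) v →
    ENNReal.ofReal T < Tmax ∧ ∀ t ∈ Icc 0 T, v t =ᵐ[volume] w t

end

end Grushin

namespace Grushin

/-! ### Partial products and partial fractions of hyperbolic functions -/

/-! Three facts about the kernel carry the linear theory: it is nonnegative, it has mass one in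
either point, and it is bounded by a constant times t^{-(N+2k)/2}. Only the last can be read off the
oscillatory formula. In y the kernel is the Fourier transform of the radial function `symbol`.
Euler's product for sinh and the partial fractions of coth exhibit the symbol as a limit of products
of factors (1 + a|ξ|²)^{-N/2} and exp(-c(1 - (1 + a|ξ|²)^{-1})) with a, c ≥ 0. Through the Gamma
integral and the exponential series these are built from Gaussians with positive coefficients, so
multiplication by them preserves nonnegativity of Fourier transforms (`posMultiplier_symbolExt`,
`heatKernel_nonneg`). The mass is found by testing against a Gaussian and rescaling; the limit
theorem used there, `tendsto_lintegral_heatKernel_mul_gaussian`, also gives concentration as t → 0.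
Interpolation between mass and height yields L^a → L^b smoothing with exponent (N+2k)/2 · (1/a -
1/b) (`opBound_kerH`).

Fubini turns the memory term into a Volterra operator with kernel `kerM`, which smooths like the
heat kernel but with a time singularity weaker by 1 - γ. The problem becomes u = S(t)u₀ + ∑ cᵢ ∫₀ᵗ
Kᵢ(t-τ)|u|^{pᵢ-1}u dτ, treated abstractly in `Scheme`. The condition on q says that pᵢαᵢ < 1, so
that the nonlinearity is integrable in time at 0. The central estimate is `diffBound_contract`: in
norms weighted by e^{λτ} the nonlinear part is Lipschitz on balls with an arbitrarily small
constant, because e^{-λσ} ≤ (λσ)^{-ε} trades a little integrability in time for a factor λ^{-ε}. It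
gives uniqueness on intervals of any length, a contraction on short ones (hence existence by Picard
iteration and Lipschitz dependence), absolute convergence of the integrals, and the decay of the
weighted norms at 0. The estimate is used in two instances: `Problem.weighted`, with the norms of
X_T, and `Problem.uniform`, with only the L^q norm, available when q ≥ max p₁ p₂.

For large q, mild solutions are continuous in L^q by dominated convergence with moving majorants
(`tendsto_volterra_kerH`, `tendsto_volterra_kerM`). The equation has memory, so a solution is not
restarted at time T. Instead its history on [0, T] is kept as a source term and the Volterra
equation is solved for the remainder (`exists_extension`); the law S(t+s) = S(t)S(s) is never
needed. The extension time depends only on bounds for the norm and for T, which gives the maximal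
solution and the blow-up alternative. -/

theorem tendsto_prod_sinh (v : ℝ) :
    Tendsto (fun n : ℕ => Real.pi * v * ∏ j ∈ Finset.range n, (1 + v ^ 2 / ((j : ℝ) + 1) ^ 2))
      atTop (𝓝 (Real.sinh (Real.pi * v))) := by
  -- The product for sin at the imaginary point iv, multiplied by -i, since sin(iπv) = i sinh(πv).
  have h := Complex.tendsto_euler_sin_prod (v * Complex.I)
  have h2 := (h.mul_const (-Complex.I))
  have e1 : Complex.sin (Real.pi * (v * Complex.I)) * (-Complex.I)
      = ((Real.sinh (Real.pi * v) : ℝ) : ℂ) := by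
    rw [← mul_assoc, Complex.sin_mul_I, mul_assoc]
    simp
  rw [e1] at h2
  have h3 := (Complex.continuous_re.tendsto _).comp h2
  simp only [Complex.ofReal_re] at h3
  refine h3.congr fun n => ?_
  simp only [Function.comp_apply]
  have : (Real.pi * (v * Complex.I) * ∏ j ∈ Finset.range n,
      (1 - (v * Complex.I) ^ 2 / ((j : ℂ) + 1) ^ 2)) * (-Complex.I)
      = ((Real.pi * v * ∏ j ∈ Finset.range n, (1 + v ^ 2 / ((j : ℝ) + 1) ^ 2) : ℝ) : ℂ) := by
    push_cast
    have : ∀ j : ℕ, (1 - (v * Complex.I) ^ 2 / ((j : ℂ) + 1) ^ 2)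
        = (1 + (v : ℂ) ^ 2 / ((j : ℂ) + 1) ^ 2) := fun j => by
      rw [mul_pow, Complex.I_sq]; ring
    simp_rw [this]
    linear_combination (-(Real.pi : ℂ) * v * ∏ j ∈ Finset.range n,
      (1 + (v : ℂ) ^ 2 / ((j : ℂ) + 1) ^ 2)) * Complex.I_sq
  rw [this, Complex.ofReal_re]

/-- The Mittag-Leffler expansion of π cot at iv, multiplied by i. The poles ±(j+1) pair up to the
real terms 2v/(v² + (j+1)²). -/
theorem tendsto_sum_coth {v : ℝ} (hv : 0 < v) :
    Tendsto (fun n : ℕ => 1 / v + ∑ j ∈ Finset.range n, 2 * v / (v ^ 2 + ((j : ℝ) + 1) ^ 2))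
      atTop (𝓝 (Real.pi * (Real.cosh (Real.pi * v) / Real.sinh (Real.pi * v)))) := by
  have hz : (v * Complex.I : ℂ) ∈ Complex.integerComplement := by
    rw [Complex.mem_integerComplement_iff]
    rintro ⟨n, hn⟩
    have := congrArg Complex.im hn
    simp at this
    exact hv.ne this
  have h0 := cot_series_rep' hz
  have hs := (summable_cotTerm hz).hasSum.tendsto_sum_nat
  simp only [cotTerm] at hs
  rw [← h0] at hs
  have h2 := (hs.mul_const Complex.I)
  have e1 : (Real.pi * Complex.cot (Real.pi * (v * Complex.I)) - 1 / (v * Complex.I)) * Complex.I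
      = ((Real.pi * (Real.cosh (Real.pi * v) / Real.sinh (Real.pi * v)) - 1 / v : ℝ) : ℂ) := by
    rw [← mul_assoc, Complex.cot, Complex.sin_mul_I, Complex.cos_mul_I]
    have : (Complex.sinh (Real.pi * v)) ≠ 0 := by
      rw [← Complex.ofReal_mul, ← Complex.ofReal_sinh]
      exact_mod_cast (Real.sinh_pos_iff.2 (by positivity)).ne'
    have hv' : (v : ℂ) ≠ 0 := by exact_mod_cast hv.ne'
    push_cast
    field_simp
  rw [e1] at h2
  have h3 := ((Complex.continuous_re.tendsto _).comp h2).const_add (1 / v)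
  simp only [Complex.ofReal_re, add_sub_cancel] at h3
  refine h3.congr fun n => ?_
  simp only [Function.comp_apply]
  congr 1
  have : (∑ j ∈ Finset.range n,
      (1 / (v * Complex.I - ((j : ℂ) + 1)) + 1 / (v * Complex.I + ((j : ℂ) + 1)))) * Complex.I
      = ((∑ j ∈ Finset.range n, 2 * v / (v ^ 2 + ((j : ℝ) + 1) ^ 2) : ℝ) : ℂ) := by
    push_cast
    rw [Finset.sum_mul]
    refine Finset.sum_congr rfl fun j _ => ?_
    have hj : (v : ℂ) ^ 2 + ((j : ℂ) + 1) ^ 2 ≠ 0 := by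
      have : 0 < v ^ 2 + ((j : ℝ) + 1) ^ 2 := by positivity
      exact_mod_cast this.ne'
    have e : (v * Complex.I - ((j : ℂ) + 1)) * (v * Complex.I + ((j : ℂ) + 1))
        = - ((v : ℂ) ^ 2 + ((j : ℂ) + 1) ^ 2) := by
      linear_combination (v : ℂ) ^ 2 * Complex.I_sq
    have h1 : (v * Complex.I - ((j : ℂ) + 1)) ≠ 0 := fun h => by
      rw [h, zero_mul] at e; exact hj (neg_eq_zero.1 e.symm)
    have h2 : (v * Complex.I + ((j : ℂ) + 1)) ≠ 0 := fun h => by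
      rw [h, mul_zero] at e; exact hj (neg_eq_zero.1 e.symm)
    rw [div_add_div _ _ h1 h2, e, div_mul_eq_mul_div, div_eq_div_iff (neg_ne_zero.2 hj) hj]
    linear_combination (-2 * (v : ℂ) * (v ^ 2 + ((j : ℂ) + 1) ^ 2)) * -Complex.I_sq
  rw [this, Complex.ofReal_re]

/-! ### Positive multipliers -/

section Multiplier

variable {V : Type*} [NormedAddCommGroup V] [InnerProductSpace ℝ V] [FiniteDimensional ℝ V]
  [MeasurableSpace V] [BorelSpace V]

open scoped ComplexOrder

/-- Integrable functions with nonnegative Fourier transform. -/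
def PosFourier (g : V → ℂ) : Prop :=
  Integrable g ∧ ∀ y : V, 0 ≤ ∫ ξ, Complex.exp (Complex.I * (inner ℝ ξ y : ℝ)) * g ξ

/-- Bounded functions for which multiplication preserves nonnegativity of the Fourier transform. -/
structure PosMultiplier (h : V → ℂ) : Prop where
  measurable : Measurable h
  bounded : ∃ C, ∀ ξ, ‖h ξ‖ ≤ C
  pos : ∀ g, PosFourier g → PosFourier (fun ξ => h ξ * g ξ)

theorem norm_exp_I_mul (a : ℝ) : ‖Complex.exp (Complex.I * a)‖ = 1 := by
  rw [mul_comm, Complex.norm_exp_ofReal_mul_I]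

theorem integrable_bdd_mul {h g : V → ℂ} (hh : Measurable h) {C : ℝ} (hC : ∀ ξ, ‖h ξ‖ ≤ C)
    (hg : Integrable g) : Integrable (fun ξ => h ξ * g ξ) :=
  hg.bdd_mul (c := C) hh.aestronglyMeasurable (ae_of_all _ hC)

/-- Products are compositions of the two multiplications. This is the reason for defining positivity
through multiplication: no convolution theorem and no Bochner theorem is required. -/
theorem PosMultiplier.mul {h₁ h₂ : V → ℂ} (H₁ : PosMultiplier h₁) (H₂ : PosMultiplier h₂) :
    PosMultiplier (fun ξ => h₁ ξ * h₂ ξ) := by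
  obtain ⟨C₁, hC₁⟩ := H₁.bounded
  obtain ⟨C₂, hC₂⟩ := H₂.bounded
  refine ⟨H₁.measurable.mul H₂.measurable, ⟨C₁ * C₂, fun ξ => ?_⟩, fun g hg => ?_⟩
  · rw [norm_mul]
    exact mul_le_mul (hC₁ ξ) (hC₂ ξ) (norm_nonneg _) ((norm_nonneg _).trans (hC₁ ξ))
  · simpa only [mul_assoc] using H₁.pos _ (H₂.pos g hg)

theorem PosMultiplier.const {c : ℝ} (hc : 0 ≤ c) : PosMultiplier (fun _ : V => (c : ℂ)) := by
  refine ⟨measurable_const, ⟨‖(c : ℂ)‖, fun _ => le_rfl⟩, fun g hg => ⟨hg.1.const_mul _, fun y => ?_⟩⟩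
  have : ∀ ξ, Complex.exp (Complex.I * (inner ℝ ξ y : ℝ)) * ((c : ℂ) * g ξ)
      = c * (Complex.exp (Complex.I * (inner ℝ ξ y : ℝ)) * g ξ) := fun ξ => by ring
  simp_rw [this, integral_const_mul]
  exact mul_nonneg (by exact_mod_cast hc) (hg.2 y)

theorem PosMultiplier.add {h₁ h₂ : V → ℂ} (H₁ : PosMultiplier h₁) (H₂ : PosMultiplier h₂) :
    PosMultiplier (fun ξ => h₁ ξ + h₂ ξ) := by
  obtain ⟨C₁, hC₁⟩ := H₁.bounded
  obtain ⟨C₂, hC₂⟩ := H₂.bounded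
  refine ⟨H₁.measurable.add H₂.measurable, ⟨C₁ + C₂, fun ξ =>
    (norm_add_le _ _).trans (add_le_add (hC₁ ξ) (hC₂ ξ))⟩, fun g hg => ?_⟩
  have i₁ := H₁.pos g hg
  have i₂ := H₂.pos g hg
  refine ⟨by simp only [add_mul]; exact i₁.1.add i₂.1, fun y => ?_⟩
  have hm : Measurable fun ξ : V => Complex.exp (Complex.I * (inner ℝ ξ y : ℝ)) := by fun_prop
  simp_rw [add_mul, mul_add]
  rw [integral_add (integrable_bdd_mul hm (fun ξ => (norm_exp_I_mul _).le) i₁.1)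
    (integrable_bdd_mul hm (fun ξ => (norm_exp_I_mul _).le) i₂.1)]
  exact add_nonneg (i₁.2 y) (i₂.2 y)

theorem PosMultiplier.prod {ι : Type*} (s : Finset ι) {h : ι → V → ℂ}
    (H : ∀ i ∈ s, PosMultiplier (h i)) : PosMultiplier (fun ξ => ∏ i ∈ s, h i ξ) := by
  classical
  induction s using Finset.induction_on with
  | empty => simpa using PosMultiplier.const (V := V) zero_le_one
  | insert a s ha ih =>
    simp_rw [Finset.prod_insert ha]
    exact (H a (by simp)).mul (ih fun i hi => H i (by simp [hi]))

theorem PosMultiplier.sum {ι : Type*} (s : Finset ι) {h : ι → V → ℂ}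
    (H : ∀ i ∈ s, PosMultiplier (h i)) : PosMultiplier (fun ξ => ∑ i ∈ s, h i ξ) := by
  classical
  induction s using Finset.induction_on with
  | empty => simpa using PosMultiplier.const (V := V) le_rfl
  | insert a s ha ih =>
    simp_rw [Finset.sum_insert ha]
    exact (H a (by simp)).add (ih fun i hi => H i (by simp [hi]))

theorem PosMultiplier.pow {h : V → ℂ} (H : PosMultiplier h) (n : ℕ) :
    PosMultiplier (fun ξ => h ξ ^ n) := by
  simpa using PosMultiplier.prod (Finset.range n) fun _ _ => H

theorem PosFourier.of_tendsto {g : ℕ → V → ℂ} {f : V → ℂ} {F : V → ℝ} (hg : ∀ n, PosFourier (g n))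
    (hF : Integrable F) (hb : ∀ n ξ, ‖g n ξ‖ ≤ F ξ)
    (hl : ∀ᵐ ξ, Tendsto (fun n => g n ξ) atTop (𝓝 (f ξ))) : PosFourier f := by
  have hf : AEStronglyMeasurable f volume :=
    aestronglyMeasurable_of_tendsto_ae _ (fun n => (hg n).1.aestronglyMeasurable) hl
  refine ⟨hF.mono' hf ?_, fun y => ?_⟩
  · filter_upwards [hl] with ξ h
    exact le_of_tendsto h.norm (Eventually.of_forall fun n => hb n ξ)
  have hm : Measurable fun ξ : V => Complex.exp (Complex.I * (inner ℝ ξ y : ℝ)) := by fun_prop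
  refine ge_of_tendsto (tendsto_integral_of_dominated_convergence F
    (F := fun n ξ => Complex.exp (Complex.I * (inner ℝ ξ y : ℝ)) * g n ξ) (fun n =>
    hm.aestronglyMeasurable.mul (hg n).1.aestronglyMeasurable) hF (fun n => ae_of_all _ fun ξ => ?_)
    ?_) (Eventually.of_forall fun n => (hg n).2 y)
  · rw [norm_mul, norm_exp_I_mul, one_mul]; exact hb n ξ
  · filter_upwards [hl] with ξ h using h.const_mul _

theorem PosMultiplier.of_tendsto {h : ℕ → V → ℂ} {f : V → ℂ} {C : ℝ}
    (H : ∀ n, PosMultiplier (h n)) (hb : ∀ n ξ, ‖h n ξ‖ ≤ C)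
    (hl : ∀ ξ, Tendsto (fun n => h n ξ) atTop (𝓝 (f ξ))) : PosMultiplier f := by
  refine ⟨measurable_of_tendsto_metrizable (fun n => (H n).measurable)
    (tendsto_pi_nhds.2 hl), ⟨C, fun ξ => le_of_tendsto (hl ξ).norm
      (Eventually.of_forall fun n => hb n ξ)⟩, fun g hg => ?_⟩
  refine PosFourier.of_tendsto (fun n => (H n).pos g hg) (hg.1.norm.const_mul C) (fun n ξ => ?_)
    (ae_of_all _ fun ξ => (hl ξ).mul_const _)
  rw [norm_mul]
  exact mul_le_mul_of_nonneg_right (hb n ξ) (norm_nonneg _)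

/-- Positive mixtures of multipliers are multipliers, by Fubini. Gaussians and negative powers are
obtained in this way. -/
theorem PosMultiplier.integral {Ω : Type*} [MeasurableSpace Ω] {μ : Measure Ω} [SFinite μ]
    {h : V → Ω → ℂ} (hm : Measurable (Function.uncurry h)) {F : Ω → ℝ} (hF : Integrable F μ)
    (hb : ∀ ξ, ∀ ω, ‖h ξ ω‖ ≤ F ω)
    (H : ∀ᵐ ω ∂μ, PosMultiplier (fun ξ => h ξ ω)) : PosMultiplier (fun ξ => ∫ ω, h ξ ω ∂μ) := by
  have hmi : Measurable fun ξ => ∫ ω, h ξ ω ∂μ :=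
    (hm.stronglyMeasurable.integral_prod_right (ν := μ)).measurable
  have hbi : ∀ ξ, ‖∫ ω, h ξ ω ∂μ‖ ≤ ∫ ω, F ω ∂μ := fun ξ =>
    norm_integral_le_of_norm_le hF (ae_of_all _ fun ω => hb ξ ω)
  refine ⟨hmi, ⟨_, hbi⟩, fun g hg => ⟨integrable_bdd_mul hmi hbi hg.1, fun y => ?_⟩⟩
  have hme : Measurable fun ξ : V => Complex.exp (Complex.I * (inner ℝ ξ y : ℝ)) := by fun_prop
  have hint : Integrable (fun a : V × Ω =>
      Complex.exp (Complex.I * (inner ℝ a.1 y : ℝ)) * (h a.1 a.2 * g a.1)) (volume.prod μ) := by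
    refine (hg.1.norm.mul_prod hF).mono' ?_ ?_
    · exact ((hme.comp measurable_fst).aestronglyMeasurable).mul
        (hm.aestronglyMeasurable.mul hg.1.aestronglyMeasurable.comp_fst)
    · refine ae_of_all _ fun a => ?_
      rw [norm_mul, norm_mul, norm_exp_I_mul, one_mul, mul_comm]
      exact mul_le_mul_of_nonneg_left (hb _ _) (norm_nonneg _)
  have e : ∫ ξ, Complex.exp (Complex.I * (inner ℝ ξ y : ℝ)) * ((∫ ω, h ξ ω ∂μ) * g ξ)
      = ∫ ω, (∫ ξ, Complex.exp (Complex.I * (inner ℝ ξ y : ℝ)) * (h ξ ω * g ξ)) ∂μ := by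
    rw [← integral_integral_swap hint]
    refine integral_congr_ae (ae_of_all _ fun ξ => ?_)
    simp only
    rw [integral_const_mul, integral_mul_const]
  rw [e]
  refine integral_nonneg_of_ae ?_
  filter_upwards [H] with ω hω using (hω.pos g hg).2 y

/-- Multiplication by a character translates the Fourier transform by η, which does not affect its
sign. -/
theorem PosMultiplier.character (η : V) :
    PosMultiplier (fun ξ : V => Complex.exp (Complex.I * (inner ℝ ξ η : ℝ))) := by
  have hm : Measurable fun ξ : V => Complex.exp (Complex.I * (inner ℝ ξ η : ℝ)) := by fun_prop
  refine ⟨hm, ⟨1, fun ξ => (norm_exp_I_mul _).le⟩, fun g hg =>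
    ⟨integrable_bdd_mul hm (fun ξ => (norm_exp_I_mul _).le) hg.1, fun y => ?_⟩⟩
  have := hg.2 (y + η)
  refine this.trans_eq (integral_congr_ae (ae_of_all _ fun ξ => ?_))
  simp only
  rw [← mul_assoc, ← Complex.exp_add, inner_add_right]
  push_cast
  ring_nf

/-- A Gaussian is the Fourier transform of a Gaussian, hence a mixture of characters with positive
weights. -/
theorem PosMultiplier.gaussian {s : ℝ} (hs : 0 ≤ s) :
    PosMultiplier (fun ξ : V => ((Real.exp (-s * ‖ξ‖ ^ 2) : ℝ) : ℂ)) := by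
  rcases hs.eq_or_lt with rfl | hs
  · simpa using PosMultiplier.const (V := V) zero_le_one
  -- The transform of exp(-b|η|²) is proportional to exp(-|ξ|²/(4b)), and 1/(4b) has to equal s.
  set b : ℝ := 1 / (4 * s) with hbd
  have hb : 0 < b := by positivity
  have hb' : 0 < (b : ℂ).re := by simpa using hb
  have key : ∀ ξ : V, ∫ η : V, Complex.exp (-b * ‖η‖ ^ 2) *
      Complex.exp (Complex.I * (inner ℝ ξ η : ℝ))
      = (((Real.pi / b) ^ (Module.finrank ℝ V / 2 : ℝ) : ℝ) : ℂ)
        * ((Real.exp (-s * ‖ξ‖ ^ 2) : ℝ) : ℂ) := fun ξ => by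
    have := GaussianFourier.integral_cexp_neg_mul_sq_norm_add hb' Complex.I ξ
    simp_rw [Complex.exp_add] at this
    rw [this]
    congr 1
    · rw [Complex.ofReal_cpow (by positivity)]; push_cast; rfl
    · rw [Complex.ofReal_exp, Complex.I_sq]; congr 1
      have : (s : ℂ) ≠ 0 := by exact_mod_cast hs.ne'
      rw [hbd]; push_cast; field_simp
  have hc : 0 < (Real.pi / b) ^ (Module.finrank ℝ V / 2 : ℝ) := by
    have := Real.pi_pos
    positivity
  have hmix : PosMultiplier (fun ξ : V => ∫ η : V, Complex.exp (-b * ‖η‖ ^ 2) *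
      Complex.exp (Complex.I * (inner ℝ ξ η : ℝ))) := by
    refine PosMultiplier.integral (F := fun η : V => Real.exp (-b * ‖η‖ ^ 2)) ?_ ?_ ?_ ?_
    · simp only [Function.uncurry_def]
      fun_prop
    · have := GaussianFourier.integrable_cexp_neg_mul_sq_norm_add hb' 0 (0 : V)
      refine this.norm.congr (ae_of_all _ fun η => ?_)
      simp only [zero_mul, add_zero]
      rw [Complex.norm_exp]
      congr 1
      rw [← Complex.ofReal_pow, ← Complex.ofReal_neg, ← Complex.ofReal_mul, Complex.ofReal_re]
    · intro ξ η
      rw [norm_mul, norm_exp_I_mul, mul_one, Complex.norm_exp]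
      apply le_of_eq
      congr 1
      rw [← Complex.ofReal_pow, ← Complex.ofReal_neg, ← Complex.ofReal_mul, Complex.ofReal_re]
    · refine ae_of_all _ fun η => ?_
      have := (PosMultiplier.const (V := V) (Real.exp_pos (-b * ‖η‖ ^ 2)).le).mul
        (PosMultiplier.character η)
      simpa using this
  have := (PosMultiplier.const (V := V) (inv_nonneg.2 hc.le)).mul hmix
  simp_rw [key] at this
  refine (congrArg PosMultiplier ?_).mp this
  funext ξ
  rw [← mul_assoc, ← Complex.ofReal_mul, inv_mul_cancel₀ hc.ne']
  simp

/-- The Gamma integral Γ(m) ρ^{-m} = ∫ u^{m-1} e^{-ρu} du at ρ = 1 + a|ξ|² is a mixture of Gaussians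
in ξ with nonnegative weights. -/
theorem PosMultiplier.rpow_neg {a m : ℝ} (ha : 0 ≤ a) (hm : 0 < m) :
    PosMultiplier (fun ξ : V => (((1 + a * ‖ξ‖ ^ 2) ^ (-m) : ℝ) : ℂ)) := by
  have hint : IntegrableOn (fun u : ℝ => u ^ (m - 1) * Real.exp (-(1 * u))) (Ioi 0) := by
    have := Real.GammaIntegral_convergent hm
    refine this.congr_fun (fun u _ => ?_) measurableSet_Ioi
    simp only [one_mul]; ring
  -- The absolute value on u changes nothing on (0, ∞); it makes the bound by F hold at every u, as
  -- the mixture lemma demands.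
  have key : ∀ ξ : V, ∫ u in Ioi (0 : ℝ), (((u ^ (m - 1) * Real.exp (-(1 * u)))
      * Real.exp (-(|u| * a) * ‖ξ‖ ^ 2) : ℝ) : ℂ)
      = ((Real.Gamma m : ℝ) : ℂ) * (((1 + a * ‖ξ‖ ^ 2) ^ (-m) : ℝ) : ℂ) := fun ξ => by
    have hr : 0 < 1 + a * ‖ξ‖ ^ 2 := by positivity
    have := Real.integral_rpow_mul_exp_neg_mul_Ioi hm hr
    rw [integral_complex_ofReal, ← Complex.ofReal_mul]
    congr 1
    rw [Real.rpow_neg hr.le, mul_comm (Real.Gamma m), ← Real.inv_rpow hr.le, ← one_div, ← this]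
    refine setIntegral_congr_fun measurableSet_Ioi fun u hu => ?_
    rw [mul_assoc, ← Real.exp_add, abs_of_pos hu]
    ring_nf
  have hmix : PosMultiplier (fun ξ : V => ∫ u in Ioi (0 : ℝ), (((u ^ (m - 1) *
      Real.exp (-(1 * u))) * Real.exp (-(|u| * a) * ‖ξ‖ ^ 2) : ℝ) : ℂ)) := by
    refine PosMultiplier.integral (F := fun u => ‖u ^ (m - 1) * Real.exp (-(1 * u))‖)
      ?_ hint.norm ?_ ?_
    · simp only [Function.uncurry_def]
      fun_prop
    · intro ξ u
      rw [Complex.norm_real, norm_mul]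
      refine mul_le_of_le_one_right (norm_nonneg _) ?_
      rw [Real.norm_eq_abs, Real.abs_exp, Real.exp_le_one_iff]
      have : 0 ≤ |u| * a * ‖ξ‖ ^ 2 := by positivity
      linarith
    · filter_upwards [self_mem_ae_restrict (measurableSet_Ioi (a := (0 : ℝ)))] with u hu
      have hu : (0 : ℝ) < u := hu
      have := (PosMultiplier.const (V := V) (c := u ^ (m - 1) * Real.exp (-(1 * u)))
        (by positivity)).mul (PosMultiplier.gaussian (V := V) (s := |u| * a) (by positivity))
      simpa using this
  have hG := Real.Gamma_pos_of_pos hm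
  have := (PosMultiplier.const (V := V) (inv_nonneg.2 hG.le)).mul hmix
  simp_rw [key] at this
  refine (congrArg PosMultiplier ?_).mp this
  funext ξ
  rw [← mul_assoc, ← Complex.ofReal_mul, inv_mul_cancel₀ hG.ne']
  simp

/-- The partial sums of the exponential series have positive coefficients and are bounded by exp C.
-/
theorem PosMultiplier.exp {h : V → ℂ} (H : PosMultiplier h) :
    PosMultiplier (fun ξ => Complex.exp (h ξ)) := by
  obtain ⟨C, hC⟩ := H.bounded
  refine PosMultiplier.of_tendsto (C := Real.exp C)
    (h := fun n ξ => ∑ j ∈ Finset.range n, h ξ ^ j / (j.factorial : ℂ)) (fun n => ?_)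
    (fun n ξ => ?_) fun ξ => ?_
  · refine PosMultiplier.sum _ fun j _ => ?_
    have := (H.pow j).mul (PosMultiplier.const (V := V) (c := (j.factorial : ℝ)⁻¹) (by positivity))
    simpa [div_eq_mul_inv] using this
  · calc ‖∑ j ∈ Finset.range n, h ξ ^ j / (j.factorial : ℂ)‖
        ≤ ∑ j ∈ Finset.range n, ‖h ξ‖ ^ j / (j.factorial : ℝ) := by
          refine (norm_sum_le _ _).trans (Finset.sum_le_sum fun j _ => ?_)
          simp
      _ ≤ Real.exp ‖h ξ‖ := Real.sum_le_exp_of_nonneg (norm_nonneg _) n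
      _ ≤ Real.exp C := Real.exp_le_exp.2 (hC ξ)
  · rw [Complex.exp_eq_exp_ℂ]
    exact (NormedSpace.expSeries_div_hasSum_exp (h ξ)).tendsto_sum_nat

/-- The constant 1 is not integrable, so h is applied to the Gaussians exp(-|ξ|²/(n+1)), which have
positive transforms and increase to 1. -/
theorem PosMultiplier.posFourier {h : V → ℂ} (H : PosMultiplier h) (hi : Integrable h) :
    PosFourier h := by
  have hg : ∀ n : ℕ, PosFourier
      (fun ξ : V => ((Real.exp (-(1 / ((n : ℝ) + 1)) * ‖ξ‖ ^ 2) : ℝ) : ℂ)) := fun n => by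
    have hb : 0 < ((1 / ((n : ℝ) + 1) : ℝ) : ℂ).re := by
      rw [Complex.ofReal_re]; positivity
    have e : ∀ ξ : V, ((Real.exp (-(1 / ((n : ℝ) + 1)) * ‖ξ‖ ^ 2) : ℝ) : ℂ)
        = Complex.exp (-((1 / ((n : ℝ) + 1) : ℝ) : ℂ) * ‖ξ‖ ^ 2) := fun ξ => by push_cast; rfl
    refine ⟨?_, fun y => ?_⟩
    · simpa [e] using GaussianFourier.integrable_cexp_neg_mul_sq_norm_add hb 0 (0 : V)
    · have := GaussianFourier.integral_cexp_neg_mul_sq_norm_add hb Complex.I y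
      simp_rw [e, ← Complex.exp_add, add_comm (Complex.I * _), real_inner_comm y]
      rw [this]
      have h1 : (Real.pi / ((1 / ((n : ℝ) + 1) : ℝ) : ℂ)) ^ (Module.finrank ℝ V / 2 : ℂ)
        = (((Real.pi / (1 / ((n : ℝ) + 1))) ^ (Module.finrank ℝ V / 2 : ℝ) : ℝ) : ℂ) := by
        rw [Complex.ofReal_cpow (by positivity)]; push_cast; rfl
      have h2 : Complex.exp (Complex.I ^ 2 * ‖y‖ ^ 2 / (4 * ((1 / ((n : ℝ) + 1) : ℝ) : ℂ)))
        = ((Real.exp (-1 * ‖y‖ ^ 2 / (4 * (1 / ((n : ℝ) + 1)))) : ℝ) : ℂ) := by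
        rw [Complex.I_sq]; push_cast; rfl
      rw [h1, h2, ← Complex.ofReal_mul]
      have : 0 ≤ (Real.pi / (1 / ((n : ℝ) + 1))) ^ (Module.finrank ℝ V / 2 : ℝ)
        * Real.exp (-1 * ‖y‖ ^ 2 / (4 * (1 / ((n : ℝ) + 1)))) := by positivity
      exact_mod_cast this
  refine PosFourier.of_tendsto (fun n => H.pos _ (hg n)) hi.norm (fun n ξ => ?_)
    (ae_of_all _ fun ξ => ?_)
  · rw [norm_mul, Complex.norm_real]
    refine mul_le_of_le_one_right (norm_nonneg _) ?_
    rw [Real.norm_eq_abs, Real.abs_exp, Real.exp_le_one_iff]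
    have : 0 ≤ (1 / ((n : ℝ) + 1)) * ‖ξ‖ ^ 2 := by positivity
    linarith
  · have h1 := (tendsto_one_div_add_atTop_nhds_zero_nat (𝕜 := ℝ)).neg.mul_const (‖ξ‖ ^ 2)
    have h2 := (Complex.continuous_ofReal.comp Real.continuous_exp).tendsto _ |>.comp h1
    have := h2.const_mul (h ξ)
    simpa using this

end Multiplier

end Grushin

namespace Grushin

noncomputable section

/-! ### The symbol of the heat kernel -/

section Symbol

variable {N k : ℕ}

/-- The partial Fourier transform of the heat kernel, as a function of `r = ‖ξ‖`. -/
def symbol (x x₀ : EuclideanSpace ℝ (Fin N)) (t r : ℝ) : ℝ :=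
  (r / Real.sinh (r * t)) ^ ((N : ℝ) / 2) *
    Real.exp (-(r / 2 * ((‖x‖ ^ 2 + ‖x₀‖ ^ 2) * (Real.cosh (r * t) / Real.sinh (r * t))
      - 2 * (inner ℝ x x₀ : ℝ) * (1 / Real.sinh (r * t)))))

/-- The symbol with its limit value at `r = 0`. -/
def symbolExt (x x₀ : EuclideanSpace ℝ (Fin N)) (t r : ℝ) : ℝ :=
  if r = 0 then t ^ (-((N : ℝ) / 2)) * Real.exp (-(‖x - x₀‖ ^ 2 / (2 * t))) else symbol x x₀ t r

/-- Finite products converging to the symbol. -/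
def symbolApprox (x x₀ : EuclideanSpace ℝ (Fin N)) (t r : ℝ) (m : ℕ) : ℝ :=
  (t ^ (-((N : ℝ) / 2)) * Real.exp (-(‖x - x₀‖ ^ 2 / (2 * t)))) *
    ((∏ j ∈ Finset.range m, (1 + (t / Real.pi / ((j : ℝ) + 1)) ^ 2 * r ^ 2) ^ (-((N : ℝ) / 2))) *
    ∏ j ∈ Finset.range m,
      (Real.exp (-(‖x + x₀‖ ^ 2 / t *
          (1 - (1 + (t / Real.pi / (2 * (j : ℝ) + 1)) ^ 2 * r ^ 2) ^ (-1 : ℝ)))) *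
        Real.exp (-(‖x - x₀‖ ^ 2 / t *
          (1 - (1 + (t / Real.pi / (2 * (j : ℝ) + 2)) ^ 2 * r ^ 2) ^ (-1 : ℝ))))))

theorem heatKernel_eq (x x₀ : EuclideanSpace ℝ (Fin N)) (y : EuclideanSpace ℝ (Fin k)) (t : ℝ) :
    heatKernel x x₀ y t = 1 / (2 * Real.pi) ^ (((N : ℝ) + 2 * k) / 2) *
      (∫ ξ : EuclideanSpace ℝ (Fin k),
        Complex.exp (Complex.I * (inner ℝ ξ y : ℝ)) * (symbol x x₀ t ‖ξ‖ : ℂ)).re := by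
  rw [heatKernel]
  congr 3
  funext ξ
  rw [sub_eq_add_neg, Complex.exp_add, symbol, Complex.ofReal_mul _ (Real.exp _),
    Complex.ofReal_exp, Complex.ofReal_neg]
  ring

theorem one_sub_inv_nonneg {a : ℝ} (ha : 0 ≤ a) : 0 ≤ 1 - (1 + a) ^ (-1 : ℝ) := by
  rw [Real.rpow_neg_one, sub_nonneg]
  exact inv_le_one_of_one_le₀ (by linarith)

theorem symbolApprox_nonneg (x x₀ : EuclideanSpace ℝ (Fin N)) {t : ℝ} (ht : 0 < t) (r : ℝ)
    (m : ℕ) : 0 ≤ symbolApprox x x₀ t r m := by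
  unfold symbolApprox
  refine mul_nonneg (by positivity) (mul_nonneg (Finset.prod_nonneg fun j _ => by positivity)
    (Finset.prod_nonneg fun j _ => by positivity))

theorem symbolApprox_le (x x₀ : EuclideanSpace ℝ (Fin N)) {t : ℝ} (ht : 0 < t) (r : ℝ) (m : ℕ) :
    symbolApprox x x₀ t r m ≤ t ^ (-((N : ℝ) / 2)) * Real.exp (-(‖x - x₀‖ ^ 2 / (2 * t))) := by
  unfold symbolApprox
  refine mul_le_of_le_one_right (by positivity) (mul_le_one₀ ?_ ?_ ?_)
  · refine Finset.prod_le_one (fun j _ => by positivity) fun j _ => ?_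
    exact Real.rpow_le_one_of_one_le_of_nonpos
      (le_add_of_nonneg_right (by positivity)) (neg_nonpos.2 (by positivity))
  · exact Finset.prod_nonneg fun j _ => by positivity
  · refine Finset.prod_le_one (fun j _ => by positivity) fun j _ => ?_
    refine mul_le_one₀ ?_ (Real.exp_pos _).le ?_ <;>
    · rw [Real.exp_le_one_iff, neg_nonpos]
      exact mul_nonneg (by positivity) (one_sub_inv_nonneg (by positivity))

/-- The half-angle identity expresses the exponent of the symbol through hyperbolic cotangents
alone, whose partial fractions are known. -/
theorem csch_eq {θ : ℝ} (hθ : 0 < θ) : 1 / Real.sinh θ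
    = Real.cosh (θ / 2) / Real.sinh (θ / 2) - Real.cosh θ / Real.sinh θ := by
  have h1 : Real.sinh (θ / 2) ≠ 0 := (Real.sinh_pos_iff.2 (by positivity)).ne'
  have h2 : Real.cosh (θ / 2) ≠ 0 := (Real.cosh_pos _).ne'
  have e1 : Real.sinh θ = 2 * Real.sinh (θ / 2) * Real.cosh (θ / 2) := by
    rw [← Real.sinh_two_mul]; ring_nf
  have e2 : Real.cosh θ = Real.cosh (θ / 2) ^ 2 + Real.sinh (θ / 2) ^ 2 := by
    rw [← Real.cosh_two_mul]; ring_nf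
  have e3 := Real.cosh_sq (θ / 2)
  rw [e1, e2]
  field_simp
  linear_combination -e3

theorem sum_range_two_mul (f : ℕ → ℝ) (m : ℕ) :
    ∑ j ∈ Finset.range (2 * m), f j = ∑ j ∈ Finset.range m, (f (2 * j) + f (2 * j + 1)) := by
  induction m with
  | zero => simp
  | succ m ih => rw [Nat.mul_succ, Finset.sum_range_succ, Finset.sum_range_succ, ih,
      Finset.sum_range_succ]; ring

/-- With a = |x|² + |x₀|² and b = x·x₀, the half-angle identity turns the exponent into r/2 times
(a+2b) coth(rt) - 2b coth(rt/2). In the partial fractions the odd poles keep the coefficient a+2b =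
|x+x₀|², while at the even poles the two series combine to a-2b = |x-x₀|². All coefficients are
therefore nonnegative, which is hidden in the closed form. -/
theorem tendsto_exponent (x x₀ : EuclideanSpace ℝ (Fin N)) {t r : ℝ} (ht : 0 < t) (hr : 0 < r) :
    Tendsto (fun m : ℕ => ‖x - x₀‖ ^ 2 / (2 * t) + ∑ j ∈ Finset.range m,
      (‖x + x₀‖ ^ 2 / t * (1 - (1 + (t / Real.pi / (2 * (j : ℝ) + 1)) ^ 2 * r ^ 2) ^ (-1 : ℝ)) +
        ‖x - x₀‖ ^ 2 / t * (1 - (1 + (t / Real.pi / (2 * (j : ℝ) + 2)) ^ 2 * r ^ 2) ^ (-1 : ℝ))))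
      atTop (𝓝 (r / 2 * ((‖x‖ ^ 2 + ‖x₀‖ ^ 2) * (Real.cosh (r * t) / Real.sinh (r * t))
      - 2 * (inner ℝ x x₀ : ℝ) * (1 / Real.sinh (r * t))))) := by
  have hπ := Real.pi_pos
  set v : ℝ := r * t / Real.pi with hv
  have hv0 : 0 < v := by positivity
  have hrv : r = Real.pi * v / t := by rw [hv]; field_simp
  have hθ : r * t = Real.pi * v := by rw [hv]; field_simp
  -- Use 2m terms at v against m terms at v/2, since the j-th pole of the latter is the 2j-th pole
  -- of the former.
  have h1 := (tendsto_sum_coth hv0).comp (tendsto_id.const_mul_atTop' (r := 2) (by norm_num))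
  have h2 := tendsto_sum_coth (half_pos hv0)
  have ep : ‖x + x₀‖ ^ 2 = ‖x‖ ^ 2 + ‖x₀‖ ^ 2 + 2 * inner ℝ x x₀ := by
    rw [norm_add_sq_real]; ring
  have em : ‖x - x₀‖ ^ 2 = ‖x‖ ^ 2 + ‖x₀‖ ^ 2 - 2 * inner ℝ x x₀ := by
    rw [norm_sub_sq_real]; ring
  set a := ‖x‖ ^ 2 + ‖x₀‖ ^ 2
  set b := (inner ℝ x x₀ : ℝ)
  have h3 := ((h1.const_mul (a + 2 * b)).sub (h2.const_mul (2 * b))).const_mul (r / (2 * Real.pi))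
  convert h3 using 1
  · funext m
    rw [Function.comp_apply, id_eq, sum_range_two_mul, ep, em]
    rw [mul_sub, mul_add (a + 2 * b), mul_add (2 * b), Finset.mul_sum, Finset.mul_sum]
    rw [← mul_sub, add_sub_add_comm, ← Finset.sum_sub_distrib, mul_add, Finset.mul_sum]
    congr 1
    · rw [hrv]; field_simp; ring
    · refine Finset.sum_congr rfl fun j _ => ?_
      rw [Real.rpow_neg_one, Real.rpow_neg_one, hrv]
      push_cast
      field_simp
      ring
  · rw [csch_eq (by positivity : 0 < r * t), hθ, show Real.pi * v / 2 = Real.pi * (v / 2) by ring]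
    congr 1
    field_simp
    ring

/-- Euler's product, raised to the power -N/2, gives the prefactor and the partial fractions give
the exponential. At r = 0 every approximation already equals the limit. -/
theorem tendsto_symbolApprox (x x₀ : EuclideanSpace ℝ (Fin N)) {t r : ℝ} (ht : 0 < t)
    (hr : 0 ≤ r) : Tendsto (symbolApprox x x₀ t r) atTop (𝓝 (symbolExt x x₀ t r)) := by
  have hπ := Real.pi_pos
  rcases hr.eq_or_lt with rfl | hr
  · have : ∀ m, symbolApprox x x₀ t 0 m = symbolExt x x₀ t 0 := fun m => by
      simp [symbolApprox, symbolExt]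
    exact tendsto_const_nhds.congr fun m => (this m).symm
  have hs : 0 < Real.sinh (r * t) := Real.sinh_pos_iff.2 (by positivity)
  rw [symbolExt, if_neg hr.ne', symbol]
  have h1 := tendsto_exponent x x₀ ht hr
  have h2 := (Real.continuous_exp.tendsto _).comp h1.neg
  have h3 := (tendsto_prod_sinh (r * t / Real.pi)).const_mul (1 / (r * t))
  have h4 : Tendsto (fun m : ℕ => ∏ j ∈ Finset.range m,
      (1 + (t / Real.pi / ((j : ℝ) + 1)) ^ 2 * r ^ 2)) atTop (𝓝 (Real.sinh (r * t) / (r * t))) := by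
    convert h3 using 1
    · funext m
      rw [show Real.pi * (r * t / Real.pi) = r * t by field_simp, ← mul_assoc,
        one_div_mul_cancel (by positivity), one_mul]
      refine Finset.prod_congr rfl fun j _ => ?_
      field_simp
    · rw [show Real.pi * (r * t / Real.pi) = r * t by field_simp]
      congr 1; ring
  have h5 := (h4.rpow_const (p := -((N : ℝ) / 2)) (Or.inl (by positivity))).const_mul
    (t ^ (-((N : ℝ) / 2)))
  have h6 := h5.mul h2
  convert h6 using 1
  · funext m
    simp only [Function.comp_apply, symbolApprox]
    rw [neg_add, Real.exp_add, ← Finset.sum_neg_distrib, Real.exp_sum,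
      ← Real.finsetProd_rpow _ _ (fun j _ => by positivity)]
    simp_rw [neg_add, Real.exp_add]
    ring
  · congr 2
    rw [← Real.mul_rpow ht.le (by positivity), Real.rpow_neg (by positivity),
      ← Real.inv_rpow (by positivity)]
    congr 1
    field_simp

/-- Every factor of the approximating products apart from the value at r = 0 is at most one. The
bound is Gaussian in x - x₀ uniformly in frequency and serves as the majorant in the computation of
the mass. -/
theorem symbolExt_le (x x₀ : EuclideanSpace ℝ (Fin N)) {t r : ℝ} (ht : 0 < t)
    (hr : 0 ≤ r) : symbolExt x x₀ t r ≤
      t ^ (-((N : ℝ) / 2)) * Real.exp (-(‖x - x₀‖ ^ 2 / (2 * t))) :=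
  le_of_tendsto' (tendsto_symbolApprox x x₀ ht hr) fun m => symbolApprox_le x x₀ ht r m

theorem symbol_nonneg (x x₀ : EuclideanSpace ℝ (Fin N)) {t r : ℝ} (ht : 0 < t)
    (hr : 0 ≤ r) : 0 ≤ symbol x x₀ t r := by
  refine mul_nonneg (Real.rpow_nonneg (div_nonneg hr ?_) _) (Real.exp_pos _).le
  exact Real.sinh_nonneg_iff.2 (by positivity)

theorem posMultiplier_symbolExt (x x₀ : EuclideanSpace ℝ (Fin N)) {t : ℝ} (ht : 0 < t) :
    PosMultiplier (fun ξ : EuclideanSpace ℝ (Fin k) => (symbolExt x x₀ t ‖ξ‖ : ℂ)) := by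
  refine PosMultiplier.of_tendsto
    (C := t ^ (-((N : ℝ) / 2)) * Real.exp (-(‖x - x₀‖ ^ 2 / (2 * t))))
    (h := fun m ξ => (symbolApprox x x₀ t ‖ξ‖ m : ℂ)) (fun m => ?_) (fun m ξ => ?_) fun ξ => ?_
  -- Write exp(-c(1 - p)) = exp(-c) exp(cp), where p = (1 + a²|ξ|²)^{-1} is a multiplier and c ≥ 0.
  · have hexp : ∀ (c a : ℝ), 0 ≤ c → PosMultiplier (fun ξ : EuclideanSpace ℝ (Fin k) =>
        ((Real.exp (-(c * (1 - (1 + a ^ 2 * ‖ξ‖ ^ 2) ^ (-1 : ℝ)))) : ℝ) : ℂ)) := fun c a hc => by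
      have := (PosMultiplier.const (V := EuclideanSpace ℝ (Fin k)) (Real.exp_pos (-c)).le).mul
        ((PosMultiplier.const hc).mul (PosMultiplier.rpow_neg (sq_nonneg a) one_pos)).exp
      refine (congrArg PosMultiplier ?_).mp this
      funext ξ
      rw [← Complex.ofReal_mul c, ← Complex.ofReal_exp, ← Complex.ofReal_mul, ← Real.exp_add]
      ring_nf
    simp only [symbolApprox, Complex.ofReal_mul, Complex.ofReal_prod]
    refine PosMultiplier.mul ?_ (PosMultiplier.mul ?_ ?_)
    · rw [← Complex.ofReal_mul]
      exact PosMultiplier.const (by positivity)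
    · refine PosMultiplier.prod _ fun j _ => ?_
      rcases Nat.eq_zero_or_pos N with rfl | hN
      · simpa using PosMultiplier.const (V := EuclideanSpace ℝ (Fin k)) zero_le_one
      · exact PosMultiplier.rpow_neg (sq_nonneg _) (by positivity)
    · exact PosMultiplier.prod _ fun j _ => (hexp _ _ (by positivity)).mul (hexp _ _ (by positivity))
  · rw [Complex.norm_real, Real.norm_of_nonneg (symbolApprox_nonneg x x₀ ht _ m)]
    exact symbolApprox_le x x₀ ht _ m
  · exact (Complex.continuous_ofReal.tendsto _).comp (tendsto_symbolApprox x x₀ ht (norm_nonneg ξ))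

theorem exponent_nonneg (x x₀ : EuclideanSpace ℝ (Fin N)) {t r : ℝ} (ht : 0 < t) (hr : 0 < r) :
    0 ≤ r / 2 * ((‖x‖ ^ 2 + ‖x₀‖ ^ 2) * (Real.cosh (r * t) / Real.sinh (r * t))
      - 2 * (inner ℝ x x₀ : ℝ) * (1 / Real.sinh (r * t))) :=
  ge_of_tendsto' (tendsto_exponent x x₀ ht hr) fun m => add_nonneg (by positivity)
    (Finset.sum_nonneg fun j _ => add_nonneg
      (mul_nonneg (by positivity) (one_sub_inv_nonneg (by positivity)))
      (mul_nonneg (by positivity) (one_sub_inv_nonneg (by positivity))))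

/-- Follows from sinh s = 2 sinh(s/2) cosh(s/2) with sinh(s/2) ≥ s/2 and cosh(s/2) ≥ e^{s/2}/2. -/
theorem div_sinh_le {s : ℝ} (hs : 0 ≤ s) : s / Real.sinh s ≤ 2 * Real.exp (-(s / 2)) := by
  rcases hs.eq_or_lt with rfl | hs
  · simp
  have h1 : s / 2 ≤ Real.sinh (s / 2) := Real.self_le_sinh_iff.2 (by positivity)
  have h2 : Real.exp (s / 2) / 2 ≤ Real.cosh (s / 2) := by
    rw [Real.cosh_eq]; have := Real.exp_pos (-(s / 2)); linarith
  have h3 : Real.sinh s = 2 * Real.sinh (s / 2) * Real.cosh (s / 2) := by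
    rw [← Real.sinh_two_mul]; ring_nf
  have hsi : 0 < Real.sinh s := Real.sinh_pos_iff.2 hs
  rw [div_le_iff₀ hsi, h3]
  have h4 : s / 2 * (Real.exp (s / 2) / 2) ≤ Real.sinh (s / 2) * Real.cosh (s / 2) :=
    mul_le_mul h1 h2 (by positivity) (Real.sinh_nonneg_iff.2 (by positivity))
  calc s = 2 * Real.exp (-(s / 2)) * (2 * (s / 2 * (Real.exp (s / 2) / 2))) := by
        rw [show 2 * Real.exp (-(s / 2)) * (2 * (s / 2 * (Real.exp (s / 2) / 2)))
          = s * (Real.exp (-(s / 2)) * Real.exp (s / 2)) by ring, ← Real.exp_add]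
        simp
    _ ≤ _ := by
        rw [mul_assoc 2 (Real.sinh _)]
        gcongr

/-- All the decay in frequency comes from the power N/2 of r/sinh(rt); the exponential factor is
merely at most one. This is why N ≥ 1 is required for integrability in ξ. -/
theorem symbol_le_exp (x x₀ : EuclideanSpace ℝ (Fin N)) {t r : ℝ} (ht : 0 < t) (hr : 0 ≤ r) :
    symbol x x₀ t r ≤ (2 / t) ^ ((N : ℝ) / 2) * Real.exp (-((N : ℝ) / 4 * (t * r))) := by
  have h1 : r / Real.sinh (r * t) ≤ 2 / t * Real.exp (-(r * t / 2)) := by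
    have := div_sinh_le (s := r * t) (by positivity)
    calc r / Real.sinh (r * t) = (r * t / Real.sinh (r * t)) / t := by field_simp
      _ ≤ (2 * Real.exp (-(r * t / 2))) / t := by gcongr
      _ = _ := by ring
  have h0 : 0 ≤ r / Real.sinh (r * t) := div_nonneg hr (Real.sinh_nonneg_iff.2 (by positivity))
  have h2 : (2 / t * Real.exp (-(r * t / 2))) ^ ((N : ℝ) / 2)
      = (2 / t) ^ ((N : ℝ) / 2) * Real.exp (-((N : ℝ) / 4 * (t * r))) := by
    rw [Real.mul_rpow (by positivity) (Real.exp_pos _).le, ← Real.exp_mul]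
    ring_nf
  rw [← h2, symbol]
  have h3 : Real.exp (-(r / 2 * ((‖x‖ ^ 2 + ‖x₀‖ ^ 2) * (Real.cosh (r * t) / Real.sinh (r * t))
      - 2 * (inner ℝ x x₀ : ℝ) * (1 / Real.sinh (r * t))))) ≤ 1 := by
    rw [Real.exp_le_one_iff, neg_nonpos]
    rcases hr.eq_or_lt with rfl | hr
    · simp
    · exact exponent_nonneg x x₀ ht hr
  calc _ ≤ (r / Real.sinh (r * t)) ^ ((N : ℝ) / 2) * 1 := by gcongr
    _ ≤ _ := by rw [mul_one]; exact Real.rpow_le_rpow h0 h1 (by positivity)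

theorem integrable_exp_neg_mul_norm {c : ℝ} (hc : 0 < c) :
    Integrable (fun ξ : EuclideanSpace ℝ (Fin k) => Real.exp (-(c * ‖ξ‖))) := by
  set n : ℕ := Module.finrank ℝ (EuclideanSpace ℝ (Fin k)) + 1
  have h1 : Integrable (fun ξ : EuclideanSpace ℝ (Fin k) => (1 + ‖ξ‖) ^ (-(n : ℝ))) :=
    integrable_one_add_norm (by simp [n])
  refine (h1.const_mul (n.factorial / c ^ n * Real.exp c)).mono' (by fun_prop)
    (ae_of_all _ fun ξ => ?_)
  rw [Real.norm_eq_abs, Real.abs_exp]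
  have h2 := Real.pow_div_factorial_le_exp (c * (1 + ‖ξ‖)) (by positivity) n
  have h3 : Real.exp (-(c * ‖ξ‖)) = Real.exp c * (Real.exp (c * (1 + ‖ξ‖)))⁻¹ := by
    rw [← Real.exp_neg, ← Real.exp_add]; ring_nf
  rw [h3, Real.rpow_neg (by positivity), Real.rpow_natCast]
  have h4 : (Real.exp (c * (1 + ‖ξ‖)))⁻¹ ≤ ((c * (1 + ‖ξ‖)) ^ n / n.factorial)⁻¹ :=
    inv_anti₀ (by positivity) h2
  calc _ ≤ Real.exp c * ((c * (1 + ‖ξ‖)) ^ n / n.factorial)⁻¹ := by gcongr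
    _ = _ := by rw [mul_pow]; field_simp

theorem measurable_symbol : Measurable (fun a : (EuclideanSpace ℝ (Fin N) × EuclideanSpace ℝ (Fin N))
    × ℝ × ℝ => symbol a.1.1 a.1.2 a.2.1 a.2.2) := by
  unfold symbol
  have hs : Measurable Real.sinh := Real.continuous_sinh.measurable
  have hc : Measurable Real.cosh := Real.continuous_cosh.measurable
  have h0 : Measurable (fun a : (EuclideanSpace ℝ (Fin N) × EuclideanSpace ℝ (Fin N)) × ℝ × ℝ =>
      Real.sinh (a.2.2 * a.2.1)) := hs.comp (by fun_prop)
  have h1 : Measurable (fun a : (EuclideanSpace ℝ (Fin N) × EuclideanSpace ℝ (Fin N)) × ℝ × ℝ =>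
      Real.cosh (a.2.2 * a.2.1)) := hc.comp (by fun_prop)
  fun_prop

theorem measurable_symbol_norm (x x₀ : EuclideanSpace ℝ (Fin N)) (t : ℝ) :
    Measurable (fun ξ : EuclideanSpace ℝ (Fin k) => symbol x x₀ t ‖ξ‖) :=
  measurable_symbol.comp (f := fun ξ : EuclideanSpace ℝ (Fin k) => ((x, x₀), t, ‖ξ‖)) (by fun_prop)

theorem integrable_symbol (hN : 1 ≤ N) (x x₀ : EuclideanSpace ℝ (Fin N)) {t : ℝ} (ht : 0 < t) :
    Integrable (fun ξ : EuclideanSpace ℝ (Fin k) => symbol x x₀ t ‖ξ‖) := by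
  have hc : 0 < (N : ℝ) / 4 * t := by positivity
  refine ((integrable_exp_neg_mul_norm hc).const_mul ((2 / t) ^ ((N : ℝ) / 2))).mono'
    (measurable_symbol_norm x x₀ t).aestronglyMeasurable (ae_of_all _ fun ξ => ?_)
  rw [Real.norm_of_nonneg (symbol_nonneg x x₀ ht (norm_nonneg _))]
  refine (symbol_le_exp x x₀ ht (norm_nonneg ξ)).trans_eq ?_
  rw [mul_assoc ((N : ℝ) / 4)]

end Symbol

end

end Grushin

namespace Grushin

noncomputable section

/-! ### Properties of the heat kernel -/

section Kernel

variable {N k : ℕ}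

theorem ae_norm_ne_zero (hk : 1 ≤ k) : ∀ᵐ ξ : EuclideanSpace ℝ (Fin k), ‖ξ‖ ≠ 0 := by
  have : Nonempty (Fin k) := ⟨⟨0, hk⟩⟩
  have : ({0}ᶜ : Set (EuclideanSpace ℝ (Fin k))) ∈ ae volume :=
    compl_mem_ae_iff.2 (measure_singleton 0)
  filter_upwards [this] with ξ h
  exact norm_ne_zero_iff.2 h

theorem ae_symbolExt_eq (hk : 1 ≤ k) (x x₀ : EuclideanSpace ℝ (Fin N)) (t : ℝ) :
    ∀ᵐ ξ : EuclideanSpace ℝ (Fin k), symbolExt x x₀ t ‖ξ‖ = symbol x x₀ t ‖ξ‖ := by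
  filter_upwards [ae_norm_ne_zero hk] with ξ h
  rw [symbolExt, if_neg h]

/-- The extended symbol is an integrable positive multiplier, so its transform is nonnegative. It
may differ from the symbol at ξ = 0, a null set because k ≥ 1. -/
theorem heatKernel_nonneg (hN : 1 ≤ N) (hk : 1 ≤ k) (x x₀ : EuclideanSpace ℝ (Fin N))
    (y : EuclideanSpace ℝ (Fin k)) {t : ℝ} (ht : 0 < t) : 0 ≤ heatKernel x x₀ y t := by
  have hi : Integrable (fun ξ : EuclideanSpace ℝ (Fin k) => (symbolExt x x₀ t ‖ξ‖ : ℂ)) := by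
    refine (integrable_symbol hN x x₀ ht).ofReal.congr ?_
    filter_upwards [ae_symbolExt_eq hk x x₀ t] with ξ h
    rw [h]; rfl
  have h := ((posMultiplier_symbolExt x x₀ ht).posFourier hi).2 y
  rw [heatKernel_eq]
  refine mul_nonneg (by positivity) ?_
  rw [integral_congr_ae (g := fun ξ => Complex.exp (Complex.I * (inner ℝ ξ y : ℝ)) *
    (symbolExt x x₀ t ‖ξ‖ : ℂ))]
  · exact (Complex.le_def.1 h).1
  · filter_upwards [ae_symbolExt_eq hk x x₀ t] with ξ h
    rw [h]

theorem symbol_comm (x x₀ : EuclideanSpace ℝ (Fin N)) (t r : ℝ) :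
    symbol x₀ x t r = symbol x x₀ t r := by
  rw [symbol, symbol, real_inner_comm x₀ x, add_comm (‖x₀‖ ^ 2)]

/-- The substitution ξ ↦ -ξ. As a function of two points the kernel is symmetric, so that mass one
in one point implies it in the other. -/
theorem heatKernel_comm (x x₀ : EuclideanSpace ℝ (Fin N)) (y : EuclideanSpace ℝ (Fin k)) (t : ℝ) :
    heatKernel x₀ x (-y) t = heatKernel x x₀ y t := by
  rw [heatKernel_eq, heatKernel_eq, ← integral_neg_eq_self]
  simp_rw [inner_neg_neg, norm_neg, symbol_comm x x₀]

theorem norm_cexp_mul_symbol (x x₀ : EuclideanSpace ℝ (Fin N)) (y ξ : EuclideanSpace ℝ (Fin k))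
    {t : ℝ} (ht : 0 < t) :
    ‖Complex.exp (Complex.I * (inner ℝ ξ y : ℝ)) * (symbol x x₀ t ‖ξ‖ : ℂ)‖
      = symbol x x₀ t ‖ξ‖ := by
  rw [norm_mul, norm_exp_I_mul, one_mul, Complex.norm_real,
    Real.norm_of_nonneg (symbol_nonneg x x₀ ht (norm_nonneg _))]

/-- The constant in the bound `K ≤ M t ^ (-(N/2 + k))`. -/
def kernelConst (N k : ℕ) : ℝ := 1 / (2 * Real.pi) ^ (((N : ℝ) + 2 * k) / 2) *
  (2 ^ ((N : ℝ) / 2) * ∫ ξ : EuclideanSpace ℝ (Fin k), Real.exp (-((N : ℝ) / 4 * ‖ξ‖)))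

theorem kernelConst_nonneg : 0 ≤ kernelConst N k := by
  unfold kernelConst
  have : 0 ≤ ∫ ξ : EuclideanSpace ℝ (Fin k), Real.exp (-((N : ℝ) / 4 * ‖ξ‖)) :=
    integral_nonneg fun ξ => (Real.exp_pos _).le
  positivity

/-- The prefactor of the symbol contributes t^{-N/2}, and rescaling ξ by t contributes t^{-k}. -/
theorem abs_heatKernel_le (hN : 1 ≤ N) (x x₀ : EuclideanSpace ℝ (Fin N))
    (y : EuclideanSpace ℝ (Fin k)) {t : ℝ} (ht : 0 < t) :
    |heatKernel x x₀ y t| ≤ kernelConst N k * t ^ (-(((N : ℝ) + 2 * k) / 2)) := by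
  rw [heatKernel_eq, abs_mul, abs_of_nonneg (by positivity :
    (0 : ℝ) ≤ 1 / (2 * Real.pi) ^ (((N : ℝ) + 2 * k) / 2)), kernelConst, mul_assoc]
  refine mul_le_mul_of_nonneg_left ?_ (by positivity)
  refine (Complex.abs_re_le_norm _).trans ?_
  have hc : 0 < (N : ℝ) / 4 * t := by positivity
  have h1 : ‖∫ ξ : EuclideanSpace ℝ (Fin k),
      Complex.exp (Complex.I * (inner ℝ ξ y : ℝ)) * (symbol x x₀ t ‖ξ‖ : ℂ)‖
      ≤ ∫ ξ : EuclideanSpace ℝ (Fin k), (2 / t) ^ ((N : ℝ) / 2) *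
        Real.exp (-((N : ℝ) / 4 * ‖t • ξ‖)) := by
    refine norm_integral_le_of_norm_le ?_ (ae_of_all _ fun ξ => ?_)
    · refine ((integrable_exp_neg_mul_norm hc).const_mul ((2 / t) ^ ((N : ℝ) / 2))).congr
        (ae_of_all _ fun ξ => ?_)
      simp only [norm_smul, Real.norm_of_nonneg ht.le, mul_assoc]
    · rw [norm_cexp_mul_symbol x x₀ y ξ ht, norm_smul, Real.norm_of_nonneg ht.le]
      exact symbol_le_exp x x₀ ht (norm_nonneg _)
  refine h1.trans_eq ?_
  rw [integral_const_mul, Measure.integral_comp_smul volume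
    (fun ξ : EuclideanSpace ℝ (Fin k) => Real.exp (-((N : ℝ) / 4 * ‖ξ‖)))]
  rw [finrank_euclideanSpace_fin, smul_eq_mul, abs_of_pos (by positivity),
    Real.div_rpow (by norm_num) ht.le, add_div, mul_div_cancel_left₀ _ (two_ne_zero),
    neg_add, Real.rpow_add ht, Real.rpow_neg ht.le, Real.rpow_neg ht.le, Real.rpow_natCast]
  ring

theorem measurable_heatKernel : Measurable
    (fun a : (EuclideanSpace ℝ (Fin N) × EuclideanSpace ℝ (Fin N)) × EuclideanSpace ℝ (Fin k) × ℝ =>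
      heatKernel a.1.1 a.1.2 a.2.1 a.2.2) := by
  simp_rw [heatKernel_eq]
  refine Measurable.const_mul (Complex.measurable_re.comp ?_) _
  refine StronglyMeasurable.measurable (StronglyMeasurable.integral_prod_right
    (f := fun a : (EuclideanSpace ℝ (Fin N) × EuclideanSpace ℝ (Fin N)) ×
      EuclideanSpace ℝ (Fin k) × ℝ => fun ξ : EuclideanSpace ℝ (Fin k) =>
      Complex.exp (Complex.I * (inner ℝ ξ a.2.1 : ℝ)) * (symbol a.1.1 a.1.2 a.2.2 ‖ξ‖ : ℂ)) ?_)
  refine Measurable.stronglyMeasurable ?_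
  simp only [Function.uncurry_def]
  refine Measurable.mul (by fun_prop) (Complex.measurable_ofReal.comp ?_)
  exact measurable_symbol.comp (f := fun p : ((EuclideanSpace ℝ (Fin N) ×
    EuclideanSpace ℝ (Fin N)) × EuclideanSpace ℝ (Fin k) × ℝ) × EuclideanSpace ℝ (Fin k) =>
    (p.1.1, p.1.2.2, ‖p.2‖)) (by fun_prop)

theorem continuousAt_symbol (x x₀ : EuclideanSpace ℝ (Fin N)) {t r : ℝ} (ht : 0 < t)
    (hr : 0 ≤ r) : ContinuousAt (fun s => symbol x x₀ s r) t := by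
  rcases hr.eq_or_lt with rfl | hr
  · simp [symbol, continuousAt_const]
  have hs : 0 < Real.sinh (r * t) := Real.sinh_pos_iff.2 (by positivity)
  have h1 : ContinuousAt (fun s => Real.sinh (r * s)) t :=
    (Real.continuous_sinh.comp (continuous_const.mul continuous_id)).continuousAt
  have h2 : ContinuousAt (fun s => Real.cosh (r * s)) t :=
    (Real.continuous_cosh.comp (continuous_const.mul continuous_id)).continuousAt
  unfold symbol
  refine ContinuousAt.mul (ContinuousAt.rpow_const (continuousAt_const.div h1 hs.ne')
    (Or.inr (by positivity))) (Real.continuous_exp.continuousAt.comp ?_)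
  exact (continuousAt_const.mul ((continuousAt_const.mul (h2.div h1 hs.ne')).sub
    (continuousAt_const.mul (continuousAt_const.div h1 hs.ne')))).neg

theorem continuousAt_heatKernel (hN : 1 ≤ N) (x x₀ : EuclideanSpace ℝ (Fin N))
    (y : EuclideanSpace ℝ (Fin k)) {t : ℝ} (ht : 0 < t) :
    ContinuousAt (fun s => heatKernel x x₀ y s) t := by
  simp_rw [heatKernel_eq]
  refine ContinuousAt.mul continuousAt_const (Complex.continuous_re.continuousAt.comp ?_)
  have hc : 0 < (N : ℝ) / 4 * (t / 2) := by positivity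
  refine continuousAt_of_dominated (bound := fun ξ => (2 / (t / 2)) ^ ((N : ℝ) / 2) *
    Real.exp (-((N : ℝ) / 4 * (t / 2) * ‖ξ‖))) ?_ ?_
    ((integrable_exp_neg_mul_norm hc).const_mul _) ?_
  · refine Eventually.of_forall fun s => Measurable.aestronglyMeasurable ?_
    exact Measurable.mul (by fun_prop) (Complex.measurable_ofReal.comp (measurable_symbol_norm _ _ _))
  · filter_upwards [lt_mem_nhds (half_lt_self ht)] with s hs
    have hs0 : 0 < s := (half_pos ht).trans hs
    refine ae_of_all _ fun ξ => ?_
    rw [norm_cexp_mul_symbol x x₀ y ξ hs0]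
    refine (symbol_le_exp x x₀ hs0 (norm_nonneg _)).trans ?_
    rw [mul_assoc ((N : ℝ) / 4)]
    gcongr
  · refine ae_of_all _ fun ξ => continuousAt_const.mul ?_
    exact Complex.continuous_ofReal.continuousAt.comp (continuousAt_symbol x x₀ ht (norm_nonneg _))

theorem lintegral_comp_smul {n : ℕ} (F : EuclideanSpace ℝ (Fin n) → ℝ≥0∞) {R : ℝ} (hR : 0 < R) :
    ∫⁻ x, F x = ENNReal.ofReal (R ^ n) * ∫⁻ v, F (R • v) := by
  have h := Measure.map_addHaar_smul (volume : Measure (EuclideanSpace ℝ (Fin n))) hR.ne'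
  have h2 : ∫⁻ v, F (R • v) = ∫⁻ x, F x ∂(Measure.map (R • ·) volume) :=
    (lintegral_map_equiv F (Homeomorph.smulOfNeZero R hR.ne').toMeasurableEquiv).symm
  rw [h2, h, lintegral_smul_measure, finrank_euclideanSpace_fin, abs_of_pos (by positivity),
    smul_eq_mul, ← mul_assoc, ← ENNReal.ofReal_mul (by positivity), mul_inv_cancel₀ (by positivity)]
  simp

theorem integrable_gaussian {n : ℕ} {b : ℝ} (hb : 0 < b) :
    Integrable (fun v : EuclideanSpace ℝ (Fin n) => Real.exp (-b * ‖v‖ ^ 2)) := by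
  have hb' : 0 < (b : ℂ).re := by simpa using hb
  refine (GaussianFourier.integrable_cexp_neg_mul_sq_norm_add hb' 0
    (0 : EuclideanSpace ℝ (Fin n))).norm.congr (ae_of_all _ fun η => ?_)
  simp only [zero_mul, add_zero]
  rw [Complex.norm_exp]
  congr 1
  rw [← Complex.ofReal_pow, ← Complex.ofReal_neg, ← Complex.ofReal_mul, Complex.ofReal_re]

/-- The Gaussian in y makes Fubini legitimate before integrability of the kernel in y is known. The
y-integral concentrates at frequencies of size √ε, whence the substitution ξ = √ε ζ. -/
theorem integral_heatKernel_mul_gaussian (hN : 1 ≤ N) (x x₀ : EuclideanSpace ℝ (Fin N)) {t ε : ℝ}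
    (ht : 0 < t) (hε : 0 < ε) :
    ∫ y : EuclideanSpace ℝ (Fin k), heatKernel x x₀ y t * Real.exp (-ε * ‖y‖ ^ 2)
      = 1 / (2 * Real.pi) ^ (((N : ℝ) + 2 * k) / 2) * (Real.pi ^ ((k : ℝ) / 2) *
        ∫ ζ : EuclideanSpace ℝ (Fin k), symbol x x₀ t (Real.sqrt ε * ‖ζ‖) *
          Real.exp (-(1 / 4) * ‖ζ‖ ^ 2)) := by
  have hπ := Real.pi_pos
  have hε' : 0 < (ε : ℂ).re := by simpa using hε
  have hs := (integrable_symbol (k := k) hN x x₀ ht)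
  have hg := integrable_gaussian (n := k) hε
  have hint : Integrable (fun a : EuclideanSpace ℝ (Fin k) × EuclideanSpace ℝ (Fin k) =>
      Complex.exp (Complex.I * (inner ℝ a.2 a.1 : ℝ)) * (symbol x x₀ t ‖a.2‖ : ℂ) *
        (Real.exp (-ε * ‖a.1‖ ^ 2) : ℂ)) (volume.prod volume) := by
    refine (hg.mul_prod hs).mono' ?_ (ae_of_all _ fun a => ?_)
    · refine (Measurable.mul (Measurable.mul (by fun_prop) ?_) (by fun_prop)).aestronglyMeasurable
      exact Complex.measurable_ofReal.comp ((measurable_symbol_norm x x₀ t).comp measurable_snd)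
    · rw [norm_mul, norm_cexp_mul_symbol x x₀ _ _ ht, Complex.norm_real, Real.norm_eq_abs,
        Real.abs_exp, mul_comm]
  have h1 : ∀ y : EuclideanSpace ℝ (Fin k), heatKernel x x₀ y t * Real.exp (-ε * ‖y‖ ^ 2)
      = 1 / (2 * Real.pi) ^ (((N : ℝ) + 2 * k) / 2) * (∫ ξ : EuclideanSpace ℝ (Fin k),
        Complex.exp (Complex.I * (inner ℝ ξ y : ℝ)) * (symbol x x₀ t ‖ξ‖ : ℂ) *
        (Real.exp (-ε * ‖y‖ ^ 2) : ℂ)).re := fun y => by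
    rw [heatKernel_eq, integral_mul_const, Complex.re_mul_ofReal, mul_assoc]
  simp_rw [h1]
  rw [integral_const_mul]
  congr 1
  have h2 := integral_re hint.integral_prod_left
  simp only [RCLike.re_to_complex] at h2
  rw [h2, integral_integral_swap hint]
  have h3 : ∀ ξ : EuclideanSpace ℝ (Fin k), (∫ y : EuclideanSpace ℝ (Fin k),
        Complex.exp (Complex.I * (inner ℝ ξ y : ℝ)) * (symbol x x₀ t ‖ξ‖ : ℂ) *
        (Real.exp (-ε * ‖y‖ ^ 2) : ℂ))
      = ((symbol x x₀ t ‖ξ‖ * ((Real.pi / ε) ^ ((k : ℝ) / 2) *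
        Real.exp (-(1 / (4 * ε)) * ‖ξ‖ ^ 2)) : ℝ) : ℂ) := fun ξ => by
    have := GaussianFourier.integral_cexp_neg_mul_sq_norm_add hε' Complex.I ξ
    simp_rw [Complex.exp_add] at this
    have e : ∀ y : EuclideanSpace ℝ (Fin k),
        Complex.exp (Complex.I * (inner ℝ ξ y : ℝ)) * (symbol x x₀ t ‖ξ‖ : ℂ) *
        (Real.exp (-ε * ‖y‖ ^ 2) : ℂ) = (symbol x x₀ t ‖ξ‖ : ℂ) *
        (Complex.exp (-ε * ‖y‖ ^ 2) * Complex.exp (Complex.I * (inner ℝ ξ y : ℝ))) := fun y => by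
      push_cast; ring
    simp_rw [e]
    rw [integral_const_mul, this, finrank_euclideanSpace_fin]
    rw [Complex.ofReal_mul, Complex.ofReal_mul, Complex.ofReal_cpow (by positivity),
      Complex.ofReal_exp, Complex.I_sq]
    push_cast
    congr 3
    field_simp
  simp_rw [h3]
  rw [integral_complex_ofReal, Complex.ofReal_re]
  have hq : 0 < Real.sqrt ε := Real.sqrt_pos.2 hε
  have h4 := Measure.integral_comp_smul volume (fun ξ : EuclideanSpace ℝ (Fin k) =>
    symbol x x₀ t ‖ξ‖ * ((Real.pi / ε) ^ ((k : ℝ) / 2) *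
        Real.exp (-(1 / (4 * ε)) * ‖ξ‖ ^ 2))) (Real.sqrt ε)
  rw [finrank_euclideanSpace_fin, abs_of_pos (by positivity), smul_eq_mul, eq_comm,
    inv_mul_eq_iff_eq_mul₀ (by positivity)] at h4
  rw [h4, ← integral_const_mul, ← integral_const_mul]
  congr 1
  funext ζ
  rw [norm_smul, Real.norm_of_nonneg hq.le, mul_pow, Real.sq_sqrt hε.le]
  have e1 : Real.sqrt ε ^ k * (Real.pi / ε) ^ ((k : ℝ) / 2) = Real.pi ^ ((k : ℝ) / 2) := by
    rw [← Real.rpow_natCast (Real.sqrt ε), Real.sqrt_eq_rpow, ← Real.rpow_mul hε.le,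
      show (1 / 2 * (k : ℝ)) = (k : ℝ) / 2 by ring, ← Real.mul_rpow hε.le (by positivity)]
    congr 1; field_simp
  rw [← e1, show -(1 / (4 * ε)) * (ε * ‖ζ‖ ^ 2) = -(1 / 4) * ‖ζ‖ ^ 2 by field_simp]
  ring

end Kernel

end

end Grushin

namespace Grushin

noncomputable section

/-! ### Mass and concentration of the heat kernel -/

section Mass

variable {N k : ℕ}

theorem integrable_symbol_mul_gaussian (x x₀ : EuclideanSpace ℝ (Fin N)) {t ε : ℝ} (ht : 0 < t) :
    Integrable (fun ζ : EuclideanSpace ℝ (Fin k) => symbol x x₀ t (Real.sqrt ε * ‖ζ‖) *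
      Real.exp (-(1 / 4) * ‖ζ‖ ^ 2)) := by
  refine ((integrable_gaussian (b := 1 / 4) (by norm_num)).const_mul
    ((2 / t) ^ ((N : ℝ) / 2))).mono' ?_ (ae_of_all _ fun ζ => ?_)
  · refine Measurable.aestronglyMeasurable (Measurable.mul ?_ (by fun_prop))
    exact measurable_symbol.comp (f := fun ξ : EuclideanSpace ℝ (Fin k) =>
      ((x, x₀), t, Real.sqrt ε * ‖ξ‖)) (by fun_prop)
  · have h0 : 0 ≤ Real.sqrt ε * ‖ζ‖ := by positivity
    rw [norm_mul, Real.norm_of_nonneg (symbol_nonneg x x₀ ht h0), Real.norm_eq_abs, Real.abs_exp]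
    refine mul_le_mul_of_nonneg_right ((symbol_le_exp x x₀ ht h0).trans ?_) (Real.exp_pos _).le
    refine mul_le_of_le_one_right (by positivity) ?_
    rw [Real.exp_le_one_iff, neg_nonpos]
    positivity

/-- With the further substitution x₀ = x + √t v the integrand has a majorant, Gaussian in v and ζ,
that does not depend on t and ε. The extra weight with parameter δ localises in the x-variable. -/
theorem lintegral_heatKernel_mul_gaussian (hN : 1 ≤ N) (hk : 1 ≤ k) (z : Space N k) {t ε : ℝ}
    (δ : ℝ) (ht : 0 < t) (hε : 0 < ε) :
    ∫⁻ w : Space N k, ENNReal.ofReal (heatKernel z.1 w.1 (z.2 - w.2) t *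
        Real.exp (-ε * ‖z.2 - w.2‖ ^ 2)) * ENNReal.ofReal (Real.exp (-δ * ‖w.1 - z.1‖ ^ 2))
      = ENNReal.ofReal (1 / (2 * Real.pi) ^ (((N : ℝ) + 2 * k) / 2) * Real.pi ^ ((k : ℝ) / 2)) *
        ∫⁻ a : EuclideanSpace ℝ (Fin N) × EuclideanSpace ℝ (Fin k),
          ENNReal.ofReal (t ^ ((N : ℝ) / 2) *
            symbol z.1 (z.1 + Real.sqrt t • a.1) t (Real.sqrt ε * ‖a.2‖) *
            Real.exp (-(1 / 4) * ‖a.2‖ ^ 2)) *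
          ENNReal.ofReal (Real.exp (-δ * (t * ‖a.1‖ ^ 2))) := by
  have hπ := Real.pi_pos
  set c := 1 / (2 * Real.pi) ^ (((N : ℝ) + 2 * k) / 2) * Real.pi ^ ((k : ℝ) / 2) with hc
  have hc0 : 0 ≤ c := by positivity
  have hmK : Measurable (fun w : Space N k => heatKernel z.1 w.1 (z.2 - w.2) t) :=
    measurable_heatKernel.comp (f := fun w : Space N k => ((z.1, w.1), z.2 - w.2, t)) (by fun_prop)
  rw [Measure.volume_eq_prod, lintegral_prod _ (by fun_prop)]
  have h1 : ∀ x₀ : EuclideanSpace ℝ (Fin N),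
      (∫⁻ y₀ : EuclideanSpace ℝ (Fin k), ENNReal.ofReal (heatKernel z.1 x₀ (z.2 - y₀) t *
        Real.exp (-ε * ‖z.2 - y₀‖ ^ 2)) * ENNReal.ofReal (Real.exp (-δ * ‖x₀ - z.1‖ ^ 2)))
      = ENNReal.ofReal c * ∫⁻ ζ : EuclideanSpace ℝ (Fin k), ENNReal.ofReal
          (symbol z.1 x₀ t (Real.sqrt ε * ‖ζ‖) * Real.exp (-(1 / 4) * ‖ζ‖ ^ 2)) *
          ENNReal.ofReal (Real.exp (-δ * ‖x₀ - z.1‖ ^ 2)) := fun x₀ => by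
    have hm : Measurable (fun y : EuclideanSpace ℝ (Fin k) => heatKernel z.1 x₀ y t) :=
      measurable_heatKernel.comp (f := fun y : EuclideanSpace ℝ (Fin k) => ((z.1, x₀), y, t))
        (by fun_prop)
    have hi : Integrable (fun y : EuclideanSpace ℝ (Fin k) =>
        heatKernel z.1 x₀ y t * Real.exp (-ε * ‖y‖ ^ 2)) :=
      (integrable_gaussian hε).bdd_mul (c := kernelConst N k * t ^ (-(((N : ℝ) + 2 * k) / 2)))
        hm.aestronglyMeasurable (ae_of_all _ fun y => abs_heatKernel_le hN _ _ _ ht)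
    rw [lintegral_mul_const' _ _ ENNReal.ofReal_ne_top, lintegral_mul_const' _ _ ENNReal.ofReal_ne_top,
      lintegral_sub_left_eq_self (fun y => ENNReal.ofReal (heatKernel z.1 x₀ y t *
        Real.exp (-ε * ‖y‖ ^ 2))), ← ofReal_integral_eq_lintegral_ofReal hi
        (ae_of_all _ fun y => mul_nonneg (heatKernel_nonneg hN hk _ _ _ ht) (Real.exp_pos _).le),
      integral_heatKernel_mul_gaussian hN _ _ ht hε, ← mul_assoc, ← hc, ENNReal.ofReal_mul hc0,
      ofReal_integral_eq_lintegral_ofReal (integrable_symbol_mul_gaussian z.1 x₀ ht)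
        (ae_of_all _ fun ζ => mul_nonneg (symbol_nonneg _ _ ht (by positivity)) (Real.exp_pos _).le),
      mul_assoc]
  simp_rw [h1]
  rw [lintegral_const_mul' _ _ ENNReal.ofReal_ne_top]
  congr 1
  have hms : Measurable (fun a : EuclideanSpace ℝ (Fin N) × EuclideanSpace ℝ (Fin k) =>
      symbol z.1 (z.1 + Real.sqrt t • a.1) t (Real.sqrt ε * ‖a.2‖)) :=
    measurable_symbol.comp (f := fun a : EuclideanSpace ℝ (Fin N) × EuclideanSpace ℝ (Fin k) =>
      ((z.1, z.1 + Real.sqrt t • a.1), t, Real.sqrt ε * ‖a.2‖)) (by fun_prop)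
  have hq : 0 < Real.sqrt t := Real.sqrt_pos.2 ht
  rw [lintegral_prod _ (by fun_prop), ← lintegral_add_left_eq_self _ z.1,
    lintegral_comp_smul _ hq, ← lintegral_const_mul' _ _ ENNReal.ofReal_ne_top]
  congr 1
  funext v
  rw [← lintegral_const_mul' _ _ ENNReal.ofReal_ne_top]
  congr 1
  funext ζ
  have e1 : Real.sqrt t ^ N = t ^ ((N : ℝ) / 2) := by
    rw [← Real.rpow_natCast (Real.sqrt t), Real.sqrt_eq_rpow, ← Real.rpow_mul ht.le]
    ring_nf
  rw [← mul_assoc, ← ENNReal.ofReal_mul (by positivity), e1, add_sub_cancel_left, norm_smul,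
    Real.norm_of_nonneg hq.le, mul_pow, Real.sq_sqrt ht.le, mul_assoc (t ^ ((N : ℝ) / 2))]

theorem tendsto_div_sinh : Tendsto (fun θ : ℝ => θ / Real.sinh θ) (𝓝[>] 0) (𝓝 1) := by
  have h := (hasDerivAt_iff_tendsto_slope_zero.1 (Real.hasDerivAt_sinh 0)).mono_left
    (nhdsWithin_mono _ (fun x (hx : (0 : ℝ) < x) => hx.ne') : 𝓝[>] (0 : ℝ) ≤ 𝓝[≠] 0)
  have h2 := h.inv₀ (by simp)
  simp only [zero_add, Real.sinh_zero, sub_zero, smul_eq_mul, mul_inv, inv_inv, Real.cosh_zero,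
    inv_one] at h2
  exact h2

theorem tendsto_cosh_sub_one_div : Tendsto (fun θ : ℝ => (Real.cosh θ - 1) / θ) (𝓝[>] 0) (𝓝 0) := by
  have h := (hasDerivAt_iff_tendsto_slope_zero.1 (Real.hasDerivAt_cosh 0)).mono_left
    (nhdsWithin_mono _ (fun x (hx : (0 : ℝ) < x) => hx.ne') : 𝓝[>] (0 : ℝ) ≤ 𝓝[≠] 0)
  simp only [zero_add, Real.cosh_zero, smul_eq_mul, Real.sinh_zero] at h
  exact h.congr fun θ => by rw [div_eq_inv_mul]

/-- Put θ = est → 0. Eliminating the inner product through t|v|² = a - 2x·x₀, with a = |x|² + |x₀|²,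
leaves the exponent |v|²/2 · θ/sinh θ plus a bounded multiple of (cosh θ - 1)/sinh θ. -/
theorem tendsto_symbol_scaled {ι : Type*} {l : Filter ι} {t e : ι → ℝ} {t₀ e₀ : ℝ}
    (ht : ∀ᶠ i in l, 0 < t i) (he : ∀ᶠ i in l, 0 < e i) (htl : Tendsto t l (𝓝 t₀))
    (hel : Tendsto e l (𝓝 e₀)) (h0 : e₀ * t₀ = 0) (x v : EuclideanSpace ℝ (Fin N)) {s : ℝ}
    (hs : 0 < s) :
    Tendsto (fun i => t i ^ ((N : ℝ) / 2) * symbol x (x + Real.sqrt (t i) • v) (t i) (e i * s)) l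
      (𝓝 (Real.exp (-(1 / 2) * ‖v‖ ^ 2))) := by
  have hθ : Tendsto (fun i => e i * s * t i) l (𝓝[>] 0) := by
    refine tendsto_nhdsWithin_iff.2 ⟨?_, ?_⟩
    · have := (hel.mul_const s).mul htl
      rwa [mul_right_comm, h0, zero_mul] at this
    · filter_upwards [ht, he] with i h1 h2
      exact mem_Ioi.2 (by positivity)
  have hA := tendsto_div_sinh.comp hθ
  have hB := tendsto_cosh_sub_one_div.comp hθ
  have hsq : Tendsto (fun i => Real.sqrt (t i)) l (𝓝 (Real.sqrt t₀)) :=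
    (Real.continuous_sqrt.tendsto _).comp htl
  have ha : Tendsto (fun i => ‖x‖ ^ 2 + ‖x + Real.sqrt (t i) • v‖ ^ 2) l
      (𝓝 (‖x‖ ^ 2 + ‖x + Real.sqrt t₀ • v‖ ^ 2)) :=
    (((hsq.smul_const v).const_add x).norm.pow 2).const_add _
  have hE := (hA.mul_const (‖v‖ ^ 2 / 2)).add (((hel.mul_const (s / 2)).mul ha).mul (hA.mul hB))
  have hP := (hA.rpow_const (p := (N : ℝ) / 2) (Or.inl one_ne_zero)).mul
    ((Real.continuous_exp.tendsto _).comp hE.neg)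
  simp only [Real.one_rpow, one_mul, mul_zero, add_zero] at hP
  rw [show -(‖v‖ ^ 2 / 2) = -(1 / 2) * ‖v‖ ^ 2 by ring] at hP
  refine hP.congr' ?_
  filter_upwards [ht, he] with i h1 h2
  have hsi : 0 < Real.sinh (e i * s * t i) := Real.sinh_pos_iff.2 (by positivity)
  simp only [Function.comp_apply, symbol]
  rw [← mul_assoc (t i ^ ((N : ℝ) / 2)), ← Real.mul_rpow h1.le (by positivity)]
  have e2 : t i * ‖v‖ ^ 2 = (‖x‖ ^ 2 + ‖x + Real.sqrt (t i) • v‖ ^ 2)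
      - 2 * inner ℝ x (x + Real.sqrt (t i) • v) := by
    have h3 := norm_sub_sq_real x (x + Real.sqrt (t i) • v)
    rw [sub_add_cancel_left, norm_neg, norm_smul, mul_pow, Real.norm_of_nonneg (Real.sqrt_nonneg _),
      Real.sq_sqrt h1.le] at h3
    linarith
  congr 2
  · ring
  · congr 1
    set a := ‖x‖ ^ 2 + ‖x + Real.sqrt (t i) • v‖ ^ 2
    rw [show 2 * inner ℝ x (x + Real.sqrt (t i) • v) = a - t i * ‖v‖ ^ 2 by linarith]
    field_simp
    ring

theorem symbol_scaled_le (x v : EuclideanSpace ℝ (Fin N)) {t r : ℝ} (ht : 0 < t) (hr : 0 < r) :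
    t ^ ((N : ℝ) / 2) * symbol x (x + Real.sqrt t • v) t r ≤ Real.exp (-(1 / 2) * ‖v‖ ^ 2) := by
  have h := symbolExt_le x (x + Real.sqrt t • v) ht hr.le
  rw [symbolExt, if_neg hr.ne'] at h
  calc _ ≤ t ^ ((N : ℝ) / 2) * _ := mul_le_mul_of_nonneg_left h (by positivity)
    _ = _ := by
      rw [← mul_assoc, ← Real.rpow_add ht, add_neg_cancel, Real.rpow_zero, one_mul,
        sub_add_cancel_left, norm_neg, norm_smul, mul_pow, Real.norm_of_nonneg (Real.sqrt_nonneg _),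
        Real.sq_sqrt ht.le]
      congr 1
      field_simp

theorem lintegral_gaussian {n : ℕ} {b : ℝ} (hb : 0 < b) :
    ∫⁻ v : EuclideanSpace ℝ (Fin n), ENNReal.ofReal (Real.exp (-b * ‖v‖ ^ 2))
      = ENNReal.ofReal ((Real.pi / b) ^ ((n : ℝ) / 2)) := by
  rw [← ofReal_integral_eq_lintegral_ofReal (integrable_gaussian hb)
    (ae_of_all _ fun v => (Real.exp_pos _).le), GaussianFourier.integral_rexp_neg_mul_sq_norm hb,
    finrank_euclideanSpace_fin]

/-- Stated along a general filter because two limits are needed: t fixed, ε → 0 and δ = 0 gives the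
mass, while t → 0 with ε = δ = 1 gives concentration at z. -/
theorem tendsto_lintegral_heatKernel_mul_gaussian (hN : 1 ≤ N) (hk : 1 ≤ k) (z : Space N k)
    {ι : Type*} {l : Filter ι} [l.IsCountablyGenerated] {t ε : ι → ℝ} {δ t₀ ε₀ : ℝ}
    (ht : ∀ᶠ i in l, 0 < t i) (hε : ∀ᶠ i in l, 0 < ε i) (htl : Tendsto t l (𝓝 t₀))
    (hεl : Tendsto ε l (𝓝 ε₀)) (h0 : Real.sqrt ε₀ * t₀ = 0) (hδ : 0 ≤ δ) (hδt : δ * t₀ = 0) :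
    Tendsto (fun i => ∫⁻ w : Space N k, ENNReal.ofReal (heatKernel z.1 w.1 (z.2 - w.2) (t i) *
        Real.exp (-ε i * ‖z.2 - w.2‖ ^ 2)) * ENNReal.ofReal (Real.exp (-δ * ‖w.1 - z.1‖ ^ 2)))
      l (𝓝 1) := by
  have hπ := Real.pi_pos
  set c := 1 / (2 * Real.pi) ^ (((N : ℝ) + 2 * k) / 2) * Real.pi ^ ((k : ℝ) / 2) with hc
  have hc0 : 0 ≤ c := by positivity
  have hsq : Tendsto (fun i => Real.sqrt (ε i)) l (𝓝 (Real.sqrt ε₀)) :=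
    (Real.continuous_sqrt.tendsto _).comp hεl
  have hval : ∫⁻ a : EuclideanSpace ℝ (Fin N) × EuclideanSpace ℝ (Fin k),
      ENNReal.ofReal (Real.exp (-(1 / 2) * ‖a.1‖ ^ 2)) *
        ENNReal.ofReal (Real.exp (-(1 / 4) * ‖a.2‖ ^ 2))
      = ENNReal.ofReal ((Real.pi / (1 / 2)) ^ ((N : ℝ) / 2) * (Real.pi / (1 / 4)) ^ ((k : ℝ) / 2)) := by
    rw [Measure.volume_eq_prod, lintegral_prod_mul
        (f := fun v : EuclideanSpace ℝ (Fin N) => ENNReal.ofReal (Real.exp (-(1 / 2) * ‖v‖ ^ 2)))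
        (g := fun v : EuclideanSpace ℝ (Fin k) => ENNReal.ofReal (Real.exp (-(1 / 4) * ‖v‖ ^ 2)))
        (by fun_prop) (by fun_prop),
      lintegral_gaussian (by norm_num), lintegral_gaussian (by norm_num),
      ← ENNReal.ofReal_mul (by positivity)]
  -- The normalisation of the kernel: (2π)^{-(N+2k)/2} π^{k/2} (2π)^{N/2} (4π)^{k/2} = 1.
  have hone : ENNReal.ofReal c * ENNReal.ofReal
      ((Real.pi / (1 / 2)) ^ ((N : ℝ) / 2) * (Real.pi / (1 / 4)) ^ ((k : ℝ) / 2)) = 1 := by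
    rw [← ENNReal.ofReal_mul hc0, ← ENNReal.ofReal_one]
    congr 1
    rw [hc, show Real.pi / (1 / 2) = 2 * Real.pi by ring,
      show Real.pi / (1 / 4) = (2 * Real.pi) * (2 * Real.pi) / Real.pi by field_simp; ring,
      add_div, mul_div_cancel_left₀ _ (two_ne_zero), Real.rpow_add (x := 2 * Real.pi) (by positivity) ((N : ℝ) / 2) k,
      Real.div_rpow (by positivity) hπ.le,
      Real.mul_rpow (x := 2 * Real.pi) (y := 2 * Real.pi) (by positivity) (by positivity),
      ← Real.rpow_add (x := 2 * Real.pi) (by positivity) ((k : ℝ) / 2), add_halves]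
    have hA : 0 < (2 * Real.pi) ^ ((N : ℝ) / 2) := by positivity
    have hB : 0 < (2 * Real.pi) ^ (k : ℝ) := by positivity
    have hC : 0 < Real.pi ^ ((k : ℝ) / 2) := by positivity
    generalize (2 * Real.pi) ^ ((N : ℝ) / 2) = A at *
    generalize (2 * Real.pi) ^ (k : ℝ) = B at *
    generalize Real.pi ^ ((k : ℝ) / 2) = D at *
    field_simp
  rw [← hone, ← hval]
  have hae : ∀ᵐ a : EuclideanSpace ℝ (Fin N) × EuclideanSpace ℝ (Fin k), ‖a.2‖ ≠ 0 :=
    Measure.quasiMeasurePreserving_snd.ae (ae_norm_ne_zero hk)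
  have hlim : Tendsto (fun i => ∫⁻ a : EuclideanSpace ℝ (Fin N) × EuclideanSpace ℝ (Fin k),
      ENNReal.ofReal (t i ^ ((N : ℝ) / 2) *
        symbol z.1 (z.1 + Real.sqrt (t i) • a.1) (t i) (Real.sqrt (ε i) * ‖a.2‖) *
        Real.exp (-(1 / 4) * ‖a.2‖ ^ 2)) *
      ENNReal.ofReal (Real.exp (-δ * (t i * ‖a.1‖ ^ 2)))) l
      (𝓝 (∫⁻ a : EuclideanSpace ℝ (Fin N) × EuclideanSpace ℝ (Fin k),
        ENNReal.ofReal (Real.exp (-(1 / 2) * ‖a.1‖ ^ 2)) *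
        ENNReal.ofReal (Real.exp (-(1 / 4) * ‖a.2‖ ^ 2)))) := by
    refine tendsto_lintegral_filter_of_dominated_convergence (fun a =>
      ENNReal.ofReal (Real.exp (-(1 / 2) * ‖a.1‖ ^ 2)) *
        ENNReal.ofReal (Real.exp (-(1 / 4) * ‖a.2‖ ^ 2))) ?_ ?_ ?_ ?_
    · refine Eventually.of_forall fun i => ?_
      have hms : Measurable (fun a : EuclideanSpace ℝ (Fin N) × EuclideanSpace ℝ (Fin k) =>
          symbol z.1 (z.1 + Real.sqrt (t i) • a.1) (t i) (Real.sqrt (ε i) * ‖a.2‖)) :=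
        measurable_symbol.comp
          (f := fun a : EuclideanSpace ℝ (Fin N) × EuclideanSpace ℝ (Fin k) =>
          ((z.1, z.1 + Real.sqrt (t i) • a.1), t i, Real.sqrt (ε i) * ‖a.2‖)) (by fun_prop)
      fun_prop
    · filter_upwards [ht, hε] with i hti hεi
      filter_upwards [hae] with a ha
      have hr : 0 < Real.sqrt (ε i) * ‖a.2‖ := by
        have := Real.sqrt_pos.2 hεi
        positivity
      rw [← ENNReal.ofReal_mul (Real.exp_pos _).le]
      refine (mul_le_of_le_one_right (zero_le) ?_).trans (ENNReal.ofReal_le_ofReal ?_)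
      · rw [← ENNReal.ofReal_one]
        refine ENNReal.ofReal_le_ofReal ?_
        rw [Real.exp_le_one_iff]
        have : 0 ≤ δ * (t i * ‖a.1‖ ^ 2) := by positivity
        linarith
      · exact mul_le_mul_of_nonneg_right (symbol_scaled_le _ _ hti hr) (Real.exp_pos _).le
    · rw [hval]; exact ENNReal.ofReal_ne_top
    · filter_upwards [hae] with a ha
      have hpos : 0 < ‖a.2‖ := (norm_nonneg _).lt_of_ne' ha
      have h1 := tendsto_symbol_scaled ht (hε.mono fun i hi => Real.sqrt_pos.2 hi) htl hsq h0
        z.1 a.1 hpos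
      have h2 := ENNReal.tendsto_ofReal (h1.mul_const (Real.exp (-(1 / 4) * ‖a.2‖ ^ 2)))
      have h3 : Tendsto (fun i => ENNReal.ofReal (Real.exp (-δ * (t i * ‖a.1‖ ^ 2)))) l (𝓝 1) := by
        rw [← ENNReal.ofReal_one]
        refine ENNReal.tendsto_ofReal ?_
        have := (Real.continuous_exp.tendsto _).comp
          ((htl.mul_const (‖a.1‖ ^ 2)).const_mul (-δ))
        rwa [← mul_assoc, neg_mul δ, hδt, neg_zero, zero_mul, Real.exp_zero] at this
      have h4 := ENNReal.Tendsto.mul h2 (Or.inr ENNReal.one_ne_top) h3 (Or.inr ENNReal.ofReal_ne_top)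
      rwa [mul_one, ENNReal.ofReal_mul (Real.exp_pos _).le] at h4
  refine (ENNReal.Tendsto.const_mul hlim (Or.inr ENNReal.ofReal_ne_top)).congr' ?_
  filter_upwards [ht, hε] with i hti hεi
  rw [lintegral_heatKernel_mul_gaussian hN hk z δ hti hεi]

/-- Since the kernel is nonnegative, the integrals against exp(-|y - y₀|²/(n+1)) increase to the
mass by monotone convergence; their limit has just been computed. -/
theorem lintegral_heatKernel (hN : 1 ≤ N) (hk : 1 ≤ k) (z : Space N k) {t : ℝ} (ht : 0 < t) :
    ∫⁻ w : Space N k, ENNReal.ofReal (heatKernel z.1 w.1 (z.2 - w.2) t) = 1 := by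
  have hmK : Measurable (fun w : Space N k => heatKernel z.1 w.1 (z.2 - w.2) t) :=
    measurable_heatKernel.comp (f := fun w : Space N k => ((z.1, w.1), z.2 - w.2, t)) (by fun_prop)
  have h1 := tendsto_lintegral_heatKernel_mul_gaussian hN hk z (l := atTop) (t := fun _ : ℕ => t)
    (ε := fun n : ℕ => 1 / ((n : ℝ) + 1)) (δ := 0) (t₀ := t) (ε₀ := 0)
    (Eventually.of_forall fun _ => ht) (Eventually.of_forall fun n => by positivity)
    tendsto_const_nhds tendsto_one_div_add_atTop_nhds_zero_nat (by simp) le_rfl (by simp)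
  refine tendsto_nhds_unique (lintegral_tendsto_of_tendsto_of_monotone (fun n => ?_)
    (ae_of_all _ fun w => ?_) (ae_of_all _ fun w => ?_)) h1
  · fun_prop
  · intro m n hmn
    simp only [neg_zero, zero_mul, Real.exp_zero, ENNReal.ofReal_one, mul_one]
    refine ENNReal.ofReal_le_ofReal (mul_le_mul_of_nonneg_left (Real.exp_le_exp.2 ?_)
      (heatKernel_nonneg hN hk _ _ _ ht))
    have : 1 / ((n : ℝ) + 1) ≤ 1 / ((m : ℝ) + 1) := Nat.one_div_le_one_div hmn
    nlinarith [sq_nonneg ‖z.2 - w.2‖]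
  · simp only [neg_zero, zero_mul, Real.exp_zero, ENNReal.ofReal_one, mul_one]
    refine ENNReal.tendsto_ofReal ?_
    have h2 := (tendsto_one_div_add_atTop_nhds_zero_nat (𝕜 := ℝ)).neg.mul_const (‖z.2 - w.2‖ ^ 2)
    have h3 := ((Real.continuous_exp.tendsto _).comp h2).const_mul
      (heatKernel z.1 w.1 (z.2 - w.2) t)
    simpa using h3

theorem lintegral_heatKernel_left (hN : 1 ≤ N) (hk : 1 ≤ k) (w : Space N k) {t : ℝ} (ht : 0 < t) :
    ∫⁻ z : Space N k, ENNReal.ofReal (heatKernel z.1 w.1 (z.2 - w.2) t) = 1 := by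
  rw [← lintegral_heatKernel hN hk w ht]
  congr 1
  funext z
  rw [← heatKernel_comm, neg_sub]

end Mass

end

end Grushin

namespace Grushin

noncomputable section

/-! ### Integral inequalities -/

section Linear

theorem eLpNorm_ofReal_eq {α E : Type*} [MeasurableSpace α] {μ : Measure α}
    [TopologicalSpace E] [ContinuousENorm E]
    {r : ℝ} (hr : 0 < r) (f : α → E) :
    eLpNorm f (ENNReal.ofReal r) μ = (∫⁻ z, ‖f z‖ₑ ^ r ∂μ) ^ (1 / r) := by
  rw [eLpNorm_eq_lintegral_rpow_enorm_toReal (by simpa using hr) ENNReal.ofReal_ne_top,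
    ENNReal.toReal_ofReal hr.le]

theorem eLpNorm_ofReal_rpow {α E : Type*} [MeasurableSpace α] {μ : Measure α}
    [TopologicalSpace E] [ContinuousENorm E]
    {r : ℝ} (hr : 0 < r) (f : α → E) :
    eLpNorm f (ENNReal.ofReal r) μ ^ r = ∫⁻ z, ‖f z‖ₑ ^ r ∂μ := by
  rw [eLpNorm_ofReal_eq hr, ← ENNReal.rpow_mul, one_div_mul_cancel hr.ne', ENNReal.rpow_one]

/-- Jensen's inequality for the measure κμ, whose mass need not be one; by Hölder with exponents a
and a/(a-1). -/
theorem lintegral_mul_rpow_le {α : Type*} [MeasurableSpace α] {μ : Measure α} {κ φ : α → ℝ≥0∞}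
    (hκ : AEMeasurable κ μ) (hφ : AEMeasurable φ μ) {a : ℝ} (ha : 1 ≤ a) :
    (∫⁻ x, κ x * φ x ∂μ) ^ a ≤ (∫⁻ x, κ x ∂μ) ^ (a - 1) * ∫⁻ x, κ x * φ x ^ a ∂μ := by
  have ha0 : 0 < a := by linarith
  have h := ENNReal.lintegral_mul_norm_pow_le (hκ.mul (hφ.pow_const a)) hκ
    (p := 1 / a) (q := 1 - 1 / a) (by positivity)
    (by rw [sub_nonneg, div_le_one ha0]; exact ha) (by ring)
  have e : ∀ x, (κ x * φ x ^ a) ^ (1 / a) * κ x ^ (1 - 1 / a) = κ x * φ x := fun x => by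
    rw [ENNReal.mul_rpow_of_nonneg _ _ (by positivity), ← ENNReal.rpow_mul,
      mul_one_div_cancel ha0.ne', ENNReal.rpow_one, mul_right_comm, ← ENNReal.rpow_add_of_nonneg _ _
      (by positivity) (by rw [sub_nonneg, div_le_one ha0]; exact ha)]
    simp
  simp only [Pi.mul_apply, e] at h
  have h2 := ENNReal.rpow_le_rpow h ha0.le
  rw [ENNReal.mul_rpow_of_nonneg _ _ ha0.le, ← ENNReal.rpow_mul, ← ENNReal.rpow_mul,
    one_div_mul_cancel ha0.ne', ENNReal.rpow_one] at h2
  rwa [mul_comm, show (1 - 1 / a) * a = a - 1 by field_simp] at h2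

variable {Ω Z : Type*} [MeasurableSpace Ω] [MeasurableSpace Z] {μ : Measure Ω} {ν : Measure Z}

/-- Minkowski's integral inequality, with a positive finite majorant. -/
theorem eLpNorm_lintegral_le_of_pos [SFinite μ] [SFinite ν] {F : Ω → Z → ℝ≥0∞}
    (hF : Measurable (Function.uncurry F)) {b : ℝ} (hb : 1 ≤ b) {ρ : Ω → ℝ≥0∞} (hρ : Measurable ρ)
    (hpos : ∀ᵐ ω ∂μ, ρ ω ≠ 0) (hfin : ∀ᵐ ω ∂μ, ρ ω ≠ ∞)
    (h : ∀ᵐ ω ∂μ, eLpNorm (F ω) (ENNReal.ofReal b) ν ≤ ρ ω) :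
    eLpNorm (fun z => ∫⁻ ω, F ω z ∂μ) (ENNReal.ofReal b) ν ≤ ∫⁻ ω, ρ ω ∂μ := by
  have hb0 : 0 < b := by linarith
  have hF' : Measurable (fun a : Ω × Z => F a.1 a.2) := hF
  rw [← ENNReal.rpow_le_rpow_iff hb0, eLpNorm_ofReal_rpow hb0]
  simp only [enorm_eq_self]
  calc ∫⁻ z, (∫⁻ ω, F ω z ∂μ) ^ b ∂ν
      ≤ ∫⁻ z, (∫⁻ ω, ρ ω ∂μ) ^ (b - 1) * ∫⁻ ω, ρ ω * (F ω z / ρ ω) ^ b ∂μ ∂ν := by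
        refine lintegral_mono fun z => ?_
        have hm : Measurable fun ω => F ω z := hF'.comp (measurable_id.prodMk measurable_const)
        -- Jensen for the measure ρμ and the quotient F/ρ, whose slices have norm at most one.
        have := lintegral_mul_rpow_le (μ := μ) hρ.aemeasurable (φ := fun ω => F ω z / ρ ω)
          (hm.div hρ).aemeasurable hb
        refine le_trans (le_of_eq ?_) this
        congr 1
        refine lintegral_congr_ae ?_
        filter_upwards [hpos, hfin] with ω h1 h2
        rw [ENNReal.mul_div_cancel h1 h2]
    _ = (∫⁻ ω, ρ ω ∂μ) ^ (b - 1) * ∫⁻ ω, ∫⁻ z, ρ ω * (F ω z / ρ ω) ^ b ∂ν ∂μ := by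
        rw [lintegral_const_mul _ (by fun_prop), lintegral_lintegral_swap (by fun_prop)]
    _ ≤ (∫⁻ ω, ρ ω ∂μ) ^ (b - 1) * ∫⁻ ω, ρ ω ∂μ := by
        refine mul_le_mul_right (lintegral_mono_ae ?_) _
        filter_upwards [hpos, hfin, h] with ω h1 h2 h3
        have hm : Measurable fun z => F ω z := hF'.comp (measurable_const.prodMk measurable_id)
        have h4 := ENNReal.rpow_le_rpow h3 hb0.le
        rw [eLpNorm_ofReal_rpow hb0] at h4
        simp only [enorm_eq_self] at h4
        rw [lintegral_const_mul _ (by fun_prop)]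
        simp_rw [ENNReal.div_rpow_of_nonneg _ _ hb0.le, div_eq_mul_inv]
        rw [lintegral_mul_const _ (by fun_prop)]
        calc ρ ω * ((∫⁻ z, F ω z ^ b ∂ν) * (ρ ω ^ b)⁻¹) ≤ ρ ω * (ρ ω ^ b * (ρ ω ^ b)⁻¹) := by
              gcongr
          _ ≤ ρ ω * 1 := by gcongr; exact ENNReal.mul_inv_le_one _
          _ = ρ ω := mul_one _
    _ = (∫⁻ ω, ρ ω ∂μ) ^ b := by
        conv_lhs => rw [← ENNReal.rpow_one (∫⁻ ω, ρ ω ∂μ), ← ENNReal.rpow_mul, one_mul]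
        rw [← ENNReal.rpow_add_of_nonneg _ _ (by linarith) zero_le_one, sub_add_cancel]

theorem measurable_eLpNorm_slice [SFinite ν] {F : Ω → Z → ℝ≥0∞}
    (hF : Measurable (Function.uncurry F)) {b : ℝ} (hb : 0 < b) :
    Measurable fun ω => eLpNorm (F ω) (ENNReal.ofReal b) ν := by
  have hF' : Measurable (fun a : Ω × Z => F a.1 a.2) := hF
  simp_rw [eLpNorm_ofReal_eq hb, enorm_eq_self]
  fun_prop

/-- Minkowski's integral inequality. -/
theorem eLpNorm_lintegral_le [SigmaFinite μ] [SFinite ν] {F : Ω → Z → ℝ≥0∞}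
    (hF : Measurable (Function.uncurry F)) {b : ℝ} (hb : 1 ≤ b) :
    eLpNorm (fun z => ∫⁻ ω, F ω z ∂μ) (ENNReal.ofReal b) ν
      ≤ ∫⁻ ω, eLpNorm (F ω) (ENNReal.ofReal b) ν ∂μ := by
  have hb0 : 0 < b := by linarith
  have hm := measurable_eLpNorm_slice (ν := ν) hF hb0
  refine ENNReal.le_of_forall_pos_le_add fun ε hε hfin => ?_
  -- The slice norms may vanish; a positive function of small integral is added to obtain a majorant
  -- by which one can divide.
  obtain ⟨g, hg0, hgm, hg⟩ := exists_pos_lintegral_lt_of_sigmaFinite μ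
    (ε := (ε : ℝ≥0∞)) (by simpa using hε.ne')
  have := eLpNorm_lintegral_le_of_pos (μ := μ) (ν := ν) hF hb
    (ρ := fun ω => eLpNorm (F ω) (ENNReal.ofReal b) ν + g ω)
    (hm.add hgm.coe_nnreal_ennreal) (ae_of_all _ fun ω => ?_) ?_ (ae_of_all _ fun ω => ?_)
  · refine this.trans ?_
    rw [lintegral_add_left hm]
    gcongr
  · have : (g ω : ℝ≥0∞) ≠ 0 := by simpa using (hg0 ω).ne'
    simp [this]
  · filter_upwards [ae_lt_top hm hfin.ne] with ω hω
    exact ENNReal.add_ne_top.2 ⟨hω.ne, ENNReal.coe_ne_top⟩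
  · exact le_self_add

/-- A doubly sub-Markovian kernel bounded by `M` maps `L^a` to `L^b`. -/
theorem eLpNorm_kernel_le [SFinite ν] {κ : Z → Z → ℝ≥0∞} (hκ : Measurable (Function.uncurry κ))
    {M : ℝ≥0∞} (h1 : ∀ z, ∫⁻ w, κ z w ∂ν ≤ 1) (h2 : ∀ w, ∫⁻ z, κ z w ∂ν ≤ 1)
    (hM : ∀ z w, κ z w ≤ M) {a b : ℝ} (ha : 1 ≤ a) (hab : a ≤ b) {φ : Z → ℝ≥0∞}
    (hφ : Measurable φ) :
    eLpNorm (fun z => ∫⁻ w, κ z w * φ w ∂ν) (ENNReal.ofReal b) ν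
      ≤ M ^ (1 / a - 1 / b) * eLpNorm φ (ENNReal.ofReal a) ν := by
  have ha0 : 0 < a := by linarith
  have hb0 : 0 < b := by linarith
  have hκ' : Measurable (fun p : Z × Z => κ p.1 p.2) := hκ
  set A := ∫⁻ w, φ w ^ a ∂ν with hA
  -- Jensen yields both endpoints: κ ≤ M gives a bound in L^∞, mass at most one in the other
  -- variable gives a bound in L^a. Then the b-th power is split as (b - a) + a.
  have hJ : ∀ z, (∫⁻ w, κ z w * φ w ∂ν) ^ a ≤ ∫⁻ w, κ z w * φ w ^ a ∂ν := fun z => by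
    have hm : Measurable fun w => κ z w := hκ'.comp (measurable_const.prodMk measurable_id)
    refine (lintegral_mul_rpow_le hm.aemeasurable hφ.aemeasurable ha).trans ?_
    exact mul_le_of_le_one_left zero_le (ENNReal.rpow_le_one (h1 z) (by linarith))
  have hsup : ∀ z, (∫⁻ w, κ z w * φ w ∂ν) ≤ (M * A) ^ (1 / a) := fun z => by
    rw [one_div, ENNReal.le_rpow_inv_iff ha0]
    refine (hJ z).trans ?_
    rw [hA, ← lintegral_const_mul _ (by fun_prop)]
    exact lintegral_mono fun w => by gcongr; exact hM z w
  have hint : ∫⁻ z, (∫⁻ w, κ z w * φ w ∂ν) ^ a ∂ν ≤ A := by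
    refine (lintegral_mono hJ).trans ?_
    rw [lintegral_lintegral_swap (by fun_prop)]
    refine lintegral_mono fun w => ?_
    have hm : Measurable fun z => κ z w := hκ'.comp (measurable_id.prodMk measurable_const)
    simp only
    rw [lintegral_mul_const _ hm]
    exact mul_le_of_le_one_left zero_le (h2 w)
  have hK : Measurable fun z => ∫⁻ w, κ z w * φ w ∂ν := by fun_prop
  rw [← ENNReal.rpow_le_rpow_iff hb0, eLpNorm_ofReal_rpow hb0, eLpNorm_ofReal_eq ha0]
  simp only [enorm_eq_self]
  calc ∫⁻ z, (∫⁻ w, κ z w * φ w ∂ν) ^ b ∂ν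
      = ∫⁻ z, (∫⁻ w, κ z w * φ w ∂ν) ^ (b - a) * (∫⁻ w, κ z w * φ w ∂ν) ^ a ∂ν := by
        refine lintegral_congr fun z => ?_
        rw [← ENNReal.rpow_add_of_nonneg _ _ (by linarith) ha0.le, sub_add_cancel]
    _ ≤ ∫⁻ z, ((M * A) ^ (1 / a)) ^ (b - a) * (∫⁻ w, κ z w * φ w ∂ν) ^ a ∂ν := by
        refine lintegral_mono fun z => ?_
        exact mul_le_mul_left (ENNReal.rpow_le_rpow (hsup z) (by linarith)) _
    _ ≤ ((M * A) ^ (1 / a)) ^ (b - a) * A := by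
        rw [lintegral_const_mul _ (by fun_prop)]
        gcongr
    _ = (M ^ (1 / a - 1 / b) * A ^ (1 / a)) ^ b := by
        have e0 : 0 ≤ 1 / a - 1 / b := sub_nonneg.2 (one_div_le_one_div_of_le ha0 hab)
        rw [ENNReal.mul_rpow_of_nonneg _ _ (by positivity), ENNReal.mul_rpow_of_nonneg _ _
          (by linarith : 0 ≤ b - a), ENNReal.mul_rpow_of_nonneg _ _ hb0.le, ← ENNReal.rpow_mul,
          ← ENNReal.rpow_mul, ← ENNReal.rpow_mul, ← ENNReal.rpow_mul, mul_assoc]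
        congr 1
        · congr 1; field_simp
        · conv_lhs => rw [← ENNReal.rpow_one A, ← ENNReal.rpow_mul, one_mul]
          rw [← ENNReal.rpow_add_of_nonneg _ _
            (mul_nonneg (by positivity) (by linarith)) zero_le_one]
          congr 1; field_simp; ring

/-! ### Power-type singular integrals in time -/

theorem lintegral_comp_mul_left {f : ℝ → ℝ≥0∞} {c : ℝ} (hc : 0 < c) :
    ∫⁻ x, f x = ENNReal.ofReal c * ∫⁻ x, f (c * x) := by
  have h := Real.smul_map_volume_mul_left hc.ne'
  conv_lhs => rw [← h]
  rw [lintegral_smul_measure, abs_of_pos hc, smul_eq_mul]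
  congr 1
  exact lintegral_map_equiv f (Homeomorph.mulLeft₀ c hc.ne').toMeasurableEquiv

/-- The Beta integral `∫₀¹ (1-x)^{-a} x^{-b} dx`. -/
def betaConst (a b : ℝ) : ℝ :=
  (∫⁻ x in Ioo (0 : ℝ) 1, ENNReal.ofReal ((1 - x) ^ (-a) * x ^ (-b))).toReal

theorem betaConst_nonneg (a b : ℝ) : 0 ≤ betaConst a b := ENNReal.toReal_nonneg

/-- Convergence of the Beta integral shows that passing to real numbers loses nothing. -/
theorem ofReal_betaConst {a b : ℝ} (ha : a < 1) (hb : b < 1) : ENNReal.ofReal (betaConst a b)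
    = ∫⁻ x in Ioo (0 : ℝ) 1, ENNReal.ofReal ((1 - x) ^ (-a) * x ^ (-b)) := by
  refine ENNReal.ofReal_toReal (ne_of_lt ?_)
  have h := Complex.betaIntegral_convergent (u := ((1 - b : ℝ) : ℂ)) (v := ((1 - a : ℝ) : ℂ))
    (by rw [Complex.ofReal_re]; linarith) (by rw [Complex.ofReal_re]; linarith)
  rw [intervalIntegrable_iff_integrableOn_Ioo_of_le zero_le_one] at h
  have h2 := h.2
  rw [HasFiniteIntegral] at h2
  refine lt_of_le_of_lt (le_of_eq ?_) h2
  refine setLIntegral_congr_fun measurableSet_Ioo fun x hx => ?_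
  have hx0 : 0 < x := hx.1
  have hx1 : 0 < 1 - x := sub_pos.2 hx.2
  rw [← ofReal_norm, norm_mul]
  have e1 : ((1 : ℂ) - (x : ℂ)) = ((1 - x : ℝ) : ℂ) := by push_cast; rfl
  rw [e1, Complex.norm_cpow_eq_rpow_re_of_pos hx0, Complex.norm_cpow_eq_rpow_re_of_pos hx1, mul_comm]
  congr 3 <;> simp

theorem lintegral_beta {a b : ℝ} (ha : a < 1) (hb : b < 1) {σ : ℝ} (hσ : 0 < σ) :
    ∫⁻ s in Ioo 0 σ, ENNReal.ofReal ((σ - s) ^ (-a) * s ^ (-b))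
      = ENNReal.ofReal (betaConst a b * σ ^ (1 - a - b)) := by
  rw [← lintegral_indicator measurableSet_Ioo, lintegral_comp_mul_left hσ, mul_comm (betaConst a b),
    ENNReal.ofReal_mul (by positivity), ofReal_betaConst ha hb, ← lintegral_indicator measurableSet_Ioo,
    ← lintegral_const_mul' _ _ ENNReal.ofReal_ne_top, ← lintegral_const_mul' _ _ ENNReal.ofReal_ne_top]
  congr 1
  funext x
  by_cases hx : x ∈ Ioo (0 : ℝ) 1
  · have hx' : σ * x ∈ Ioo 0 σ := ⟨mul_pos hσ hx.1, mul_lt_of_lt_one_right hσ hx.2⟩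
    have h1 : 0 < 1 - x := sub_pos.2 hx.2
    have h0 := hx.1
    rw [indicator_of_mem hx, indicator_of_mem hx', ← ENNReal.ofReal_mul hσ.le,
      ← ENNReal.ofReal_mul (by positivity)]
    congr 1
    rw [show σ - σ * x = σ * (1 - x) by ring, Real.mul_rpow hσ.le h1.le, Real.mul_rpow hσ.le h0.le,
      show 1 - a - b = 1 + (-a) + (-b) by ring, Real.rpow_add hσ, Real.rpow_add hσ, Real.rpow_one]
    ring
  · have hx' : σ * x ∉ Ioo 0 σ := fun h => hx
      ⟨pos_of_mul_pos_right h.1 hσ.le, by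
        have := h.2
        by_contra hc
        nlinarith [not_lt.1 hc]⟩
    rw [indicator_of_notMem hx, indicator_of_notMem hx', mul_zero, mul_zero]

end Linear

end

end Grushin

namespace Grushin

noncomputable section

/-! ### The power nonlinearity -/

section Power

theorem power_zero {p : ℝ} : power p 0 = 0 := by simp [power]

theorem measurable_power (p : ℝ) : Measurable (power p) := by
  unfold power; fun_prop

theorem power_of_nonneg {p a : ℝ} (hp : 1 < p) (ha : 0 ≤ a) : power p a = a ^ p := by
  rw [power, abs_of_nonneg ha]
  rcases ha.eq_or_lt with rfl | ha
  · rw [mul_zero, Real.zero_rpow (by linarith)]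
  · rw [Real.rpow_sub_one ha.ne', div_mul_cancel₀ _ ha.ne']

theorem power_neg (p a : ℝ) : power p (-a) = -power p a := by simp [power]

theorem power_nonneg {p a : ℝ} (ha : 0 ≤ a) : 0 ≤ power p a := by
  unfold power; positivity

/-- Bernoulli's inequality for (b/a)^p, multiplied by a^p. -/
theorem rpow_sub_rpow_le {p a b : ℝ} (hp : 1 < p) (hb : 0 ≤ b) (hba : b ≤ a) :
    a ^ p - b ^ p ≤ p * a ^ (p - 1) * (a - b) := by
  rcases (hb.trans hba).eq_or_lt with h | ha
  · have : b = 0 := le_antisymm (hba.trans h.ge) hb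
    simp [this, ← h]
  have h := one_add_mul_self_le_rpow_one_add (s := b / a - 1) (by
    have : 0 ≤ b / a := by positivity
    linarith) hp.le
  rw [add_sub_cancel, Real.div_rpow hb ha.le] at h
  have hap : 0 < a ^ p := by positivity
  have h2 := mul_le_mul_of_nonneg_left h hap.le
  rw [mul_div_cancel₀ _ hap.ne'] at h2
  have e : a ^ p = a ^ (p - 1) * a := by rw [Real.rpow_sub_one ha.ne', div_mul_cancel₀ _ ha.ne']
  have e2 : a ^ p * (1 + p * (b / a - 1)) = a ^ p - p * a ^ (p - 1) * (a - b) := by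
    rw [e]; field_simp; ring
  linarith

/-- By symmetry and oddness one may take |b| ≤ |a| and a ≥ 0. Equal signs are the Bernoulli
estimate; for opposite signs superadditivity of the p-th power suffices. -/
theorem abs_power_sub_le {p : ℝ} (hp : 1 < p) (a b : ℝ) :
    |power p a - power p b| ≤ p * (|a| + |b|) ^ (p - 1) * |a - b| := by
  wlog hab : |b| ≤ |a| generalizing a b
  · rw [abs_sub_comm, add_comm, abs_sub_comm a]
    exact this b a (not_le.1 hab).le
  wlog ha : 0 ≤ a generalizing a b
  · have := this (-a) (-b) (by simpa using hab) (by linarith)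
    rw [power_neg, power_neg] at this
    simp only [abs_neg] at this
    rwa [← neg_add', abs_neg, ← neg_add', abs_neg, ← sub_eq_add_neg, ← sub_eq_add_neg] at this
  rw [abs_of_nonneg ha] at hab ⊢
  rcases le_or_gt 0 b with hb | hb
  · rw [abs_of_nonneg hb] at hab ⊢
    rw [power_of_nonneg hp ha, power_of_nonneg hp hb, abs_of_nonneg (sub_nonneg.2
      (Real.rpow_le_rpow hb hab (by linarith))), abs_of_nonneg (sub_nonneg.2 hab)]
    refine (rpow_sub_rpow_le hp hb hab).trans ?_
    have : a ^ (p - 1) ≤ (a + b) ^ (p - 1) := Real.rpow_le_rpow ha (by linarith) (by linarith)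
    gcongr
  · obtain ⟨c, rfl⟩ : ∃ c, b = -c := ⟨-b, by ring⟩
    have hc : 0 < c := by linarith
    rw [abs_neg, abs_of_pos hc, power_neg, sub_neg_eq_add, sub_neg_eq_add,
      power_of_nonneg hp ha, power_of_nonneg hp hc.le, abs_of_nonneg (by positivity),
      abs_of_nonneg (by positivity)]
    have h := Real.add_rpow_le_rpow_add ha hc.le hp.le
    have hac : 0 < a + c := by linarith
    have e : (a + c) ^ p = (a + c) ^ (p - 1) * (a + c) := by
      rw [Real.rpow_sub_one hac.ne', div_mul_cancel₀ _ hac.ne']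
    have : 0 ≤ (a + c) ^ (p - 1) * (a + c) := by positivity
    nlinarith

variable {Z : Type*} [MeasurableSpace Z] {ν : Measure Z}

/-- The pointwise Lipschitz bound followed by Hölder with exponents p/(p-1) and p. -/
theorem eLpNorm_power_sub_le {p s : ℝ} (hp : 1 < p) (hs : 1 ≤ s) {f g : Z → ℝ}
    (hf : Measurable f) (hg : Measurable g) :
    eLpNorm (fun z => ‖power p (f z) - power p (g z)‖ₑ) (ENNReal.ofReal s) ν
      ≤ ENNReal.ofReal p * (eLpNorm f (ENNReal.ofReal (p * s)) ν +
        eLpNorm g (ENNReal.ofReal (p * s)) ν) ^ (p - 1) *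
        eLpNorm (f - g) (ENNReal.ofReal (p * s)) ν := by
  have hs0 : 0 < s := by linarith
  have hp0 : 0 < p := by linarith
  have hps : 0 < p * s := by positivity
  set h : Z → ℝ≥0∞ := fun z => ‖f z‖ₑ + ‖g z‖ₑ with hh
  set d : Z → ℝ≥0∞ := fun z => ‖f z - g z‖ₑ with hd
  have hhm : Measurable h := by fun_prop
  have hdm : Measurable d := by fun_prop
  have hpt : ∀ z, ‖power p (f z) - power p (g z)‖ₑ ≤ ENNReal.ofReal p * (h z ^ (p - 1) * d z) :=
    fun z => by
    rw [Real.enorm_eq_ofReal_abs]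
    refine (ENNReal.ofReal_le_ofReal (abs_power_sub_le hp _ _)).trans_eq ?_
    rw [hh, hd, mul_assoc, ENNReal.ofReal_mul hp0.le, ENNReal.ofReal_mul (by positivity),
      ← ENNReal.ofReal_rpow_of_nonneg (by positivity) (by linarith),
      ENNReal.ofReal_add (abs_nonneg _) (abs_nonneg _)]
    simp only [Real.enorm_eq_ofReal_abs]
  have htri : eLpNorm h (ENNReal.ofReal (p * s)) ν ≤ eLpNorm f (ENNReal.ofReal (p * s)) ν +
        eLpNorm g (ENNReal.ofReal (p * s)) ν := by
    have := eLpNorm_add_le (μ := ν) (f := fun z => ‖f z‖ₑ) (g := fun z => ‖g z‖ₑ)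
      (p := ENNReal.ofReal (p * s)) (by fun_prop) (by fun_prop)
      (by rw [ENNReal.one_le_ofReal]; nlinarith)
    rwa [eLpNorm_enorm, eLpNorm_enorm] at this
  have hmain : eLpNorm (fun z => h z ^ (p - 1) * d z) (ENNReal.ofReal s) ν
      ≤ eLpNorm h (ENNReal.ofReal (p * s)) ν ^ (p - 1) * eLpNorm d (ENNReal.ofReal (p * s)) ν := by
    rw [← ENNReal.rpow_le_rpow_iff hs0, eLpNorm_ofReal_rpow hs0,
      ENNReal.mul_rpow_of_nonneg _ _ hs0.le, ← ENNReal.rpow_mul]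
    simp only [enorm_eq_self]
    have hH := ENNReal.lintegral_mul_norm_pow_le (μ := ν) (hhm.pow_const (p * s)).aemeasurable
      (hdm.pow_const (p * s)).aemeasurable (p := (p - 1) / p) (q := 1 / p)
      (div_nonneg (by linarith) hp0.le) (by positivity) (by field_simp; ring)
    rw [eLpNorm_ofReal_eq hps, eLpNorm_ofReal_eq hps]
    simp only [enorm_eq_self]
    refine le_trans (le_of_eq ?_) (hH.trans (le_of_eq ?_))
    · refine lintegral_congr fun z => ?_
      rw [ENNReal.mul_rpow_of_nonneg _ _ hs0.le, ← ENNReal.rpow_mul, ← ENNReal.rpow_mul,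
        ← ENNReal.rpow_mul]
      congr 2 <;> field_simp
    · rw [← ENNReal.rpow_mul, ← ENNReal.rpow_mul]
      congr 2 <;> field_simp
  calc eLpNorm (fun z => ‖power p (f z) - power p (g z)‖ₑ) (ENNReal.ofReal s) ν
      ≤ eLpNorm (fun z => ENNReal.ofReal p * (h z ^ (p - 1) * d z)) (ENNReal.ofReal s) ν :=
        eLpNorm_mono_enorm fun z => by simpa only [enorm_eq_self] using hpt z
    _ = ENNReal.ofReal p * eLpNorm (fun z => h z ^ (p - 1) * d z) (ENNReal.ofReal s) ν := by
        rw [eLpNorm_ofReal_eq hs0, eLpNorm_ofReal_eq hs0]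
        simp only [enorm_eq_self, ENNReal.mul_rpow_of_nonneg (ENNReal.ofReal p) _ hs0.le]
        rw [lintegral_const_mul _ (by fun_prop), ENNReal.mul_rpow_of_nonneg _ _ (by positivity),
          ← ENNReal.rpow_mul, mul_one_div_cancel hs0.ne', ENNReal.rpow_one]
    _ ≤ _ := by
        rw [mul_assoc]
        refine mul_le_mul_right (hmain.trans ?_) _
        have e : eLpNorm d (ENNReal.ofReal (p * s)) ν
          = eLpNorm (f - g) (ENNReal.ofReal (p * s)) ν := eLpNorm_enorm (f - g)
        rw [e]
        exact mul_le_mul_left (ENNReal.rpow_le_rpow htri (by linarith)) _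

end Power

/-! ### Volterra operators -/

section Volterra

set_option linter.unusedSectionVars false

variable {Z : Type*} [MeasureSpace Z] [SFinite (volume : Measure Z)]

/-- The kernels `κ σ`, `σ > 0`, act from `L^a` to `L^b` with norm at most `C σ^{-θ}`. -/
def OpBound (κ : ℝ → Z → Z → ℝ) (a b C θ : ℝ) : Prop :=
  ∀ σ, 0 < σ → ∀ φ : Z → ℝ≥0∞, Measurable φ →
    eLpNorm (fun z => ∫⁻ w, ENNReal.ofReal (κ σ z w) * φ w) (ENNReal.ofReal b) volume
      ≤ ENNReal.ofReal (C * σ ^ (-θ)) * eLpNorm φ (ENNReal.ofReal a) volume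

/-- The Volterra operator `∫₀ᵗ ∫ κ(t - τ, z, w) f(τ, w) dw dτ`. -/
def volterra (κ : ℝ → Z → Z → ℝ) (f : ℝ → Z → ℝ) (t : ℝ) (z : Z) : ℝ :=
  ∫ a : ℝ × Z, κ (t - a.1) z a.2 * f a.1 a.2 ∂((volume.restrict (Ioo 0 t)).prod volume)

/-- The Volterra operator on nonnegative functions. -/
def lvolterra (κ : ℝ → Z → Z → ℝ) (F : ℝ → Z → ℝ≥0∞) (t : ℝ) (z : Z) : ℝ≥0∞ :=
  ∫⁻ τ in Ioo 0 t, ∫⁻ w, ENNReal.ofReal (κ (t - τ) z w) * F τ w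

variable {κ : ℝ → Z → Z → ℝ} {f g : ℝ → Z → ℝ} {F : ℝ → Z → ℝ≥0∞}

theorem measurable_volterra (hκ : Measurable fun a : ℝ × Z × Z => κ a.1 a.2.1 a.2.2)
    (hf : Measurable fun a : ℝ × Z => f a.1 a.2) :
    Measurable fun a : ℝ × Z => volterra κ f a.1 a.2 := by
  -- The domain of integration depends on t; an indicator turns this into a parametric integral over
  -- a fixed space.
  have e : ∀ a : ℝ × Z, volterra κ f a.1 a.2 = ∫ b : ℝ × Z,
      {c : (ℝ × Z) × (ℝ × Z) | 0 < c.2.1 ∧ c.2.1 < c.1.1}.indicator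
      (fun c => κ (c.1.1 - c.2.1) c.1.2 c.2.2 * f c.2.1 c.2.2) (a, b) := fun a => by
    rw [volterra, ← Measure.restrict_univ (μ := (volume : Measure Z)), Measure.prod_restrict,
      ← Measure.volume_eq_prod, ← integral_indicator (measurableSet_Ioo.prod MeasurableSet.univ)]
    congr 1
    funext b
    simp only [indicator, mem_prod, mem_Ioo, mem_univ, and_true, mem_ofPred_eq]
  simp_rw [e]
  refine (StronglyMeasurable.integral_prod_right' (Measurable.stronglyMeasurable ?_)).measurable
  refine Measurable.indicator ?_ ?_
  · have h1 : Measurable fun c : (ℝ × Z) × (ℝ × Z) => κ (c.1.1 - c.2.1) c.1.2 c.2.2 :=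
      hκ.comp (f := fun c : (ℝ × Z) × (ℝ × Z) => (c.1.1 - c.2.1, c.1.2, c.2.2)) (by fun_prop)
    have h2 : Measurable fun c : (ℝ × Z) × (ℝ × Z) => f c.2.1 c.2.2 := hf.comp measurable_snd
    exact h1.mul h2
  · exact (measurableSet_lt measurable_const (measurable_fst.comp measurable_snd)).inter
      (measurableSet_lt (measurable_fst.comp measurable_snd) (measurable_fst.comp measurable_fst))

theorem measurable_kernel_slice (hκ : Measurable fun a : ℝ × Z × Z => κ a.1 a.2.1 a.2.2) (t : ℝ) :
    Measurable fun a : (ℝ × Z) × Z => κ (t - a.1.1) a.1.2 a.2 :=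
  hκ.comp (f := fun c : (ℝ × Z) × Z => (t - c.1.1, c.1.2, c.2)) (by fun_prop)

theorem measurable_kernel_inner (hκ : Measurable fun a : ℝ × Z × Z => κ a.1 a.2.1 a.2.2)
    (hF : Measurable fun a : ℝ × Z => F a.1 a.2) (t : ℝ) :
    Measurable fun a : ℝ × Z => ∫⁻ w, ENNReal.ofReal (κ (t - a.1) a.2 w) * F a.1 w := by
  refine Measurable.lintegral_prod_right' (f := fun c : (ℝ × Z) × Z =>
    ENNReal.ofReal (κ (t - c.1.1) c.1.2 c.2) * F c.1.1 c.2) ?_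
  exact (measurable_kernel_slice hκ t).ennreal_ofReal.mul
    (hF.comp (f := fun c : (ℝ × Z) × Z => (c.1.1, c.2)) (by fun_prop))

theorem measurable_lvolterra (hκ : Measurable fun a : ℝ × Z × Z => κ a.1 a.2.1 a.2.2)
    (hF : Measurable fun a : ℝ × Z => F a.1 a.2) (t : ℝ) : Measurable (lvolterra κ F t) :=
  Measurable.lintegral_prod_left (measurable_kernel_inner hκ hF t)

theorem lintegral_prod_eq_lvolterra (hκ : Measurable fun a : ℝ × Z × Z => κ a.1 a.2.1 a.2.2)
    (hF : Measurable fun a : ℝ × Z => F a.1 a.2) (t : ℝ) (z : Z) :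
    ∫⁻ a : ℝ × Z, ENNReal.ofReal (κ (t - a.1) z a.2) * F a.1 a.2
      ∂((volume.restrict (Ioo 0 t)).prod volume) = lvolterra κ F t z := by
  rw [lintegral_prod]
  · rfl
  · refine (Measurable.mul ?_ hF).aemeasurable
    exact (hκ.comp (f := fun c : ℝ × Z => (t - c.1, z, c.2)) (by fun_prop)).ennreal_ofReal

theorem ae_prod_mem_Ioo (t : ℝ) :
    ∀ᵐ a : ℝ × Z ∂((volume.restrict (Ioo 0 t)).prod volume), a.1 ∈ Ioo 0 t :=
  Measure.quasiMeasurePreserving_fst.ae (ae_restrict_mem measurableSet_Ioo)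

theorem lintegral_enorm_eq_lvolterra (hκ : Measurable fun a : ℝ × Z × Z => κ a.1 a.2.1 a.2.2)
    (hpos : ∀ σ, 0 < σ → ∀ z w, 0 ≤ κ σ z w)
    (hf : Measurable fun a : ℝ × Z => f a.1 a.2) (t : ℝ) (z : Z) :
    ∫⁻ a : ℝ × Z, ‖κ (t - a.1) z a.2 * f a.1 a.2‖ₑ ∂((volume.restrict (Ioo 0 t)).prod volume)
      = lvolterra κ (fun τ w => ‖f τ w‖ₑ) t z := by
  rw [← lintegral_prod_eq_lvolterra hκ (by fun_prop)]
  refine lintegral_congr_ae ?_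
  filter_upwards [ae_prod_mem_Ioo t] with a ha
  rw [enorm_mul, Real.enorm_of_nonneg (hpos _ (sub_pos.2 ha.2) _ _)]

theorem integrable_volterra (hκ : Measurable fun a : ℝ × Z × Z => κ a.1 a.2.1 a.2.2)
    (hpos : ∀ σ, 0 < σ → ∀ z w, 0 ≤ κ σ z w)
    (hf : Measurable fun a : ℝ × Z => f a.1 a.2) {t : ℝ} {z : Z}
    (h : lvolterra κ (fun τ w => ‖f τ w‖ₑ) t z ≠ ∞) :
    Integrable (fun a : ℝ × Z => κ (t - a.1) z a.2 * f a.1 a.2)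
      ((volume.restrict (Ioo 0 t)).prod volume) := by
  refine ⟨Measurable.aestronglyMeasurable ?_, ?_⟩
  · exact (hκ.comp (f := fun c : ℝ × Z => (t - c.1, z, c.2)) (by fun_prop)).mul hf
  · rw [HasFiniteIntegral, lintegral_enorm_eq_lvolterra hκ hpos hf]
    exact lt_top_iff_ne_top.2 h

theorem enorm_volterra_le (hκ : Measurable fun a : ℝ × Z × Z => κ a.1 a.2.1 a.2.2)
    (hpos : ∀ σ, 0 < σ → ∀ z w, 0 ≤ κ σ z w)
    (hf : Measurable fun a : ℝ × Z => f a.1 a.2) (t : ℝ) (z : Z) :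
    ‖volterra κ f t z‖ₑ ≤ lvolterra κ (fun τ w => ‖f τ w‖ₑ) t z :=
  (enorm_integral_le_lintegral_enorm _).trans_eq (lintegral_enorm_eq_lvolterra hκ hpos hf t z)

theorem volterra_sub (hκ : Measurable fun a : ℝ × Z × Z => κ a.1 a.2.1 a.2.2)
    (hpos : ∀ σ, 0 < σ → ∀ z w, 0 ≤ κ σ z w)
    (hf : Measurable fun a : ℝ × Z => f a.1 a.2) (hg : Measurable fun a : ℝ × Z => g a.1 a.2)
    {t : ℝ} {z : Z} (h1 : lvolterra κ (fun τ w => ‖f τ w‖ₑ) t z ≠ ∞)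
    (h2 : lvolterra κ (fun τ w => ‖g τ w‖ₑ) t z ≠ ∞) :
    volterra κ f t z - volterra κ g t z = volterra κ (fun τ w => f τ w - g τ w) t z := by
  unfold volterra
  rw [← integral_sub (integrable_volterra hκ hpos hf h1) (integrable_volterra hκ hpos hg h2)]
  simp only [mul_sub]

theorem volterra_nonneg (hpos : ∀ σ, 0 < σ → ∀ z w, 0 ≤ κ σ z w) (hf : ∀ τ w, 0 ≤ f τ w)
    (t : ℝ) (z : Z) : 0 ≤ volterra κ f t z := by
  refine integral_nonneg_of_ae ?_
  filter_upwards [ae_prod_mem_Ioo t] with a ha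
  exact mul_nonneg (hpos _ (sub_pos.2 ha.2) _ _) (hf _ _)

theorem eLpNorm_lvolterra_le (hκ : Measurable fun a : ℝ × Z × Z => κ a.1 a.2.1 a.2.2)
    (hF : Measurable fun a : ℝ × Z => F a.1 a.2) {a b C θ : ℝ} (hb : 1 ≤ b)
    (hop : OpBound κ a b C θ) (t : ℝ) :
    eLpNorm (lvolterra κ F t) (ENNReal.ofReal b) volume ≤
      ∫⁻ τ in Ioo 0 t, ENNReal.ofReal (C * (t - τ) ^ (-θ)) *
        eLpNorm (F τ) (ENNReal.ofReal a) volume := by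
  refine (eLpNorm_lintegral_le (measurable_kernel_inner hκ hF t) hb).trans ?_
  refine setLIntegral_mono_ae' measurableSet_Ioo (ae_of_all _ fun τ hτ => ?_)
  exact hop _ (sub_pos.2 hτ.2) _ (hF.comp measurable_prodMk_left)

/-- Exchanges exponential decay for a weak power singularity. At x = λ(t-τ) it produces the small
factor λ^{-ε} of the weighted estimates. -/
theorem exp_neg_le_rpow {x ε : ℝ} (hx : 0 < x) (h0 : 0 ≤ ε) (h1 : ε ≤ 1) :
    Real.exp (-x) ≤ x ^ (-ε) := by
  rw [Real.exp_neg, Real.rpow_neg hx.le]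
  refine inv_anti₀ (by positivity) ?_
  rcases le_total x 1 with h | h
  · exact (Real.rpow_le_one hx.le h h0).trans (Real.one_le_exp hx.le)
  · calc x ^ ε ≤ x ^ (1 : ℝ) := Real.rpow_le_rpow_of_exponent_le h h1
      _ = x := Real.rpow_one x
      _ ≤ Real.exp x := by linarith [Real.add_one_le_exp x]

/-- Factor e^{λτ} = e^{λt} e^{-λ(t-τ)} and absorb the second exponential into the singularity,
raising θ to θ + ε. A Beta integral remains. -/
theorem eLpNorm_lvolterra_le_of_weight (hκ : Measurable fun a : ℝ × Z × Z => κ a.1 a.2.1 a.2.2)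
    (hF : Measurable fun a : ℝ × Z => F a.1 a.2) {a b C θ β ε lam t : ℝ} {D : ℝ≥0∞} (hb : 1 ≤ b)
    (hC : 0 ≤ C) (hop : OpBound κ a b C θ) (hβ : β < 1) (hε0 : 0 ≤ ε) (hε1 : ε ≤ 1)
    (hθ : θ + ε < 1) (hlam : 0 < lam) (ht : 0 < t)
    (hD : ∀ τ ∈ Ioo 0 t, eLpNorm (F τ) (ENNReal.ofReal a) volume
      ≤ D * ENNReal.ofReal (τ ^ (-β) * Real.exp (lam * τ))) :
    eLpNorm (lvolterra κ F t) (ENNReal.ofReal b) volume ≤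
      D * ENNReal.ofReal (C * betaConst (θ + ε) β * lam ^ (-ε) * Real.exp (lam * t) *
        t ^ (1 - (θ + ε) - β)) := by
  refine (eLpNorm_lvolterra_le hκ hF hb hop t).trans ?_
  calc ∫⁻ τ in Ioo 0 t, ENNReal.ofReal (C * (t - τ) ^ (-θ)) * eLpNorm (F τ) (ENNReal.ofReal a) volume
      ≤ ∫⁻ τ in Ioo 0 t, D * ENNReal.ofReal (C * lam ^ (-ε) * Real.exp (lam * t)) *
        ENNReal.ofReal ((t - τ) ^ (-(θ + ε)) * τ ^ (-β)) := by
        refine setLIntegral_mono_ae' measurableSet_Ioo (ae_of_all _ fun τ hτ => ?_)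
        have h0 : 0 < t - τ := sub_pos.2 hτ.2
        have hτ0 : 0 < τ := hτ.1
        refine (mul_le_mul_right (hD τ hτ) _).trans ?_
        rw [mul_left_comm, mul_assoc, ← ENNReal.ofReal_mul (by positivity),
          ← ENNReal.ofReal_mul (by positivity)]
        refine mul_le_mul_right (ENNReal.ofReal_le_ofReal ?_) _
        have h1 := exp_neg_le_rpow (x := lam * (t - τ)) (by positivity) hε0 hε1
        rw [Real.mul_rpow hlam.le h0.le] at h1
        have h2 : Real.exp (lam * τ) = Real.exp (lam * t) * Real.exp (-(lam * (t - τ))) := by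
          rw [← Real.exp_add]; ring_nf
        rw [h2, neg_add θ, Real.rpow_add h0]
        calc C * (t - τ) ^ (-θ) * (τ ^ (-β) * (Real.exp (lam * t) * Real.exp (-(lam * (t - τ)))))
            ≤ C * (t - τ) ^ (-θ) * (τ ^ (-β) * (Real.exp (lam * t) *
              (lam ^ (-ε) * (t - τ) ^ (-ε)))) := by gcongr
          _ = _ := by ring
    _ = _ := by
        rw [lintegral_const_mul _ (by fun_prop), lintegral_beta hθ hβ ht, mul_assoc,
          ← ENNReal.ofReal_mul (by positivity)]
        congr 2
        ring

end Volterra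

end

end Grushin

namespace Grushin

noncomputable section

/-! ### Abstract Volterra equations with power nonlinearities -/

/-- The data of a Volterra equation `u = g + ∑ᵢ cᵢ ∫₀ᵗ Kᵢ(t - τ) |u|^{pᵢ-1} u dτ`, in the spaces with
norms `t^{A j} ‖u(t)‖_{L^{R j}}`, `j = 0, 1, 2`. The `i`-th nonlinearity is estimated in `L^{s i}` by
means of the norm with index `i + 1`. -/
structure Scheme (Z : Type*) [MeasureSpace Z] where
  (p s c : Fin 2 → ℝ)
  (ker : Fin 2 → ℝ → Z → Z → ℝ)
  (R A : Fin 3 → ℝ)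
  (θ : Fin 2 → Fin 3 → ℝ)
  (C : ℝ)
  one_lt_p : ∀ i, 1 < p i
  one_le_s : ∀ i, 1 ≤ s i
  one_le_R : ∀ j, 1 ≤ R j
  R_succ : ∀ i : Fin 2, R i.succ = p i * s i
  C_nonneg : 0 ≤ C
  beta_lt : ∀ i : Fin 2, p i * A i.succ < 1
  theta_lt : ∀ i j, θ i j < 1
  exponent_pos : ∀ i j, 0 < A j + 1 - θ i j - p i * A i.succ
  measurable_ker : ∀ i, Measurable fun a : ℝ × Z × Z => ker i a.1 a.2.1 a.2.2
  ker_nonneg : ∀ i σ, 0 < σ → ∀ z w, 0 ≤ ker i σ z w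
  opBound : ∀ i j, OpBound (ker i) (s i) (R j) C (θ i j)

namespace Scheme

set_option linter.unusedSectionVars false

variable {Z : Type*} [MeasureSpace Z] [SFinite (volume : Measure Z)] (S : Scheme Z)

/-- The weighted norms `t^{A j} ‖f‖_{L^{R j}}`. -/
def wn {E : Type*} [TopologicalSpace E] [ContinuousENorm E] (j : Fin 3) (t : ℝ) (f : Z → E) :
    ℝ≥0∞ :=
  ENNReal.ofReal (t ^ S.A j) * eLpNorm f (ENNReal.ofReal (S.R j)) volume

/-- The nonlinear part of the integral equation. -/
def duhamel (u : ℝ → Z → ℝ) (t : ℝ) (z : Z) : ℝ :=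
  ∑ i, S.c i * volterra (S.ker i) (fun τ w => power (S.p i) (u τ w)) t z

/-- The difference of the `i`-th nonlinearities, propagated to time `t`. -/
def diffTerm (i : Fin 2) (u v : ℝ → Z → ℝ) (t : ℝ) (z : Z) : ℝ≥0∞ :=
  lvolterra (S.ker i) (fun τ w => ‖power (S.p i) (u τ w) - power (S.p i) (v τ w)‖ₑ) t z

/-- A majorant of the difference of the nonlinear parts. -/
def diffBound (u v : ℝ → Z → ℝ) (t : ℝ) (z : Z) : ℝ≥0∞ :=
  ∑ i, ‖S.c i‖ₑ * S.diffTerm i u v t z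

/-- Bounds on `(0, t)` in the norms that control the nonlinearities. -/
def Close (R : ℝ≥0∞) (D : ℝ → ℝ≥0∞) (t : ℝ) (u v : ℝ → Z → ℝ) : Prop :=
  ∀ τ ∈ Ioo 0 t, ∀ i : Fin 2, S.wn i.succ τ (u τ) ≤ R ∧ S.wn i.succ τ (v τ) ≤ R ∧
    S.wn i.succ τ (u τ - v τ) ≤ D τ

variable {S}

theorem le_of_wn_le {E : Type*} [TopologicalSpace E] [ContinuousENorm E] {j : Fin 3} {t : ℝ}
    (ht : 0 < t) {f : Z → E} {M : ℝ≥0∞} (h : S.wn j t f ≤ M) :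
    eLpNorm f (ENNReal.ofReal (S.R j)) volume ≤ M * ENNReal.ofReal (t ^ (-S.A j)) := by
  have h2 := mul_le_mul_left h (ENNReal.ofReal (t ^ (-S.A j)))
  refine le_trans (le_of_eq ?_) h2
  rw [wn, mul_right_comm, ← ENNReal.ofReal_mul (by positivity), ← Real.rpow_add ht,
    add_neg_cancel, Real.rpow_zero, ENNReal.ofReal_one, one_mul]

theorem wn_mono {E E' : Type*} [TopologicalSpace E] [ContinuousENorm E] [TopologicalSpace E']
    [ContinuousENorm E'] {j : Fin 3} {t : ℝ} {f : Z → E} {g : Z → E'}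
    (h : ∀ᵐ z, ‖f z‖ₑ ≤ ‖g z‖ₑ) : S.wn j t f ≤ S.wn j t g :=
  mul_le_mul_right (eLpNorm_mono_enorm_ae h) _

theorem measurable_power_comp {u : ℝ → Z → ℝ} (hu : Measurable fun a : ℝ × Z => u a.1 a.2) (p : ℝ) :
    Measurable fun a : ℝ × Z => power p (u a.1 a.2) := (measurable_power p).comp hu

theorem measurable_power_diff {u v : ℝ → Z → ℝ} (hu : Measurable fun a : ℝ × Z => u a.1 a.2)
    (hv : Measurable fun a : ℝ × Z => v a.1 a.2) (p : ℝ) :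
    Measurable fun a : ℝ × Z => ‖power p (u a.1 a.2) - power p (v a.1 a.2)‖ₑ :=
  ((measurable_power_comp hu p).sub (measurable_power_comp hv p)).enorm

theorem measurable_diffTerm {u v : ℝ → Z → ℝ} (hu : Measurable fun a : ℝ × Z => u a.1 a.2)
    (hv : Measurable fun a : ℝ × Z => v a.1 a.2) (i : Fin 2) (t : ℝ) :
    Measurable (S.diffTerm i u v t) :=
  measurable_lvolterra (S.measurable_ker i) (measurable_power_diff hu hv _) t

/-- On a ball of radius R the nonlinearity is Lipschitz with time singularity τ^{-pα}; in norms with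
growth e^{λτ}, its propagation carries the factor λ^{-ε}. The choice of λ is uniform in u, v, D and
t ≤ T. -/
theorem diffTerm_contract (S : Scheme Z) (i : Fin 2) (j : Fin 3) {R : ℝ≥0∞} (hR : R ≠ ∞) (T : ℝ)
    {c : ℝ} (hc : 0 < c) :
    ∀ᶠ lam : ℝ in atTop, ∀ (u v : ℝ → Z → ℝ) (D : ℝ≥0∞) (t : ℝ),
      (Measurable fun a : ℝ × Z => u a.1 a.2) → (Measurable fun a : ℝ × Z => v a.1 a.2) →
      0 < t → t ≤ T → S.Close R (fun τ => D * ENNReal.ofReal (Real.exp (lam * τ))) t u v →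
      S.wn j t (S.diffTerm i u v t) ≤ ENNReal.ofReal c * D * ENNReal.ofReal (Real.exp (lam * t)) := by
  set p := S.p i with hp
  set α := S.A i.succ with hα
  set β := p * α with hβ
  -- Both gaps are positive. With ε at most half of the smaller one, the kernel of order θ + ε is
  -- still integrable and the remaining power of t is nonnegative, hence at most the same power of
  -- T.
  set m₀ := min (1 - S.θ i j) (S.A j + 1 - S.θ i j - β) with hm₀
  have hm₀pos : 0 < m₀ := lt_min (by linarith [S.theta_lt i j]) (S.exponent_pos i j)
  set ε := min 1 (m₀ / 2) with hε
  have hε0 : 0 < ε := lt_min one_pos (by linarith)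
  have hε1 : ε ≤ 1 := min_le_left _ _
  have hε2 : ε ≤ m₀ / 2 := min_le_right _ _
  have hθε : S.θ i j + ε < 1 := by
    have := min_le_left (1 - S.θ i j) (S.A j + 1 - S.θ i j - β); linarith
  have hexp : 0 ≤ S.A j + (1 - (S.θ i j + ε) - β) := by
    have := min_le_right (1 - S.θ i j) (S.A j + 1 - S.θ i j - β); linarith
  have hp1 : 1 < p := S.one_lt_p i
  -- The Lipschitz constant of the power nonlinearity on the ball of radius R; 2R bounds the sum of
  -- the two norms.
  set P : ℝ≥0∞ := ENNReal.ofReal p * (2 * R) ^ (p - 1) with hP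
  have hPfin : P ≠ ∞ := ENNReal.mul_ne_top ENNReal.ofReal_ne_top
    (ENNReal.rpow_ne_top_of_nonneg (by linarith) (ENNReal.mul_ne_top (by simp) hR))
  set B := betaConst (S.θ i j + ε) β with hB
  have hB0 : 0 ≤ B := betaConst_nonneg _ _
  have hC0 := S.C_nonneg
  have hlim : Tendsto (fun lam : ℝ => P.toReal * S.C * B * T ^ (S.A j + (1 - (S.θ i j + ε) - β)) *
      lam ^ (-ε)) atTop (𝓝 0) := by
    have := (tendsto_rpow_neg_atTop hε0).const_mul
      (P.toReal * S.C * B * T ^ (S.A j + (1 - (S.θ i j + ε) - β)))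
    rwa [mul_zero] at this
  filter_upwards [hlim.eventually (ge_mem_nhds hc), eventually_gt_atTop 0] with lam hsmall hlam
  intro u v D t hu hv ht htT hclose
  have hDτ : ∀ τ ∈ Ioo 0 t, eLpNorm (fun w => ‖power p (u τ w) - power p (v τ w)‖ₑ)
      (ENNReal.ofReal (S.s i)) volume
      ≤ (P * D) * ENNReal.ofReal (τ ^ (-β) * Real.exp (lam * τ)) := fun τ hτ => by
    have hτ0 : 0 < τ := hτ.1
    obtain ⟨h1, h2, h3⟩ := hclose τ hτ i
    have h1 := le_of_wn_le hτ0 h1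
    have h2 := le_of_wn_le hτ0 h2
    have h3 := le_of_wn_le hτ0 h3
    rw [S.R_succ] at h1 h2 h3
    refine (eLpNorm_power_sub_le hp1 (S.one_le_s i) (hu.comp measurable_prodMk_left)
      (hv.comp measurable_prodMk_left)).trans ?_
    calc _ ≤ ENNReal.ofReal p * (R * ENNReal.ofReal (τ ^ (-α)) + R * ENNReal.ofReal (τ ^ (-α))) ^ (p - 1)
          * (D * ENNReal.ofReal (Real.exp (lam * τ)) * ENNReal.ofReal (τ ^ (-α))) :=
          mul_le_mul' (mul_le_mul_right (ENNReal.rpow_le_rpow (add_le_add h1 h2) (by linarith)) _) h3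
      _ = _ := by
        rw [← two_mul, ← mul_assoc 2, ENNReal.mul_rpow_of_nonneg _ _ (by linarith : 0 ≤ p - 1),
          ENNReal.ofReal_rpow_of_nonneg (by positivity) (by linarith), hP,
          ← Real.rpow_mul hτ0.le, show -β = -α * (p - 1) + -α by rw [hβ]; ring,
          Real.rpow_add hτ0, ENNReal.ofReal_mul (by positivity), ENNReal.ofReal_mul (by positivity)]
        ring
  have hmain := eLpNorm_lvolterra_le_of_weight (S.measurable_ker i)
    (measurable_power_diff hu hv p) (S.one_le_R j) S.C_nonneg (S.opBound i j) (S.beta_lt i)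
    hε0.le hε1 hθε hlam ht hDτ
  calc S.wn j t (S.diffTerm i u v t)
      ≤ ENNReal.ofReal (t ^ S.A j) * (P * D * ENNReal.ofReal (S.C * B * lam ^ (-ε) *
        Real.exp (lam * t) * t ^ (1 - (S.θ i j + ε) - β))) := mul_le_mul_right hmain _
    _ = ENNReal.ofReal (P.toReal * S.C * B * t ^ (S.A j + (1 - (S.θ i j + ε) - β)) * lam ^ (-ε))
        * D * ENNReal.ofReal (Real.exp (lam * t)) := by
        rw [Real.rpow_add ht]
        conv_lhs => rw [← ENNReal.ofReal_toReal hPfin]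
        have e : P.toReal * S.C * B * (t ^ S.A j * t ^ (1 - (S.θ i j + ε) - β)) * lam ^ (-ε)
          = t ^ S.A j * (P.toReal * (S.C * B * lam ^ (-ε) * t ^ (1 - (S.θ i j + ε) - β))) := by ring
        have hP0 : 0 ≤ P.toReal := ENNReal.toReal_nonneg
        rw [e, show S.C * B * lam ^ (-ε) * Real.exp (lam * t) * t ^ (1 - (S.θ i j + ε) - β)
          = (S.C * B * lam ^ (-ε) * t ^ (1 - (S.θ i j + ε) - β)) * Real.exp (lam * t) by ring,
          ENNReal.ofReal_mul (q := Real.exp (lam * t)) (by positivity),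
          ENNReal.ofReal_mul (p := t ^ S.A j) (by positivity), ENNReal.ofReal_mul hP0]
        ring
    _ ≤ ENNReal.ofReal c * D * ENNReal.ofReal (Real.exp (lam * t)) := by
        gcongr
        refine le_trans ?_ hsmall
        gcongr

theorem wn_diffBound_le (S : Scheme Z) {u v : ℝ → Z → ℝ}
    (hu : Measurable fun a : ℝ × Z => u a.1 a.2) (hv : Measurable fun a : ℝ × Z => v a.1 a.2)
    (j : Fin 3) (t : ℝ) :
    S.wn j t (S.diffBound u v t) ≤ ∑ i, ‖S.c i‖ₑ * S.wn j t (S.diffTerm i u v t) := by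
  have hR : (1 : ℝ≥0∞) ≤ ENNReal.ofReal (S.R j) := by
    rw [ENNReal.one_le_ofReal]; exact S.one_le_R j
  have hR0 : 0 < S.R j := by linarith [S.one_le_R j]
  have hm := fun i => measurable_diffTerm (S := S) hu hv i t
  have hsmul : ∀ i, eLpNorm (fun z => ‖S.c i‖ₑ * S.diffTerm i u v t z) (ENNReal.ofReal (S.R j)) volume
      = ‖S.c i‖ₑ * eLpNorm (S.diffTerm i u v t) (ENNReal.ofReal (S.R j)) volume := fun i => by
    have hmi := hm i
    rw [eLpNorm_ofReal_eq hR0, eLpNorm_ofReal_eq hR0]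
    simp only [enorm_eq_self, ENNReal.mul_rpow_of_nonneg _ _ hR0.le]
    rw [lintegral_const_mul _ (by fun_prop), ENNReal.mul_rpow_of_nonneg _ _ (by positivity),
      ← ENNReal.rpow_mul, mul_one_div_cancel hR0.ne', ENNReal.rpow_one]
  have h : eLpNorm (S.diffBound u v t) (ENNReal.ofReal (S.R j)) volume ≤
      ∑ i, ‖S.c i‖ₑ * eLpNorm (S.diffTerm i u v t) (ENNReal.ofReal (S.R j)) volume := by
    have e : S.diffBound u v t = (fun z => ‖S.c 0‖ₑ * S.diffTerm 0 u v t z) +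
        fun z => ‖S.c 1‖ₑ * S.diffTerm 1 u v t z := by
      funext z; simp [diffBound, Fin.sum_univ_two]
    rw [e, Fin.sum_univ_two, ← hsmul 0, ← hsmul 1]
    exact eLpNorm_add_le ((measurable_const.mul (hm 0)).aestronglyMeasurable)
      ((measurable_const.mul (hm 1)).aestronglyMeasurable) hR
  calc S.wn j t (S.diffBound u v t) ≤ ENNReal.ofReal (t ^ S.A j) * _ := mul_le_mul_right h _
    _ = _ := by
      rw [Finset.mul_sum]
      exact Finset.sum_congr rfl fun i _ => by rw [wn, mul_left_comm]

/-- In an exponentially weighted norm the nonlinear part is a contraction with arbitrarily small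
constant. -/
theorem diffBound_contract (S : Scheme Z) {R : ℝ≥0∞} (hR : R ≠ ∞) (T : ℝ) {c : ℝ} (hc : 0 < c) :
    ∃ lam : ℝ, 0 < lam ∧ ∀ (u v : ℝ → Z → ℝ) (D : ℝ≥0∞) (t : ℝ),
      (Measurable fun a : ℝ × Z => u a.1 a.2) → (Measurable fun a : ℝ × Z => v a.1 a.2) →
      0 < t → t ≤ T → S.Close R (fun τ => D * ENNReal.ofReal (Real.exp (lam * τ))) t u v →
      ∀ j, S.wn j t (S.diffBound u v t)
        ≤ ENNReal.ofReal c * D * ENNReal.ofReal (Real.exp (lam * t)) := by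
  -- The summand 1 keeps K positive when both coefficients vanish.
  set K := |S.c 0| + |S.c 1| + 1 with hK
  have hK0 : 0 < K := by positivity
  have h := eventually_all.2 fun i => eventually_all.2 fun j =>
    S.diffTerm_contract i j hR T (div_pos hc hK0)
  obtain ⟨lam, hlam, h0⟩ := (h.and (eventually_gt_atTop 0)).exists
  refine ⟨lam, h0, fun u v D t hu hv ht htT hcl j => (S.wn_diffBound_le hu hv j t).trans ?_⟩
  rw [Fin.sum_univ_two]
  calc _ ≤ ‖S.c 0‖ₑ * (ENNReal.ofReal (c / K) * D * ENNReal.ofReal (Real.exp (lam * t))) +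
        ‖S.c 1‖ₑ * (ENNReal.ofReal (c / K) * D * ENNReal.ofReal (Real.exp (lam * t))) := by
        gcongr
        · exact hlam 0 j u v D t hu hv ht htT hcl
        · exact hlam 1 j u v D t hu hv ht htT hcl
    _ = ENNReal.ofReal ((|S.c 0| + |S.c 1|) * (c / K)) * D * ENNReal.ofReal (Real.exp (lam * t)) := by
        rw [ENNReal.ofReal_mul (by positivity), ENNReal.ofReal_add (abs_nonneg _) (abs_nonneg _),
          Real.enorm_eq_ofReal_abs, Real.enorm_eq_ofReal_abs]
        ring
    _ ≤ _ := by
        gcongr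
        rw [← mul_div_assoc, div_le_iff₀ hK0, hK]
        nlinarith

end Scheme

end

end Grushin

/-! ### Consequences of the contraction estimate: absolute convergence, decay, uniqueness, short
times -/

namespace Grushin

noncomputable section

namespace Scheme

set_option linter.unusedSectionVars false

variable {Z : Type*} [MeasureSpace Z] [SigmaFinite (volume : Measure Z)] {S : Scheme Z}

theorem wn_zero (j : Fin 3) (t : ℝ) : S.wn j t (0 : Z → ℝ) = 0 := by simp [wn]

theorem wn_le_add {E E' E'' : Type*} [TopologicalSpace E] [ContinuousENorm E] [TopologicalSpace E']
    [ContinuousENorm E'] [TopologicalSpace E''] [ContinuousENorm E''] {j : Fin 3} {t : ℝ}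
    {h : Z → E} {f : Z → E'} {g : Z → E''} (hf : AEMeasurable fun z => ‖f z‖ₑ)
    (hg : AEMeasurable fun z => ‖g z‖ₑ) (hle : ∀ᵐ z, ‖h z‖ₑ ≤ ‖f z‖ₑ + ‖g z‖ₑ) :
    S.wn j t h ≤ S.wn j t f + S.wn j t g := by
  rw [wn, wn, wn, ← mul_add]
  refine mul_le_mul_right ?_ _
  have h1 : eLpNorm h (ENNReal.ofReal (S.R j)) volume ≤
      eLpNorm ((fun z => ‖f z‖ₑ) + fun z => ‖g z‖ₑ) (ENNReal.ofReal (S.R j)) volume :=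
    eLpNorm_mono_enorm_ae (by simpa using hle)
  refine h1.trans ((eLpNorm_add_le hf.aestronglyMeasurable hg.aestronglyMeasurable
    (by rw [ENNReal.one_le_ofReal]; exact S.one_le_R j)).trans (le_of_eq ?_))
  rw [eLpNorm_enorm, eLpNorm_enorm]

theorem ae_lt_top_of_wn {j : Fin 3} {t : ℝ} (ht : 0 < t) {F : Z → ℝ≥0∞} (hF : Measurable F)
    (h : S.wn j t F ≠ ∞) : ∀ᵐ z, F z < ∞ := by
  have hR0 : 0 < S.R j := by linarith [S.one_le_R j]
  have h1 : eLpNorm F (ENNReal.ofReal (S.R j)) volume ≠ ∞ := by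
    have := le_of_wn_le ht (le_refl (S.wn j t F))
    exact ne_top_of_le_ne_top (ENNReal.mul_ne_top h ENNReal.ofReal_ne_top) this
  have h2 : ∫⁻ z, F z ^ S.R j ≠ ∞ := by
    have h3 := ENNReal.rpow_ne_top_of_nonneg hR0.le h1
    rw [eLpNorm_ofReal_rpow hR0] at h3
    simpa using h3
  filter_upwards [ae_lt_top (hF.pow_const _) h2] with z hz
  exact (ENNReal.rpow_lt_top_iff_of_pos hR0).1 hz

theorem ae_eq_zero_of_wn {E : Type*} [NormedAddCommGroup E] {j : Fin 3} {t : ℝ} (ht : 0 < t)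
    {f : Z → E} (hf : AEStronglyMeasurable f volume) (h : S.wn j t f = 0) : f =ᵐ[volume] 0 := by
  have h1 := le_of_wn_le ht h.le
  rw [zero_mul, nonpos_iff_eq_zero, eLpNorm_eq_zero_iff hf
    (by simpa using (by linarith [S.one_le_R j] : (0 : ℝ) < S.R j))] at h1
  exact h1

theorem measurable_diffBound {u v : ℝ → Z → ℝ} (hu : Measurable fun a : ℝ × Z => u a.1 a.2)
    (hv : Measurable fun a : ℝ × Z => v a.1 a.2) (t : ℝ) : Measurable (S.diffBound u v t) :=
  Finset.measurable_fun_sum _ fun i _ => measurable_const.mul (measurable_diffTerm hu hv i t)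

theorem measurable_duhamel {u : ℝ → Z → ℝ} (hu : Measurable fun a : ℝ × Z => u a.1 a.2) :
    Measurable fun a : ℝ × Z => S.duhamel u a.1 a.2 :=
  Finset.measurable_fun_sum _ fun i _ => measurable_const.mul
    (measurable_volterra (S.measurable_ker i) (measurable_power_comp hu _))

/-- Comparison with the zero function turns estimates of differences into estimates of the nonlinear
term itself. -/
theorem close_zero {u : ℝ → Z → ℝ} {R : ℝ≥0∞} {t : ℝ}
    (h : ∀ τ ∈ Ioo 0 t, ∀ i : Fin 2, S.wn i.succ τ (u τ) ≤ R) :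
    S.Close R (fun _ => R) t u 0 := fun τ hτ i =>
  ⟨h τ hτ i, by simp [wn_zero], by simpa using h τ hτ i⟩

theorem Close.mono {u v : ℝ → Z → ℝ} {R : ℝ≥0∞} {D D' : ℝ → ℝ≥0∞} {t : ℝ}
    (h : S.Close R D t u v) (hD : ∀ τ ∈ Ioo 0 t, D τ ≤ D' τ) : S.Close R D' t u v :=
  fun τ hτ i => ⟨(h τ hτ i).1, (h τ hτ i).2.1, (h τ hτ i).2.2.trans (hD τ hτ)⟩

theorem le_mul_exp {D : ℝ≥0∞} {lam τ : ℝ} (hlam : 0 < lam) (hτ : 0 ≤ τ) :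
    D ≤ D * ENNReal.ofReal (Real.exp (lam * τ)) := by
  refine le_mul_of_one_le_right zero_le ?_
  rw [ENNReal.one_le_ofReal]
  exact Real.one_le_exp (by positivity)

/-- The contraction estimate against 0 bounds the Volterra integral of the absolute value in a
Lebesgue norm, so it is finite almost everywhere. This is the absolute convergence required of mild
solutions. -/
theorem ae_lvolterra_ne_top {u : ℝ → Z → ℝ} (hu : Measurable fun a : ℝ × Z => u a.1 a.2)
    {R : ℝ≥0∞} (hR : R ≠ ∞) {t : ℝ} (ht : 0 < t)
    (h : ∀ τ ∈ Ioo 0 t, ∀ i : Fin 2, S.wn i.succ τ (u τ) ≤ R) (i : Fin 2) :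
    ∀ᵐ z, lvolterra (S.ker i) (fun τ w => ‖power (S.p i) (u τ w)‖ₑ) t z < ∞ := by
  have hz : Measurable fun a : ℝ × Z => (0 : ℝ → Z → ℝ) a.1 a.2 := measurable_const
  obtain ⟨lam, hl, h0⟩ := ((S.diffTerm_contract i 0 hR t one_pos).and
    (eventually_gt_atTop 0)).exists
  have h1 := hl u 0 R t hu hz ht le_rfl ((close_zero h).mono fun τ hτ => le_mul_exp h0 hτ.1.le)
  have h2 := ae_lt_top_of_wn ht (measurable_diffTerm hu hz i t) (ne_top_of_le_ne_top
    (ENNReal.mul_ne_top (ENNReal.mul_ne_top ENNReal.ofReal_ne_top hR) ENNReal.ofReal_ne_top) h1)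
  simpa [diffTerm, power_zero] using h2

theorem enorm_duhamel_le {u : ℝ → Z → ℝ} (hu : Measurable fun a : ℝ × Z => u a.1 a.2) (t : ℝ)
    (z : Z) : ‖S.duhamel u t z‖ₑ ≤ S.diffBound u 0 t z := by
  refine (enorm_sum_le _ _).trans (Finset.sum_le_sum fun i _ => ?_)
  rw [enorm_mul]
  refine mul_le_mul_right ?_ _
  refine (enorm_volterra_le (S.measurable_ker i) (S.ker_nonneg i) (measurable_power_comp hu _)
    t z).trans (le_of_eq ?_)
  simp [diffTerm, power_zero]

theorem ae_enorm_duhamel_sub_le {u v : ℝ → Z → ℝ} (hu : Measurable fun a : ℝ × Z => u a.1 a.2)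
    (hv : Measurable fun a : ℝ × Z => v a.1 a.2) {R : ℝ≥0∞} (hR : R ≠ ∞) {t : ℝ} (ht : 0 < t)
    (h1 : ∀ τ ∈ Ioo 0 t, ∀ i : Fin 2, S.wn i.succ τ (u τ) ≤ R)
    (h2 : ∀ τ ∈ Ioo 0 t, ∀ i : Fin 2, S.wn i.succ τ (v τ) ≤ R) :
    ∀ᵐ z, ‖S.duhamel u t z - S.duhamel v t z‖ₑ ≤ S.diffBound u v t z := by
  filter_upwards [eventually_all.2 fun i => ae_lvolterra_ne_top hu hR ht h1 i,
    eventually_all.2 fun i => ae_lvolterra_ne_top hv hR ht h2 i] with z hz1 hz2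
  rw [duhamel, duhamel, ← Finset.sum_sub_distrib]
  refine (enorm_sum_le _ _).trans (Finset.sum_le_sum fun i _ => ?_)
  rw [← mul_sub, enorm_mul, volterra_sub (S.measurable_ker i) (S.ker_nonneg i)
    (measurable_power_comp hu _) (measurable_power_comp hv _) (hz1 i).ne (hz2 i).ne]
  exact mul_le_mul_right (enorm_volterra_le (S.measurable_ker i) (S.ker_nonneg i)
    ((measurable_power_comp hu _).sub (measurable_power_comp hv _)) t z) _

theorem wn_diffBound_zero_le (S : Scheme Z) {R : ℝ≥0∞} (hR : R ≠ ∞) (T : ℝ) :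
    ∃ M : ℝ≥0∞, M ≠ ∞ ∧ ∀ (u : ℝ → Z → ℝ) (t : ℝ), (Measurable fun a : ℝ × Z => u a.1 a.2) →
      0 < t → t ≤ T → (∀ τ ∈ Ioo 0 t, ∀ i : Fin 2, S.wn i.succ τ (u τ) ≤ R) →
      ∀ j, S.wn j t (S.diffBound u 0 t) ≤ M := by
  obtain ⟨lam, h0, hl⟩ := S.diffBound_contract hR T one_pos
  refine ⟨ENNReal.ofReal 1 * R * ENNReal.ofReal (Real.exp (lam * T)), ENNReal.mul_ne_top
    (ENNReal.mul_ne_top ENNReal.ofReal_ne_top hR) ENNReal.ofReal_ne_top, fun u t hu ht htT h j => ?_⟩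
  refine (hl u 0 R t hu measurable_const ht htT
    ((close_zero h).mono fun τ hτ => le_mul_exp h0 hτ.1.le) j).trans ?_
  gcongr

/-- The contraction constant may be chosen arbitrarily small, and for the corresponding λ the factor
e^{λt} is at most 2 once t ≤ log 2 / λ. -/
theorem tendsto_wn_diffBound {u : ℝ → Z → ℝ} (hu : Measurable fun a : ℝ × Z => u a.1 a.2)
    {R : ℝ≥0∞} (hR : R ≠ ∞) {T : ℝ} (hT : 0 < T)
    (h : ∀ τ ∈ Ioo 0 T, ∀ i : Fin 2, S.wn i.succ τ (u τ) ≤ R) (j : Fin 3) :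
    Tendsto (fun t => S.wn j t (S.diffBound u 0 t)) (𝓝[>] 0) (𝓝 0) := by
  rw [ENNReal.tendsto_nhds_zero]
  intro ε hε
  rcases eq_or_ne ε ∞ with rfl | hεt
  · simp
  have hε0 : 0 < ε.toReal := ENNReal.toReal_pos hε.ne' hεt
  have hR0 : 0 ≤ R.toReal := ENNReal.toReal_nonneg
  obtain ⟨lam, h0, hl⟩ := S.diffBound_contract hR T
    (c := ε.toReal / (2 * (R.toReal + 1))) (by positivity)
  filter_upwards [Ioo_mem_nhdsGT hT, Ioo_mem_nhdsGT (by positivity : 0 < Real.log 2 / lam)]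
    with t ht ht2
  refine (hl u 0 R t hu measurable_const ht.1 ht.2.le ((close_zero fun τ hτ =>
    h τ ⟨hτ.1, hτ.2.trans ht.2⟩).mono fun τ hτ => le_mul_exp h0 hτ.1.le) j).trans ?_
  have hexp : Real.exp (lam * t) ≤ 2 := by
    have := ht2.2
    rw [lt_div_iff₀ h0] at this
    calc Real.exp (lam * t) ≤ Real.exp (Real.log 2) := Real.exp_le_exp.2 (by linarith)
      _ = 2 := Real.exp_log (by norm_num)
  rw [← ENNReal.ofReal_toReal (ENNReal.mul_ne_top (ENNReal.mul_ne_top ENNReal.ofReal_ne_top hR)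
    ENNReal.ofReal_ne_top), ENNReal.toReal_mul, ENNReal.toReal_mul, ENNReal.toReal_ofReal
    (Real.exp_pos _).le, ENNReal.toReal_ofReal (by positivity)]
  refine ENNReal.ofReal_le_of_le_toReal ?_
  calc ε.toReal / (2 * (R.toReal + 1)) * R.toReal * Real.exp (lam * t)
      ≤ ε.toReal / (2 * (R.toReal + 1)) * (R.toReal + 1) * 2 := by gcongr; linarith
    _ = ε.toReal := by field_simp

/-- Uniqueness of bounded solutions. -/
theorem ae_eq_of_solutions {u v g : ℝ → Z → ℝ} (hu : Measurable fun a : ℝ × Z => u a.1 a.2)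
    (hv : Measurable fun a : ℝ × Z => v a.1 a.2) {R : ℝ≥0∞} (hR : R ≠ ∞) {T : ℝ}
    (hbu : ∀ τ ∈ Ioo 0 T, ∀ i : Fin 2, S.wn i.succ τ (u τ) ≤ R)
    (hbv : ∀ τ ∈ Ioo 0 T, ∀ i : Fin 2, S.wn i.succ τ (v τ) ≤ R)
    (hequ : ∀ t ∈ Ioc 0 T, ∀ᵐ z, u t z = g t z + S.duhamel u t z)
    (heqv : ∀ t ∈ Ioc 0 T, ∀ᵐ z, v t z = g t z + S.duhamel v t z) :
    ∀ t ∈ Ioc 0 T, u t =ᵐ[volume] v t := by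
  obtain ⟨lam, h0, hl⟩ := S.diffBound_contract hR T (c := 1 / 2) (by norm_num)
  -- The distance of the two solutions in the exponentially weighted norm. It is finite by the
  -- assumed bounds and at most half of itself, hence zero.
  set D : ℝ≥0∞ := ⨆ τ ∈ Ioo 0 T, ⨆ i : Fin 2,
    S.wn i.succ τ (u τ - v τ) * ENNReal.ofReal (Real.exp (-(lam * τ))) with hD
  have hsl : ∀ {w : ℝ → Z → ℝ} (_ : Measurable fun a : ℝ × Z => w a.1 a.2) (t : ℝ),
    Measurable (w t) := fun hw t => hw.comp measurable_prodMk_left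
  have hDfin : D ≠ ∞ := by
    refine ne_top_of_le_ne_top (ENNReal.add_ne_top.2 ⟨hR, hR⟩) (iSup₂_le fun τ hτ => iSup_le fun i => ?_)
    calc _ ≤ S.wn i.succ τ (u τ - v τ) * 1 := by
          refine mul_le_mul_right ?_ _
          rw [ENNReal.ofReal_le_one, Real.exp_le_one_iff]
          have := mul_pos h0 hτ.1
          linarith
      _ ≤ S.wn i.succ τ (u τ) + S.wn i.succ τ (v τ) := by
          rw [mul_one]
          exact wn_le_add (hsl hu τ).enorm.aemeasurable (hsl hv τ).enorm.aemeasurable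
            (ae_of_all _ fun z => enorm_sub_le)
      _ ≤ R + R := add_le_add (hbu τ hτ i) (hbv τ hτ i)
  have hcl : ∀ t ∈ Ioc 0 T, S.Close R (fun τ => D * ENNReal.ofReal (Real.exp (lam * τ))) t u v := by
    intro t ht τ hτ i
    have hτT : τ ∈ Ioo 0 T := ⟨hτ.1, hτ.2.trans_le ht.2⟩
    refine ⟨hbu τ hτT i, hbv τ hτT i, ?_⟩
    have : S.wn i.succ τ (u τ - v τ) * ENNReal.ofReal (Real.exp (-(lam * τ))) ≤ D :=
      (le_iSup (fun i : Fin 2 => S.wn i.succ τ (u τ - v τ) *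
        ENNReal.ofReal (Real.exp (-(lam * τ)))) i).trans (le_iSup₂ (f := fun τ (_ : τ ∈ Ioo 0 T) =>
        ⨆ i : Fin 2, S.wn i.succ τ (u τ - v τ) * ENNReal.ofReal (Real.exp (-(lam * τ)))) τ hτT)
    refine le_trans (le_of_eq ?_) (mul_le_mul_left this _)
    rw [mul_assoc, ← ENNReal.ofReal_mul (Real.exp_pos _).le, ← Real.exp_add]
    simp
  have hdiff : ∀ t ∈ Ioc 0 T, ∀ j, S.wn j t (u t - v t) ≤
      ENNReal.ofReal (1 / 2) * D * ENNReal.ofReal (Real.exp (lam * t)) := by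
    intro t ht j
    refine le_trans (wn_mono ?_) (hl u v D t hu hv ht.1 ht.2 (hcl t ht) j)
    have := ae_enorm_duhamel_sub_le hu hv hR ht.1 (fun τ hτ => hbu τ ⟨hτ.1, hτ.2.trans_le ht.2⟩)
      fun τ hτ => hbv τ ⟨hτ.1, hτ.2.trans_le ht.2⟩
    filter_upwards [hequ t ht, heqv t ht, this] with z h1 h2 h3
    rw [Pi.sub_apply, h1, h2, add_sub_add_left_eq_sub, enorm_eq_self]
    exact h3
  have hDle : D ≤ ENNReal.ofReal (1 / 2) * D := by
    refine iSup₂_le fun τ hτ => iSup_le fun i => ?_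
    refine (mul_le_mul_left (hdiff τ ⟨hτ.1, hτ.2.le⟩ i.succ) _).trans (le_of_eq ?_)
    rw [mul_assoc, ← ENNReal.ofReal_mul (Real.exp_pos _).le, ← Real.exp_add]
    simp
  have hD0 : D = 0 := by
    by_contra hne
    have h1 : ENNReal.ofReal (1 / 2) * D < 1 * D := by
      rw [ENNReal.mul_lt_mul_iff_left hne hDfin, ENNReal.ofReal_lt_one]
      norm_num
    rw [one_mul] at h1
    exact absurd hDle (not_le.2 h1)
  intro t ht
  have h1 := hdiff t ht 0
  rw [hD0, mul_zero, zero_mul, nonpos_iff_eq_zero] at h1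
  have h2 := ae_eq_zero_of_wn ht.1 ((hsl hu t).sub (hsl hv t)).aestronglyMeasurable h1
  filter_upwards [h2] with z hz
  exact sub_eq_zero.1 hz

/-- On short time intervals the nonlinear part is a contraction. -/
def IsContractionTime (S : Scheme Z) (R : ℝ≥0∞) (T : ℝ) : Prop :=
  ∀ (u v : ℝ → Z → ℝ) (D : ℝ≥0∞) (t : ℝ), (Measurable fun a : ℝ × Z => u a.1 a.2) →
    (Measurable fun a : ℝ × Z => v a.1 a.2) → t ∈ Ioc 0 T → S.Close R (fun _ => D) t u v →
    ∀ j, S.wn j t (S.diffBound u v t) ≤ D / 2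

/-- On t ≤ log 2 / λ the exponential weight costs at most a factor 2, so the constant 1/4 becomes
1/2 in the unweighted norms. -/
theorem exists_isContractionTime (S : Scheme Z) {R : ℝ≥0∞} (hR : R ≠ ∞) :
    ∃ T, 0 < T ∧ S.IsContractionTime R T := by
  obtain ⟨lam, h0, hl⟩ := S.diffBound_contract hR 1 (c := 1 / 4) (by norm_num)
  refine ⟨min 1 (Real.log 2 / lam), lt_min one_pos (by positivity), ?_⟩
  intro u v D t hu hv ht hcl j
  refine (hl u v D t hu hv ht.1 (ht.2.trans (min_le_left _ _))
    (hcl.mono fun τ hτ => le_mul_exp h0 hτ.1.le) j).trans ?_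
  have hexp : Real.exp (lam * t) ≤ 2 := by
    have := ht.2.trans (min_le_right _ _)
    rw [le_div_iff₀ h0] at this
    calc Real.exp (lam * t) ≤ Real.exp (Real.log 2) := Real.exp_le_exp.2 (by linarith)
      _ = 2 := Real.exp_log (by norm_num)
  calc ENNReal.ofReal (1 / 4) * D * ENNReal.ofReal (Real.exp (lam * t))
      ≤ ENNReal.ofReal (1 / 4) * D * ENNReal.ofReal 2 := by gcongr
    _ = ENNReal.ofReal (1 / 4 * 2) * D := by
        rw [ENNReal.ofReal_mul (by norm_num)]; ring
    _ = D / 2 := by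
        rw [ENNReal.div_eq_inv_mul, show (1 / 4 * 2 : ℝ) = 2⁻¹ by norm_num,
          ENNReal.ofReal_inv_of_pos (by norm_num)]
        simp

theorem IsContractionTime.mono {R : ℝ≥0∞} {T T' : ℝ} (h : S.IsContractionTime R T) (hT : T' ≤ T) :
    S.IsContractionTime R T' :=
  fun u v D t hu hv ht => h u v D t hu hv ⟨ht.1, ht.2.trans hT⟩

/-- Lipschitz dependence on the linear part. -/
theorem IsContractionTime.wn_sub_le {R : ℝ≥0∞} {T : ℝ} (hT : S.IsContractionTime R T) (hR : R ≠ ∞)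
    {u v g g' : ℝ → Z → ℝ} (hu : Measurable fun a : ℝ × Z => u a.1 a.2)
    (hv : Measurable fun a : ℝ × Z => v a.1 a.2) (hg : ∀ t, Measurable (g t))
    (hg' : ∀ t, Measurable (g' t))
    (hbu : ∀ τ ∈ Ioo 0 T, ∀ i : Fin 2, S.wn i.succ τ (u τ) ≤ R)
    (hbv : ∀ τ ∈ Ioo 0 T, ∀ i : Fin 2, S.wn i.succ τ (v τ) ≤ R)
    (hequ : ∀ t ∈ Ioc 0 T, ∀ᵐ z, u t z = g t z + S.duhamel u t z)
    (heqv : ∀ t ∈ Ioc 0 T, ∀ᵐ z, v t z = g' t z + S.duhamel v t z) {G : ℝ≥0∞}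
    (hG : ∀ t ∈ Ioc 0 T, ∀ j, S.wn j t (g t - g' t) ≤ G) :
    ∀ t ∈ Ioc 0 T, ∀ j, S.wn j t (u t - v t) ≤ 2 * G := by
  have hsl : ∀ {w : ℝ → Z → ℝ} (_ : Measurable fun a : ℝ × Z => w a.1 a.2) (t : ℝ),
    Measurable (w t) := fun hw t => hw.comp measurable_prodMk_left
  set D : ℝ≥0∞ := ⨆ τ ∈ Ioo 0 T, ⨆ i : Fin 2, S.wn i.succ τ (u τ - v τ) with hD
  have hDfin : D ≠ ∞ := by
    refine ne_top_of_le_ne_top (ENNReal.add_ne_top.2 ⟨hR, hR⟩) (iSup₂_le fun τ hτ => iSup_le fun i => ?_)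
    exact (wn_le_add (hsl hu τ).enorm.aemeasurable (hsl hv τ).enorm.aemeasurable
      (ae_of_all _ fun z => enorm_sub_le)).trans (add_le_add (hbu τ hτ i) (hbv τ hτ i))
  have hcl : ∀ t ∈ Ioc 0 T, S.Close R (fun _ => D) t u v := by
    intro t ht τ hτ i
    have hτT : τ ∈ Ioo 0 T := ⟨hτ.1, hτ.2.trans_le ht.2⟩
    exact ⟨hbu τ hτT i, hbv τ hτT i, (le_iSup (fun i : Fin 2 => S.wn i.succ τ (u τ - v τ)) i).trans
      (le_iSup₂ (f := fun τ (_ : τ ∈ Ioo 0 T) => ⨆ i : Fin 2, S.wn i.succ τ (u τ - v τ)) τ hτT)⟩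
  have hdiff : ∀ t ∈ Ioc 0 T, ∀ j, S.wn j t (u t - v t) ≤ G + D / 2 := by
    intro t ht j
    refine le_trans (wn_le_add ((hg t).sub (hg' t)).enorm.aemeasurable
      (measurable_diffBound hu hv t).enorm.aemeasurable ?_)
      (add_le_add (hG t ht j) (hT u v D t hu hv ht (hcl t ht) j))
    have := ae_enorm_duhamel_sub_le hu hv hR ht.1 (fun τ hτ => hbu τ ⟨hτ.1, hτ.2.trans_le ht.2⟩)
      fun τ hτ => hbv τ ⟨hτ.1, hτ.2.trans_le ht.2⟩
    filter_upwards [hequ t ht, heqv t ht, this] with z h1 h2 h3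
    rw [Pi.sub_apply, h1, h2, add_sub_add_comm, enorm_eq_self]
    exact (enorm_add_le _ _).trans (add_le_add le_rfl h3)
  rcases eq_or_ne G ∞ with rfl | hGt
  · simp
  have hDle : D ≤ G + D / 2 := iSup₂_le fun τ hτ => iSup_le fun i => hdiff τ ⟨hτ.1, hτ.2.le⟩ i.succ
  -- Half of D is cancelled from D ≤ G + D/2, which is legitimate because D is finite.
  have hD2 : D / 2 ≤ G := by
    have h1 : D / 2 + D / 2 ≤ G + D / 2 := by rwa [ENNReal.add_halves]
    exact (ENNReal.add_le_add_iff_right (ENNReal.div_ne_top hDfin (by simp))).1 h1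
  intro t ht j
  rw [two_mul]
  exact (hdiff t ht j).trans (add_le_add le_rfl hD2)

end Scheme

end

end Grushin

/-! ### Picard iteration -/

namespace Grushin

noncomputable section

/-- Minkowski's integral inequality for the counting measure. -/
theorem eLpNorm_tsum_le {Z : Type*} [MeasurableSpace Z] {ν : Measure Z} [SFinite ν]
    {F : ℕ → Z → ℝ≥0∞} (hF : ∀ n, Measurable (F n)) {b : ℝ} (hb : 1 ≤ b) :
    eLpNorm (fun z => ∑' n, F n z) (ENNReal.ofReal b) ν ≤
      ∑' n, eLpNorm (F n) (ENNReal.ofReal b) ν := by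
  have h := eLpNorm_lintegral_le (μ := Measure.count) (ν := ν)
    (F := F) (measurable_from_prod_countable_right hF) hb
  simpa [lintegral_count] using h

namespace Scheme

set_option linter.unusedSectionVars false

variable {Z : Type*} [MeasureSpace Z] [SigmaFinite (volume : Measure Z)] {S : Scheme Z}

theorem wn_tsum_le {F : ℕ → Z → ℝ≥0∞} (hF : ∀ n, Measurable (F n)) (j : Fin 3) (t : ℝ) :
    S.wn j t (fun z => ∑' n, F n z) ≤ ∑' n, S.wn j t (F n) := by
  simp only [wn]
  rw [ENNReal.tsum_mul_left]
  exact mul_le_mul_right (eLpNorm_tsum_le hF (S.one_le_R j)) _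

/-- The Picard iterates. -/
def picard (S : Scheme Z) (g : ℝ → Z → ℝ) : ℕ → ℝ → Z → ℝ
  | 0 => 0
  | n + 1 => fun t z => g t z + S.duhamel (picard S g n) t z

variable {g : ℝ → Z → ℝ}

theorem measurable_picard (hg : Measurable fun a : ℝ × Z => g a.1 a.2) (n : ℕ) :
    Measurable fun a : ℝ × Z => S.picard g n a.1 a.2 := by
  induction n with
  | zero => exact measurable_const
  | succ n ih => exact hg.add (measurable_duhamel ih)

theorem picard_nonneg (hg : ∀ t z, 0 ≤ g t z) (hc : ∀ i, 0 ≤ S.c i) (n : ℕ) (t : ℝ) (z : Z) :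
    0 ≤ S.picard g n t z := by
  induction n generalizing t z with
  | zero => exact le_rfl
  | succ n ih =>
    exact add_nonneg (hg t z) (Finset.sum_nonneg fun i _ => mul_nonneg (hc i)
      (volterra_nonneg (S.ker_nonneg i) (fun τ w => power_nonneg (ih τ w)) t z))

/-- The ball of radius 2G is invariant: the linear part contributes G and the nonlinear part half of
2G. -/
theorem IsContractionTime.wn_picard_le {G : ℝ≥0∞} {T : ℝ} (hT : S.IsContractionTime (2 * G) T)
    (hg : Measurable fun a : ℝ × Z => g a.1 a.2) (hG : ∀ t ∈ Ioc 0 T, ∀ j, S.wn j t (g t) ≤ G)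
    (n : ℕ) : ∀ t ∈ Ioc 0 T, ∀ j, S.wn j t (S.picard g n t) ≤ 2 * G := by
  induction n with
  | zero => intro t _ j; simp [picard, wn]
  | succ n ih =>
    intro t ht j
    have hm := measurable_picard (S := S) hg n
    refine (wn_le_add (hg.comp (measurable_prodMk_left (x := t))).enorm.aemeasurable
      (measurable_diffBound hm (v := 0) measurable_const t).enorm.aemeasurable
      (ae_of_all _ fun z => ?_)).trans ((add_le_add (hG t ht j) (hT _ 0 (2 * G) t hm measurable_const
      ht (close_zero fun τ hτ i => ih τ ⟨hτ.1, hτ.2.le.trans ht.2⟩ _) j)).trans (le_of_eq ?_))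
    · exact (enorm_add_le _ _).trans (add_le_add le_rfl (enorm_duhamel_le hm t z))
    · rw [mul_comm, ENNReal.mul_div_cancel_right (by simp) (by simp), mul_comm, two_mul]

theorem IsContractionTime.wn_picard_sub_le {G : ℝ≥0∞} (hGt : G ≠ ∞) {T : ℝ}
    (hT : S.IsContractionTime (2 * G) T)
    (hg : Measurable fun a : ℝ × Z => g a.1 a.2) (hG : ∀ t ∈ Ioc 0 T, ∀ j, S.wn j t (g t) ≤ G)
    (n : ℕ) : ∀ t ∈ Ioc 0 T, ∀ j,
      S.wn j t (S.picard g (n + 1) t - S.picard g n t) ≤ G * 2⁻¹ ^ n := by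
  have hR : 2 * G ≠ ∞ := ENNReal.mul_ne_top (by simp) hGt
  have hb := hT.wn_picard_le hg hG
  induction n with
  | zero =>
    intro t ht j
    rw [pow_zero, mul_one]
    refine le_trans (wn_mono (ae_of_all _ fun z => ?_)) (hG t ht j)
    simp [picard, duhamel, volterra, power_zero]
  | succ n ih =>
    intro t ht j
    have hm := measurable_picard (S := S) hg
    have hτ : ∀ τ ∈ Ioo 0 t, τ ∈ Ioc 0 T := fun τ h => ⟨h.1, h.2.le.trans ht.2⟩
    refine le_trans (wn_mono (g := S.diffBound (S.picard g (n + 1)) (S.picard g n) t) ?_)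
      ((hT _ _ (G * 2⁻¹ ^ n) t (hm (n + 1)) (hm n) ht fun τ h i => ⟨hb _ τ (hτ τ h) _,
        hb _ τ (hτ τ h) _, ih τ (hτ τ h) _⟩) j |>.trans (le_of_eq ?_))
    · filter_upwards [ae_enorm_duhamel_sub_le (hm (n + 1)) (hm n) hR ht.1
        (fun τ h i => hb _ τ (hτ τ h) _) (fun τ h i => hb _ τ (hτ τ h) _)] with z hz
      simpa [picard] using hz
    · rw [pow_succ, ← mul_assoc, ENNReal.div_eq_inv_mul, mul_comm]

/-- Existence of solutions on contraction intervals. -/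
theorem IsContractionTime.exists_solution {G : ℝ≥0∞} (hGt : G ≠ ∞) {T : ℝ}
    (hT : S.IsContractionTime (2 * G) T) (hg : Measurable fun a : ℝ × Z => g a.1 a.2)
    (hG : ∀ t ∈ Ioc 0 T, ∀ j, S.wn j t (g t) ≤ G) :
    ∃ u : ℝ → Z → ℝ, (Measurable fun a : ℝ × Z => u a.1 a.2) ∧
      (∀ t ∈ Ioc 0 T, ∀ᵐ z, u t z = g t z + S.duhamel u t z) ∧
      (∀ t ∈ Ioc 0 T, ∀ j, S.wn j t (u t) ≤ 2 * G) ∧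
      ((∀ t z, 0 ≤ g t z) → (∀ i, 0 ≤ S.c i) → ∀ t z, 0 ≤ u t z) := by
  have hR : 2 * G ≠ ∞ := ENNReal.mul_ne_top (by simp) hGt
  set v := S.picard g with hv
  have hm : ∀ n, Measurable fun a : ℝ × Z => v n a.1 a.2 := measurable_picard hg
  have hb := hT.wn_picard_le hg hG
  set d : ℕ → ℝ × Z → ℝ≥0∞ := fun n a => ‖v (n + 1) a.1 a.2 - v n a.1 a.2‖ₑ with hd
  have hdm : ∀ n, Measurable (d n) := fun n => ((hm _).sub (hm n)).enorm
  set H : ℝ × Z → ℝ≥0∞ := fun a => ∑' n, d n a with hH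
  have hHm : Measurable H := Measurable.tsum hdm
  have hA : MeasurableSet {a | H a < ∞} := measurableSet_lt hHm measurable_const
  have hedist : ∀ (a : ℝ × Z) n, edist (v n a.1 a.2) (v n.succ a.1 a.2) ≤ d n a := fun a n => by
    rw [edist_comm, edist_eq_enorm_sub]
  -- The limit is taken pointwise where the increments are summable and is 0 elsewhere. As an
  -- everywhere limit of truncated iterates, u' is jointly measurable and inherits nonnegativity at
  -- every point.
  set u' : ℝ × Z → ℝ := {a | H a < ∞}.indicator fun a => limUnder atTop fun n => v n a.1 a.2 with hu'
  have hlim : ∀ a, H a < ∞ → Tendsto (fun n => v n a.1 a.2) atTop (𝓝 (u' a)) := fun a ha => by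
    rw [hu', indicator_of_mem (s := {a | H a < ∞}) ha]
    exact (cauchySeq_of_edist_le_of_tsum_ne_top _ (hedist a) ha.ne).tendsto_limUnder
  have hlim' : ∀ a, Tendsto (fun n => {a | H a < ∞}.indicator (fun a => v n a.1 a.2) a) atTop
      (𝓝 (u' a)) := fun a => by
    by_cases ha : H a < ∞
    · simpa only [indicator_of_mem (s := {a | H a < ∞}) ha] using hlim a ha
    · have h' : a ∉ {a | H a < ∞} := ha
      simp [hu', indicator_of_notMem h']
  have hu'm : Measurable u' :=
    measurable_of_tendsto_metrizable (fun n => (hm n).indicator hA) (tendsto_pi_nhds.2 hlim')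
  set u : ℝ → Z → ℝ := fun t z => u' (t, z) with hu
  have hum : Measurable fun a : ℝ × Z => u a.1 a.2 := hu'm
  -- The increments are bounded by a geometric series of ratio 1/2, so the tail from m on is at most
  -- 2G · 2^{-m}, for every t and not only almost every t.
  have htail : ∀ t ∈ Ioc 0 T, ∀ j m, S.wn j t (fun z => ∑' n, d (m + n) (t, z))
      ≤ 2 * G * 2⁻¹ ^ m := fun t ht j m => by
    calc _ ≤ ∑' n, S.wn j t (fun z => d (m + n) (t, z)) :=
          wn_tsum_le (fun n => (hdm _).comp measurable_prodMk_left) j t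
      _ ≤ ∑' n, G * 2⁻¹ ^ (m + n) := ENNReal.tsum_le_tsum fun n => by
          refine le_trans (wn_mono (ae_of_all _ fun z => ?_))
            (hT.wn_picard_sub_le hGt hg hG (m + n) t ht j)
          simp [hd, hv]
      _ = _ := by
          rw [ENNReal.tsum_mul_left]
          simp_rw [pow_add]
          rw [ENNReal.tsum_mul_left, ENNReal.tsum_geometric, ENNReal.one_sub_inv_two, inv_inv]
          ring
  have hfin : ∀ t ∈ Ioc 0 T, ∀ᵐ z, H (t, z) < ∞ := fun t ht => by
    refine ae_lt_top_of_wn (S := S) (j := 0) ht.1 (hHm.comp measurable_prodMk_left)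
      (ne_top_of_le_ne_top hR ?_)
    simpa using htail t ht 0 0
  have hsub : ∀ t ∈ Ioc 0 T, ∀ j m, S.wn j t (v m t - u t) ≤ 2 * G * 2⁻¹ ^ m := fun t ht j m => by
    refine le_trans (wn_mono ?_) (htail t ht j m)
    filter_upwards [hfin t ht] with z hz
    rw [Pi.sub_apply, ← edist_eq_enorm_sub, enorm_eq_self]
    exact edist_le_tsum_of_edist_le_of_tendsto _ (hedist (t, z)) (hlim _ hz) m
  have hbu : ∀ t ∈ Ioc 0 T, ∀ j, S.wn j t (u t) ≤ 2 * G := fun t ht j => by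
    have := hsub t ht j 0
    rw [pow_zero, mul_one] at this
    refine le_trans (wn_mono (ae_of_all _ fun z => ?_)) this
    simp [hv, picard]
  refine ⟨u, hum, fun t ht => ?_, hbu, fun hg0 hc t z => ?_⟩
  · have hdu : Measurable (S.duhamel u t) := (measurable_duhamel hum).comp measurable_prodMk_left
    have hut : Measurable (u t) := hu'm.comp (measurable_prodMk_left (x := t))
    have hgt : Measurable (g t) := hg.comp measurable_prodMk_left
    have hτ : ∀ τ ∈ Ioo 0 t, τ ∈ Ioc 0 T := fun τ h => ⟨h.1, h.2.le.trans ht.2⟩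
    -- The defect of u in the equation is compared with the m-th iterate: half of the tail bound
    -- comes from the (m+1)-st increment tail, the other half from the contraction.
    have hle : ∀ m, S.wn 0 t (fun z => u t z - (g t z + S.duhamel u t z)) ≤
        2 * G * 2⁻¹ ^ m := fun m => by
      have h1 := hT (v m) u (2 * G * 2⁻¹ ^ m) t (hm m) hum ht (fun τ h i =>
        ⟨hb m τ (hτ τ h) _, hbu τ (hτ τ h) _, hsub τ (hτ τ h) _ m⟩) 0
      have h2 := hsub t ht 0 (m + 1)
      have hvm : Measurable (v (m + 1) t) := (hm (m + 1)).comp measurable_prodMk_left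
      refine (wn_le_add (f := v (m + 1) t - u t) (hvm.sub hut).enorm.aemeasurable
        (measurable_diffBound (hm m) hum t).enorm.aemeasurable ?_).trans
        ((add_le_add h2 h1).trans (le_of_eq ?_))
      · filter_upwards [ae_enorm_duhamel_sub_le (hm m) hum hR ht.1
          (fun τ h i => hb _ τ (hτ τ h) _) (fun τ h i => hbu τ (hτ τ h) _)] with z hz
        have e : u t z - (g t z + S.duhamel u t z) = -(v (m + 1) t z - u t z) +
            (S.duhamel (v m) t z - S.duhamel u t z) := by
          simp only [hv, picard]; ring
        rw [e, Pi.sub_apply, enorm_eq_self]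
        have e2 : ‖-(v (m + 1) t z - u t z)‖ₑ ≤ ‖v (m + 1) t z - u t z‖ₑ := (enorm_neg _).le
        exact (enorm_add_le _ _).trans (add_le_add e2 hz)
      · rw [pow_succ, ENNReal.div_eq_inv_mul, ← mul_assoc, mul_comm 2⁻¹, ← mul_add,
          ENNReal.inv_two_add_inv_two, mul_one]
    have hlim0 : Tendsto (fun m : ℕ => 2 * G * 2⁻¹ ^ m) atTop (𝓝 0) := by
      have := ENNReal.Tendsto.const_mul (a := 2 * G)
        (ENNReal.tendsto_pow_atTop_nhds_zero_of_lt_one (r := 2⁻¹) (by simp)) (Or.inr hR)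
      rwa [mul_zero] at this
    have h0 := le_antisymm (ge_of_tendsto' hlim0 hle) zero_le
    filter_upwards [ae_eq_zero_of_wn ht.1 (hut.sub (hgt.add hdu)).aestronglyMeasurable h0] with z hz
    exact sub_eq_zero.1 hz
  · refine ge_of_tendsto' (hlim' (t, z)) fun n => ?_
    exact indicator_nonneg (fun a _ => picard_nonneg hg0 hc n _ _) _

end Scheme

end

end Grushin

namespace Grushin

noncomputable section

/-! ### The kernels of the integral equation -/

variable {N k : ℕ}

/-- The heat kernel as a function of two points. -/
def kerH (σ : ℝ) (z w : Space N k) : ℝ := heatKernel z.1 w.1 (z.2 - w.2) σ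

/-- The kernel `∫₀^σ s^{-γ} K(σ - s) ds` of the memory term, with values in `[0, ∞]`. -/
def lkerM (γ σ : ℝ) (z w : Space N k) : ℝ≥0∞ :=
  ∫⁻ s in Ioo 0 σ, ENNReal.ofReal (s ^ (-γ) * kerH (σ - s) z w)

/-- The kernel of the memory term. -/
def kerM (γ σ : ℝ) (z w : Space N k) : ℝ := (lkerM γ σ z w).toReal

theorem measurable_kerH : Measurable fun a : ℝ × Space N k × Space N k => kerH a.1 a.2.1 a.2.2 :=
  measurable_heatKernel.comp (f := fun a : ℝ × Space N k × Space N k =>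
    ((a.2.1.1, a.2.2.1), (a.2.1.2 - a.2.2.2, a.1))) (by fun_prop)

theorem measurable_kerH_right (σ : ℝ) (z : Space N k) : Measurable (kerH σ z) :=
  measurable_kerH.comp (f := fun w : Space N k => (σ, z, w)) (by fun_prop)

theorem measurable_kerH_left (σ : ℝ) (w : Space N k) : Measurable fun z => kerH σ z w :=
  measurable_kerH.comp (f := fun z : Space N k => (σ, z, w)) (by fun_prop)

theorem kerH_nonneg (hN : 1 ≤ N) (hk : 1 ≤ k) {σ : ℝ} (hσ : 0 < σ) (z w : Space N k) :
    0 ≤ kerH σ z w := heatKernel_nonneg hN hk _ _ _ hσ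

theorem lintegral_kerH (hN : 1 ≤ N) (hk : 1 ≤ k) {σ : ℝ} (hσ : 0 < σ) (z : Space N k) :
    ∫⁻ w, ENNReal.ofReal (kerH σ z w) = 1 := lintegral_heatKernel hN hk z hσ

theorem lintegral_kerH_left (hN : 1 ≤ N) (hk : 1 ≤ k) {σ : ℝ} (hσ : 0 < σ) (w : Space N k) :
    ∫⁻ z, ENNReal.ofReal (kerH σ z w) = 1 := lintegral_heatKernel_left hN hk w hσ

theorem kerH_le (hN : 1 ≤ N) {σ : ℝ} (hσ : 0 < σ) (z w : Space N k) :
    kerH σ z w ≤ kernelConst N k * σ ^ (-(((N : ℝ) + 2 * k) / 2)) :=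
  (le_abs_self _).trans (abs_heatKernel_le hN _ _ _ hσ)

theorem measurable_lkerM (γ : ℝ) :
    Measurable fun a : ℝ × Space N k × Space N k => lkerM γ a.1 a.2.1 a.2.2 := by
  have e : ∀ a : ℝ × Space N k × Space N k, lkerM γ a.1 a.2.1 a.2.2 = ∫⁻ s : ℝ,
      {c : (ℝ × Space N k × Space N k) × ℝ | 0 < c.2 ∧ c.2 < c.1.1}.indicator
      (fun c => ENNReal.ofReal (c.2 ^ (-γ) * kerH (c.1.1 - c.2) c.1.2.1 c.1.2.2)) (a, s) := fun a => by
    rw [lkerM, ← lintegral_indicator measurableSet_Ioo]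
    rfl
  simp_rw [e]
  refine Measurable.lintegral_prod_right' (Measurable.indicator ?_ ?_)
  · have h : Measurable fun c : (ℝ × Space N k × Space N k) × ℝ =>
        kerH (c.1.1 - c.2) c.1.2.1 c.1.2.2 :=
      measurable_kerH.comp (f := fun c : (ℝ × Space N k × Space N k) × ℝ =>
        (c.1.1 - c.2, c.1.2.1, c.1.2.2)) (by fun_prop)
    exact Measurable.ennreal_ofReal (by fun_prop)
  · exact (measurableSet_lt measurable_const measurable_snd).inter
      (measurableSet_lt measurable_snd (by fun_prop))

theorem measurable_kerM (γ : ℝ) :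
    Measurable fun a : ℝ × Space N k × Space N k => kerM γ a.1 a.2.1 a.2.2 :=
  (measurable_lkerM γ).ennreal_toReal

theorem kerM_nonneg (γ σ : ℝ) (z w : Space N k) : 0 ≤ kerM γ σ z w := ENNReal.toReal_nonneg

theorem lintegral_lkerM_mul (γ σ : ℝ) (z : Space N k) {φ : Space N k → ℝ≥0∞} (hφ : Measurable φ) :
    ∫⁻ w, lkerM γ σ z w * φ w = ∫⁻ s in Ioo 0 σ, ENNReal.ofReal (s ^ (-γ)) *
      ∫⁻ w, ENNReal.ofReal (kerH (σ - s) z w) * φ w := by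
  have hm : Measurable fun c : Space N k × ℝ => kerH (σ - c.2) z c.1 :=
    measurable_kerH.comp (f := fun c : Space N k × ℝ => (σ - c.2, z, c.1)) (by fun_prop)
  have hm2 : ∀ w : Space N k, Measurable fun s : ℝ => kerH (σ - s) z w := fun w =>
    measurable_kerH.comp (f := fun s : ℝ => (σ - s, z, w)) (by fun_prop)
  have hm3 : ∀ s : ℝ, Measurable (kerH (σ - s) z) := fun s => measurable_kerH_right _ _
  have e : ∀ w, lkerM γ σ z w * φ w =
      ∫⁻ s in Ioo 0 σ, ENNReal.ofReal (s ^ (-γ) * kerH (σ - s) z w) * φ w := fun w => by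
    have := hm2 w
    rw [lintegral_mul_const _ (by fun_prop), lkerM]
  simp_rw [e]
  rw [lintegral_lintegral_swap (by fun_prop)]
  refine setLIntegral_congr_fun measurableSet_Ioo fun s hs => ?_
  have := hm3 s
  simp_rw [ENNReal.ofReal_mul (Real.rpow_nonneg hs.1.le (-γ)), mul_assoc]
  rw [lintegral_const_mul _ (by fun_prop)]

/-- The kernel with values in [0, ∞] has finite integral in w, namely ∫₀^σ s^{-γ} ds, as the heat
kernel has mass one. The real kernel is therefore faithful almost everywhere. -/
theorem ae_ofReal_kerM (hN : 1 ≤ N) (hk : 1 ≤ k) {γ : ℝ} (hγ : γ < 1) {σ : ℝ} (hσ : 0 < σ)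
    (z : Space N k) : ∀ᵐ w, ENNReal.ofReal (kerM γ σ z w) = lkerM γ σ z w := by
  have hm : Measurable (lkerM γ σ z) :=
    (measurable_lkerM γ).comp (f := fun w : Space N k => (σ, z, w)) (by fun_prop)
  have h : ∫⁻ w, lkerM γ σ z w ≠ ∞ := by
    have h1 := lintegral_lkerM_mul γ σ z (φ := fun _ => 1) measurable_const
    have h2 := lintegral_beta (a := 0) (b := γ) one_pos hγ hσ
    have h3 : ∫⁻ s in Ioo 0 σ, ENNReal.ofReal (s ^ (-γ)) *
        ∫⁻ w, ENNReal.ofReal (kerH (σ - s) z w) * 1 =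
        ∫⁻ s in Ioo 0 σ, ENNReal.ofReal ((σ - s) ^ (-(0 : ℝ)) * s ^ (-γ)) :=
      setLIntegral_congr_fun measurableSet_Ioo fun s hs => by
        simp only [mul_one, neg_zero, Real.rpow_zero, one_mul]
        rw [lintegral_kerH hN hk (sub_pos.2 hs.2), mul_one]
    simp only [mul_one] at h1 h3
    rw [h1, h3, h2]
    exact ENNReal.ofReal_ne_top
  filter_upwards [ae_lt_top hm h] with w hw
  exact ENNReal.ofReal_toReal hw.ne

theorem opBound_mono {Z : Type*} [MeasureSpace Z] {κ : ℝ → Z → Z → ℝ} {a b C C' θ : ℝ}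
    (h : OpBound κ a b C θ) (hC : C ≤ C') : OpBound κ a b C' θ := fun σ hσ φ hφ =>
  (h σ hσ φ hφ).trans (by gcongr)

theorem opBound_kerH (hN : 1 ≤ N) (hk : 1 ≤ k) {a b : ℝ} (ha : 1 ≤ a) (hab : a ≤ b) :
    OpBound (kerH (N := N) (k := k)) a b (kernelConst N k ^ (1 / a - 1 / b))
      (((N : ℝ) + 2 * k) / 2 * (1 / a - 1 / b)) := fun σ hσ φ hφ => by
  have hM := kernelConst_nonneg (N := N) (k := k)
  have hab' : 0 ≤ 1 / a - 1 / b := sub_nonneg.2 (one_div_le_one_div_of_le (by linarith) hab)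
  have hm : Measurable fun c : Space N k × Space N k => kerH σ c.1 c.2 :=
    measurable_kerH.comp (f := fun c : Space N k × Space N k => (σ, c.1, c.2)) (by fun_prop)
  refine (eLpNorm_kernel_le (κ := fun z w => ENNReal.ofReal (kerH σ z w)) hm.ennreal_ofReal
    (fun z => (lintegral_kerH hN hk hσ z).le) (fun w => (lintegral_kerH_left hN hk hσ w).le)
    (fun z w => ENNReal.ofReal_le_ofReal (kerH_le hN hσ z w)) ha hab hφ).trans (le_of_eq ?_)
  rw [ENNReal.ofReal_rpow_of_nonneg (by positivity) hab', Real.mul_rpow hM (by positivity),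
    ← Real.rpow_mul hσ.le, neg_mul]

/-- By Minkowski the operator norm is at most the Beta integral of (σ-s)^{-θ} s^{-γ}, which scales
like σ^{1-θ-γ}. -/
theorem opBound_kerM (hN : 1 ≤ N) (hk : 1 ≤ k) {γ : ℝ} (hγ : γ < 1) {a b : ℝ} (ha : 1 ≤ a)
    (hab : a ≤ b) (hθ : ((N : ℝ) + 2 * k) / 2 * (1 / a - 1 / b) < 1) :
    OpBound (kerM (N := N) (k := k) γ) a b (kernelConst N k ^ (1 / a - 1 / b) *
      betaConst (((N : ℝ) + 2 * k) / 2 * (1 / a - 1 / b)) γ)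
      (((N : ℝ) + 2 * k) / 2 * (1 / a - 1 / b) + (γ - 1)) := fun σ hσ φ hφ => by
  set θ := ((N : ℝ) + 2 * k) / 2 * (1 / a - 1 / b) with hθd
  have hM := Real.rpow_nonneg (kernelConst_nonneg (N := N) (k := k)) (1 / a - 1 / b)
  have hm : Measurable fun c : (ℝ × Space N k) × Space N k => kerH (σ - c.1.1) c.1.2 c.2 :=
    measurable_kerH.comp (f := fun c : (ℝ × Space N k) × Space N k =>
      (σ - c.1.1, c.1.2, c.2)) (by fun_prop)
  have hm2 : Measurable fun c : ℝ × Space N k => ENNReal.ofReal (c.1 ^ (-γ)) *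
      ∫⁻ w, ENNReal.ofReal (kerH (σ - c.1) c.2 w) * φ w := by
    refine Measurable.mul (by fun_prop) (Measurable.lintegral_prod_right'
      (f := fun c : (ℝ × Space N k) × Space N k =>
        ENNReal.ofReal (kerH (σ - c.1.1) c.1.2 c.2) * φ c.2) ?_)
    exact hm.ennreal_ofReal.mul (by fun_prop)
  calc eLpNorm (fun z => ∫⁻ w, ENNReal.ofReal (kerM γ σ z w) * φ w) (ENNReal.ofReal b) volume
      ≤ eLpNorm (fun z => ∫⁻ s in Ioo 0 σ, ENNReal.ofReal (s ^ (-γ)) *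
        ∫⁻ w, ENNReal.ofReal (kerH (σ - s) z w) * φ w) (ENNReal.ofReal b) volume := by
        refine eLpNorm_mono_enorm fun z => ?_
        rw [enorm_eq_self, enorm_eq_self, ← lintegral_lkerM_mul γ σ z hφ]
        exact lintegral_mono fun w => mul_le_mul_left ENNReal.ofReal_toReal_le _
    _ ≤ ∫⁻ s in Ioo 0 σ, eLpNorm (fun z => ENNReal.ofReal (s ^ (-γ)) *
        ∫⁻ w, ENNReal.ofReal (kerH (σ - s) z w) * φ w) (ENNReal.ofReal b) volume :=
        eLpNorm_lintegral_le hm2 (ha.trans hab)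
    _ ≤ ∫⁻ s in Ioo 0 σ, ENNReal.ofReal (kernelConst N k ^ (1 / a - 1 / b)) *
        eLpNorm φ (ENNReal.ofReal a) volume *
          ENNReal.ofReal ((σ - s) ^ (-θ) * s ^ (-γ)) := by
        refine setLIntegral_mono_ae' measurableSet_Ioo (ae_of_all _ fun s hs => ?_)
        have hs' : 0 < σ - s := sub_pos.2 hs.2
        have hs0 := hs.1
        have h := opBound_kerH hN hk ha hab (σ - s) hs' φ hφ
        have hb0 : 0 < b := by linarith
        have hm3 : Measurable fun z => ∫⁻ w, ENNReal.ofReal (kerH (σ - s) z w) * φ w :=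
          Measurable.lintegral_prod_right' (f := fun c : Space N k × Space N k =>
            ENNReal.ofReal (kerH (σ - s) c.1 c.2) * φ c.2)
            ((measurable_kerH.comp (f := fun c : Space N k × Space N k =>
              (σ - s, c.1, c.2)) (by fun_prop)).ennreal_ofReal.mul (by fun_prop))
        have e : eLpNorm (fun z => ENNReal.ofReal (s ^ (-γ)) *
            ∫⁻ w, ENNReal.ofReal (kerH (σ - s) z w) * φ w) (ENNReal.ofReal b) volume =
            ENNReal.ofReal (s ^ (-γ)) * eLpNorm (fun z =>
            ∫⁻ w, ENNReal.ofReal (kerH (σ - s) z w) * φ w) (ENNReal.ofReal b) volume := by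
          rw [eLpNorm_ofReal_eq hb0, eLpNorm_ofReal_eq hb0]
          simp only [enorm_eq_self, ENNReal.mul_rpow_of_nonneg _ _ hb0.le]
          rw [lintegral_const_mul _ (by fun_prop), ENNReal.mul_rpow_of_nonneg _ _ (by positivity),
            ← ENNReal.rpow_mul, mul_one_div_cancel hb0.ne', ENNReal.rpow_one]
        rw [e]
        refine (mul_le_mul_right h _).trans (le_of_eq ?_)
        rw [ENNReal.ofReal_mul hM, ENNReal.ofReal_mul (by positivity)]
        ring
    _ = _ := by
        rw [lintegral_const_mul _ (by fun_prop), lintegral_beta hθ hγ hσ,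
          mul_right_comm, ← ENNReal.ofReal_mul hM, ← mul_assoc]
        congr 4
        ring

/-- The integral equation of the problem in the norms `t^{A j} ‖·‖_{L^{R j}}`. -/
def heatScheme (hN : 1 ≤ N) (hk : 1 ≤ k) {γ : ℝ} (hγ : γ < 1) (c p s : Fin 2 → ℝ) (R A : Fin 3 → ℝ)
    (hp : ∀ i, 1 < p i) (hs : ∀ i, 1 ≤ s i) (hsR : ∀ i j, s i ≤ R j)
    (hR : ∀ i : Fin 2, R i.succ = p i * s i) (hA : ∀ i : Fin 2, p i * A i.succ < 1)
    (hθ : ∀ i j, ((N : ℝ) + 2 * k) / 2 * (1 / s i - 1 / R j) < 1)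
    (hexp : ∀ i j, 0 < A j + 1 - ((N : ℝ) + 2 * k) / 2 * (1 / s i - 1 / R j) - p i * A i.succ) :
    Scheme (Space N k) where
  p := p
  s := s
  c := c
  ker := ![kerM γ, kerH]
  R := R
  A := A
  θ i j := ((N : ℝ) + 2 * k) / 2 * (1 / s i - 1 / R j) + ![γ - 1, 0] i
  -- One constant for both kernels and all pairs of exponents: in the factor 1 + Beta, the 1 serves
  -- the heat kernel and the Beta value the memory kernel.
  C := ∑ i, ∑ j, kernelConst N k ^ (1 / s i - 1 / R j) *
    (1 + betaConst (((N : ℝ) + 2 * k) / 2 * (1 / s i - 1 / R j)) γ)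
  one_lt_p := hp
  one_le_s := hs
  one_le_R j := (hs 0).trans (hsR 0 j)
  R_succ := hR
  C_nonneg := Finset.sum_nonneg fun i _ => Finset.sum_nonneg fun j _ =>
    mul_nonneg (Real.rpow_nonneg (kernelConst_nonneg) _)
      (add_nonneg zero_le_one (betaConst_nonneg _ _))
  beta_lt := hA
  theta_lt i j := by
    have := hθ i j
    fin_cases i <;> simp at this ⊢ <;> linarith
  exponent_pos i j := by
    have := hexp i j
    fin_cases i <;> simp at this ⊢ <;> linarith
  measurable_ker i := by
    fin_cases i
    · exact measurable_kerM γ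
    · exact measurable_kerH
  ker_nonneg i σ hσ z w := by
    fin_cases i
    · exact kerM_nonneg γ σ z w
    · exact kerH_nonneg hN hk hσ z w
  opBound i j := by
    have h0 : ∀ i j, 0 ≤ kernelConst N k ^ (1 / s i - 1 / R j) :=
      fun i j => Real.rpow_nonneg (kernelConst_nonneg) _
    have hB := fun i j => betaConst_nonneg (((N : ℝ) + 2 * k) / 2 * (1 / s i - 1 / R j)) γ
    have hle : kernelConst N k ^ (1 / s i - 1 / R j) *
        (1 + betaConst (((N : ℝ) + 2 * k) / 2 * (1 / s i - 1 / R j)) γ) ≤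
        ∑ i, ∑ j, kernelConst N k ^ (1 / s i - 1 / R j) *
          (1 + betaConst (((N : ℝ) + 2 * k) / 2 * (1 / s i - 1 / R j)) γ) := by
      refine (Finset.single_le_sum (f := fun j => kernelConst N k ^ (1 / s i - 1 / R j) *
        (1 + betaConst (((N : ℝ) + 2 * k) / 2 * (1 / s i - 1 / R j)) γ))
        (fun j _ => mul_nonneg (h0 i j) (by linarith [hB i j])) (Finset.mem_univ j)).trans ?_
      exact Finset.single_le_sum (f := fun i => ∑ j, kernelConst N k ^ (1 / s i - 1 / R j) *
        (1 + betaConst (((N : ℝ) + 2 * k) / 2 * (1 / s i - 1 / R j)) γ))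
        (fun i _ => Finset.sum_nonneg fun j _ => mul_nonneg (h0 i j) (by linarith [hB i j]))
        (Finset.mem_univ i)
    have hmem : ∀ i j, kernelConst N k ^ (1 / s i - 1 / R j) * betaConst (((N : ℝ) + 2 * k) / 2 *
        (1 / s i - 1 / R j)) γ ≤ kernelConst N k ^ (1 / s i - 1 / R j) *
        (1 + betaConst (((N : ℝ) + 2 * k) / 2 * (1 / s i - 1 / R j)) γ) := fun i j =>
      mul_le_mul_of_nonneg_left (by linarith) (h0 i j)
    have hloc : ∀ i j, kernelConst N k ^ (1 / s i - 1 / R j) ≤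
        kernelConst N k ^ (1 / s i - 1 / R j) *
        (1 + betaConst (((N : ℝ) + 2 * k) / 2 * (1 / s i - 1 / R j)) γ) := fun i j =>
      le_mul_of_one_le_right (h0 i j) (by linarith [hB i j])
    fin_cases i
    · exact opBound_mono (opBound_kerM hN hk hγ (hs 0) (hsR 0 j) (hθ 0 j)) ((hmem 0 j).trans hle)
    · have h := opBound_mono (opBound_kerH hN hk (hs 1) (hsR 1 j)) ((hloc 1 j).trans hle)
      simpa using h

end

end Grushin

namespace Grushin

noncomputable section

variable {N k : ℕ}

/-! ### The integral equation in terms of Volterra operators -/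

/-- The reordering of the variables `((s, τ), w)` as `((τ, w), s)`. -/
theorem measurePreserving_reorder :
    MeasurePreserving (fun a : (ℝ × ℝ) × Space N k => ((a.1.2, a.2), a.1.1)) :=
  (Measure.measurePreserving_swap (μ := (volume : Measure ℝ))
    (ν := (volume : Measure (ℝ × Space N k)))).comp
    (measurePreserving_prodAssoc (volume : Measure ℝ) (volume : Measure ℝ)
      (volume : Measure (Space N k)))

/-- The integrand of the memory term. -/
def memoryIntegrand (γ t : ℝ) (z : Space N k) (f : ℝ → Space N k → ℝ)
    (b : (ℝ × Space N k) × ℝ) : ℝ :=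
  {b : (ℝ × Space N k) × ℝ | 0 < b.1.1 ∧ b.1.1 < b.2 ∧ b.2 < t}.indicator
    (fun b => kerH (t - b.2) z b.1.2 * ((b.2 - b.1.1) ^ (-γ) * f b.1.1 b.1.2)) b

theorem measurableSet_memory (t : ℝ) :
    MeasurableSet {b : (ℝ × Space N k) × ℝ | 0 < b.1.1 ∧ b.1.1 < b.2 ∧ b.2 < t} := by
  have h1 : MeasurableSet {b : (ℝ × Space N k) × ℝ | 0 < b.1.1} :=
    measurableSet_lt (by fun_prop) (by fun_prop)
  have h2 : MeasurableSet {b : (ℝ × Space N k) × ℝ | b.1.1 < b.2} :=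
    measurableSet_lt (by fun_prop) (by fun_prop)
  have h3 : MeasurableSet {b : (ℝ × Space N k) × ℝ | b.2 < t} :=
    measurableSet_lt (by fun_prop) (by fun_prop)
  exact h1.inter (h2.inter h3)

variable {f : ℝ → Space N k → ℝ}

theorem measurable_memoryIntegrand (γ t : ℝ) (z : Space N k)
    (hf : Measurable fun a : ℝ × Space N k => f a.1 a.2) :
    Measurable (memoryIntegrand γ t z f) := by
  refine Measurable.indicator ?_ (measurableSet_memory t)
  have h1 : Measurable fun b : (ℝ × Space N k) × ℝ => kerH (t - b.2) z b.1.2 :=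
    measurable_kerH.comp (f := fun b : (ℝ × Space N k) × ℝ => (t - b.2, z, b.1.2)) (by fun_prop)
  have h2 : Measurable fun b : (ℝ × Space N k) × ℝ => f b.1.1 b.1.2 :=
    hf.comp (f := fun b : (ℝ × Space N k) × ℝ => b.1) (by fun_prop)
  fun_prop

theorem memoryIntegrand_of_notMem {γ t : ℝ} {z : Space N k} {τ : ℝ} (hτ : τ ∉ Ioo 0 t)
    (w : Space N k) (s : ℝ) : memoryIntegrand γ t z f ((τ, w), s) = 0 :=
  indicator_of_notMem (s := {b : (ℝ × Space N k) × ℝ | 0 < b.1.1 ∧ b.1.1 < b.2 ∧ b.2 < t})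
    (fun h => hτ ⟨h.1, h.2.1.trans h.2.2⟩) _

/-- The intermediate time is measured from τ. In this variable the integrand is the one defining the
memory kernel at time t - τ. -/
theorem memoryIntegrand_add {γ t : ℝ} {z : Space N k} {τ : ℝ} (hτ : τ ∈ Ioo 0 t)
    (w : Space N k) (s : ℝ) : memoryIntegrand γ t z f ((τ, w), s + τ) =
      (Ioo 0 (t - τ)).indicator (fun r => r ^ (-γ) * kerH (t - τ - r) z w) s * f τ w := by
  by_cases h : s ∈ Ioo 0 (t - τ)
  · have h' : ((τ, w), s + τ) ∈
        {b : (ℝ × Space N k) × ℝ | 0 < b.1.1 ∧ b.1.1 < b.2 ∧ b.2 < t} :=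
      ⟨hτ.1, lt_add_of_pos_left _ h.1, lt_sub_iff_add_lt.1 h.2⟩
    rw [memoryIntegrand, indicator_of_mem h', indicator_of_mem h]
    simp only [add_sub_cancel_right]
    rw [show t - (s + τ) = t - τ - s by ring]
    ring
  · have h' : ((τ, w), s + τ) ∉
        {b : (ℝ × Space N k) × ℝ | 0 < b.1.1 ∧ b.1.1 < b.2 ∧ b.2 < t} :=
      fun h' => h ⟨pos_of_lt_add_left h'.2.1, lt_sub_iff_add_lt.2 h'.2.2⟩
    rw [memoryIntegrand, indicator_of_notMem h', indicator_of_notMem h, zero_mul]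

theorem measurable_kerM_section (γ σ : ℝ) (z w : Space N k) :
    Measurable fun r : ℝ => r ^ (-γ) * kerH (σ - r) z w := by
  have h : Measurable fun r : ℝ => kerH (σ - r) z w :=
    measurable_kerH.comp (f := fun r : ℝ => (σ - r, z, w)) (by fun_prop)
  fun_prop

theorem kerM_section_nonneg (hN : 1 ≤ N) (hk : 1 ≤ k) (γ σ : ℝ) (z w : Space N k) (r : ℝ) :
    0 ≤ (Ioo 0 σ).indicator (fun r => r ^ (-γ) * kerH (σ - r) z w) r :=
  indicator_nonneg (fun _ hr => mul_nonneg (Real.rpow_nonneg hr.1.le _)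
    (kerH_nonneg hN hk (sub_pos.2 hr.2) _ _)) r

theorem lkerM_eq (γ σ : ℝ) (z w : Space N k) :
    lkerM γ σ z w = ∫⁻ r, ENNReal.ofReal
      ((Ioo 0 σ).indicator (fun r => r ^ (-γ) * kerH (σ - r) z w) r) := by
  rw [lkerM, ← lintegral_indicator measurableSet_Ioo]
  congr 1
  funext r
  by_cases h : r ∈ Ioo 0 σ
  · rw [indicator_of_mem h, indicator_of_mem h]
  · rw [indicator_of_notMem h, indicator_of_notMem h, ENNReal.ofReal_zero]

theorem integral_memoryIntegrand (hN : 1 ≤ N) (hk : 1 ≤ k) (γ t : ℝ) (z : Space N k) {τ : ℝ}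
    (hτ : τ ∈ Ioo 0 t) (w : Space N k) :
    ∫ s, memoryIntegrand γ t z f ((τ, w), s) = kerM γ (t - τ) z w * f τ w := by
  rw [← integral_add_right_eq_self _ τ]
  simp_rw [memoryIntegrand_add hτ]
  rw [integral_mul_const, integral_eq_lintegral_of_nonneg_ae
    (ae_of_all _ (kerM_section_nonneg hN hk γ (t - τ) z w))
    ((measurable_kerM_section γ (t - τ) z w).indicator measurableSet_Ioo).aestronglyMeasurable,
    kerM, lkerM_eq]

theorem lintegral_memoryIntegrand (hN : 1 ≤ N) (hk : 1 ≤ k) (γ t : ℝ) (z : Space N k) {τ : ℝ}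
    (hτ : τ ∈ Ioo 0 t) (w : Space N k) :
    ∫⁻ s, ‖memoryIntegrand γ t z f ((τ, w), s)‖ₑ = lkerM γ (t - τ) z w * ‖f τ w‖ₑ := by
  rw [← lintegral_add_right_eq_self _ τ]
  simp_rw [memoryIntegrand_add hτ, enorm_mul]
  rw [lintegral_mul_const _
    ((measurable_kerM_section γ (t - τ) z w).indicator measurableSet_Ioo).enorm, lkerM_eq]
  simp_rw [Real.enorm_of_nonneg (kerM_section_nonneg hN hk γ (t - τ) z w _)]

/-- Tonelli gives an equality in [0, ∞], so absolute convergence of the memory integral is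
equivalent to finiteness of a Volterra integral. -/
theorem lintegral_enorm_memoryIntegrand (hN : 1 ≤ N) (hk : 1 ≤ k) {γ : ℝ} (hγ : γ < 1) (t : ℝ)
    (z : Space N k) (hf : Measurable fun a : ℝ × Space N k => f a.1 a.2) :
    ∫⁻ b, ‖memoryIntegrand γ t z f b‖ₑ =
      lvolterra (kerM γ) (fun τ w => ‖f τ w‖ₑ) t z := by
  have hm := (measurable_memoryIntegrand γ t z hf).enorm
  rw [Measure.volume_eq_prod, lintegral_prod _ hm.aemeasurable, Measure.volume_eq_prod,
    lintegral_prod _ (Measurable.lintegral_prod_right' hm).aemeasurable, lvolterra,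
    ← lintegral_indicator measurableSet_Ioo]
  refine lintegral_congr fun τ => ?_
  by_cases hτ : τ ∈ Ioo 0 t
  · rw [indicator_of_mem hτ]
    refine lintegral_congr_ae ?_
    filter_upwards [ae_ofReal_kerM hN hk hγ (sub_pos.2 hτ.2) z] with w hw
    rw [hw, lintegral_memoryIntegrand hN hk γ t z hτ]
  · rw [indicator_of_notMem hτ]
    simp [memoryIntegrand_of_notMem hτ]

theorem integrableOn_memory_iff (hN : 1 ≤ N) (hk : 1 ≤ k) {γ : ℝ} (hγ : γ < 1) (t : ℝ)
    (z : Space N k) (hf : Measurable fun a : ℝ × Space N k => f a.1 a.2) :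
    IntegrableOn (fun a : (ℝ × ℝ) × Space N k => heatKernel z.1 a.2.1 (z.2 - a.2.2) (t - a.1.1) *
      ((a.1.1 - a.1.2) ^ (-γ) * f a.1.2 a.2))
      {a | 0 < a.1.2 ∧ a.1.2 < a.1.1 ∧ a.1.1 < t} volume ↔
    lvolterra (kerM γ) (fun τ w => ‖f τ w‖ₑ) t z ≠ ∞ := by
  have hm := measurable_memoryIntegrand γ t z hf
  have hE : MeasurableSet {a : (ℝ × ℝ) × Space N k | 0 < a.1.2 ∧ a.1.2 < a.1.1 ∧ a.1.1 < t} :=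
    measurePreserving_reorder.measurable (measurableSet_memory t)
  rw [← integrable_indicator_iff hE, ← lintegral_enorm_memoryIntegrand hN hk hγ t z hf,
    ← lt_top_iff_ne_top]
  have e : {a : (ℝ × ℝ) × Space N k | 0 < a.1.2 ∧ a.1.2 < a.1.1 ∧ a.1.1 < t}.indicator
      (fun a : (ℝ × ℝ) × Space N k => heatKernel z.1 a.2.1 (z.2 - a.2.2) (t - a.1.1) *
      ((a.1.1 - a.1.2) ^ (-γ) * f a.1.2 a.2)) =
      memoryIntegrand γ t z f ∘ fun a : (ℝ × ℝ) × Space N k => ((a.1.2, a.2), a.1.1) := rfl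
  rw [e, measurePreserving_reorder.integrable_comp hm.aestronglyMeasurable]
  exact ⟨fun h => h.2, fun h => ⟨hm.aestronglyMeasurable, h⟩⟩

theorem volterra_eq_integral {κ : ℝ → Space N k → Space N k → ℝ} (t : ℝ) (z : Space N k) :
    volterra κ f t z = ∫ a : ℝ × Space N k, (Ioo 0 t ×ˢ univ).indicator
      (fun a => κ (t - a.1) z a.2 * f a.1 a.2) a := by
  rw [volterra, ← Measure.restrict_univ (μ := (volume : Measure (Space N k))),
    Measure.prod_restrict, ← Measure.volume_eq_prod,
    integral_indicator (measurableSet_Ioo.prod MeasurableSet.univ)]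

theorem integral_eq_setIntegral_Ioo (F : ℝ → ℝ) {t : ℝ} (ht : 0 ≤ t) :
    ∫ s in (0 : ℝ)..t, F s = ∫ s in Ioo 0 t, F s := by
  rw [intervalIntegral.integral_of_le ht, integral_Ioc_eq_integral_Ioo]

theorem semigroup_of_pos {t : ℝ} (ht : 0 < t) (φ : Space N k → ℝ) (z : Space N k) :
    semigroup t φ z = ∫ w, kerH t z w * φ w := by
  rw [semigroup, if_neg ht.ne']
  rfl

/-- The same triple integral evaluated in two orders: s innermost gives the Volterra operator, s
outermost gives the iterated integral of the mild formulation. -/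
theorem integral_semigroup_memory (hN : 1 ≤ N) (hk : 1 ≤ k) {γ : ℝ} (hγ : γ < 1) {t : ℝ}
    (ht : 0 ≤ t) (z : Space N k) (hf : Measurable fun a : ℝ × Space N k => f a.1 a.2)
    (hfin : lvolterra (kerM γ) (fun τ w => ‖f τ w‖ₑ) t z ≠ ∞) :
    ∫ s in (0 : ℝ)..t, semigroup (t - s) (fun w => ∫ τ in (0 : ℝ)..s, (s - τ) ^ (-γ) * f τ w) z =
      volterra (kerM γ) f t z := by
  have hm := measurable_memoryIntegrand γ t z hf
  have hi : Integrable (memoryIntegrand γ t z f) := ⟨hm.aestronglyMeasurable, by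
    rw [HasFiniteIntegral, lintegral_enorm_memoryIntegrand hN hk hγ t z hf]
    exact lt_top_iff_ne_top.2 hfin⟩
  have h1 : ∫ b, memoryIntegrand γ t z f b = volterra (kerM γ) f t z := by
    rw [volterra_eq_integral, Measure.volume_eq_prod, integral_prod _ hi]
    congr 1
    funext a
    by_cases ha : a.1 ∈ Ioo 0 t
    · have ha' : a ∈ Ioo 0 t ×ˢ (univ : Set (Space N k)) := ⟨ha, mem_univ _⟩
      rw [indicator_of_mem ha']
      exact integral_memoryIntegrand hN hk γ t z ha a.2
    · have ha' : a ∉ Ioo 0 t ×ˢ (univ : Set (Space N k)) := fun h => ha h.1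
      rw [indicator_of_notMem ha']
      have : ∀ s, memoryIntegrand γ t z f (a, s) = 0 := memoryIntegrand_of_notMem ha a.2
      simp [this]
  rw [← h1, Measure.volume_eq_prod, integral_prod_symm _ hi, integral_eq_setIntegral_Ioo _ ht,
    ← integral_indicator measurableSet_Ioo]
  refine integral_congr_ae ?_
  filter_upwards [hi.prod_left_ae] with s hs
  by_cases h : s ∈ Ioo 0 t
  · rw [indicator_of_mem h, Measure.volume_eq_prod, integral_prod_symm _ hs,
      semigroup_of_pos (sub_pos.2 h.2)]
    congr 1
    funext w
    rw [integral_eq_setIntegral_Ioo _ h.1.le, ← integral_indicator measurableSet_Ioo,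
      ← integral_const_mul]
    congr 1
    funext τ
    by_cases hτ : τ ∈ Ioo 0 s
    · have h' : ((τ, w), s) ∈ {b : (ℝ × Space N k) × ℝ | 0 < b.1.1 ∧ b.1.1 < b.2 ∧ b.2 < t} :=
        ⟨hτ.1, hτ.2, h.2⟩
      rw [indicator_of_mem hτ, memoryIntegrand, indicator_of_mem h']
    · have h' : ((τ, w), s) ∉ {b : (ℝ × Space N k) × ℝ | 0 < b.1.1 ∧ b.1.1 < b.2 ∧ b.2 < t} :=
        fun h' => hτ ⟨h'.1, h'.2.1⟩
      rw [indicator_of_notMem hτ, memoryIntegrand, indicator_of_notMem h', mul_zero]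
  · rw [indicator_of_notMem h]
    symm
    refine integral_eq_zero_of_ae (ae_of_all _ fun a => ?_)
    exact indicator_of_notMem
      (s := {b : (ℝ × Space N k) × ℝ | 0 < b.1.1 ∧ b.1.1 < b.2 ∧ b.2 < t})
      (fun h' => h ⟨h'.1.trans h'.2.1, h'.2.2⟩) _

theorem restrict_prod_eq (t : ℝ) :
    (volume : Measure (ℝ × Space N k)).restrict {a | 0 < a.1 ∧ a.1 < t} =
      (volume.restrict (Ioo 0 t)).prod volume := by
  rw [← Measure.restrict_univ (μ := (volume : Measure (Space N k))), Measure.prod_restrict,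
    ← Measure.volume_eq_prod]
  congr 1
  ext a
  simp

theorem integrableOn_local_iff (hN : 1 ≤ N) (hk : 1 ≤ k) (t : ℝ)
    (z : Space N k) (hf : Measurable fun a : ℝ × Space N k => f a.1 a.2) :
    IntegrableOn (fun a : ℝ × Space N k =>
      heatKernel z.1 a.2.1 (z.2 - a.2.2) (t - a.1) * f a.1 a.2) {a | 0 < a.1 ∧ a.1 < t} volume ↔
    lvolterra kerH (fun τ w => ‖f τ w‖ₑ) t z ≠ ∞ := by
  rw [IntegrableOn, restrict_prod_eq]
  refine ⟨fun h => ?_, fun h => integrable_volterra measurable_kerH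
    (fun σ hσ => kerH_nonneg hN hk hσ) hf h⟩
  rw [← lintegral_enorm_eq_lvolterra measurable_kerH (fun σ hσ => kerH_nonneg hN hk hσ) hf]
  exact h.2.ne

theorem integral_semigroup_local (hN : 1 ≤ N) (hk : 1 ≤ k) {t : ℝ}
    (ht : 0 ≤ t) (z : Space N k) (hf : Measurable fun a : ℝ × Space N k => f a.1 a.2)
    (hfin : lvolterra kerH (fun τ w => ‖f τ w‖ₑ) t z ≠ ∞) :
    ∫ s in (0 : ℝ)..t, semigroup (t - s) (f s) z = volterra kerH f t z := by
  rw [volterra, integral_prod _ (integrable_volterra measurable_kerH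
    (fun σ hσ => kerH_nonneg hN hk hσ) hf hfin), integral_eq_setIntegral_Ioo _ ht]
  exact setIntegral_congr_fun measurableSet_Ioo fun s hs => semigroup_of_pos (sub_pos.2 hs.2) _ _

theorem measurable_semigroup {φ : Space N k → ℝ} (hφ : Measurable φ) :
    Measurable fun a : ℝ × Space N k => semigroup a.1 φ a.2 := by
  refine Measurable.ite (measurable_fst (measurableSet_singleton 0)) (by fun_prop) ?_
  refine (StronglyMeasurable.integral_prod_right' (f := fun c : (ℝ × Space N k) × Space N k =>
    kerH c.1.1 c.1.2 c.2 * φ c.2) (Measurable.stronglyMeasurable ?_)).measurable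
  exact (measurable_kerH.comp (f := fun c : (ℝ × Space N k) × Space N k =>
    (c.1.1, c.1.2, c.2)) (by fun_prop)).mul (by fun_prop)

/-- The sum of the two Duhamel integrals, as Volterra operators. -/
def duhamelTerm (γ κ₁ κ₂ p₁ p₂ : ℝ) (u : ℝ → Space N k → ℝ) (t : ℝ) (z : Space N k) : ℝ :=
  κ₁ * volterra (kerM γ) (fun τ w => power p₁ (u τ w)) t z +
    κ₂ * volterra kerH (fun τ w => power p₂ (u τ w)) t z

theorem measurable_power_uncurry {u : ℝ → Space N k → ℝ}
    (hu : Measurable fun a : ℝ × Space N k => u a.1 a.2) (p : ℝ) :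
    Measurable fun a : ℝ × Space N k => (fun τ w => power p (u τ w)) a.1 a.2 :=
  (measurable_power p).comp hu

theorem measurable_duhamelTerm {u : ℝ → Space N k → ℝ}
    (hu : Measurable fun a : ℝ × Space N k => u a.1 a.2) (γ κ₁ κ₂ p₁ p₂ : ℝ) :
    Measurable fun a : ℝ × Space N k => duhamelTerm γ κ₁ κ₂ p₁ p₂ u a.1 a.2 :=
  ((measurable_volterra (measurable_kerM γ) (measurable_power_uncurry hu p₁)).const_mul κ₁).add
    ((measurable_volterra measurable_kerH (measurable_power_uncurry hu p₂)).const_mul κ₂)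

theorem isMildSolution_of_volterra (hN : 1 ≤ N) (hk : 1 ≤ k) {γ κ₁ κ₂ p₁ p₂ q T : ℝ} (hγ : γ < 1)
    {u₀ : Space N k → ℝ} {u : ℝ → Space N k → ℝ}
    (hu : Measurable fun a : ℝ × Space N k => u a.1 a.2) (hu0 : u 0 =ᵐ[volume] u₀)
    {M : ℝ≥0∞} (hM : M ≠ ∞) (hb : ∀ t ∈ Icc 0 T, eLpNorm (u t) (ENNReal.ofReal q) volume ≤ M)
    (h1 : ∀ t ∈ Ioc 0 T, ∀ᵐ z, lvolterra (kerM γ) (fun τ w => ‖power p₁ (u τ w)‖ₑ) t z < ∞)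
    (h2 : ∀ t ∈ Ioc 0 T, ∀ᵐ z, lvolterra kerH (fun τ w => ‖power p₂ (u τ w)‖ₑ) t z < ∞)
    (heq : ∀ t ∈ Ioc 0 T, ∀ᵐ z, u t z = semigroup t u₀ z + duhamelTerm γ κ₁ κ₂ p₁ p₂ u t z) :
    IsMildSolution γ κ₁ κ₂ p₁ p₂ q T u₀ u where
  aestronglyMeasurable := hu.aestronglyMeasurable
  memLp t ht := ⟨(hu.comp (measurable_prodMk_left (x := t))).aestronglyMeasurable,
    (hb t ht).trans_lt (lt_top_iff_ne_top.2 hM)⟩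
  bounded := (iSup₂_le hb).trans_lt (lt_top_iff_ne_top.2 hM)
  integrable_memory t ht := by
    rcases ht.1.eq_or_lt with rfl | h0
    · exact ae_of_all _ fun z =>
        (integrableOn_memory_iff (f := fun τ w => power p₁ (u τ w)) hN hk hγ 0 z (measurable_power_uncurry hu p₁)).2
          (by simp [lvolterra])
    · filter_upwards [h1 t ⟨h0, ht.2⟩] with z hz
      exact (integrableOn_memory_iff hN hk hγ t z (measurable_power_uncurry hu p₁)).2 hz.ne
  integrable_local t ht := by
    rcases ht.1.eq_or_lt with rfl | h0
    · exact ae_of_all _ fun z =>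
        (integrableOn_local_iff (f := fun τ w => power p₂ (u τ w)) hN hk 0 z (measurable_power_uncurry hu p₂)).2
          (by simp [lvolterra])
    · filter_upwards [h2 t ⟨h0, ht.2⟩] with z hz
      exact (integrableOn_local_iff hN hk t z (measurable_power_uncurry hu p₂)).2 hz.ne
  equation t ht := by
    rcases ht.1.eq_or_lt with rfl | h0
    · filter_upwards [hu0] with z hz
      simp [hz, semigroup]
    · filter_upwards [h1 t ⟨h0, ht.2⟩, h2 t ⟨h0, ht.2⟩, heq t ⟨h0, ht.2⟩] with z hz1 hz2 hz
      rw [hz, duhamelTerm, ← integral_semigroup_memory hN hk hγ ht.1 z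
        (measurable_power_uncurry hu p₁) hz1.ne, ← integral_semigroup_local hN hk ht.1 z
        (measurable_power_uncurry hu p₂) hz2.ne, add_assoc]
      rfl

/-- Mild solutions have versions that satisfy the equation with Volterra operators. -/
theorem IsMildSolution.exists_volterra (hN : 1 ≤ N) (hk : 1 ≤ k) {γ κ₁ κ₂ p₁ p₂ q T : ℝ}
    (hγ : γ < 1) {u₀ : Space N k → ℝ} (hu₀ : Measurable u₀) {u : ℝ → Space N k → ℝ}
    (h : IsMildSolution γ κ₁ κ₂ p₁ p₂ q T u₀ u) :
    ∃ v : ℝ → Space N k → ℝ, (Measurable fun a : ℝ × Space N k => v a.1 a.2) ∧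
      (∀ t ∈ Icc 0 T, u t =ᵐ[volume] v t) ∧
      ∀ t ∈ Icc 0 T, ∀ z, v t z = semigroup t u₀ z + duhamelTerm γ κ₁ κ₂ p₁ p₂ v t z := by
  obtain ⟨m, hms, h1⟩ := h.aestronglyMeasurable
  have hmm : Measurable m := hms.measurable
  have hum : ∀ᵐ a : ℝ × Space N k, a.1 ∈ Icc 0 T → u a.1 a.2 = m a := by
    rw [← Measure.restrict_univ (μ := (volume : Measure (Space N k))), Measure.prod_restrict,
      ← Measure.volume_eq_prod, Filter.EventuallyEq,
      ae_restrict_iff' (measurableSet_Icc.prod MeasurableSet.univ)] at h1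
    filter_upwards [h1] with a ha h'
    exact ha ⟨h', mem_univ _⟩
  set m' : ℝ → Space N k → ℝ := fun t z => m (t, z) with hm'
  have hmm' : Measurable fun a : ℝ × Space N k => m' a.1 a.2 := hmm
  -- Sections in time for almost every w: the memory integral at every s, not merely almost every s,
  -- is then insensitive to replacing u by m'.
  have hsec : ∀ᵐ w : Space N k, ∀ᵐ τ : ℝ, τ ∈ Icc 0 T → u τ w = m' τ w := by
    have h2 : ∀ᵐ a : Space N k × ℝ, a.2 ∈ Icc 0 T → u a.2 a.1 = m (a.2, a.1) :=
      (Measure.measurePreserving_swap (μ := (volume : Measure (Space N k)))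
        (ν := (volume : Measure ℝ))).quasiMeasurePreserving.ae hum
    exact Measure.ae_ae_of_ae_prod h2
  have hmem : ∀ s ∈ Icc 0 T, memory γ p₁ u s =ᵐ[volume]
      fun w => ∫ τ in (0 : ℝ)..s, (s - τ) ^ (-γ) * power p₁ (m' τ w) := fun s hs => by
    filter_upwards [hsec] with w hw
    refine intervalIntegral.integral_congr_ae ?_
    filter_upwards [hw] with τ hτ h'
    rw [uIoc_of_le hs.1] at h'
    rw [hτ ⟨h'.1.le, h'.2.trans hs.2⟩]
  have hloc : ∀ᵐ s : ℝ, s ∈ Icc 0 T → u s =ᵐ[volume] m' s := by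
    have h2 := Measure.ae_ae_of_ae_prod hum
    filter_upwards [h2] with s hs h'
    filter_upwards [hs] with w hw
    exact hw h'
  have hsem : ∀ {s t : ℝ} {φ ψ : Space N k → ℝ} (z : Space N k), s < t → φ =ᵐ[volume] ψ →
      semigroup (t - s) φ z = semigroup (t - s) ψ z := fun {s t φ ψ} z hst hφ => by
    rw [semigroup_of_pos (sub_pos.2 hst), semigroup_of_pos (sub_pos.2 hst)]
    refine integral_congr_ae ?_
    filter_upwards [hφ] with w hw
    rw [hw]
  -- The measurable representative m' agrees with u only at almost every time. The right-hand side
  -- of the equation evaluated at m' is jointly measurable and agrees with u at every time.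
  set v : ℝ → Space N k → ℝ := fun t z =>
    semigroup t u₀ z + duhamelTerm γ κ₁ κ₂ p₁ p₂ m' t z with hv
  have hvm : Measurable fun a : ℝ × Space N k => v a.1 a.2 :=
    (measurable_semigroup hu₀).add (measurable_duhamelTerm hmm' γ κ₁ κ₂ p₁ p₂)
  have huv : ∀ t ∈ Icc 0 T, u t =ᵐ[volume] v t := fun t ht => by
    filter_upwards [h.equation t ht, h.integrable_memory t ht, h.integrable_local t ht]
      with z hz hz1 hz2
    have i1 : lvolterra (kerM γ) (fun τ w => ‖power p₁ (m' τ w)‖ₑ) t z ≠ ∞ := by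
      refine (integrableOn_memory_iff hN hk hγ t z (measurable_power_uncurry hmm' p₁)).1 ?_
      refine hz1.congr_fun_ae ?_
      have hq : ∀ᵐ a : (ℝ × ℝ) × Space N k, a.1.2 ∈ Icc 0 T → u a.1.2 a.2 = m (a.1.2, a.2) :=
        (Measure.quasiMeasurePreserving_fst.comp
          (measurePreserving_reorder (N := N) (k := k)).quasiMeasurePreserving).ae hum
      have hE : MeasurableSet {a : (ℝ × ℝ) × Space N k | 0 < a.1.2 ∧ a.1.2 < a.1.1 ∧ a.1.1 < t} :=
        measurePreserving_reorder.measurable (measurableSet_memory t)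
      filter_upwards [ae_restrict_of_ae hq, ae_restrict_mem hE] with a ha ha'
      rw [ha ⟨ha'.1.le, (ha'.2.1.trans ha'.2.2).le.trans ht.2⟩]
    have i2 : lvolterra kerH (fun τ w => ‖power p₂ (m' τ w)‖ₑ) t z ≠ ∞ := by
      refine (integrableOn_local_iff hN hk t z (measurable_power_uncurry hmm' p₂)).1 ?_
      refine hz2.congr_fun_ae ?_
      have hE : MeasurableSet {a : ℝ × Space N k | 0 < a.1 ∧ a.1 < t} :=
        measurable_fst measurableSet_Ioo
      filter_upwards [ae_restrict_of_ae hum, ae_restrict_mem hE] with a ha ha'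
      rw [ha ⟨ha'.1.le, ha'.2.le.trans ht.2⟩]
    change _ = semigroup t u₀ z + duhamelTerm γ κ₁ κ₂ p₁ p₂ m' t z
    rw [hz, duhamelTerm, ← integral_semigroup_memory hN hk hγ ht.1 z
        (measurable_power_uncurry hmm' p₁) i1, ← integral_semigroup_local hN hk ht.1 z
        (measurable_power_uncurry hmm' p₂) i2, add_assoc]
    congr 3
    · rw [integral_eq_setIntegral_Ioo _ ht.1, integral_eq_setIntegral_Ioo _ ht.1]
      exact setIntegral_congr_fun measurableSet_Ioo fun s hs =>
        hsem z hs.2 (hmem s ⟨hs.1.le, hs.2.le.trans ht.2⟩)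
    · rw [integral_eq_setIntegral_Ioo _ ht.1, integral_eq_setIntegral_Ioo _ ht.1]
      refine setIntegral_congr_ae measurableSet_Ioo ?_
      filter_upwards [hloc] with s hs h'
      refine hsem z h'.2 ?_
      filter_upwards [hs ⟨h'.1.le, h'.2.le.trans ht.2⟩] with w hw
      rw [hw]
  refine ⟨v, hvm, huv, fun t ht z => ?_⟩
  -- Since v and m' agree almost everywhere in space-time, they have the same Duhamel terms at every
  -- point; hence v satisfies its equation everywhere.
  have hvm' : ∀ᵐ a : ℝ × Space N k, a.1 ∈ Icc 0 T → v a.1 a.2 = m' a.1 a.2 := by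
    have hms : MeasurableSet {a : ℝ × Space N k | a.1 ∈ Icc 0 T → v a.1 a.2 = m' a.1 a.2} :=
      (measurable_fst measurableSet_Icc).imp (measurableSet_eq_fun hvm hmm')
    refine (Measure.ae_prod_iff_ae_ae hms).2 ?_
    filter_upwards [hloc] with s hs
    by_cases h' : s ∈ Icc 0 T
    · filter_upwards [hs h', huv s h'] with w h1 h2 _
      rw [← h2, h1]
    · exact ae_of_all _ fun w h'' => absurd h'' h'
  have hμ : ∀ᵐ a : ℝ × Space N k ∂((volume.restrict (Ioo 0 t)).prod volume),
      v a.1 a.2 = m' a.1 a.2 := by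
    rw [← restrict_prod_eq]
    have hE : MeasurableSet {a : ℝ × Space N k | 0 < a.1 ∧ a.1 < t} :=
      measurable_fst measurableSet_Ioo
    filter_upwards [ae_restrict_of_ae hvm', ae_restrict_mem hE] with a ha ha'
    exact ha ⟨ha'.1.le, ha'.2.le.trans ht.2⟩
  have hvol : ∀ (κ : ℝ → Space N k → Space N k → ℝ) (p : ℝ),
      volterra κ (fun τ w => power p (v τ w)) t z = volterra κ (fun τ w => power p (m' τ w)) t z :=
    fun κ p => by
      refine integral_congr_ae ?_
      filter_upwards [hμ] with a ha
      rw [ha]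
  have hd : duhamelTerm γ κ₁ κ₂ p₁ p₂ v t z = duhamelTerm γ κ₁ κ₂ p₁ p₂ m' t z := by
    simp only [duhamelTerm, hvol]
  rw [hd]

end

end Grushin

namespace Grushin

noncomputable section

/-- Dominated convergence to zero with convergent dominating functions. -/
theorem tendsto_lintegral_zero_of_le {α ι : Type*} [MeasurableSpace α] {μ : Measure α}
    {l : Filter ι} [l.IsCountablyGenerated] {G g : ι → α → ℝ≥0∞} {g₀ : α → ℝ≥0∞}
    (hG : ∀ᶠ i in l, Measurable (G i)) (hg : ∀ᶠ i in l, Measurable (g i)) (hg₀ : Measurable g₀)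
    (hle : ∀ᶠ i in l, ∀ᵐ x ∂μ, G i x ≤ g i x)
    (hG0 : ∀ᵐ x ∂μ, Tendsto (fun i => G i x) l (𝓝 0))
    (hgl : ∀ᵐ x ∂μ, Tendsto (fun i => g i x) l (𝓝 (g₀ x)))
    (hint : Tendsto (fun i => ∫⁻ x, g i x ∂μ) l (𝓝 (∫⁻ x, g₀ x ∂μ))) (hfin : ∫⁻ x, g₀ x ∂μ ≠ ∞) :
    Tendsto (fun i => ∫⁻ x, G i x ∂μ) l (𝓝 0) := by
  -- G is at most min(G, g₀) plus the excess g - min(g, g₀). The first is dominated by g₀; the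
  -- integral of the second tends to 0 because the integrals of g converge to that of g₀.
  have h1 : Tendsto (fun i => ∫⁻ x, min (G i x) (g₀ x) ∂μ) l (𝓝 (∫⁻ _, 0 ∂μ)) := by
    refine tendsto_lintegral_filter_of_dominated_convergence g₀ ?_
      (Eventually.of_forall fun i => ae_of_all _ fun x => min_le_right _ _) hfin ?_
    · filter_upwards [hG] with i hi using hi.min hg₀
    · filter_upwards [hG0] with x hx
      exact tendsto_of_tendsto_of_tendsto_of_le_of_le tendsto_const_nhds hx (fun i => zero_le)
        fun i => min_le_left _ _
  have h2 : Tendsto (fun i => ∫⁻ x, min (g i x) (g₀ x) ∂μ) l (𝓝 (∫⁻ x, g₀ x ∂μ)) := by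
    refine tendsto_lintegral_filter_of_dominated_convergence g₀ ?_
      (Eventually.of_forall fun i => ae_of_all _ fun x => min_le_right _ _) hfin ?_
    · filter_upwards [hg] with i hi using hi.min hg₀
    · filter_upwards [hgl] with x hx
      simpa using hx.min (tendsto_const_nhds (x := g₀ x))
  have h3 : Tendsto (fun i => ∫⁻ x, (g i x - min (g i x) (g₀ x)) ∂μ) l (𝓝 0) := by
    have h := ENNReal.Tendsto.sub hint h2 (Or.inl hfin)
    rw [tsub_self] at h
    refine h.congr' ?_
    filter_upwards [hg] with i hi
    rw [lintegral_sub (hi.min hg₀) (ne_top_of_le_ne_top hfin (lintegral_mono fun x =>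
      min_le_right _ _)) (ae_of_all _ fun x => min_le_left _ _)]
  have h4 := h1.add h3
  rw [lintegral_zero, add_zero] at h4
  refine tendsto_of_tendsto_of_tendsto_of_le_of_le' tendsto_const_nhds h4
    (Eventually.of_forall fun i => zero_le) ?_
  filter_upwards [hG, hle] with i hi hile
  rw [← lintegral_add_left (hi.min hg₀)]
  refine lintegral_mono_ae ?_
  filter_upwards [hile] with x hx
  rcases le_total (G i x) (g₀ x) with h | h
  · rw [min_eq_left h]
    exact le_self_add
  · rw [min_eq_right h, min_eq_right (h.trans hx), add_tsub_cancel_of_le (h.trans hx)]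
    exact hx

variable {N k : ℕ}

/-! ### The heat semigroup on Lebesgue spaces -/

theorem kerH_symm (σ : ℝ) (z w : Space N k) : kerH σ z w = kerH σ w z := by
  have h := heatKernel_comm w.1 z.1 (w.2 - z.2) σ
  rw [neg_sub] at h
  exact h

theorem enorm_semigroup_le (hN : 1 ≤ N) (hk : 1 ≤ k) {σ : ℝ} (hσ : 0 < σ) (φ : Space N k → ℝ)
    (z : Space N k) :
    ‖semigroup σ φ z‖ₑ ≤ ∫⁻ w, ENNReal.ofReal (kerH σ z w) * ‖φ w‖ₑ := by
  rw [semigroup_of_pos hσ]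
  refine (enorm_integral_le_lintegral_enorm _).trans (le_of_eq (lintegral_congr fun w => ?_))
  rw [enorm_mul, Real.enorm_of_nonneg (kerH_nonneg hN hk hσ z w)]

theorem measurable_semigroup_slice {φ : Space N k → ℝ} (hφ : Measurable φ) (t : ℝ) :
    Measurable (semigroup t φ) := (measurable_semigroup hφ).comp (measurable_prodMk_left (x := t))

theorem eLpNorm_semigroup_le (hN : 1 ≤ N) (hk : 1 ≤ k) {a b : ℝ} (ha : 1 ≤ a) (hab : a ≤ b) {σ : ℝ}
    (hσ : 0 < σ) {φ : Space N k → ℝ} (hφ : Measurable φ) :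
    eLpNorm (semigroup σ φ) (ENNReal.ofReal b) volume ≤
      ENNReal.ofReal (kernelConst N k ^ (1 / a - 1 / b) *
        σ ^ (-(((N : ℝ) + 2 * k) / 2 * (1 / a - 1 / b)))) *
        eLpNorm φ (ENNReal.ofReal a) volume := by
  refine (eLpNorm_mono_enorm fun z => ?_).trans
    ((opBound_kerH hN hk ha hab σ hσ (fun w => ‖φ w‖ₑ) hφ.enorm).trans (le_of_eq ?_))
  · rw [enorm_eq_self]
    exact enorm_semigroup_le hN hk hσ φ z
  · rw [eLpNorm_enorm]

theorem eLpNorm_semigroup_le_self (hN : 1 ≤ N) (hk : 1 ≤ k) {a : ℝ} (ha : 1 ≤ a) {σ : ℝ}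
    (hσ : 0 ≤ σ) {φ : Space N k → ℝ} (hφ : Measurable φ) :
    eLpNorm (semigroup σ φ) (ENNReal.ofReal a) volume ≤ eLpNorm φ (ENNReal.ofReal a) volume := by
  rcases hσ.eq_or_lt with rfl | hσ
  · refine le_of_eq (eLpNorm_congr_ae (ae_of_all _ fun z => by simp [semigroup]))
  · simpa using eLpNorm_semigroup_le hN hk ha le_rfl hσ hφ

theorem ae_lt_top_of_eLpNorm {Z : Type*} [MeasurableSpace Z] {ν : Measure Z} {a : ℝ} (ha : 0 < a)
    {F : Z → ℝ≥0∞} (hF : Measurable F) (h : eLpNorm F (ENNReal.ofReal a) ν ≠ ∞) :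
    ∀ᵐ z ∂ν, F z < ∞ := by
  have h2 : ∫⁻ z, F z ^ a ∂ν ≠ ∞ := by
    have h3 := ENNReal.rpow_ne_top_of_nonneg ha.le h
    rw [eLpNorm_ofReal_rpow ha] at h3
    simpa using h3
  filter_upwards [ae_lt_top (hF.pow_const _) h2] with z hz
  exact (ENNReal.rpow_lt_top_iff_of_pos ha).1 hz

theorem measurable_kernel_lintegral {σ : ℝ} {φ : Space N k → ℝ≥0∞} (hφ : Measurable φ) :
    Measurable fun z => ∫⁻ w, ENNReal.ofReal (kerH σ z w) * φ w :=
  Measurable.lintegral_prod_right' (f := fun c : Space N k × Space N k =>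
    ENNReal.ofReal (kerH σ c.1 c.2) * φ c.2)
    ((measurable_kerH.comp (f := fun c : Space N k × Space N k =>
      (σ, c.1, c.2)) (by fun_prop)).ennreal_ofReal.mul (by fun_prop))

theorem ae_integrable_kerH_mul (hN : 1 ≤ N) (hk : 1 ≤ k) {a : ℝ} (ha : 1 ≤ a) {σ : ℝ} (hσ : 0 < σ)
    {φ : Space N k → ℝ} (hφ : Measurable φ) (hφa : eLpNorm φ (ENNReal.ofReal a) volume ≠ ∞) :
    ∀ᵐ z, Integrable fun w => kerH σ z w * φ w := by
  have h := opBound_kerH hN hk ha le_rfl σ hσ (fun w => ‖φ w‖ₑ) hφ.enorm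
  rw [eLpNorm_enorm] at h
  have h1 := ne_top_of_le_ne_top (ENNReal.mul_ne_top ENNReal.ofReal_ne_top hφa) h
  filter_upwards [ae_lt_top_of_eLpNorm (by linarith) (measurable_kernel_lintegral hφ.enorm) h1]
    with z hz
  refine ⟨((measurable_kerH_right σ z).mul hφ).aestronglyMeasurable, ?_⟩
  rw [HasFiniteIntegral]
  refine lt_of_le_of_lt (le_of_eq (lintegral_congr fun w => ?_)) hz
  rw [enorm_mul, Real.enorm_of_nonneg (kerH_nonneg hN hk hσ z w)]

theorem ae_semigroup_sub (hN : 1 ≤ N) (hk : 1 ≤ k) {a : ℝ} (ha : 1 ≤ a) {σ : ℝ} (hσ : 0 ≤ σ)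
    {φ ψ : Space N k → ℝ} (hφ : Measurable φ) (hψ : Measurable ψ)
    (hφa : eLpNorm φ (ENNReal.ofReal a) volume ≠ ∞)
    (hψa : eLpNorm ψ (ENNReal.ofReal a) volume ≠ ∞) :
    ∀ᵐ z, semigroup σ φ z - semigroup σ ψ z = semigroup σ (φ - ψ) z := by
  rcases hσ.eq_or_lt with rfl | hσ
  · exact ae_of_all _ fun z => by simp [semigroup]
  filter_upwards [ae_integrable_kerH_mul hN hk ha hσ hφ hφa,
    ae_integrable_kerH_mul hN hk ha hσ hψ hψa] with z h1 h2
  rw [semigroup_of_pos hσ, semigroup_of_pos hσ, semigroup_of_pos hσ, ← integral_sub h1 h2]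
  simp [mul_sub]

theorem eLpNorm_semigroup_sub_le (hN : 1 ≤ N) (hk : 1 ≤ k) {a : ℝ} (ha : 1 ≤ a) {σ : ℝ} (hσ : 0 ≤ σ)
    {φ ψ : Space N k → ℝ} (hφ : Measurable φ) (hψ : Measurable ψ)
    (hφa : eLpNorm φ (ENNReal.ofReal a) volume ≠ ∞)
    (hψa : eLpNorm ψ (ENNReal.ofReal a) volume ≠ ∞) :
    eLpNorm (semigroup σ φ - semigroup σ ψ) (ENNReal.ofReal a) volume ≤
      eLpNorm (φ - ψ) (ENNReal.ofReal a) volume :=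
  (eLpNorm_congr_ae (ae_semigroup_sub hN hk ha hσ hφ hψ hφa hψa)).trans_le
    (eLpNorm_semigroup_le_self hN hk ha hσ (hφ.sub hψ))

/-! ### Continuity at positive times -/

/-- The absolute difference of the kernels at two times. -/
def kerD (t σ : ℝ) (z w : Space N k) : ℝ≥0∞ := ‖kerH t z w - kerH σ z w‖ₑ

theorem measurable_kerD (t σ : ℝ) : Measurable fun c : Space N k × Space N k => kerD t σ c.1 c.2 :=
  ((measurable_kerH.comp (f := fun c : Space N k × Space N k => (t, c.1, c.2)) (by fun_prop)).sub
    (measurable_kerH.comp (f := fun c : Space N k × Space N k => (σ, c.1, c.2)) (by fun_prop))).enorm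

theorem measurable_kerD_right (t σ : ℝ) (z : Space N k) : Measurable (kerD t σ z) :=
  ((measurable_kerH_right t z).sub (measurable_kerH_right σ z)).enorm

theorem measurable_kerD_left (t σ : ℝ) (w : Space N k) : Measurable fun z => kerD t σ z w :=
  ((measurable_kerH_left t w).sub (measurable_kerH_left σ w)).enorm

theorem kerD_le (hN : 1 ≤ N) (hk : 1 ≤ k) {t σ : ℝ} (ht : 0 < t) (hσ : 0 < σ) (z w : Space N k) :
    kerD t σ z w ≤ ENNReal.ofReal (kerH t z w) + ENNReal.ofReal (kerH σ z w) := by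
  refine enorm_sub_le.trans (le_of_eq ?_)
  rw [Real.enorm_of_nonneg (kerH_nonneg hN hk ht z w),
    Real.enorm_of_nonneg (kerH_nonneg hN hk hσ z w)]

theorem lintegral_kerD_left_le (hN : 1 ≤ N) (hk : 1 ≤ k) {t σ : ℝ} (ht : 0 < t) (hσ : 0 < σ)
    (w : Space N k) : ∫⁻ z, kerD t σ z w ≤ 2 := by
  refine (lintegral_mono fun z => kerD_le hN hk ht hσ z w).trans ?_
  rw [lintegral_add_left (measurable_kerH_left t w).ennreal_ofReal, lintegral_kerH_left hN hk ht,
    lintegral_kerH_left hN hk hσ, one_add_one_eq_two]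

theorem lintegral_kerD_le (hN : 1 ≤ N) (hk : 1 ≤ k) {t σ : ℝ} (ht : 0 < t) (hσ : 0 < σ)
    (z : Space N k) : ∫⁻ w, kerD t σ z w ≤ 2 := by
  refine (lintegral_mono fun w => kerD_le hN hk ht hσ z w).trans ?_
  rw [lintegral_add_left (measurable_kerH_right t z).ennreal_ofReal, lintegral_kerH hN hk ht,
    lintegral_kerH hN hk hσ, one_add_one_eq_two]

theorem tendsto_kerH (hN : 1 ≤ N) {σ : ℝ} (hσ : 0 < σ) (z w : Space N k) :
    Tendsto (fun t => kerH t z w) (𝓝 σ) (𝓝 (kerH σ z w)) :=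
  continuousAt_heatKernel hN z.1 w.1 (z.2 - w.2) hσ

/-- Scheffé's argument: the kernels converge pointwise and all have mass one, so they converge in
L¹. -/
theorem tendsto_lintegral_kerD (hN : 1 ≤ N) (hk : 1 ≤ k) {σ : ℝ} (hσ : 0 < σ) (w : Space N k) :
    Tendsto (fun t => ∫⁻ z, kerD t σ z w) (𝓝 σ) (𝓝 0) := by
  have hm := fun t => (measurable_kerH_left (N := N) (k := k) t w).ennreal_ofReal
  have hpos : ∀ᶠ t in 𝓝 σ, 0 < t := eventually_gt_nhds hσ
  have hI : ∀ t, 0 < t →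
      ∫⁻ z, (ENNReal.ofReal (kerH t z w) + ENNReal.ofReal (kerH σ z w)) = 2 := fun t ht => by
    rw [lintegral_add_left (hm t), lintegral_kerH_left hN hk ht, lintegral_kerH_left hN hk hσ,
      one_add_one_eq_two]
  refine tendsto_lintegral_zero_of_le (g := fun t z => ENNReal.ofReal (kerH t z w) +
    ENNReal.ofReal (kerH σ z w)) (g₀ := fun z => ENNReal.ofReal (kerH σ z w) +
    ENNReal.ofReal (kerH σ z w)) (Eventually.of_forall fun t => measurable_kerD_left t σ w)
    (Eventually.of_forall fun t => (hm t).add (hm σ)) ((hm σ).add (hm σ)) ?_ ?_ ?_ ?_ ?_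
  · filter_upwards [hpos] with t ht
    exact ae_of_all _ fun z => kerD_le hN hk ht hσ z w
  · refine ae_of_all _ fun z => ?_
    have h := ((tendsto_kerH hN hσ z w).sub_const (kerH σ z w)).enorm
    simpa [kerD] using h
  · refine ae_of_all _ fun z => ?_
    exact (ENNReal.tendsto_ofReal (tendsto_kerH hN hσ z w)).add tendsto_const_nhds
  · rw [hI σ hσ]
    refine tendsto_const_nhds.congr' ?_
    filter_upwards [hpos] with t ht
    rw [hI t ht]
  · rw [hI σ hσ]
    simp

/-- The interpolation argument for bounded kernels, applied to |K_t - K_σ|. For t > σ/2 the sup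
bound is uniform, and the L^a bound tends to 0 because the L¹ distance in z does so for each w,
dominated by 2. -/
theorem tendsto_eLpNorm_kerD (hN : 1 ≤ N) (hk : 1 ≤ k) {a b : ℝ} (ha : 1 ≤ a) (hab : a ≤ b)
    {σ : ℝ} (hσ : 0 < σ) {φ : Space N k → ℝ≥0∞} (hφ : Measurable φ)
    (hφa : eLpNorm φ (ENNReal.ofReal a) volume ≠ ∞) :
    Tendsto (fun t => eLpNorm (fun z => ∫⁻ w, kerD t σ z w * φ w) (ENNReal.ofReal b) volume)
      (𝓝 σ) (𝓝 0) := by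
  have ha0 : 0 < a := by linarith
  have hb0 : 0 < b := by linarith
  set A := ∫⁻ w, φ w ^ a with hA
  have hAfin : A ≠ ∞ := by
    have h3 := ENNReal.rpow_ne_top_of_nonneg ha0.le hφa
    rw [eLpNorm_ofReal_rpow ha0] at h3
    simpa using h3
  set B : ℝ≥0∞ := 2 * ENNReal.ofReal (kernelConst N k * (σ / 2) ^ (-(((N : ℝ) + 2 * k) / 2))) with hB
  have hBfin : B ≠ ∞ := ENNReal.mul_ne_top (by simp) ENNReal.ofReal_ne_top
  have h2a : (2 : ℝ≥0∞) ^ (a - 1) ≠ ∞ := ENNReal.rpow_ne_top_of_nonneg (by linarith) (by simp)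
  have hhalf : ∀ t, σ / 2 < t → ∀ z w : Space N k, ENNReal.ofReal (kerH t z w) ≤
      ENNReal.ofReal (kernelConst N k * (σ / 2) ^ (-(((N : ℝ) + 2 * k) / 2))) :=
    fun t ht z w => ENNReal.ofReal_le_ofReal ((kerH_le hN (by linarith) z w).trans
      (mul_le_mul_of_nonneg_left (Real.rpow_le_rpow_of_nonpos (by positivity) ht.le
        (by rw [neg_nonpos]; positivity)) kernelConst_nonneg))
  have hJ : ∀ t, 0 < t → ∀ z, (∫⁻ w, kerD t σ z w * φ w) ^ a ≤
      2 ^ (a - 1) * ∫⁻ w, kerD t σ z w * φ w ^ a := fun t ht z =>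
    (lintegral_mul_rpow_le (measurable_kerD_right t σ z).aemeasurable hφ.aemeasurable ha).trans
      (mul_le_mul_left (ENNReal.rpow_le_rpow (lintegral_kerD_le hN hk ht hσ z) (by linarith)) _)
  have hsup : ∀ t, σ / 2 < t → ∀ z, (∫⁻ w, kerD t σ z w * φ w) ≤
      (2 ^ (a - 1) * (B * A)) ^ (1 / a) := fun t ht z => by
    rw [one_div, ENNReal.le_rpow_inv_iff ha0]
    refine (hJ t (by linarith) z).trans (mul_le_mul_right ?_ _)
    rw [← lintegral_const_mul _ (by fun_prop)]
    refine lintegral_mono fun w => mul_le_mul_left ?_ _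
    refine (kerD_le hN hk (by linarith) hσ z w).trans ?_
    rw [hB, two_mul]
    exact add_le_add (hhalf t ht z w) (hhalf σ (by linarith) z w)
  set Q := (2 ^ (a - 1) * (B * A)) ^ (1 / a) with hQ
  have hQfin : Q ≠ ∞ := ENNReal.rpow_ne_top_of_nonneg (by positivity)
    (ENNReal.mul_ne_top h2a (ENNReal.mul_ne_top hBfin hAfin))
  have hlim : Tendsto (fun t => ∫⁻ w, (∫⁻ z, kerD t σ z w) * φ w ^ a) (𝓝 σ)
      (𝓝 (∫⁻ _ : Space N k, 0)) := by
    have hfa : ∀ᵐ w, φ w ^ a ≠ ∞ := (ae_lt_top (hφ.pow_const a) hAfin).mono fun w hw => hw.ne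
    refine tendsto_lintegral_filter_of_dominated_convergence (fun w => 2 * φ w ^ a) ?_ ?_ ?_ ?_
    · refine Eventually.of_forall fun t => Measurable.mul ?_ (by fun_prop)
      exact Measurable.lintegral_prod_left (measurable_kerD t σ)
    · filter_upwards [eventually_gt_nhds hσ] with t ht
      exact ae_of_all _ fun w => mul_le_mul_left (lintegral_kerD_left_le hN hk ht hσ w) _
    · rw [lintegral_const_mul _ (by fun_prop)]
      exact ENNReal.mul_ne_top (by simp) hAfin
    · filter_upwards [hfa] with w hw
      have := ENNReal.Tendsto.mul_const (tendsto_lintegral_kerD hN hk hσ w) (Or.inr hw)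
      rwa [zero_mul] at this
  rw [lintegral_zero] at hlim
  have hbound : ∀ᶠ t in 𝓝 σ, eLpNorm (fun z => ∫⁻ w, kerD t σ z w * φ w) (ENNReal.ofReal b) volume ≤
      (Q ^ (b - a) * (2 ^ (a - 1) * ∫⁻ w, (∫⁻ z, kerD t σ z w) * φ w ^ a)) ^ (1 / b) := by
    filter_upwards [eventually_gt_nhds (half_lt_self hσ)] with t ht
    have ht0 : 0 < t := by linarith
    have hmD := measurable_kerD (N := N) (k := k) t σ
    have hmI : Measurable fun z => ∫⁻ w, kerD t σ z w * φ w ^ a :=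
      Measurable.lintegral_prod_right' (f := fun c : Space N k × Space N k =>
        kerD t σ c.1 c.2 * φ c.2 ^ a) (by fun_prop)
    rw [eLpNorm_ofReal_eq hb0]
    refine ENNReal.rpow_le_rpow ?_ (by positivity)
    simp only [enorm_eq_self]
    calc ∫⁻ z, (∫⁻ w, kerD t σ z w * φ w) ^ b
        ≤ ∫⁻ z, Q ^ (b - a) * (2 ^ (a - 1) * ∫⁻ w, kerD t σ z w * φ w ^ a) := by
          refine lintegral_mono fun z => ?_
          calc (∫⁻ w, kerD t σ z w * φ w) ^ b
              = (∫⁻ w, kerD t σ z w * φ w) ^ (b - a) * (∫⁻ w, kerD t σ z w * φ w) ^ a := by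
                rw [← ENNReal.rpow_add_of_nonneg _ _ (by linarith) (by linarith), sub_add_cancel]
            _ ≤ _ := mul_le_mul' (ENNReal.rpow_le_rpow (hsup t ht z) (by linarith)) (hJ t ht0 z)
      _ = Q ^ (b - a) * (2 ^ (a - 1) * ∫⁻ z, ∫⁻ w, kerD t σ z w * φ w ^ a) := by
          rw [lintegral_const_mul _ (by fun_prop), lintegral_const_mul _ (by fun_prop)]
      _ = _ := by
          rw [lintegral_lintegral_swap (by fun_prop)]
          congr 3
          funext w
          rw [lintegral_mul_const _ (measurable_kerD_left t σ w)]
  have hz : Tendsto (fun t => (Q ^ (b - a) * (2 ^ (a - 1) * ∫⁻ w, (∫⁻ z, kerD t σ z w) * φ w ^ a))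
      ^ (1 / b)) (𝓝 σ) (𝓝 0) := by
    have h1 := ENNReal.Tendsto.const_mul (ENNReal.Tendsto.const_mul hlim (Or.inr h2a))
      (a := Q ^ (b - a)) (Or.inr (ENNReal.rpow_ne_top_of_nonneg (by linarith) hQfin))
    have h2 := h1.ennrpow_const (1 / b)
    rwa [mul_zero, mul_zero, ENNReal.zero_rpow_of_pos (by positivity)] at h2
  exact tendsto_of_tendsto_of_tendsto_of_le_of_le' tendsto_const_nhds hz
    (Eventually.of_forall fun _ => zero_le) hbound

theorem tendsto_eLpNorm_semigroup (hN : 1 ≤ N) (hk : 1 ≤ k) {a b : ℝ} (ha : 1 ≤ a) (hab : a ≤ b)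
    {σ : ℝ} (hσ : 0 < σ) {φ : Space N k → ℝ} (hφ : Measurable φ)
    (hφa : eLpNorm φ (ENNReal.ofReal a) volume ≠ ∞) :
    Tendsto (fun t => eLpNorm (semigroup t φ - semigroup σ φ) (ENNReal.ofReal b) volume)
      (𝓝 σ) (𝓝 0) := by
  have h := tendsto_eLpNorm_kerD hN hk ha hab hσ hφ.enorm (by rwa [eLpNorm_enorm])
  refine tendsto_of_tendsto_of_tendsto_of_le_of_le' tendsto_const_nhds h
    (Eventually.of_forall fun _ => zero_le) ?_
  filter_upwards [eventually_gt_nhds hσ] with t ht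
  refine eLpNorm_mono_enorm_ae ?_
  filter_upwards [ae_integrable_kerH_mul hN hk ha ht hφ hφa,
    ae_integrable_kerH_mul hN hk ha hσ hφ hφa] with z h1 h2
  rw [Pi.sub_apply, semigroup_of_pos ht, semigroup_of_pos hσ, ← integral_sub h1 h2, enorm_eq_self]
  refine (enorm_integral_le_lintegral_enorm _).trans (le_of_eq (lintegral_congr fun w => ?_))
  rw [← sub_mul, enorm_mul, kerD]

end

end Grushin

namespace Grushin

noncomputable section

variable {N k : ℕ}

/-! ### Continuity at time zero -/

/-- Approximate identity. With E a Gaussian bump at z, the K-integral of E tends to 1, so that of 1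
- E tends to 0, and away from z the function 1 - E is bounded below. -/
theorem tendsto_lintegral_kerH_mul (hN : 1 ≤ N) (hk : 1 ≤ k) (z : Space N k)
    {η : Space N k → ℝ≥0∞} {B : ℝ≥0∞} (hB : B ≠ ∞) (hηB : ∀ w, η w ≤ B)
    (hη : Tendsto η (𝓝 z) (𝓝 0)) :
    Tendsto (fun t => ∫⁻ w, ENNReal.ofReal (kerH t z w) * η w) (𝓝[>] 0) (𝓝 0) := by
  set E : Space N k → ℝ := fun w =>
    Real.exp (-1 * ‖z.2 - w.2‖ ^ 2) * Real.exp (-1 * ‖w.1 - z.1‖ ^ 2) with hE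
  have hEm : Measurable E := by fun_prop
  have hE0 : ∀ w, 0 ≤ E w := fun w => by positivity
  have hE1 : ∀ w, E w ≤ 1 := fun w => by
    rw [hE]
    dsimp only
    rw [← Real.exp_add, Real.exp_le_one_iff]
    nlinarith [sq_nonneg ‖z.2 - w.2‖, sq_nonneg ‖w.1 - z.1‖]
  have hid : Tendsto (fun t : ℝ => t) (𝓝[>] 0) (𝓝 0) := tendsto_nhdsWithin_of_tendsto_nhds tendsto_id
  have hgauss := tendsto_lintegral_heatKernel_mul_gaussian hN hk z (l := 𝓝[>] (0 : ℝ))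
    (t := fun t => t) (ε := fun _ => 1) (δ := 1) (t₀ := 0) (ε₀ := 1)
    self_mem_nhdsWithin (Eventually.of_forall fun _ => one_pos) hid tendsto_const_nhds
    (by simp) zero_le_one (by simp)
  have hJ : Tendsto (fun t => ∫⁻ w, ENNReal.ofReal (kerH t z w) * ENNReal.ofReal (1 - E w))
      (𝓝[>] 0) (𝓝 0) := by
    have h := ENNReal.Tendsto.sub (tendsto_const_nhds (x := (1 : ℝ≥0∞)) (f := 𝓝[>] (0 : ℝ))) hgauss
      (Or.inl (by simp))
    rw [tsub_self] at h
    refine h.congr' ?_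
    filter_upwards [self_mem_nhdsWithin] with t ht
    have ht0 : 0 < t := ht
    have hm := (measurable_kerH_right t z).ennreal_ofReal
    have hI : ∫⁻ w : Space N k, ENNReal.ofReal (heatKernel z.1 w.1 (z.2 - w.2) t *
        Real.exp (-1 * ‖z.2 - w.2‖ ^ 2)) * ENNReal.ofReal (Real.exp (-1 * ‖w.1 - z.1‖ ^ 2)) =
        ∫⁻ w, ENNReal.ofReal (kerH t z w) * ENNReal.ofReal (E w) := by
      refine lintegral_congr fun w => ?_
      change ENNReal.ofReal (kerH t z w * _) * _ = _
      rw [ENNReal.ofReal_mul (kerH_nonneg hN hk ht0 z w), mul_assoc, ← ENNReal.ofReal_mul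
        (Real.exp_pos _).le]
    have hsum : (∫⁻ w, ENNReal.ofReal (kerH t z w) * ENNReal.ofReal (E w)) +
        ∫⁻ w, ENNReal.ofReal (kerH t z w) * ENNReal.ofReal (1 - E w) = 1 := by
      rw [← lintegral_add_left (by fun_prop), ← lintegral_kerH hN hk ht0 z]
      refine lintegral_congr fun w => ?_
      rw [← mul_add, ← ENNReal.ofReal_add (hE0 w) (sub_nonneg.2 (hE1 w)), add_sub_cancel,
        ENNReal.ofReal_one, mul_one]
    rw [hI]
    refine (ENNReal.eq_sub_of_add_eq' (by simp) ?_).symm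
    rw [add_comm, hsum]
  rw [ENNReal.tendsto_nhds_zero]
  intro ε hε
  have hε2 : 0 < ε / 2 := ENNReal.half_pos hε.ne'
  obtain ⟨δ, hδ, hball⟩ := Metric.eventually_nhds_iff.1 (ENNReal.tendsto_nhds_zero.1 hη _ hε2)
  have hc : 0 < 1 - Real.exp (-δ ^ 2) := by
    rw [sub_pos, Real.exp_lt_one_iff]
    nlinarith
  set C : ℝ≥0∞ := B / ENNReal.ofReal (1 - Real.exp (-δ ^ 2)) with hC
  have hCfin : C ≠ ∞ := ENNReal.div_ne_top hB (ENNReal.ofReal_pos.2 hc).ne'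
  have hηle : ∀ w, η w ≤ ε / 2 + C * ENNReal.ofReal (1 - E w) := fun w => by
    by_cases hw : dist w z < δ
    · exact (hball hw).trans le_self_add
    · refine le_add_left ((hηB w).trans ?_)
      have hEw : E w ≤ Real.exp (-δ ^ 2) := by
        rw [hE]
        dsimp only
        rw [← Real.exp_add, Real.exp_le_exp]
        rw [not_lt, Prod.dist_eq, le_max_iff, dist_eq_norm, dist_eq_norm, norm_sub_rev w.2] at hw
        rcases hw with hw | hw
        · nlinarith [sq_nonneg ‖z.2 - w.2‖]
        · nlinarith [sq_nonneg ‖w.1 - z.1‖]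
      calc B = C * ENNReal.ofReal (1 - Real.exp (-δ ^ 2)) := by
            rw [hC, ENNReal.div_mul_cancel (ENNReal.ofReal_pos.2 hc).ne' ENNReal.ofReal_ne_top]
        _ ≤ _ := by gcongr
  have hCJ := ENNReal.Tendsto.const_mul hJ (a := C) (Or.inr hCfin)
  rw [mul_zero] at hCJ
  filter_upwards [ENNReal.tendsto_nhds_zero.1 hCJ _ hε2, self_mem_nhdsWithin] with t ht ht0
  have hm := (measurable_kerH_right t z).ennreal_ofReal
  calc ∫⁻ w, ENNReal.ofReal (kerH t z w) * η w
      ≤ ∫⁻ w, (ENNReal.ofReal (kerH t z w) * (ε / 2) +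
        C * (ENNReal.ofReal (kerH t z w) * ENNReal.ofReal (1 - E w))) := by
        refine lintegral_mono fun w => ?_
        rw [mul_left_comm, ← mul_add]
        exact mul_le_mul_right (hηle w) _
    _ = ε / 2 + C * ∫⁻ w, ENNReal.ofReal (kerH t z w) * ENNReal.ofReal (1 - E w) := by
        rw [lintegral_add_left (by fun_prop), lintegral_mul_const _ hm, lintegral_kerH hN hk ht0,
          one_mul, lintegral_const_mul _ (by fun_prop)]
    _ ≤ ε / 2 + ε / 2 := add_le_add le_rfl ht
    _ = ε := ENNReal.add_halves ε

theorem integral_kerH (hN : 1 ≤ N) (hk : 1 ≤ k) {σ : ℝ} (hσ : 0 < σ) (z : Space N k) :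
    Integrable (kerH σ z) ∧ ∫ w, kerH σ z w = 1 := by
  have hm := measurable_kerH_right σ z
  refine ⟨⟨hm.aestronglyMeasurable, ?_⟩, ?_⟩
  · rw [HasFiniteIntegral]
    simp_rw [Real.enorm_of_nonneg (kerH_nonneg hN hk hσ z _)]
    rw [lintegral_kerH hN hk hσ]
    exact ENNReal.one_lt_top
  · rw [integral_eq_lintegral_of_nonneg_ae (ae_of_all _ (kerH_nonneg hN hk hσ z))
      hm.aestronglyMeasurable, lintegral_kerH hN hk hσ, ENNReal.toReal_one]

/-- Jensen bounds |S(t)ψ - ψ|^a at z by the average of |ψ(w) - ψ(z)|^a. The double integral is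
symmetric and vanishes unless z or w lies in the support, so it is at most twice the integral over z
in the support, a set of finite measure on which dominated convergence applies. -/
theorem tendsto_eLpNorm_semigroup_of_compactSupport (hN : 1 ≤ N) (hk : 1 ≤ k) {a : ℝ} (ha : 1 ≤ a)
    {ψ : Space N k → ℝ} (hψ : Continuous ψ) (hψs : HasCompactSupport ψ) :
    Tendsto (fun t => eLpNorm (semigroup t ψ - ψ) (ENNReal.ofReal a) volume) (𝓝[>] 0) (𝓝 0) := by
  have ha0 : 0 < a := by linarith
  obtain ⟨B, hB⟩ := hψs.exists_bound_of_continuous hψ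
  set D : Space N k → Space N k → ℝ≥0∞ := fun z w => ‖ψ w - ψ z‖ₑ ^ a with hD
  have hψm := hψ.measurable
  have hDm : Measurable fun c : Space N k × Space N k => D c.1 c.2 := by fun_prop
  have hDB : ∀ z w, D z w ≤ ENNReal.ofReal (2 * B) ^ a := fun z w => by
    refine ENNReal.rpow_le_rpow ?_ ha0.le
    rw [← ofReal_norm]
    exact ENNReal.ofReal_le_ofReal ((norm_sub_le _ _).trans (by linarith [hB w, hB z]))
  have hBfin : ENNReal.ofReal (2 * B) ^ a ≠ ∞ :=
    ENNReal.rpow_ne_top_of_nonneg ha0.le ENNReal.ofReal_ne_top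
  have hsym : ∀ z w, D z w = D w z := fun z w => by
    simp only [hD]
    rw [← enorm_neg, neg_sub]
  set Q := tsupport ψ with hQ
  have hQm : MeasurableSet Q := (isClosed_tsupport ψ).measurableSet
  have hQfin : volume Q ≠ ∞ := hψs.isCompact.measure_lt_top.ne
  have hlim : Tendsto (fun t => ∫⁻ z in Q, ∫⁻ w, ENNReal.ofReal (kerH t z w) * D z w) (𝓝[>] 0)
      (𝓝 (∫⁻ _ in Q, 0)) := by
    have hKm := fun t => (measurable_kerH.comp (f := fun c : Space N k × Space N k =>
      (t, c.1, c.2)) (by fun_prop)).ennreal_ofReal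
    refine tendsto_lintegral_filter_of_dominated_convergence
      (fun _ => ENNReal.ofReal (2 * B) ^ a) ?_ ?_ ?_ ?_
    · refine Eventually.of_forall fun t => Measurable.lintegral_prod_right'
        (f := fun c : Space N k × Space N k => ENNReal.ofReal (kerH t c.1 c.2) * D c.1 c.2) ?_
      exact (hKm t).mul hDm
    · filter_upwards [self_mem_nhdsWithin] with t ht
      refine ae_of_all _ fun z => ?_
      calc ∫⁻ w, ENNReal.ofReal (kerH t z w) * D z w
          ≤ ∫⁻ w, ENNReal.ofReal (kerH t z w) * ENNReal.ofReal (2 * B) ^ a :=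
            lintegral_mono fun w => mul_le_mul_right (hDB z w) _
        _ = _ := by
            rw [lintegral_mul_const _ (measurable_kerH_right t z).ennreal_ofReal,
              lintegral_kerH hN hk ht, one_mul]
    · rw [setLIntegral_const]
      exact ENNReal.mul_ne_top hBfin hQfin
    · refine ae_of_all _ fun z => tendsto_lintegral_kerH_mul hN hk z hBfin (hDB z) ?_
      have h1 : Tendsto (fun w => ‖ψ w - ψ z‖ₑ ^ a) (𝓝 z) (𝓝 (‖ψ z - ψ z‖ₑ ^ a)) :=
        (((hψ.tendsto z).sub_const (ψ z)).enorm).ennrpow_const a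
      simpa [hD, ENNReal.zero_rpow_of_pos ha0] using h1
  rw [lintegral_zero] at hlim
  have hbound : ∀ᶠ t in 𝓝[>] (0 : ℝ), eLpNorm (semigroup t ψ - ψ) (ENNReal.ofReal a) volume ≤
      (2 * ∫⁻ z in Q, ∫⁻ w, ENNReal.ofReal (kerH t z w) * D z w) ^ (1 / a) := by
    filter_upwards [self_mem_nhdsWithin] with t ht
    have ht0 : 0 < t := ht
    have hKm : Measurable fun c : Space N k × Space N k => ENNReal.ofReal (kerH t c.1 c.2) :=
      (measurable_kerH.comp (f := fun c : Space N k × Space N k =>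
        (t, c.1, c.2)) (by fun_prop)).ennreal_ofReal
    set I : Space N k → Space N k → ℝ≥0∞ := fun z w => ENNReal.ofReal (kerH t z w) * D z w with hI
    have hIm : Measurable fun c : Space N k × Space N k => I c.1 c.2 := hKm.mul hDm
    have hIsym : ∀ z w, I z w = I w z := fun z w => by
      simp only [hI]
      rw [kerH_symm, hsym]
    have hint : ∀ z, Integrable fun w => kerH t z w * ψ w := fun z =>
      (integral_kerH hN hk ht0 z).1.mul_bdd (c := B) hψ.aestronglyMeasurable (ae_of_all _ hB)
    have hpt : ∀ z, ‖semigroup t ψ z - ψ z‖ₑ ^ a ≤ ∫⁻ w, I z w := fun z => by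
      have e : semigroup t ψ z - ψ z = ∫ w, kerH t z w * (ψ w - ψ z) := by
        simp_rw [mul_sub]
        rw [integral_sub (hint z) ((integral_kerH hN hk ht0 z).1.mul_const _), integral_mul_const,
          (integral_kerH hN hk ht0 z).2, one_mul, semigroup_of_pos ht0]
      have h1 : ‖semigroup t ψ z - ψ z‖ₑ ≤ ∫⁻ w, ENNReal.ofReal (kerH t z w) * ‖ψ w - ψ z‖ₑ := by
        rw [e]
        refine (enorm_integral_le_lintegral_enorm _).trans (le_of_eq (lintegral_congr fun w => ?_))
        rw [enorm_mul, Real.enorm_of_nonneg (kerH_nonneg hN hk ht0 z w)]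
      have hm := (measurable_kerH_right t z).ennreal_ofReal
      refine (ENNReal.rpow_le_rpow h1 ha0.le).trans ((lintegral_mul_rpow_le hm.aemeasurable
        (by fun_prop) ha).trans (le_of_eq ?_))
      rw [lintegral_kerH hN hk ht0, ENNReal.one_rpow, one_mul]
    have hsupp : ∀ z w, I z w ≤ Q.indicator (fun z => I z w) z + Q.indicator (I z) w := fun z w => by
      by_cases hz : z ∈ Q
      · rw [indicator_of_mem hz]
        exact le_self_add
      · by_cases hw : w ∈ Q
        · rw [indicator_of_mem hw]
          exact le_add_self
        · have h0 : ψ z = 0 := image_eq_zero_of_notMem_tsupport hz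
          have h1 : ψ w = 0 := image_eq_zero_of_notMem_tsupport hw
          simp [hI, hD, h0, h1, ENNReal.zero_rpow_of_pos ha0]
    rw [eLpNorm_ofReal_eq ha0]
    refine ENNReal.rpow_le_rpow ?_ (by positivity)
    have hm1 : Measurable fun c : Space N k × Space N k => Q.indicator (fun z => I z c.2) c.1 := by
      have : (fun c : Space N k × Space N k => Q.indicator (fun z => I z c.2) c.1) =
        (Prod.fst ⁻¹' Q).indicator fun c => I c.1 c.2 := by
        funext c
        by_cases hc : c.1 ∈ Q
        · rw [indicator_of_mem hc, indicator_of_mem (s := Prod.fst ⁻¹' Q) hc]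
        · rw [indicator_of_notMem hc, indicator_of_notMem (s := Prod.fst ⁻¹' Q) hc]
      rw [this]
      exact hIm.indicator (measurable_fst hQm)
    have hm2 : Measurable fun c : Space N k × Space N k => Q.indicator (I c.1) c.2 := by
      have : (fun c : Space N k × Space N k => Q.indicator (I c.1) c.2) =
        (Prod.snd ⁻¹' Q).indicator fun c => I c.1 c.2 := by
        funext c
        by_cases hc : c.2 ∈ Q
        · rw [indicator_of_mem hc, indicator_of_mem (s := Prod.snd ⁻¹' Q) hc]
        · rw [indicator_of_notMem hc, indicator_of_notMem (s := Prod.snd ⁻¹' Q) hc]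
      rw [this]
      exact hIm.indicator (measurable_snd hQm)
    have hfirst : ∫⁻ z, ∫⁻ w, Q.indicator (fun z => I z w) z = ∫⁻ z in Q, ∫⁻ w, I z w := by
      rw [← lintegral_indicator hQm]
      refine lintegral_congr fun z => ?_
      by_cases hz : z ∈ Q
      · simp only [indicator_of_mem hz]
      · simp only [indicator_of_notMem hz, lintegral_zero]
    have hsecond : ∫⁻ z, ∫⁻ w, Q.indicator (I z) w = ∫⁻ z in Q, ∫⁻ w, I z w := by
      rw [lintegral_lintegral_swap hm2.aemeasurable, ← hfirst]
      refine lintegral_congr fun w => lintegral_congr fun z => ?_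
      by_cases hw : w ∈ Q
      · rw [indicator_of_mem hw, indicator_of_mem hw, hIsym]
      · rw [indicator_of_notMem hw, indicator_of_notMem hw]
    calc ∫⁻ z, ‖(semigroup t ψ - ψ) z‖ₑ ^ a
        ≤ ∫⁻ z, ∫⁻ w, (Q.indicator (fun z => I z w) z + Q.indicator (I z) w) :=
          lintegral_mono fun z => (hpt z).trans (lintegral_mono fun w => hsupp z w)
      _ = ∫⁻ z, ((∫⁻ w, Q.indicator (fun z => I z w) z) + ∫⁻ w, Q.indicator (I z) w) :=
          lintegral_congr fun z => lintegral_add_left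
            (f := fun w => Q.indicator (fun z => I z w) z)
            (hm1.comp (measurable_prodMk_left (x := z))) _
      _ = _ := by
          rw [lintegral_add_left (f := fun z => ∫⁻ w, Q.indicator (fun z => I z w) z)
            hm1.lintegral_prod_right', hfirst, hsecond, two_mul]
  have hz : Tendsto (fun t => (2 * ∫⁻ z in Q, ∫⁻ w, ENNReal.ofReal (kerH t z w) * D z w)
      ^ (1 / a)) (𝓝[>] 0) (𝓝 0) := by
    have h1 := (ENNReal.Tendsto.const_mul hlim (a := 2) (Or.inr (by simp))).ennrpow_const (1 / a)
    rwa [mul_zero, ENNReal.zero_rpow_of_pos (by positivity)] at h1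
  exact tendsto_of_tendsto_of_tendsto_of_le_of_le' tendsto_const_nhds hz
    (Eventually.of_forall fun _ => zero_le) hbound

theorem tendsto_eLpNorm_semigroup_zero (hN : 1 ≤ N) (hk : 1 ≤ k) {a : ℝ} (ha : 1 ≤ a)
    {φ : Space N k → ℝ} (hφ : Measurable φ) (hφa : eLpNorm φ (ENNReal.ofReal a) volume ≠ ∞) :
    Tendsto (fun t => eLpNorm (semigroup t φ - φ) (ENNReal.ofReal a) volume) (𝓝[>] 0) (𝓝 0) := by
  have ha1 : (1 : ℝ≥0∞) ≤ ENNReal.ofReal a := by rwa [ENNReal.one_le_ofReal]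
  rw [ENNReal.tendsto_nhds_zero]
  intro ε hε
  have hε3 : ε / 3 ≠ 0 := (ENNReal.div_pos hε.ne' (by simp)).ne'
  obtain ⟨ψ, hψs, hψε, hψc, hψL⟩ := MemLp.exists_hasCompactSupport_eLpNorm_sub_le
    ENNReal.ofReal_ne_top (⟨hφ.aestronglyMeasurable, lt_top_iff_ne_top.2 hφa⟩ :
      MemLp φ (ENNReal.ofReal a) volume) hε3
  have h0 := ENNReal.tendsto_nhds_zero.1
    (tendsto_eLpNorm_semigroup_of_compactSupport hN hk ha hψc hψs) _ (pos_iff_ne_zero.2 hε3)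
  filter_upwards [h0, self_mem_nhdsWithin] with t ht ht0
  have hψm := hψc.measurable
  have hS := fun {χ : Space N k → ℝ} (hχ : Measurable χ) => measurable_semigroup_slice hχ t
  have e : semigroup t φ - φ = (semigroup t φ - semigroup t ψ) + (semigroup t ψ - ψ) - (φ - ψ) := by
    abel
  rw [e]
  calc _ ≤ eLpNorm (semigroup t φ - semigroup t ψ) (ENNReal.ofReal a) volume +
        eLpNorm (semigroup t ψ - ψ) (ENNReal.ofReal a) volume +
        eLpNorm (φ - ψ) (ENNReal.ofReal a) volume :=
        (eLpNorm_sub_le (((hS hφ).sub (hS hψm)).add ((hS hψm).sub hψm)).aestronglyMeasurable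
          (hφ.sub hψm).aestronglyMeasurable ha1).trans (add_le_add (eLpNorm_add_le
          ((hS hφ).sub (hS hψm)).aestronglyMeasurable ((hS hψm).sub hψm).aestronglyMeasurable ha1)
          le_rfl)
    _ ≤ ε / 3 + ε / 3 + ε / 3 := add_le_add (add_le_add ((eLpNorm_semigroup_sub_le hN hk ha
        (le_of_lt ht0) hφ hψm hφa hψL.2.ne).trans hψε) ht) hψε
    _ = ε := ENNReal.add_thirds ε

/-- Decay of the weighted norms of the linear flow. -/
theorem tendsto_rpow_mul_eLpNorm_semigroup (hN : 1 ≤ N) (hk : 1 ≤ k) {a b : ℝ} (ha : 1 ≤ a)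
    (hab : a < b) {φ : Space N k → ℝ} (hφ : Measurable φ)
    (hφa : eLpNorm φ (ENNReal.ofReal a) volume ≠ ∞) :
    Tendsto (fun t : ℝ => ENNReal.ofReal (t ^ (((N : ℝ) + 2 * k) / 2 * (1 / a - 1 / b))) *
      eLpNorm (semigroup t φ) (ENNReal.ofReal b) volume) (𝓝[>] 0) (𝓝 0) := by
  have hb : 1 ≤ b := ha.trans hab.le
  have hb1 : (1 : ℝ≥0∞) ≤ ENNReal.ofReal b := by rwa [ENNReal.one_le_ofReal]
  have hN' : (0 : ℝ) < N := by exact_mod_cast hN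
  set θ := ((N : ℝ) + 2 * k) / 2 * (1 / a - 1 / b) with hθ
  have hθ0 : 0 < θ := mul_pos (by positivity)
    (sub_pos.2 (one_div_lt_one_div_of_lt (by linarith) hab))
  set C := ENNReal.ofReal (kernelConst N k ^ (1 / a - 1 / b)) with hC
  have hw : ∀ {χ : Space N k → ℝ} (_ : Measurable χ) {t : ℝ}, 0 < t → ENNReal.ofReal (t ^ θ) *
      eLpNorm (semigroup t χ) (ENNReal.ofReal b) volume ≤
      C * eLpNorm χ (ENNReal.ofReal a) volume := fun {χ} hχ {t} ht => by
    refine (mul_le_mul_right (eLpNorm_semigroup_le hN hk ha hab.le ht hχ) _).trans (le_of_eq ?_)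
    rw [ENNReal.ofReal_mul (Real.rpow_nonneg kernelConst_nonneg _), ← mul_assoc, mul_left_comm,
      ← ENNReal.ofReal_mul (by positivity), ← Real.rpow_add ht, add_neg_cancel, Real.rpow_zero,
      ENNReal.ofReal_one, mul_one]
  rw [ENNReal.tendsto_nhds_zero]
  intro ε hε
  have hε2 : 0 < ε / 2 := ENNReal.half_pos hε.ne'
  -- The approximant lies in L^b too, where S(t) is a contraction, so its weighted norm is at most
  -- t^θ‖ψ‖_b → 0. The error is controlled by the smoothing constant C, whence the tolerance ε/2/C.
  obtain ⟨ψ, hψs, hψε, hψc, hψL⟩ := MemLp.exists_hasCompactSupport_eLpNorm_sub_le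
    ENNReal.ofReal_ne_top (⟨hφ.aestronglyMeasurable, lt_top_iff_ne_top.2 hφa⟩ :
      MemLp φ (ENNReal.ofReal a) volume) (ε := ε / 2 / C)
      (ENNReal.div_pos hε2.ne' ENNReal.ofReal_ne_top).ne'
  have hψm := hψc.measurable
  have hψb : eLpNorm ψ (ENNReal.ofReal b) volume ≠ ∞ :=
    (hψc.memLp_of_hasCompactSupport hψs).2.ne
  have hlim : Tendsto (fun t : ℝ => ENNReal.ofReal (t ^ θ) * eLpNorm ψ (ENNReal.ofReal b) volume)
      (𝓝[>] 0) (𝓝 0) := by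
    have h1 : Tendsto (fun t : ℝ => t ^ θ) (𝓝[>] 0) (𝓝 0) := by
      have := (Real.continuousAt_rpow_const 0 θ (Or.inr hθ0.le)).tendsto
      rw [Real.zero_rpow hθ0.ne'] at this
      exact tendsto_nhdsWithin_of_tendsto_nhds this
    have h2 := ENNReal.Tendsto.mul_const (ENNReal.tendsto_ofReal h1) (Or.inr hψb)
    rwa [ENNReal.ofReal_zero, zero_mul] at h2
  filter_upwards [ENNReal.tendsto_nhds_zero.1 hlim _ hε2, self_mem_nhdsWithin] with t ht ht0
  have ht' : 0 < t := ht0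
  have hS := fun {χ : Space N k → ℝ} (hχ : Measurable χ) => measurable_semigroup_slice hχ t
  have h1 : eLpNorm (semigroup t φ) (ENNReal.ofReal b) volume ≤
      eLpNorm (semigroup t (φ - ψ)) (ENNReal.ofReal b) volume +
      eLpNorm ψ (ENNReal.ofReal b) volume := by
    calc _ ≤ eLpNorm (semigroup t (φ - ψ) + semigroup t ψ) (ENNReal.ofReal b) volume := by
          refine eLpNorm_mono_enorm_ae ?_
          filter_upwards [ae_semigroup_sub hN hk ha ht'.le hφ hψm hφa hψL.2.ne] with z hz
          rw [Pi.add_apply, ← hz, sub_add_cancel]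
      _ ≤ _ := (eLpNorm_add_le (hS (hφ.sub hψm)).aestronglyMeasurable
          (hS hψm).aestronglyMeasurable hb1).trans
          (add_le_add le_rfl (eLpNorm_semigroup_le_self hN hk hb ht'.le hψm))
  calc _ ≤ ENNReal.ofReal (t ^ θ) * (eLpNorm (semigroup t (φ - ψ)) (ENNReal.ofReal b) volume +
      eLpNorm ψ (ENNReal.ofReal b) volume) := mul_le_mul_right h1 _
    _ ≤ C * (ε / 2 / C) + ε / 2 := by
        rw [mul_add]
        exact add_le_add ((hw (hφ.sub hψm) ht').trans (mul_le_mul_right hψε _)) ht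
    _ ≤ ε / 2 + ε / 2 := add_le_add ENNReal.mul_div_le le_rfl
    _ = ε := ENNReal.add_halves ε

end

end Grushin

namespace Grushin

noncomputable section

variable {N k : ℕ}

/-! ### Continuity of the Duhamel terms -/

theorem eLpNorm_lvolterra_ne_top {Z : Type*} [MeasureSpace Z] [SFinite (volume : Measure Z)]
    {κ : ℝ → Z → Z → ℝ} (hκ : Measurable fun a : ℝ × Z × Z => κ a.1 a.2.1 a.2.2)
    {F : ℝ → Z → ℝ≥0∞} (hF : Measurable fun a : ℝ × Z => F a.1 a.2) {a b C θ t : ℝ} (hb : 1 ≤ b)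
    (hC : 0 ≤ C) (hop : OpBound κ a b C θ) (hθ : θ < 1) (ht : 0 < t) {M : ℝ≥0∞} (hM : M ≠ ∞)
    (hFM : ∀ τ ∈ Ioo 0 t, eLpNorm (F τ) (ENNReal.ofReal a) volume ≤ M) :
    eLpNorm (lvolterra κ F t) (ENNReal.ofReal b) volume ≠ ∞ := by
  have h := eLpNorm_lvolterra_le_of_weight (β := 0) (ε := 0) (lam := 1) (D := M) hκ hF hb hC hop
    one_pos le_rfl zero_le_one (by linarith) one_pos ht fun τ hτ => (hFM τ hτ).trans
      (le_mul_of_one_le_right zero_le (by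
        rw [ENNReal.one_le_ofReal, neg_zero, Real.rpow_zero, one_mul, one_mul]
        exact Real.one_le_exp hτ.1.le))
  exact ne_top_of_le_ne_top (ENNReal.mul_ne_top hM ENNReal.ofReal_ne_top) h

/-- The integrand `S(s - τ) f(τ)` of the local Duhamel term, extended by zero to `τ ≥ s`. -/
def propagated (f : ℝ → Space N k → ℝ) (s τ : ℝ) (z : Space N k) : ℝ :=
  if τ < s then semigroup (s - τ) (f τ) z else 0

variable {f : ℝ → Space N k → ℝ}

theorem propagated_of_lt {s τ : ℝ} (h : τ < s) : propagated f s τ = semigroup (s - τ) (f τ) :=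
  funext fun _ => if_pos h

theorem propagated_of_le {s τ : ℝ} (h : s ≤ τ) : propagated f s τ = 0 :=
  funext fun _ => if_neg (not_lt.2 h)

theorem measurable_propagated (hf : Measurable fun a : ℝ × Space N k => f a.1 a.2) (s : ℝ) :
    Measurable fun a : ℝ × Space N k => propagated f s a.1 a.2 := by
  have e : (fun a : ℝ × Space N k => propagated f s a.1 a.2) = fun a : ℝ × Space N k =>
      if a.1 < s then ∫ w, kerH (s - a.1) a.2 w * f a.1 w else 0 := by
    funext a
    by_cases h : a.1 < s
    · rw [propagated, if_pos h, if_pos h, semigroup_of_pos (sub_pos.2 h)]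
    · rw [propagated, if_neg h, if_neg h]
  rw [e]
  refine Measurable.ite (measurableSet_lt measurable_fst measurable_const) ?_ measurable_const
  refine (StronglyMeasurable.integral_prod_right' (f := fun c : (ℝ × Space N k) × Space N k =>
    kerH (s - c.1.1) c.1.2 c.2 * f c.1.1 c.2) (Measurable.stronglyMeasurable ?_)).measurable
  exact (measurable_kerH.comp (f := fun c : (ℝ × Space N k) × Space N k =>
    (s - c.1.1, c.1.2, c.2)) (by fun_prop)).mul
    (hf.comp (f := fun c : (ℝ × Space N k) × Space N k => (c.1.1, c.2)) (by fun_prop))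

theorem volterra_eq_integral_propagated (hN : 1 ≤ N) (hk : 1 ≤ k)
    (hf : Measurable fun a : ℝ × Space N k => f a.1 a.2) {s T : ℝ} (hsT : s ≤ T) {z : Space N k}
    (hfin : lvolterra kerH (fun τ w => ‖f τ w‖ₑ) s z ≠ ∞) :
    Integrable (fun τ => propagated f s τ z) (volume.restrict (Ioo 0 T)) ∧
      volterra kerH f s z = ∫ τ in Ioo 0 T, propagated f s τ z := by
  have hi := integrable_volterra measurable_kerH (fun σ hσ => kerH_nonneg hN hk hσ) hf hfin
  have e : ∀ τ ∈ Ioo 0 s, ∫ w, kerH (s - τ) z w * f τ w = propagated f s τ z := fun τ hτ => by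
    rw [propagated, if_pos hτ.2, semigroup_of_pos (sub_pos.2 hτ.2)]
  have h0 : ∀ τ ∈ Ioo 0 T \ Ioo 0 s, propagated f s τ z = 0 := fun τ hτ => by
    rw [propagated, if_neg fun h => hτ.2 ⟨hτ.1.1, h⟩]
  have hsub : Ioo 0 s ⊆ Ioo 0 T := Ioo_subset_Ioo_right hsT
  have hon : IntegrableOn (fun τ => propagated f s τ z) (Ioo 0 s) :=
    (integrableOn_congr_fun e measurableSet_Ioo).1 hi.integral_prod_left
  refine ⟨?_, ?_⟩
  · exact hon.of_forall_sdiff_eq_zero measurableSet_Ioo h0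
  · rw [volterra, integral_prod _ hi, setIntegral_congr_fun measurableSet_Ioo e]
    exact (setIntegral_eq_of_subset_of_forall_sdiff_eq_zero measurableSet_Ioo hsub h0).symm

/-- By Minkowski it suffices to integrate over τ the norm of the difference of the propagated
integrands, which tends to 0 for every τ ≠ t by continuity of the semigroup at positive times. -/
theorem tendsto_volterra_kerH (hN : 1 ≤ N) (hk : 1 ≤ k) {a b : ℝ} (ha : 1 ≤ a) (hab : a ≤ b)
    (hθ : ((N : ℝ) + 2 * k) / 2 * (1 / a - 1 / b) < 1)
    (hf : Measurable fun a : ℝ × Space N k => f a.1 a.2) {T : ℝ} {M : ℝ≥0∞} (hM : M ≠ ∞)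
    (hfM : ∀ τ ∈ Ioo 0 T, eLpNorm (f τ) (ENNReal.ofReal a) volume ≤ M) {t : ℝ} (ht : t ∈ Icc 0 T) :
    Tendsto (fun s => eLpNorm (volterra kerH f s - volterra kerH f t) (ENNReal.ofReal b) volume)
      (𝓝[Icc 0 T] t) (𝓝 0) := by
  have hb : 1 ≤ b := ha.trans hab
  have hb0 : 0 < b := by linarith
  have hb1 : (1 : ℝ≥0∞) ≤ ENNReal.ofReal b := by rwa [ENNReal.one_le_ofReal]
  set θ := ((N : ℝ) + 2 * k) / 2 * (1 / a - 1 / b) with hθd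
  set C := kernelConst N k ^ (1 / a - 1 / b) with hC
  have hC0 : 0 ≤ C := Real.rpow_nonneg kernelConst_nonneg _
  have hfs : ∀ τ, Measurable (f τ) := fun τ => hf.comp (measurable_prodMk_left (x := τ))
  have hpm := measurable_propagated hf
  have hps : ∀ s τ, Measurable (propagated f s τ) := fun s τ =>
    (hpm s).comp (measurable_prodMk_left (x := τ))
  set h : ℝ → ℝ → ℝ≥0∞ := fun s τ => if τ < s then ENNReal.ofReal (C * (s - τ) ^ (-θ)) * M else 0
    with hh
  have hhm : ∀ s, Measurable (h s) := fun s =>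
    Measurable.ite measurableSet_Iio (by fun_prop) measurable_const
  have hle : ∀ s, ∀ τ ∈ Ioo 0 T, eLpNorm (propagated f s τ) (ENNReal.ofReal b) volume ≤ h s τ := by
    intro s τ hτ
    by_cases hs : τ < s
    · simp only [hh, if_pos hs, propagated_of_lt hs]
      exact (eLpNorm_semigroup_le hN hk ha hab (sub_pos.2 hs) (hfs τ)).trans
        (mul_le_mul_right (hfM τ hτ) _)
    · simp [propagated_of_le (not_lt.1 hs)]
  have hhint : ∀ s ∈ Icc 0 T, ∫⁻ τ in Ioo 0 T, h s τ =
      ENNReal.ofReal (C * (betaConst θ 0 * s ^ (1 - θ))) * M := by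
    intro s hs
    have e1 : ∫⁻ τ in Ioo 0 T, h s τ = ∫⁻ τ in Ioo 0 s, ENNReal.ofReal (C * (s - τ) ^ (-θ)) * M := by
      rw [← lintegral_indicator measurableSet_Ioo, ← lintegral_indicator measurableSet_Ioo]
      congr 1
      funext τ
      by_cases h0 : τ ∈ Ioo 0 s
      · rw [indicator_of_mem h0, indicator_of_mem (Ioo_subset_Ioo_right hs.2 h0)]
        simp only [hh, if_pos h0.2]
      · rw [indicator_of_notMem h0]
        by_cases h1 : τ ∈ Ioo 0 T
        · rw [indicator_of_mem h1]
          simp only [hh]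
          rw [if_neg fun h2 => h0 ⟨h1.1, h2⟩]
        · rw [indicator_of_notMem h1]
    rw [e1, lintegral_mul_const _ (by fun_prop)]
    simp_rw [ENNReal.ofReal_mul hC0]
    rw [lintegral_const_mul _ (by fun_prop)]
    rcases hs.1.eq_or_lt with rfl | h0
    · simp [Real.zero_rpow (by linarith : 1 - θ ≠ 0)]
    · have := lintegral_beta hθ (b := 0) zero_lt_one h0
      simp only [neg_zero, Real.rpow_zero, mul_one, sub_zero] at this
      rw [this]
  have hfin : ∀ s ∈ Icc 0 T, ∀ᵐ z, lvolterra kerH (fun τ w => ‖f τ w‖ₑ) s z ≠ ∞ := by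
    intro s hs
    rcases hs.1.eq_or_lt with rfl | h0
    · exact ae_of_all _ fun z => by simp [lvolterra]
    have h1 := eLpNorm_lvolterra_ne_top measurable_kerH (F := fun τ w => ‖f τ w‖ₑ) hf.enorm hb hC0
      (opBound_kerH hN hk ha hab) hθ h0 hM fun τ hτ => by
        rw [eLpNorm_enorm]
        exact hfM τ ⟨hτ.1, hτ.2.trans_le hs.2⟩
    exact (ae_lt_top_of_eLpNorm hb0 (measurable_lvolterra measurable_kerH hf.enorm s) h1).mono
      fun z hz => hz.ne
  have hmink : ∀ s ∈ Icc 0 T, eLpNorm (volterra kerH f s - volterra kerH f t) (ENNReal.ofReal b)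
      volume ≤ ∫⁻ τ in Ioo 0 T, eLpNorm (propagated f s τ - propagated f t τ) (ENNReal.ofReal b)
      volume := by
    intro s hs
    have hm : Measurable fun a : ℝ × Space N k => ‖propagated f s a.1 a.2 - propagated f t a.1 a.2‖ₑ :=
      ((hpm s).sub (hpm t)).enorm
    calc _ ≤ eLpNorm (fun z => ∫⁻ τ in Ioo 0 T, ‖propagated f s τ z - propagated f t τ z‖ₑ)
          (ENNReal.ofReal b) volume := by
          refine eLpNorm_mono_enorm_ae ?_
          filter_upwards [hfin s hs, hfin t ht] with z h1 h2
          obtain ⟨i1, e1⟩ := volterra_eq_integral_propagated hN hk hf hs.2 h1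
          obtain ⟨i2, e2⟩ := volterra_eq_integral_propagated hN hk hf ht.2 h2
          rw [Pi.sub_apply, e1, e2, ← integral_sub i1 i2, enorm_eq_self]
          exact enorm_integral_le_lintegral_enorm _
      _ ≤ ∫⁻ τ in Ioo 0 T, eLpNorm (fun z => ‖propagated f s τ z - propagated f t τ z‖ₑ)
          (ENNReal.ofReal b) volume := eLpNorm_lintegral_le hm hb
      _ = _ := by
          refine lintegral_congr fun τ => ?_
          rw [← eLpNorm_enorm (propagated f s τ - propagated f t τ)]
          rfl
  have hmem : ∀ᶠ s in 𝓝[Icc 0 T] t, s ∈ Icc 0 T := self_mem_nhdsWithin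
  have hnet : ∀ᵐ τ ∂(volume.restrict (Ioo 0 T)), τ ≠ t :=
    ae_restrict_of_ae (Measure.ae_ne volume t)
  have hid : Tendsto (fun s : ℝ => s) (𝓝[Icc 0 T] t) (𝓝 t) :=
    tendsto_nhdsWithin_of_tendsto_nhds tendsto_id
  refine tendsto_of_tendsto_of_tendsto_of_le_of_le' tendsto_const_nhds ?_
    (Eventually.of_forall fun _ => zero_le) (hmem.mono hmink)
  -- The majorant (s-τ)^{-θ} has a singularity that moves with s, so no fixed majorant is used;
  -- instead its integral, a multiple of s^{1-θ}, is continuous in s.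
  refine tendsto_lintegral_zero_of_le (g := fun s τ => h s τ + h t τ) (g₀ := fun τ => h t τ + h t τ)
    (Eventually.of_forall fun s => ?_) (Eventually.of_forall fun s => (hhm s).add (hhm t))
    ((hhm t).add (hhm t)) ?_ ?_ ?_ ?_ ?_
  · simp_rw [← eLpNorm_enorm (propagated f s _ - propagated f t _)]
    exact measurable_eLpNorm_slice (ν := volume)
      (F := fun τ z => ‖propagated f s τ z - propagated f t τ z‖ₑ)
      ((hpm s).sub (hpm t)).enorm hb0
  · refine Eventually.of_forall fun s => ?_
    filter_upwards [ae_restrict_mem measurableSet_Ioo] with τ hτ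
    exact (eLpNorm_sub_le (hps s τ).aestronglyMeasurable (hps t τ).aestronglyMeasurable hb1).trans
      (add_le_add (hle s τ hτ) (hle t τ hτ))
  · filter_upwards [hnet, ae_restrict_mem measurableSet_Ioo] with τ hne hτ
    rcases lt_or_gt_of_ne hne with h1 | h1
    · have hsub : Tendsto (fun s => s - τ) (𝓝[Icc 0 T] t) (𝓝 (t - τ)) := hid.sub_const τ
      have h2 := (tendsto_eLpNorm_semigroup hN hk ha hab (sub_pos.2 h1) (hfs τ)
        (ne_top_of_le_ne_top hM (hfM τ hτ))).comp hsub
      refine h2.congr' ?_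
      filter_upwards [hid.eventually (lt_mem_nhds h1)] with s hs
      rw [propagated_of_lt hs, propagated_of_lt h1]
      rfl
    · refine tendsto_const_nhds.congr' ?_
      filter_upwards [hid.eventually (gt_mem_nhds h1)] with s hs
      rw [propagated_of_le (le_of_lt hs), propagated_of_le (le_of_lt h1)]
      simp
  · filter_upwards [hnet] with τ hne
    refine Tendsto.add ?_ tendsto_const_nhds
    rcases lt_or_gt_of_ne hne with h1 | h1
    · have h2 : Tendsto (fun s => ENNReal.ofReal (C * (s - τ) ^ (-θ)) * M) (𝓝[Icc 0 T] t)
          (𝓝 (ENNReal.ofReal (C * (t - τ) ^ (-θ)) * M)) := by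
        refine ENNReal.Tendsto.mul_const (ENNReal.tendsto_ofReal ?_) (Or.inr hM)
        exact ((hid.sub_const τ).rpow_const (Or.inl (sub_pos.2 h1).ne')).const_mul C
      simp only [hh, if_pos h1]
      refine h2.congr' ?_
      filter_upwards [hid.eventually (lt_mem_nhds h1)] with s hs
      rw [if_pos hs]
    · simp only [hh, if_neg (not_lt.2 (le_of_lt h1))]
      refine tendsto_const_nhds.congr' ?_
      filter_upwards [hid.eventually (gt_mem_nhds h1)] with s hs
      rw [if_neg (not_lt.2 (le_of_lt hs))]
  · have h2 : Tendsto (fun s => (∫⁻ τ in Ioo 0 T, h s τ) + ∫⁻ τ in Ioo 0 T, h t τ) (𝓝[Icc 0 T] t)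
        (𝓝 ((∫⁻ τ in Ioo 0 T, h t τ) + ∫⁻ τ in Ioo 0 T, h t τ)) := by
      refine Tendsto.add ?_ tendsto_const_nhds
      rw [hhint t ht]
      refine Tendsto.congr' (hmem.mono fun s hs => (hhint s hs).symm) ?_
      refine ENNReal.Tendsto.mul_const (ENNReal.tendsto_ofReal ?_) (Or.inr hM)
      exact ((hid.rpow_const (Or.inr (by linarith))).const_mul _).const_mul C
    simp_rw [lintegral_add_right _ (hhm t)]
    exact h2
  · rw [lintegral_add_right _ (hhm t), hhint t ht]
    exact ENNReal.add_ne_top.2 ⟨ENNReal.mul_ne_top ENNReal.ofReal_ne_top hM,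
      ENNReal.mul_ne_top ENNReal.ofReal_ne_top hM⟩

/-- The memory integral of a function. -/
def memoryInt (γ : ℝ) (f : ℝ → Space N k → ℝ) (s : ℝ) (w : Space N k) : ℝ :=
  ∫ τ in Ioo 0 s, (s - τ) ^ (-γ) * f τ w

theorem measurable_memory_indicator (γ : ℝ) (hf : Measurable fun a : ℝ × Space N k => f a.1 a.2) :
    Measurable fun c : (ℝ × Space N k) × ℝ => {c : (ℝ × Space N k) × ℝ | 0 < c.2 ∧ c.2 < c.1.1}.indicator
      (fun c => (c.1.1 - c.2) ^ (-γ) * f c.2 c.1.2) c := by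
  have h1 : MeasurableSet {c : (ℝ × Space N k) × ℝ | 0 < c.2} :=
    measurableSet_lt (by fun_prop) (by fun_prop)
  have h2 : MeasurableSet {c : (ℝ × Space N k) × ℝ | c.2 < c.1.1} :=
    measurableSet_lt (by fun_prop) (by fun_prop)
  refine Measurable.indicator ?_ (h1.inter h2)
  have h3 : Measurable fun c : (ℝ × Space N k) × ℝ => f c.2 c.1.2 :=
    hf.comp (f := fun c : (ℝ × Space N k) × ℝ => (c.2, c.1.2)) (by fun_prop)
  fun_prop

theorem measurable_memoryInt (γ : ℝ) (hf : Measurable fun a : ℝ × Space N k => f a.1 a.2) :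
    Measurable fun a : ℝ × Space N k => memoryInt γ f a.1 a.2 := by
  have e : ∀ a : ℝ × Space N k, memoryInt γ f a.1 a.2 = ∫ τ,
      {c : (ℝ × Space N k) × ℝ | 0 < c.2 ∧ c.2 < c.1.1}.indicator
        (fun c => (c.1.1 - c.2) ^ (-γ) * f c.2 c.1.2) (a, τ) := fun a => by
    rw [memoryInt, ← integral_indicator measurableSet_Ioo]
    rfl
  simp_rw [e]
  exact (StronglyMeasurable.integral_prod_right'
    (measurable_memory_indicator γ hf).stronglyMeasurable).measurable

theorem eLpNorm_memoryInt_le {γ : ℝ} (hγ : γ < 1) {a : ℝ} (ha : 1 ≤ a)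
    (hf : Measurable fun a : ℝ × Space N k => f a.1 a.2) {M : ℝ≥0∞} {s : ℝ} (hs : 0 < s)
    (hfM : ∀ τ ∈ Ioo 0 s, eLpNorm (f τ) (ENNReal.ofReal a) volume ≤ M) :
    eLpNorm (memoryInt γ f s) (ENNReal.ofReal a) volume ≤
      ENNReal.ofReal (betaConst γ 0 * s ^ (1 - γ)) * M := by
  have hm : Measurable fun a : ℝ × Space N k => ‖(s - a.1) ^ (-γ) * f a.1 a.2‖ₑ := by fun_prop
  calc eLpNorm (memoryInt γ f s) (ENNReal.ofReal a) volume
      ≤ eLpNorm (fun w => ∫⁻ τ in Ioo 0 s, ‖(s - τ) ^ (-γ) * f τ w‖ₑ) (ENNReal.ofReal a) volume :=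
        eLpNorm_mono_enorm fun w => by
          rw [enorm_eq_self]
          exact enorm_integral_le_lintegral_enorm _
    _ ≤ ∫⁻ τ in Ioo 0 s, eLpNorm (fun w => ‖(s - τ) ^ (-γ) * f τ w‖ₑ) (ENNReal.ofReal a) volume :=
        eLpNorm_lintegral_le hm ha
    _ ≤ ∫⁻ τ in Ioo 0 s, ENNReal.ofReal ((s - τ) ^ (-γ)) * M := by
        refine setLIntegral_mono_ae' measurableSet_Ioo (ae_of_all _ fun τ hτ => ?_)
        have h0 : 0 ≤ (s - τ) ^ (-γ) := Real.rpow_nonneg (sub_pos.2 hτ.2).le _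
        have e : eLpNorm (fun w => ‖(s - τ) ^ (-γ) * f τ w‖ₑ) (ENNReal.ofReal a) volume =
            eLpNorm ((s - τ) ^ (-γ) • f τ) (ENNReal.ofReal a) volume :=
          eLpNorm_enorm ((s - τ) ^ (-γ) • f τ)
        rw [e, eLpNorm_const_smul, Real.enorm_of_nonneg h0]
        exact mul_le_mul_right (hfM τ hτ) _
    _ = _ := by
        have h := lintegral_beta hγ (b := 0) zero_lt_one hs
        simp only [neg_zero, Real.rpow_zero, mul_one, sub_zero] at h
        rw [lintegral_mul_const _ (by fun_prop), h]

/-- The memory integral of f is again bounded in L^a, and the memory Volterra operator on f is the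
heat one on this integral, so continuity reduces to the local case. -/
theorem tendsto_volterra_kerM (hN : 1 ≤ N) (hk : 1 ≤ k) {γ : ℝ} (hγ : γ < 1) {a b : ℝ} (ha : 1 ≤ a)
    (hab : a ≤ b) (hθ : ((N : ℝ) + 2 * k) / 2 * (1 / a - 1 / b) < 1)
    (hf : Measurable fun a : ℝ × Space N k => f a.1 a.2) {T : ℝ} {M : ℝ≥0∞} (hM : M ≠ ∞)
    (hfM : ∀ τ ∈ Ioo 0 T, eLpNorm (f τ) (ENNReal.ofReal a) volume ≤ M) {t : ℝ} (ht : t ∈ Icc 0 T) :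
    Tendsto (fun s => eLpNorm (volterra (kerM γ) f s - volterra (kerM γ) f t) (ENNReal.ofReal b)
      volume) (𝓝[Icc 0 T] t) (𝓝 0) := by
  have hb : 1 ≤ b := ha.trans hab
  have hb0 : 0 < b := by linarith
  have hC0 : 0 ≤ kernelConst N k ^ (1 / a - 1 / b) := Real.rpow_nonneg kernelConst_nonneg _
  have hmm := measurable_memoryInt γ hf
  set M' : ℝ≥0∞ := ENNReal.ofReal (betaConst γ 0 * T ^ (1 - γ)) * M with hM'd
  have hM' : M' ≠ ∞ := ENNReal.mul_ne_top ENNReal.ofReal_ne_top hM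
  have hmM : ∀ τ ∈ Ioo 0 T, eLpNorm (memoryInt γ f τ) (ENNReal.ofReal a) volume ≤ M' := by
    intro τ hτ
    refine (eLpNorm_memoryInt_le hγ ha hf hτ.1 fun r hr =>
      hfM r ⟨hr.1, hr.2.trans hτ.2⟩).trans (mul_le_mul_left (ENNReal.ofReal_le_ofReal ?_) _)
    exact mul_le_mul_of_nonneg_left (Real.rpow_le_rpow hτ.1.le hτ.2.le (by linarith))
      (betaConst_nonneg _ _)
  have hae : ∀ s ∈ Icc 0 T, volterra (kerM γ) f s =ᵐ[volume] volterra kerH (memoryInt γ f) s := by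
    intro s hs
    rcases hs.1.eq_or_lt with rfl | h0
    · exact ae_of_all _ fun z => by simp [volterra]
    have h1 := eLpNorm_lvolterra_ne_top (measurable_kerM γ) (F := fun τ w => ‖f τ w‖ₑ) hf.enorm hb
      (mul_nonneg hC0 (betaConst_nonneg _ _)) (opBound_kerM hN hk hγ ha hab hθ) (by linarith) h0 hM
      fun τ hτ => by
        rw [eLpNorm_enorm]
        exact hfM τ ⟨hτ.1, hτ.2.trans_le hs.2⟩
    have h2 := eLpNorm_lvolterra_ne_top measurable_kerH (F := fun τ w => ‖memoryInt γ f τ w‖ₑ)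
      hmm.enorm hb hC0 (opBound_kerH hN hk ha hab) hθ h0 hM' fun τ hτ => by
        rw [eLpNorm_enorm]
        exact hmM τ ⟨hτ.1, hτ.2.trans_le hs.2⟩
    filter_upwards [ae_lt_top_of_eLpNorm hb0 (measurable_lvolterra (measurable_kerM γ) hf.enorm s) h1,
      ae_lt_top_of_eLpNorm hb0 (measurable_lvolterra measurable_kerH hmm.enorm s) h2] with z hz1 hz2
    rw [← integral_semigroup_memory hN hk hγ h0.le z hf hz1.ne,
      ← integral_semigroup_local hN hk h0.le z hmm hz2.ne, integral_eq_setIntegral_Ioo _ h0.le,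
      integral_eq_setIntegral_Ioo _ h0.le]
    refine setIntegral_congr_fun measurableSet_Ioo fun r hr => ?_
    have e : (fun w => ∫ τ in (0 : ℝ)..r, (r - τ) ^ (-γ) * f τ w) = memoryInt γ f r := by
      funext w
      rw [integral_eq_setIntegral_Ioo _ hr.1.le, memoryInt]
    simp only [e]
  refine (tendsto_volterra_kerH hN hk ha hab hθ hmm hM' hmM ht).congr' ?_
  filter_upwards [self_mem_nhdsWithin] with s hs
  exact eLpNorm_congr_ae ((hae s hs).sub (hae t ht)).symm

end

end Grushin

namespace Grushin

noncomputable section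

/-- The parameters of the problem, in the subcritical range. -/
structure Problem (N k : ℕ) where
  (γ κ₁ κ₂ p₁ p₂ q : ℝ)
  one_le_N : 1 ≤ N
  one_le_k : 1 ≤ k
  γ_lt_one : γ < 1
  one_lt_p₁ : 1 < p₁
  one_lt_p₂ : 1 < p₂
  one_le_q : 1 ≤ q
  crit₁ : ((N : ℝ) + 2 * k) / 2 * (p₁ - 1) < q
  crit₂ : ((N : ℝ) + 2 * k) / 2 * (p₂ - 1) < q

variable {N k : ℕ}

/-- The weight α is exactly the smoothing exponent of the semigroup from L^q to L^{pq}. -/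
theorem alpha_eq {p q : ℝ} (hp : 1 < p) (hq : 1 ≤ q) :
    alpha N k p q = ((N : ℝ) + 2 * k) / 2 * (1 / q - 1 / (p * q)) := by
  have : q ≠ 0 := by linarith
  have : p ≠ 0 := by linarith
  rw [alpha]
  field_simp

/-- The subcritical condition in the form in which it is used: |u|^p has a singularity τ^{-pα} in
L^q, integrable at τ = 0. -/
theorem mul_alpha_lt_one {p q : ℝ} (hp : 1 < p) (hq : 1 ≤ q)
    (h : ((N : ℝ) + 2 * k) / 2 * (p - 1) < q) : p * alpha N k p q < 1 := by
  have h0 : 0 < q := by linarith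
  have : p ≠ 0 := by linarith
  have e : p * alpha N k p q = ((N : ℝ) + 2 * k) / 2 * (p - 1) / q := by
    rw [alpha]
    field_simp
  rwa [e, div_lt_one h0]

theorem alpha_nonneg {p q : ℝ} (hp : 1 < p) (hq : 1 ≤ q) : 0 ≤ alpha N k p q := by
  have : 0 ≤ p - 1 := by linarith
  rw [alpha]
  positivity

theorem alpha_lt_one {p q : ℝ} (hp : 1 < p) (hq : 1 ≤ q)
    (h : ((N : ℝ) + 2 * k) / 2 * (p - 1) < q) : alpha N k p q < 1 :=
  lt_of_le_of_lt (le_mul_of_one_le_left (alpha_nonneg hp hq) hp.le) (mul_alpha_lt_one hp hq h)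

namespace Problem

variable (P : Problem N k)

/-- The right-hand side of the integral equation, without the linear term. -/
def duhamel (u : ℝ → Space N k → ℝ) : ℝ → Space N k → ℝ :=
  duhamelTerm P.γ P.κ₁ P.κ₂ P.p₁ P.p₂ u

/-- The integral equation in the norms of `X_T`. -/
def weighted : Scheme (Space N k) :=
  heatScheme P.one_le_N P.one_le_k P.γ_lt_one ![P.κ₁, P.κ₂] ![P.p₁, P.p₂] ![P.q, P.q]
    ![P.q, P.p₁ * P.q, P.p₂ * P.q] ![0, alpha N k P.p₁ P.q, alpha N k P.p₂ P.q]
    (by simp [Fin.forall_fin_two, P.one_lt_p₁, P.one_lt_p₂])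
    (by simp [Fin.forall_fin_two, P.one_le_q])
    (by
      have h0 : 0 ≤ P.q := by linarith [P.one_le_q]
      have h1 := le_mul_of_one_le_left h0 P.one_lt_p₁.le
      have h2 := le_mul_of_one_le_left h0 P.one_lt_p₂.le
      simp [Fin.forall_fin_succ, h1, h2])
    (by simp [Fin.forall_fin_two])
    (by simp [Fin.forall_fin_two, mul_alpha_lt_one P.one_lt_p₁ P.one_le_q P.crit₁,
      mul_alpha_lt_one P.one_lt_p₂ P.one_le_q P.crit₂])
    (by
      have h1 := alpha_lt_one P.one_lt_p₁ P.one_le_q P.crit₁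
      have h2 := alpha_lt_one P.one_lt_p₂ P.one_le_q P.crit₂
      rw [alpha_eq P.one_lt_p₁ P.one_le_q] at h1
      rw [alpha_eq P.one_lt_p₂ P.one_le_q] at h2
      intro i j
      fin_cases i <;> fin_cases j <;> simp <;> simp at h1 h2 <;> assumption)
    (by
      have h1 := mul_alpha_lt_one P.one_lt_p₁ P.one_le_q P.crit₁
      have h2 := mul_alpha_lt_one P.one_lt_p₂ P.one_le_q P.crit₂
      have e1 := alpha_eq (N := N) (k := k) P.one_lt_p₁ P.one_le_q
      have e2 := alpha_eq (N := N) (k := k) P.one_lt_p₂ P.one_le_q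
      intro i j
      fin_cases i <;> fin_cases j <;> simp <;> simp at e1 e2 <;> linarith)

/-- The integral equation in `L^q`, for `q ≥ max p₁ p₂`. -/
def uniform (h : max P.p₁ P.p₂ ≤ P.q) : Scheme (Space N k) :=
  heatScheme P.one_le_N P.one_le_k P.γ_lt_one ![P.κ₁, P.κ₂] ![P.p₁, P.p₂] ![P.q / P.p₁, P.q / P.p₂]
    ![P.q, P.q, P.q] ![0, 0, 0]
    (by simp [Fin.forall_fin_two, P.one_lt_p₁, P.one_lt_p₂])
    (by
      have h1 : 0 < P.p₁ := by linarith [P.one_lt_p₁]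
      have h2 : 0 < P.p₂ := by linarith [P.one_lt_p₂]
      simp [Fin.forall_fin_two, one_le_div h1, one_le_div h2, (max_le_iff.1 h).1,
        (max_le_iff.1 h).2])
    (by
      have h0 : 0 ≤ P.q := by linarith [P.one_le_q]
      have h1 := div_le_self h0 P.one_lt_p₁.le
      have h2 := div_le_self h0 P.one_lt_p₂.le
      simp [Fin.forall_fin_succ, h1, h2])
    (by
      have h1 : P.p₁ ≠ 0 := by linarith [P.one_lt_p₁]
      have h2 : P.p₂ ≠ 0 := by linarith [P.one_lt_p₂]
      simp [Fin.forall_fin_two, mul_div_cancel₀, h1, h2])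
    (by simp [Fin.forall_fin_two])
    (by
      have h1 : ((N : ℝ) + 2 * k) / 2 * (1 / (P.q / P.p₁) - 1 / P.q) < 1 := by
        have h0 : 0 < P.q := by linarith [P.one_le_q]
        rw [one_div_div, ← sub_div, ← mul_div_assoc, div_lt_one h0]
        exact P.crit₁
      have h2 : ((N : ℝ) + 2 * k) / 2 * (1 / (P.q / P.p₂) - 1 / P.q) < 1 := by
        have h0 : 0 < P.q := by linarith [P.one_le_q]
        rw [one_div_div, ← sub_div, ← mul_div_assoc, div_lt_one h0]
        exact P.crit₂
      intro i j
      fin_cases i <;> fin_cases j <;> simp at h1 h2 ⊢ <;> assumption)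
    (by
      have h1 : ((N : ℝ) + 2 * k) / 2 * (1 / (P.q / P.p₁) - 1 / P.q) < 1 := by
        have h0 : 0 < P.q := by linarith [P.one_le_q]
        rw [one_div_div, ← sub_div, ← mul_div_assoc, div_lt_one h0]
        exact P.crit₁
      have h2 : ((N : ℝ) + 2 * k) / 2 * (1 / (P.q / P.p₂) - 1 / P.q) < 1 := by
        have h0 : 0 < P.q := by linarith [P.one_le_q]
        rw [one_div_div, ← sub_div, ← mul_div_assoc, div_lt_one h0]
        exact P.crit₂
      intro i j
      fin_cases i <;> fin_cases j <;> simp at h1 h2 ⊢ <;> assumption)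

variable {P}

theorem weighted_duhamel (u : ℝ → Space N k → ℝ) : P.weighted.duhamel u = P.duhamel u := by
  funext t z
  rw [Scheme.duhamel, Fin.sum_univ_two]
  rfl

theorem uniform_duhamel (h : max P.p₁ P.p₂ ≤ P.q) (u : ℝ → Space N k → ℝ) :
    (P.uniform h).duhamel u = P.duhamel u := by
  funext t z
  rw [Scheme.duhamel, Fin.sum_univ_two]
  rfl

theorem weighted_wn_zero (t : ℝ) (f : Space N k → ℝ) :
    P.weighted.wn 0 t f = eLpNorm f (ENNReal.ofReal P.q) volume := by
  simp [Scheme.wn, weighted, heatScheme]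

theorem uniform_wn (h : max P.p₁ P.p₂ ≤ P.q) (j : Fin 3) (t : ℝ) (f : Space N k → ℝ) :
    (P.uniform h).wn j t f = eLpNorm f (ENNReal.ofReal P.q) volume := by
  fin_cases j <;> simp [Scheme.wn, uniform, heatScheme]

theorem measurable_duhamel {u : ℝ → Space N k → ℝ}
    (hu : Measurable fun a : ℝ × Space N k => u a.1 a.2) :
    Measurable fun a : ℝ × Space N k => P.duhamel u a.1 a.2 :=
  measurable_duhamelTerm hu _ _ _ _ _

/-- The Duhamel terms only depend on the classes of the slices. -/
theorem duhamel_congr {u v : ℝ → Space N k → ℝ} (hu : Measurable fun a : ℝ × Space N k => u a.1 a.2)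
    (hv : Measurable fun a : ℝ × Space N k => v a.1 a.2) {t : ℝ}
    (h : ∀ τ ∈ Ioo 0 t, u τ =ᵐ[volume] v τ) (z : Space N k) : P.duhamel u t z = P.duhamel v t z := by
  have hμ : ∀ᵐ a : ℝ × Space N k ∂((volume.restrict (Ioo 0 t)).prod volume), u a.1 a.2 = v a.1 a.2 :=
    (Measure.ae_prod_iff_ae_ae (measurableSet_eq_fun hu hv)).2
      ((ae_restrict_iff' measurableSet_Ioo).2 (ae_of_all _ h))
  have hvol : ∀ (κ : ℝ → Space N k → Space N k → ℝ) (p : ℝ),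
      volterra κ (fun τ w => power p (u τ w)) t z = volterra κ (fun τ w => power p (v τ w)) t z :=
    fun κ p => by
      refine integral_congr_ae ?_
      filter_upwards [hμ] with a ha
      rw [ha]
  simp only [duhamel, duhamelTerm, hvol]

/-- Solutions of the integral equation with Volterra operators, for positive times. -/
structure Solves (P : Problem N k) (u₀ : Space N k → ℝ) (T : ℝ) (u : ℝ → Space N k → ℝ) : Prop where
  measurable : Measurable fun a : ℝ × Space N k => u a.1 a.2
  equation : ∀ t ∈ Ioc 0 T, ∀ᵐ z, u t z = semigroup t u₀ z + P.duhamel u t z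

/-- Mild solutions of the problem. -/
def IsMild (P : Problem N k) (T : ℝ) (u₀ : Space N k → ℝ) (u : ℝ → Space N k → ℝ) : Prop :=
  IsMildSolution P.γ P.κ₁ P.κ₂ P.p₁ P.p₂ P.q T u₀ u

theorem IsMild.exists_solves {T : ℝ} {u₀ : Space N k → ℝ} (hu₀ : Measurable u₀)
    {u : ℝ → Space N k → ℝ} (h : P.IsMild T u₀ u) :
    ∃ v, P.Solves u₀ T v ∧ ∀ t ∈ Icc 0 T, u t =ᵐ[volume] v t := by
  obtain ⟨v, hv, huv, heq⟩ :=
    IsMildSolution.exists_volterra P.one_le_N P.one_le_k P.γ_lt_one hu₀ h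
  exact ⟨v, ⟨hv, fun t ht => ae_of_all _ fun z => heq t (Ioc_subset_Icc_self ht) z⟩, huv⟩

theorem IsMild.initial {T : ℝ} (hT : 0 ≤ T) {u₀ : Space N k → ℝ} {u : ℝ → Space N k → ℝ}
    (h : P.IsMild T u₀ u) : u 0 =ᵐ[volume] u₀ := by
  filter_upwards [h.equation 0 ⟨le_rfl, hT⟩] with z hz
  simpa [semigroup] using hz

theorem Solves.isMild {S : Scheme (Space N k)} (h0 : S.ker 0 = kerM P.γ) (h1 : S.ker 1 = kerH)
    (hp0 : S.p 0 = P.p₁) (hp1 : S.p 1 = P.p₂) {T : ℝ} {u₀ : Space N k → ℝ}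
    {u : ℝ → Space N k → ℝ} (h : P.Solves u₀ T u) (hu0 : u 0 =ᵐ[volume] u₀) {M R : ℝ≥0∞}
    (hM : M ≠ ∞) (hb : ∀ t ∈ Icc 0 T, eLpNorm (u t) (ENNReal.ofReal P.q) volume ≤ M) (hR : R ≠ ∞)
    (hR' : ∀ τ ∈ Ioo 0 T, ∀ i : Fin 2, S.wn i.succ τ (u τ) ≤ R) : P.IsMild T u₀ u := by
  have hfin := fun t (ht : t ∈ Ioc 0 T) => Scheme.ae_lvolterra_ne_top (S := S) h.measurable hR ht.1
    fun τ hτ => hR' τ ⟨hτ.1, hτ.2.trans_le ht.2⟩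
  refine isMildSolution_of_volterra P.one_le_N P.one_le_k P.γ_lt_one h.measurable hu0 hM hb
    (fun t ht => ?_) (fun t ht => ?_) h.equation
  · have := hfin t ht 0
    rwa [h0, hp0] at this
  · have := hfin t ht 1
    rwa [h1, hp1] at this

end Problem

end

end Grushin

namespace Grushin

noncomputable section

variable {N k : ℕ}

namespace Problem

variable {P : Problem N k}

/-! ### Local existence -/

/-- A bound for the linear flow as a map from `L^q` to `X_T`. -/
def linConst (P : Problem N k) : ℝ :=
  1 + kernelConst N k ^ (1 / P.q - 1 / (P.p₁ * P.q)) + kernelConst N k ^ (1 / P.q - 1 / (P.p₂ * P.q))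

theorem one_le_linConst : 1 ≤ P.linConst := by
  have h := fun x => Real.rpow_nonneg (kernelConst_nonneg (N := N) (k := k)) x
  have h1 := h (1 / P.q - 1 / (P.p₁ * P.q))
  have h2 := h (1 / P.q - 1 / (P.p₂ * P.q))
  rw [linConst]
  linarith

theorem weightedNorm_semigroup_le (hN : 1 ≤ N) (hk : 1 ≤ k) {p q : ℝ} (hp : 1 < p) (hq : 1 ≤ q)
    {φ : Space N k → ℝ} (hφ : Measurable φ) {t : ℝ} (ht : 0 < t) :
    weightedNorm p q t (semigroup t φ) ≤ ENNReal.ofReal (kernelConst N k ^ (1 / q - 1 / (p * q))) *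
      eLpNorm φ (ENNReal.ofReal q) volume := by
  have hqp : q ≤ p * q := le_mul_of_one_le_left (by linarith) hp.le
  refine (mul_le_mul_right (eLpNorm_semigroup_le hN hk hq hqp ht hφ) _).trans (le_of_eq ?_)
  rw [alpha_eq hp hq, ENNReal.ofReal_mul (Real.rpow_nonneg kernelConst_nonneg _), ← mul_assoc,
    mul_left_comm, ← ENNReal.ofReal_mul (by positivity), ← Real.rpow_add ht, add_neg_cancel,
    Real.rpow_zero, ENNReal.ofReal_one, mul_one]

theorem wn_semigroup_le {φ : Space N k → ℝ} (hφ : Measurable φ) {t : ℝ} (ht : 0 < t) (j : Fin 3) :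
    P.weighted.wn j t (semigroup t φ) ≤
      ENNReal.ofReal P.linConst * eLpNorm φ (ENNReal.ofReal P.q) volume := by
  have h := fun x => Real.rpow_nonneg (kernelConst_nonneg (N := N) (k := k)) x
  have h1 := h (1 / P.q - 1 / (P.p₁ * P.q))
  have h2 := h (1 / P.q - 1 / (P.p₂ * P.q))
  fin_cases j
  · refine (weighted_wn_zero t _).trans_le ((eLpNorm_semigroup_le_self P.one_le_N P.one_le_k
      P.one_le_q ht.le hφ).trans (le_mul_of_one_le_left zero_le ?_))
    rw [ENNReal.one_le_ofReal]
    exact one_le_linConst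
  · refine (weightedNorm_semigroup_le P.one_le_N P.one_le_k P.one_lt_p₁ P.one_le_q hφ ht).trans
      (mul_le_mul_left (ENNReal.ofReal_le_ofReal ?_) _)
    rw [linConst]
    linarith
  · refine (weightedNorm_semigroup_le P.one_le_N P.one_le_k P.one_lt_p₂ P.one_le_q hφ ht).trans
      (mul_le_mul_left (ENNReal.ofReal_le_ofReal ?_) _)
    rw [linConst]
    linarith

/-- The time of existence for initial conditions of norm at most `ρ`. -/
def time (P : Problem N k) (ρ : ℝ) : ℝ :=
  (P.weighted.exists_isContractionTime
    (ENNReal.mul_ne_top (ENNReal.ofNat_ne_top (n := 2)) (ENNReal.ofReal_ne_top (r := P.linConst * ρ)))).choose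

theorem time_pos (ρ : ℝ) : 0 < P.time ρ := (Exists.choose_spec (P.weighted.exists_isContractionTime
  (ENNReal.mul_ne_top (ENNReal.ofNat_ne_top (n := 2)) (ENNReal.ofReal_ne_top (r := P.linConst * ρ))))).1

theorem isContractionTime_time (ρ : ℝ) :
    P.weighted.IsContractionTime (2 * ENNReal.ofReal (P.linConst * ρ)) (P.time ρ) :=
  (Exists.choose_spec (P.weighted.exists_isContractionTime
  (ENNReal.mul_ne_top (ENNReal.ofNat_ne_top (n := 2)) (ENNReal.ofReal_ne_top (r := P.linConst * ρ))))).2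

theorem radius_ne_top (ρ : ℝ) : 2 * ENNReal.ofReal (P.linConst * ρ) ≠ ∞ :=
  ENNReal.mul_ne_top (by simp) ENNReal.ofReal_ne_top

theorem wn_semigroup_le_of_le {φ : Space N k → ℝ} (hφ : Measurable φ) {ρ : ℝ}
    (hρ : eLpNorm φ (ENNReal.ofReal P.q) volume ≤ ENNReal.ofReal ρ) {t : ℝ} (ht : 0 < t)
    (j : Fin 3) : P.weighted.wn j t (semigroup t φ) ≤ ENNReal.ofReal (P.linConst * ρ) := by
  refine (wn_semigroup_le hφ ht j).trans ((mul_le_mul_right hρ _).trans (le_of_eq ?_))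
  rw [ENNReal.ofReal_mul (zero_le_one.trans one_le_linConst)]

theorem exists_solves {φ : Space N k → ℝ} (hφ : Measurable φ) {ρ : ℝ}
    (hρ : eLpNorm φ (ENNReal.ofReal P.q) volume ≤ ENNReal.ofReal ρ) :
    ∃ u : ℝ → Space N k → ℝ, P.Solves φ (P.time ρ) u ∧ u 0 = φ ∧
      (∀ t ∈ Ioc 0 (P.time ρ), ∀ j, P.weighted.wn j t (u t) ≤
        2 * ENNReal.ofReal (P.linConst * ρ)) ∧
      (0 ≤ᵐ[volume] φ → 0 ≤ P.κ₁ → 0 ≤ P.κ₂ → ∀ t, 0 < t → ∀ z, 0 ≤ u t z) := by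
  -- Only positive times matter for the equation. The value 0 elsewhere makes g nonnegative at all
  -- times when φ is, as the nonnegativity clause of the existence theorem requires.
  set g : ℝ → Space N k → ℝ := fun t z => if 0 < t then semigroup t φ z else 0 with hg
  have hgm : Measurable fun a : ℝ × Space N k => g a.1 a.2 :=
    Measurable.ite (measurableSet_lt measurable_const measurable_fst) (measurable_semigroup hφ)
      measurable_const
  have hgt : ∀ t, 0 < t → g t = semigroup t φ := fun t ht => funext fun z => if_pos ht
  obtain ⟨v, hvm, hveq, hvb, hvpos⟩ := (isContractionTime_time (P := P) ρ).exists_solution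
    ENNReal.ofReal_ne_top hgm fun t ht j => by
      rw [hgt t ht.1]
      exact wn_semigroup_le_of_le hφ hρ ht.1 j
  -- The initial value is inserted by hand; the Duhamel terms do not see it.
  set u : ℝ → Space N k → ℝ := fun t z => if 0 < t then v t z else φ z with hu
  have hut : ∀ t, 0 < t → u t = v t := fun t ht => funext fun z => if_pos ht
  have hum : Measurable fun a : ℝ × Space N k => u a.1 a.2 :=
    Measurable.ite (measurableSet_lt measurable_const measurable_fst) hvm (by fun_prop)
  refine ⟨u, ⟨hum, fun t ht => ?_⟩, funext fun z => if_neg (lt_irrefl 0), fun t ht j => ?_, ?_⟩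
  · filter_upwards [hveq t ht] with z hz
    rw [hut t ht.1, hz, hgt t ht.1, weighted_duhamel,
      duhamel_congr hum hvm fun τ hτ => by rw [hut τ hτ.1]]
  · rw [hut t ht.1]
    exact hvb t ht j
  · intro hφ0 h1 h2 t ht z
    rw [hut t ht]
    refine hvpos (fun s w => ?_) (fun i => ?_) t z
    · by_cases hs : 0 < s
      · rw [hgt s hs, semigroup_of_pos hs]
        refine integral_nonneg_of_ae ?_
        filter_upwards [hφ0] with y hy
        exact mul_nonneg (kerH_nonneg P.one_le_N P.one_le_k hs w y) hy
      · exact (if_neg hs).ge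
    · fin_cases i
      · exact h1
      · exact h2

theorem Solves.ae_eq_of_weighted {φ : Space N k → ℝ} {T : ℝ} {u v : ℝ → Space N k → ℝ}
    (hu : P.Solves φ T u) (hv : P.Solves φ T v) {R R' : ℝ≥0∞} (hR : R ≠ ∞) (hR' : R' ≠ ∞)
    (hbu : ∀ τ ∈ Ioo 0 T, ∀ i : Fin 2, P.weighted.wn i.succ τ (u τ) ≤ R)
    (hbv : ∀ τ ∈ Ioo 0 T, ∀ i : Fin 2, P.weighted.wn i.succ τ (v τ) ≤ R') :
    ∀ t ∈ Ioc 0 T, u t =ᵐ[volume] v t :=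
  Scheme.ae_eq_of_solutions (S := P.weighted) (g := fun t => semigroup t φ) hu.measurable
    hv.measurable (ENNReal.add_ne_top.2 ⟨hR, hR'⟩)
    (fun τ hτ i => (hbu τ hτ i).trans le_self_add) (fun τ hτ i => (hbv τ hτ i).trans le_add_self)
    (by rw [weighted_duhamel]; exact hu.equation) (by rw [weighted_duhamel]; exact hv.equation)

theorem Solves.mono {φ : Space N k → ℝ} {T T' : ℝ} {u : ℝ → Space N k → ℝ} (hu : P.Solves φ T u)
    (h : T' ≤ T) : P.Solves φ T' u :=
  ⟨hu.measurable, fun t ht => hu.equation t ⟨ht.1, ht.2.trans h⟩⟩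

theorem wn_congr {j : Fin 3} {t : ℝ} {f g : Space N k → ℝ} {S : Scheme (Space N k)}
    (h : f =ᵐ[volume] g) : S.wn j t f = S.wn j t g := by
  rw [Scheme.wn, Scheme.wn, eLpNorm_congr_ae h]

/-- A solution with any finite bound coincides, by uniqueness, with the one constructed by iteration
and inherits its bound. Finiteness of the X_T norm thus suffices in the Lipschitz estimate, where
the contraction is available only in a fixed ball. -/
theorem Solves.wn_le {φ : Space N k → ℝ} (hφ : Measurable φ) {ρ : ℝ}
    (hρ : eLpNorm φ (ENNReal.ofReal P.q) volume ≤ ENNReal.ofReal ρ) {T : ℝ} (hT : T ≤ P.time ρ)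
    {u : ℝ → Space N k → ℝ} (hu : P.Solves φ T u) {R : ℝ≥0∞} (hR : R ≠ ∞)
    (hbu : ∀ τ ∈ Ioo 0 T, ∀ i : Fin 2, P.weighted.wn i.succ τ (u τ) ≤ R) :
    ∀ t ∈ Ioc 0 T, ∀ j, P.weighted.wn j t (u t) ≤ 2 * ENNReal.ofReal (P.linConst * ρ) := by
  obtain ⟨v, hv, -, hb, -⟩ := exists_solves hφ hρ
  intro t ht j
  rw [wn_congr (hu.ae_eq_of_weighted (hv.mono hT) hR (radius_ne_top ρ) hbu
    (fun τ hτ i => hb τ ⟨hτ.1, hτ.2.le.trans hT⟩ _) t ht)]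
  exact hb t ⟨ht.1, ht.2.trans hT⟩ j

theorem wn_succ_le_normX {T : ℝ} {u : ℝ → Space N k → ℝ} {τ : ℝ} (hτ : τ ∈ Ioo 0 T) (i : Fin 2) :
    P.weighted.wn i.succ τ (u τ) ≤ normX P.p₁ P.p₂ P.q T u := by
  fin_cases i
  · exact (le_iSup₂ (f := fun t (_ : t ∈ Ioo 0 T) => weightedNorm P.p₁ P.q t (u t)) τ hτ).trans
      ((le_max_left _ _).trans le_add_self)
  · exact (le_iSup₂ (f := fun t (_ : t ∈ Ioo 0 T) => weightedNorm P.p₂ P.q t (u t)) τ hτ).trans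
      ((le_max_right _ _).trans le_add_self)

theorem memX_of_wn_le {T : ℝ} {u : ℝ → Space N k → ℝ}
    (hu : Measurable fun a : ℝ × Space N k => u a.1 a.2) {R : ℝ≥0∞} (hR : R ≠ ∞)
    (h : ∀ t ∈ Ioo 0 T, ∀ j, P.weighted.wn j t (u t) ≤ R) : MemX P.p₁ P.p₂ P.q T u where
  aestronglyMeasurable := hu.aestronglyMeasurable
  aestronglyMeasurable_slice t _ := (hu.comp (measurable_prodMk_left (x := t))).aestronglyMeasurable
  normX_lt_top := by
    refine lt_of_le_of_lt (add_le_add (iSup₂_le fun t ht => ?_) (max_le (iSup₂_le fun t ht => ?_)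
      (iSup₂_le fun t ht => ?_))) (lt_top_iff_ne_top.2 (ENNReal.add_ne_top.2 ⟨hR, hR⟩))
    · rw [← weighted_wn_zero t]
      exact h t ht 0
    · exact h t ht 1
    · exact h t ht 2

theorem Solves.isMild_of_weighted {T : ℝ} {φ : Space N k → ℝ} {u : ℝ → Space N k → ℝ}
    (h : P.Solves φ T u) (hu0 : u 0 =ᵐ[volume] φ)
    (hφ : eLpNorm φ (ENNReal.ofReal P.q) volume ≠ ∞) {R : ℝ≥0∞} (hR : R ≠ ∞)
    (hb : ∀ t ∈ Ioc 0 T, ∀ j, P.weighted.wn j t (u t) ≤ R) : P.IsMild T φ u := by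
  refine h.isMild (S := P.weighted) rfl rfl rfl rfl hu0 (ENNReal.add_ne_top.2 ⟨hφ, hR⟩)
    (fun t ht => ?_) hR (fun τ hτ i => hb τ ⟨hτ.1, hτ.2.le⟩ _)
  rcases ht.1.eq_or_lt with rfl | h0
  · rw [eLpNorm_congr_ae hu0]
    exact le_self_add
  · rw [← weighted_wn_zero t]
    exact (hb t ⟨h0, ht.2⟩ 0).trans le_add_self

/-- A mild solution has a version that solves the Volterra equation, with norms controlled by the
norm of `X_T`. -/
theorem IsMild.exists_solves_wn_le {T : ℝ} {φ : Space N k → ℝ} (hφ : Measurable φ)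
    {u : ℝ → Space N k → ℝ} (h : P.IsMild T φ u) :
    ∃ v, P.Solves φ T v ∧ (∀ t ∈ Icc 0 T, u t =ᵐ[volume] v t) ∧
      ∀ τ ∈ Ioo 0 T, ∀ i : Fin 2, P.weighted.wn i.succ τ (v τ) ≤ normX P.p₁ P.p₂ P.q T u := by
  obtain ⟨v, hv, huv⟩ := h.exists_solves hφ
  refine ⟨v, hv, huv, fun τ hτ i => ?_⟩
  rw [← wn_congr (huv τ (Ioo_subset_Icc_self hτ))]
  exact wn_succ_le_normX hτ i

/-- Lipschitz dependence on the initial condition. -/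
theorem dist_le {φ ψ : Space N k → ℝ} (hφ : Measurable φ) (hψ : Measurable ψ) {ρ : ℝ}
    (hρφ : eLpNorm φ (ENNReal.ofReal P.q) volume ≤ ENNReal.ofReal ρ)
    (hρψ : eLpNorm ψ (ENNReal.ofReal P.q) volume ≤ ENNReal.ofReal ρ) {T : ℝ} (hT0 : 0 < T)
    (hT : T ≤ P.time ρ) {u v : ℝ → Space N k → ℝ} (hu : P.IsMild T φ u)
    (huX : MemX P.p₁ P.p₂ P.q T u) (hv : P.IsMild T ψ v) (hvX : MemX P.p₁ P.p₂ P.q T v) :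
    (⨆ t ∈ Icc 0 T, eLpNorm (u t - v t) (ENNReal.ofReal P.q) volume) +
        max (⨆ t ∈ Ioo 0 T, weightedNorm P.p₁ P.q t (u t - v t))
          (⨆ t ∈ Ioo 0 T, weightedNorm P.p₂ P.q t (u t - v t)) ≤
      ENNReal.ofReal (4 * P.linConst) * eLpNorm (φ - ψ) (ENNReal.ofReal P.q) volume := by
  obtain ⟨u', hu', huu, hbu⟩ := hu.exists_solves_wn_le hφ
  obtain ⟨v', hv', hvv, hbv⟩ := hv.exists_solves_wn_le hψ
  have hbu' := hu'.wn_le hφ hρφ hT huX.normX_lt_top.ne hbu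
  have hbv' := hv'.wn_le hψ hρψ hT hvX.normX_lt_top.ne hbv
  set E := eLpNorm (φ - ψ) (ENNReal.ofReal P.q) volume with hE
  have hφfin := ne_top_of_le_ne_top ENNReal.ofReal_ne_top hρφ
  have hψfin := ne_top_of_le_ne_top ENNReal.ofReal_ne_top hρψ
  have hmain := ((isContractionTime_time (P := P) ρ).mono hT).wn_sub_le (radius_ne_top ρ)
    hu'.measurable hv'.measurable (g := fun t => semigroup t φ) (g' := fun t => semigroup t ψ)
    (measurable_semigroup_slice hφ) (measurable_semigroup_slice hψ)
    (fun τ hτ i => hbu' τ ⟨hτ.1, hτ.2.le⟩ _) (fun τ hτ i => hbv' τ ⟨hτ.1, hτ.2.le⟩ _)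
    (by rw [weighted_duhamel]; exact hu'.equation) (by rw [weighted_duhamel]; exact hv'.equation)
    (G := ENNReal.ofReal P.linConst * E) fun t ht j => by
      have hae : semigroup t φ - semigroup t ψ =ᵐ[volume] semigroup t (φ - ψ) :=
        ae_semigroup_sub P.one_le_N P.one_le_k P.one_le_q ht.1.le hφ hψ hφfin hψfin
      rw [wn_congr hae]
      exact wn_semigroup_le (hφ.sub hψ) ht.1 j
  have hdiff : ∀ t ∈ Ioc 0 T, ∀ j, P.weighted.wn j t (u t - v t) ≤
      2 * (ENNReal.ofReal P.linConst * E) := fun t ht j => by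
    rw [wn_congr ((huu t (Ioc_subset_Icc_self ht)).sub (hvv t (Ioc_subset_Icc_self ht)))]
    exact hmain t ht j
  have h1 : (1 : ℝ≥0∞) ≤ ENNReal.ofReal P.linConst := by
    rw [ENNReal.one_le_ofReal]
    exact one_le_linConst
  have hzero : eLpNorm (u 0 - v 0) (ENNReal.ofReal P.q) volume ≤
      2 * (ENNReal.ofReal P.linConst * E) := by
    rw [eLpNorm_congr_ae ((hu.initial hT0.le).sub (hv.initial hT0.le)), ← mul_assoc]
    exact le_mul_of_one_le_left zero_le (one_le_mul one_le_two h1)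
  -- The factor 2 comes from the contraction constant 1/2. It occurs twice, once for the L^q norm
  -- and once for the weighted norms, whence the constant 4.
  calc _ ≤ 2 * (ENNReal.ofReal P.linConst * E) + 2 * (ENNReal.ofReal P.linConst * E) := by
        refine add_le_add (iSup₂_le fun t ht => ?_) (max_le (iSup₂_le fun t ht => ?_)
          (iSup₂_le fun t ht => ?_))
        · rcases ht.1.eq_or_lt with rfl | h0
          · exact hzero
          · rw [← weighted_wn_zero t]
            exact hdiff t ⟨h0, ht.2⟩ 0
        · exact hdiff t ⟨ht.1, ht.2.le⟩ 1
        · exact hdiff t ⟨ht.1, ht.2.le⟩ 2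
    _ = _ := by
        rw [ENNReal.ofReal_mul (by norm_num)]
        norm_num
        ring

/-- The weighted norms of solutions tend to zero at the initial time. -/
theorem Solves.tendsto_wn {T : ℝ} (hT : 0 < T) {φ : Space N k → ℝ} (hφ : Measurable φ)
    (hφq : eLpNorm φ (ENNReal.ofReal P.q) volume ≠ ∞) {u : ℝ → Space N k → ℝ}
    (h : P.Solves φ T u) {R : ℝ≥0∞} (hR : R ≠ ∞)
    (hb : ∀ τ ∈ Ioo 0 T, ∀ i : Fin 2, P.weighted.wn i.succ τ (u τ) ≤ R) (i : Fin 2) :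
    Tendsto (fun t => P.weighted.wn i.succ t (u t)) (𝓝[>] 0) (𝓝 0) := by
  have hq0 : 0 < P.q := by linarith [P.one_le_q]
  have hS : Tendsto (fun t => P.weighted.wn i.succ t (semigroup t φ)) (𝓝[>] 0) (𝓝 0) := by
    fin_cases i
    · have h1 := tendsto_rpow_mul_eLpNorm_semigroup P.one_le_N P.one_le_k P.one_le_q
        (lt_mul_of_one_lt_left hq0 P.one_lt_p₁) hφ hφq
      rw [← alpha_eq P.one_lt_p₁ P.one_le_q] at h1
      exact h1
    · have h1 := tendsto_rpow_mul_eLpNorm_semigroup P.one_le_N P.one_le_k P.one_le_q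
        (lt_mul_of_one_lt_left hq0 P.one_lt_p₂) hφ hφq
      rw [← alpha_eq P.one_lt_p₂ P.one_le_q] at h1
      exact h1
  have hD := Scheme.tendsto_wn_diffBound (S := P.weighted) h.measurable hR hT hb i.succ
  have hsum := hS.add hD
  rw [add_zero] at hsum
  refine tendsto_of_tendsto_of_tendsto_of_le_of_le' tendsto_const_nhds hsum
    (Eventually.of_forall fun _ => zero_le) ?_
  filter_upwards [Ioo_mem_nhdsGT hT] with t ht
  have hz : Measurable fun a : ℝ × Space N k => (0 : ℝ → Space N k → ℝ) a.1 a.2 := measurable_const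
  refine Scheme.wn_le_add (measurable_semigroup_slice hφ t).enorm.aemeasurable
    (Scheme.measurable_diffBound h.measurable hz t).enorm.aemeasurable ?_
  filter_upwards [h.equation t ⟨ht.1, ht.2.le⟩] with z hz
  rw [hz, ← weighted_duhamel]
  exact (enorm_add_le _ _).trans (add_le_add le_rfl (Scheme.enorm_duhamel_le h.measurable t z))

end Problem

end

end Grushin

namespace Grushin

noncomputable section

variable {N k : ℕ}

/-! ### Bounded solutions in `L^q`, for large `q` -/

theorem eLpNorm_power_le {Z : Type*} [MeasurableSpace Z] {ν : Measure Z} [SFinite ν] {p q : ℝ}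
    (hp : 1 < p) (hq : p ≤ q) {f : Z → ℝ} (hf : Measurable f) :
    eLpNorm (fun z => power p (f z)) (ENNReal.ofReal (q / p)) ν ≤
      ENNReal.ofReal p * eLpNorm f (ENNReal.ofReal q) ν ^ (p - 1) *
        eLpNorm f (ENNReal.ofReal q) ν := by
  have hp0 : p ≠ 0 := by linarith
  have h := eLpNorm_power_sub_le (ν := ν) hp ((one_le_div (by linarith)).2 hq) hf
    (measurable_const (a := (0 : ℝ)))
  have e : eLpNorm (fun _ : Z => (0 : ℝ)) (ENNReal.ofReal q) ν = 0 := eLpNorm_zero'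
  have e' : f - (fun _ => (0 : ℝ)) = f := sub_zero f
  simp only [power_zero, sub_zero, mul_div_cancel₀ q hp0, e, add_zero, e'] at h
  rwa [eLpNorm_enorm] at h

theorem tendsto_eLpNorm_semigroup_Icc (hN : 1 ≤ N) (hk : 1 ≤ k) {a : ℝ} (ha : 1 ≤ a)
    {φ : Space N k → ℝ} (hφ : Measurable φ) (hφa : eLpNorm φ (ENNReal.ofReal a) volume ≠ ∞) {T t : ℝ}
    (ht : t ∈ Icc 0 T) : Tendsto (fun s => eLpNorm (semigroup s φ - semigroup t φ)
      (ENNReal.ofReal a) volume) (𝓝[Icc 0 T] t) (𝓝 0) := by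
  rcases ht.1.eq_or_lt with rfl | h0
  · have e : semigroup 0 φ = φ := funext fun z => by simp [semigroup]
    have h : 𝓝[Icc 0 T] (0 : ℝ) ≤ pure 0 ⊔ 𝓝[>] 0 := by
      rw [← nhdsWithin_singleton, ← nhdsWithin_union, singleton_union, Ioi_insert]
      exact nhdsWithin_mono _ Icc_subset_Ici_self
    refine Tendsto.mono_left (Tendsto.sup ?_ ?_) h
    · exact tendsto_pure_left.2 fun s hs => by simpa using mem_of_mem_nhds hs
    · rw [e]
      exact tendsto_eLpNorm_semigroup_zero hN hk ha hφ hφa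
  · exact (tendsto_eLpNorm_semigroup hN hk ha le_rfl h0 hφ hφa).mono_left nhdsWithin_le_nhds

namespace Problem

variable {P : Problem N k}

/-- Solutions of the integral equation that are bounded in `L^q`. -/
structure BddSolves (P : Problem N k) (φ : Space N k → ℝ) (T : ℝ) (u : ℝ → Space N k → ℝ) : Prop
    extends P.Solves φ T u where
  initial : u 0 =ᵐ[volume] φ
  bounded : ∃ M : ℝ≥0∞, M ≠ ∞ ∧ ∀ t ∈ Icc 0 T, eLpNorm (u t) (ENNReal.ofReal P.q) volume ≤ M

variable {φ : Space N k → ℝ} {T : ℝ} {u v : ℝ → Space N k → ℝ}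

theorem IsMild.exists_bddSolves (hT : 0 ≤ T) (hφ : Measurable φ) (h : P.IsMild T φ u) :
    ∃ v, P.BddSolves φ T v ∧ ∀ t ∈ Icc 0 T, u t =ᵐ[volume] v t := by
  obtain ⟨v, hv, huv⟩ := h.exists_solves hφ
  refine ⟨v, ⟨hv, (huv 0 ⟨le_rfl, hT⟩).symm.trans (h.initial hT), _, h.bounded.ne, fun t ht => ?_⟩, huv⟩
  rw [← eLpNorm_congr_ae (huv t ht)]
  exact le_iSup₂ (f := fun t (_ : t ∈ Icc 0 T) => eLpNorm (u t) (ENNReal.ofReal P.q) volume) t ht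

theorem BddSolves.isMild (h : max P.p₁ P.p₂ ≤ P.q) (hu : P.BddSolves φ T u) : P.IsMild T φ u := by
  obtain ⟨M, hM, hb⟩ := hu.bounded
  refine hu.toSolves.isMild (S := P.uniform h) rfl rfl rfl rfl hu.initial hM hb hM fun τ hτ i => ?_
  rw [uniform_wn]
  exact hb τ (Ioo_subset_Icc_self hτ)

theorem BddSolves.ae_eq (h : max P.p₁ P.p₂ ≤ P.q) (hu : P.BddSolves φ T u)
    (hv : P.BddSolves φ T v) : ∀ t ∈ Icc 0 T, u t =ᵐ[volume] v t := by
  obtain ⟨M, hM, hbu⟩ := hu.bounded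
  obtain ⟨M', hM', hbv⟩ := hv.bounded
  intro t ht
  rcases ht.1.eq_or_lt with rfl | h0
  · exact hu.initial.trans hv.initial.symm
  refine Scheme.ae_eq_of_solutions (S := P.uniform h) (g := fun t => semigroup t φ) hu.measurable
    hv.measurable (ENNReal.add_ne_top.2 ⟨hM, hM'⟩) (fun τ hτ i => ?_) (fun τ hτ i => ?_)
    (by rw [uniform_duhamel]; exact hu.equation) (by rw [uniform_duhamel]; exact hv.equation)
    t ⟨h0, ht.2⟩
  · rw [uniform_wn]
    exact (hbu τ (Ioo_subset_Icc_self hτ)).trans le_self_add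
  · rw [uniform_wn]
    exact (hbv τ (Ioo_subset_Icc_self hτ)).trans le_add_self

theorem BddSolves.congr (hu : P.BddSolves φ T u) {T' : ℝ} (hT' : 0 ≤ T') (hT : T' ≤ T)
    (hv : Measurable fun a : ℝ × Space N k => v a.1 a.2) (h : ∀ t ∈ Icc 0 T', v t =ᵐ[volume] u t) :
    P.BddSolves φ T' v := by
  obtain ⟨M, hM, hbu⟩ := hu.bounded
  refine ⟨⟨hv, fun t ht => ?_⟩, (h 0 ⟨le_rfl, hT'⟩).trans hu.initial, M, hM, fun t ht => ?_⟩
  · filter_upwards [h t (Ioc_subset_Icc_self ht), hu.equation t ⟨ht.1, ht.2.trans hT⟩] with z h1 h2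
    rw [h1, h2, duhamel_congr hv hu.measurable fun τ hτ => h τ ⟨hτ.1.le, hτ.2.le.trans ht.2⟩]
  · rw [eLpNorm_congr_ae (h t ht)]
    exact hbu t ⟨ht.1, ht.2.trans hT⟩

theorem BddSolves.mono (hu : P.BddSolves φ T u) {T' : ℝ} (hT' : 0 ≤ T') (hT : T' ≤ T) :
    P.BddSolves φ T' u :=
  hu.congr hT' hT hu.measurable fun _ _ => Filter.EventuallyEq.rfl

theorem duhamel_zero (u : ℝ → Space N k → ℝ) (z : Space N k) : P.duhamel u 0 z = 0 := by
  simp [duhamel, duhamelTerm, volterra]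

theorem BddSolves.equation_Icc (hu : P.BddSolves φ T u) {t : ℝ} (ht : t ∈ Icc 0 T) :
    u t =ᵐ[volume] semigroup t φ + P.duhamel u t := by
  rcases ht.1.eq_or_lt with rfl | h0
  · filter_upwards [hu.initial] with z hz
    simp [hz, semigroup, duhamel_zero]
  · exact hu.equation t ⟨h0, ht.2⟩

/-- Bounded solutions are continuous in `L^q`. -/
theorem BddSolves.continuousInLq (h : max P.p₁ P.p₂ ≤ P.q) (hφ : Measurable φ)
    (hφq : eLpNorm φ (ENNReal.ofReal P.q) volume ≠ ∞) (hu : P.BddSolves φ T u) :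
    ContinuousInLq P.q (Icc 0 T) u := by
  obtain ⟨M, hM, hb⟩ := hu.bounded
  have hq0 : 0 < P.q := by linarith [P.one_le_q]
  have hq1 : (1 : ℝ≥0∞) ≤ ENNReal.ofReal P.q := by rw [ENNReal.one_le_ofReal]; exact P.one_le_q
  have hus := fun t => hu.measurable.comp (measurable_prodMk_left (x := t))
  intro t ht
  refine ⟨⟨(hus t).aestronglyMeasurable, (hb t ht).trans_lt (lt_top_iff_ne_top.2 hM)⟩, ?_⟩
  -- For u bounded in L^q the nonlinearity is bounded in L^{q/p}, and q ≥ p makes this a normed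
  -- space to which Minkowski applies.
  have hbound : ∀ p : ℝ, 1 < p → p ≤ P.q → ∀ τ ∈ Ioo 0 T,
      eLpNorm (fun w => power p (u τ w)) (ENNReal.ofReal (P.q / p)) volume ≤
        ENNReal.ofReal p * M ^ (p - 1) * M := fun p hp hpq τ hτ => by
    refine (eLpNorm_power_le hp hpq (hus τ)).trans ?_
    have := hb τ (Ioo_subset_Icc_self hτ)
    have hp1 : 0 ≤ p - 1 := by linarith
    exact mul_le_mul' (mul_le_mul_right (ENNReal.rpow_le_rpow this hp1) _) this
  have hfin : ∀ p : ℝ, 1 < p → ENNReal.ofReal p * M ^ (p - 1) * M ≠ ∞ := fun p hp =>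
    ENNReal.mul_ne_top (ENNReal.mul_ne_top ENNReal.ofReal_ne_top
      (ENNReal.rpow_ne_top_of_nonneg (by linarith) hM)) hM
  have hθ : ∀ p : ℝ, ((N : ℝ) + 2 * k) / 2 * (p - 1) < P.q →
      ((N : ℝ) + 2 * k) / 2 * (1 / (P.q / p) - 1 / P.q) < 1 := fun p hp => by
    rw [one_div_div, ← sub_div, ← mul_div_assoc, div_lt_one hq0]
    exact hp
  have hp₁ := (max_le_iff.1 h).1
  have hp₂ := (max_le_iff.1 h).2
  have hV := tendsto_volterra_kerM P.one_le_N P.one_le_k P.γ_lt_one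
    ((one_le_div (by linarith [P.one_lt_p₁])).2 hp₁) (div_le_self hq0.le P.one_lt_p₁.le)
    (hθ _ P.crit₁) (measurable_power_uncurry hu.measurable P.p₁) (hfin _ P.one_lt_p₁)
    (hbound _ P.one_lt_p₁ hp₁) ht
  have hW := tendsto_volterra_kerH P.one_le_N P.one_le_k
    ((one_le_div (by linarith [P.one_lt_p₂])).2 hp₂) (div_le_self hq0.le P.one_lt_p₂.le)
    (hθ _ P.crit₂) (measurable_power_uncurry hu.measurable P.p₂) (hfin _ P.one_lt_p₂)
    (hbound _ P.one_lt_p₂ hp₂) ht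
  have hS := tendsto_eLpNorm_semigroup_Icc P.one_le_N P.one_le_k P.one_le_q hφ hφq ht
  have hsum := (hS.add (ENNReal.Tendsto.const_mul (a := ‖P.κ₁‖ₑ) hV (Or.inr enorm_ne_top))).add
    (ENNReal.Tendsto.const_mul (a := ‖P.κ₂‖ₑ) hW (Or.inr enorm_ne_top))
  simp only [mul_zero, add_zero] at hsum
  refine tendsto_of_tendsto_of_tendsto_of_le_of_le' tendsto_const_nhds hsum
    (Eventually.of_forall fun _ => zero_le) ?_
  filter_upwards [self_mem_nhdsWithin] with s hs
  set V := volterra (kerM P.γ) fun τ w => power P.p₁ (u τ w) with hVd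
  set W := volterra kerH fun τ w => power P.p₂ (u τ w) with hWd
  have hVm : ∀ s, Measurable (V s) := fun s => (measurable_volterra
    (f := fun τ w => power P.p₁ (u τ w)) (measurable_kerM P.γ) (measurable_power_uncurry hu.measurable P.p₁)).comp (measurable_prodMk_left (x := s))
  have hWm : ∀ s, Measurable (W s) := fun s => (measurable_volterra
    (f := fun τ w => power P.p₂ (u τ w)) measurable_kerH (measurable_power_uncurry hu.measurable P.p₂)).comp (measurable_prodMk_left (x := s))
  have e : u s - u t =ᵐ[volume] (semigroup s φ - semigroup t φ) + P.κ₁ • (V s - V t) +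
      P.κ₂ • (W s - W t) := by
    filter_upwards [hu.equation_Icc hs, hu.equation_Icc ht] with z h1 h2
    simp only [Pi.sub_apply, h1, h2, Pi.add_apply, Pi.smul_apply, smul_eq_mul, duhamel, duhamelTerm]
    ring
  rw [eLpNorm_congr_ae e]
  have hSm := measurable_semigroup_slice hφ
  refine (eLpNorm_add_le (((hSm s).sub (hSm t)).add (((hVm s).sub (hVm t)).const_smul
    P.κ₁)).aestronglyMeasurable (((hWm s).sub (hWm t)).const_smul P.κ₂).aestronglyMeasurable
    hq1).trans (add_le_add ?_ (eLpNorm_const_smul _ _ _ _).le)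
  exact (eLpNorm_add_le ((hSm s).sub (hSm t)).aestronglyMeasurable
    (((hVm s).sub (hVm t)).const_smul P.κ₁).aestronglyMeasurable hq1).trans
    (add_le_add le_rfl (eLpNorm_const_smul _ _ _ _).le)

end Problem

end

end Grushin

namespace Grushin

noncomputable section

variable {N k : ℕ}

/-! ### Continuation -/

/-- The part of a function of time that lives on `(-∞, T]`. -/
def cut (T : ℝ) (u : ℝ → Space N k → ℝ) (τ : ℝ) (w : Space N k) : ℝ := if τ ≤ T then u τ w else 0

theorem measurable_cut (T : ℝ) {u : ℝ → Space N k → ℝ}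
    (hu : Measurable fun a : ℝ × Space N k => u a.1 a.2) :
    Measurable fun a : ℝ × Space N k => cut T u a.1 a.2 :=
  Measurable.ite (measurableSet_le measurable_fst measurable_const) hu measurable_const

theorem cut_of_le {T τ : ℝ} (h : τ ≤ T) (u : ℝ → Space N k → ℝ) : cut T u τ = u τ :=
  funext fun _ => if_pos h

theorem cut_of_lt {T τ : ℝ} (h : T < τ) (u : ℝ → Space N k → ℝ) : cut T u τ = 0 :=
  funext fun _ => if_neg h.not_ge

theorem power_cut (T p : ℝ) (u : ℝ → Space N k → ℝ) (τ : ℝ) (w : Space N k) :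
    power p (cut T u τ w) = cut T (fun τ w => power p (u τ w)) τ w := by
  unfold cut
  split_ifs <;> simp [power_zero]

/-- Splits the past at time T: the history up to T is kept with the kernel at its original age, the
rest is a Volterra operator with the clock reset. It replaces the semigroup law, which `kerM` does
not satisfy. -/
theorem volterra_eq_add_shift {κ : ℝ → Space N k → Space N k → ℝ}
    (hκ : Measurable fun a : ℝ × Space N k × Space N k => κ a.1 a.2.1 a.2.2)
    (hpos : ∀ σ, 0 < σ → ∀ z w, 0 ≤ κ σ z w) {f : ℝ → Space N k → ℝ}
    (hf : Measurable fun a : ℝ × Space N k => f a.1 a.2) {T : ℝ} (hT : 0 ≤ T) {t : ℝ}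
    {z : Space N k} (h : lvolterra κ (fun τ w => ‖f τ w‖ₑ) (T + t) z ≠ ∞) :
    volterra κ f (T + t) z =
      volterra κ (cut T f) (T + t) z + volterra κ (fun τ w => f (T + τ) w) t z := by
  have hc : lvolterra κ (fun τ w => ‖cut T f τ w‖ₑ) (T + t) z ≠ ∞ := by
    refine ne_top_of_le_ne_top h (lintegral_mono fun τ => lintegral_mono fun w =>
      mul_le_mul_right ?_ _)
    dsimp only [cut]
    split_ifs <;> simp
  have hmp : MeasurePreserving ((MeasurableEquiv.addLeft T).prodCongr
      (MeasurableEquiv.refl (Space N k))) volume volume :=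
    (measurePreserving_add_left volume T).prod (MeasurePreserving.id volume)
  rw [← sub_eq_iff_eq_add', volterra_sub hκ hpos hf (measurable_cut T hf) h hc,
    volterra_eq_integral, volterra_eq_integral,
    ← hmp.integral_comp']
  refine integral_congr_ae (ae_of_all _ fun a => ?_)
  change indicator _ _ (T + a.1, a.2) = _
  by_cases h1 : 0 < a.1
  · have e : cut T f (T + a.1) = 0 := cut_of_lt (by linarith) f
    by_cases h2 : a.1 < t
    · rw [indicator_of_mem, indicator_of_mem]
      · simp [e]
      · exact ⟨⟨h1, h2⟩, mem_univ _⟩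
      · exact ⟨⟨by simp; linarith, by simp; linarith⟩, mem_univ _⟩
    · rw [indicator_of_notMem, indicator_of_notMem]
      · exact fun h => h2 h.1.2
      · intro h
        have := h.1.2
        simp at this
        linarith
  · have e : cut T f (T + a.1) = f (T + a.1) := cut_of_le (by linarith) f
    rw [indicator_of_notMem (s := Ioo 0 t ×ˢ univ) (fun h => h1 h.1.1)]
    simp [indicator, e]

namespace Problem

variable {P : Problem N k}

theorem duhamel_eq_add_shift (h : max P.p₁ P.p₂ ≤ P.q) {v : ℝ → Space N k → ℝ}
    (hv : Measurable fun a : ℝ × Space N k => v a.1 a.2) {M : ℝ≥0∞} (hM : M ≠ ∞) {T t : ℝ}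
    (hT : 0 ≤ T) (ht : 0 < t)
    (hb : ∀ τ ∈ Ioo 0 (T + t), eLpNorm (v τ) (ENNReal.ofReal P.q) volume ≤ M) :
    ∀ᵐ z, P.duhamel v (T + t) z =
      P.duhamel (cut T v) (T + t) z + P.duhamel (fun τ => v (T + τ)) t z := by
  have hfin := Scheme.ae_lvolterra_ne_top (S := P.uniform h) hv hM (by linarith : 0 < T + t)
    (fun τ hτ i => (uniform_wn h _ _ _).trans_le (hb τ hτ))
  filter_upwards [hfin 0, hfin 1] with z h1 h2
  have e1 := volterra_eq_add_shift (f := fun τ w => power P.p₁ (v τ w)) (measurable_kerM P.γ) ((P.uniform h).ker_nonneg 0)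
    (measurable_power_uncurry hv P.p₁) hT h1.ne
  have e2 := volterra_eq_add_shift (f := fun τ w => power P.p₂ (v τ w)) measurable_kerH ((P.uniform h).ker_nonneg 1)
    (measurable_power_uncurry hv P.p₂) hT h2.ne
  simp only [duhamel, duhamelTerm, power_cut]
  linear_combination P.κ₁ * e1 + P.κ₂ * e2

/-- Solutions can be continued by a time that only depends on a bound for the solution and on a bound
for its time of existence. -/
theorem exists_extension (P : Problem N k) (h : max P.p₁ P.p₂ ≤ P.q) {φ : Space N k → ℝ}
    (hφ : Measurable φ)
    (hφq : eLpNorm φ (ENNReal.ofReal P.q) volume ≠ ∞) {M : ℝ≥0∞} (hM : M ≠ ∞) (T₁ : ℝ) :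
    ∃ δ : ℝ, 0 < δ ∧ ∀ (T : ℝ) (u : ℝ → Space N k → ℝ), 0 < T → T ≤ T₁ → P.BddSolves φ T u →
      (∀ t ∈ Icc 0 T, eLpNorm (u t) (ENNReal.ofReal P.q) volume ≤ M) →
      ∃ v, P.BddSolves φ (T + δ) v := by
  -- The history is evaluated at times up to T + δ ≤ T₁ + 1, because δ is taken at most 1.
  obtain ⟨K, hK, hKb⟩ := (P.uniform h).wn_diffBound_zero_le hM (T₁ + 1)
  set G := eLpNorm φ (ENNReal.ofReal P.q) volume + K with hG
  have hGt : G ≠ ∞ := ENNReal.add_ne_top.2 ⟨hφq, hK⟩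
  have h2G : 2 * G ≠ ∞ := ENNReal.mul_ne_top (by simp) hGt
  obtain ⟨δ₀, hδ₀, hcon⟩ := (P.uniform h).exists_isContractionTime h2G
  refine ⟨min δ₀ 1, lt_min hδ₀ one_pos, fun T u hT hTT₁ hu hb => ?_⟩
  set δ := min δ₀ 1 with hδ
  have hcm := measurable_cut T hu.measurable
  -- After shifting time by T, the linear flow from the original datum and the contribution of the
  -- history together form the forcing term of a new Volterra equation. Its bound G depends only on
  -- φ, M and T₁, so the contraction time does too.
  set g : ℝ → Space N k → ℝ := fun t z => semigroup (T + t) φ z + P.duhamel (cut T u) (T + t) z with hg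
  have hgm : Measurable fun a : ℝ × Space N k => g a.1 a.2 :=
    ((measurable_semigroup hφ).comp (f := fun a : ℝ × Space N k => (T + a.1, a.2))
      (by fun_prop)).add ((measurable_duhamel hcm).comp
      (f := fun a : ℝ × Space N k => (T + a.1, a.2)) (by fun_prop))
  have hcb : ∀ τ, 0 ≤ τ → eLpNorm (cut T u τ) (ENNReal.ofReal P.q) volume ≤ M := fun τ hτ => by
    rcases le_or_gt τ T with hτT | hτT
    · rw [cut_of_le hτT]
      exact hb τ ⟨hτ, hτT⟩
    · rw [cut_of_lt hτT, eLpNorm_zero]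
      exact zero_le
  have hgG : ∀ t ∈ Ioc 0 δ, ∀ j, (P.uniform h).wn j t (g t) ≤ G := fun t ht j => by
    have ht1 : t ≤ 1 := ht.2.trans (min_le_right _ _)
    have hTt : 0 < T + t := by linarith [ht.1]
    have h1 := eLpNorm_semigroup_le_self P.one_le_N P.one_le_k P.one_le_q hTt.le hφ
    have h2 := hKb (cut T u) (T + t) hcm hTt (by linarith)
      (fun τ hτ i => (uniform_wn h _ _ _).trans_le (hcb τ hτ.1.le)) j
    have h3 : (P.uniform h).wn j (T + t) (g t) ≤
        (P.uniform h).wn j (T + t) (semigroup (T + t) φ) +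
        (P.uniform h).wn j (T + t) ((P.uniform h).diffBound (cut T u) 0 (T + t)) := by
      have hz : Measurable fun a : ℝ × Space N k => (0 : ℝ → Space N k → ℝ) a.1 a.2 :=
        measurable_const
      refine Scheme.wn_le_add (measurable_semigroup_slice hφ _).enorm.aemeasurable
        (Scheme.measurable_diffBound hcm hz _).enorm.aemeasurable (ae_of_all _ fun z => ?_)
      rw [hg, ← uniform_duhamel h]
      exact (enorm_add_le _ _).trans (add_le_add le_rfl (Scheme.enorm_duhamel_le hcm _ z))
    rw [uniform_wn] at h3 ⊢
    exact h3.trans (add_le_add ((uniform_wn h _ _ _).trans_le h1) h2)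
  obtain ⟨v', hvm, hveq, hvb, -⟩ := (hcon.mono (min_le_left _ _)).exists_solution hGt hgm hgG
  set v : ℝ → Space N k → ℝ := fun t z => if t ≤ T then u t z else v' (t - T) z with hv
  have hv1 : ∀ t ≤ T, v t = u t := fun t ht => funext fun z => if_pos ht
  have hv2 : ∀ t, T < t → v t = v' (t - T) := fun t ht => funext fun z => if_neg ht.not_ge
  have hvmeas : Measurable fun a : ℝ × Space N k => v a.1 a.2 :=
    Measurable.ite (measurableSet_le measurable_fst measurable_const) hu.measurable
      (hvm.comp (f := fun a : ℝ × Space N k => (a.1 - T, a.2)) (by fun_prop))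
  have hvM : ∀ t ∈ Icc 0 (T + δ), eLpNorm (v t) (ENNReal.ofReal P.q) volume ≤ M + 2 * G :=
    fun t ht => by
      rcases le_or_gt t T with htT | htT
      · rw [hv1 t htT]
        exact (hb t ⟨ht.1, htT⟩).trans le_self_add
      · rw [hv2 t htT, ← uniform_wn h 0 (t - T)]
        exact (hvb _ ⟨sub_pos.2 htT, by linarith [ht.2]⟩ 0).trans le_add_self
  have hMG : M + 2 * G ≠ ∞ := ENNReal.add_ne_top.2 ⟨hM, h2G⟩
  refine ⟨v, ⟨⟨hvmeas, fun t ht => ?_⟩, ?_, M + 2 * G, hMG, hvM⟩⟩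
  · rcases le_or_gt t T with htT | htT
    · rw [hv1 t htT]
      filter_upwards [hu.equation t ⟨ht.1, htT⟩] with z hz
      rw [hz, duhamel_congr hvmeas hu.measurable fun τ hτ => by rw [hv1 τ (hτ.2.le.trans htT)]]
    · obtain ⟨s, rfl⟩ : ∃ s, t = T + s := ⟨t - T, by ring⟩
      have hs : 0 < s := by linarith
      have hs' : s ≤ δ := by linarith [ht.2]
      filter_upwards [hveq s ⟨hs, hs'⟩, duhamel_eq_add_shift h hvmeas hMG hT.le hs
        fun τ hτ => hvM τ ⟨hτ.1.le, hτ.2.le.trans ht.2⟩] with z h1 h2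
      have e1 : P.duhamel (cut T v) (T + s) z = P.duhamel (cut T u) (T + s) z := by
        congr 1
        funext τ w
        unfold cut
        split_ifs with hτ
        · rw [hv1 τ hτ]
        · rfl
      have hsm : Measurable fun a : ℝ × Space N k => (fun τ => v (T + τ)) a.1 a.2 :=
        hvmeas.comp (f := fun a : ℝ × Space N k => (T + a.1, a.2)) (by fun_prop)
      have e2 : P.duhamel (fun τ => v (T + τ)) s z = P.duhamel v' s z :=
        duhamel_congr hsm hvm (fun τ hτ => by
          simp only [hv2 (T + τ) (by linarith [hτ.1]), add_sub_cancel_left]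
          rfl) z
      rw [h2, e1, e2, hv2 _ htT, add_sub_cancel_left, h1, uniform_duhamel, hg]
      ring
  · rw [hv1 0 hT.le]
    exact hu.initial

end Problem

end

end Grushin

namespace Grushin

noncomputable section

variable {N k : ℕ}

/-! ### The maximal solution -/

namespace Problem

variable {P : Problem N k} {φ : Space N k → ℝ}

theorem exists_bddSolves (hφ : Measurable φ)
    (hφq : eLpNorm φ (ENNReal.ofReal P.q) volume ≠ ∞) :
    ∃ T : ℝ, 0 < T ∧ ∃ u, P.BddSolves φ T u := by
  obtain ⟨u, hu, hu0, hb, -⟩ := exists_solves (P := P) hφ (ENNReal.ofReal_toReal hφq).ge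
  have hmild := hu.isMild_of_weighted hu0.eventuallyEq hφq (radius_ne_top _) hb
  obtain ⟨v, hv, -⟩ := hmild.exists_bddSolves (time_pos _).le hφ
  exact ⟨_, time_pos _, v, hv⟩

/-- The supremum of the times of existence. -/
def maxTime (P : Problem N k) (φ : Space N k → ℝ) : ℝ≥0∞ :=
  sSup (ENNReal.ofReal '' {T | 0 < T ∧ ∃ u, P.BddSolves φ T u})

theorem le_maxTime {T : ℝ} (hT : 0 < T) {u : ℝ → Space N k → ℝ} (hu : P.BddSolves φ T u) :
    ENNReal.ofReal T ≤ P.maxTime φ := le_sSup ⟨T, ⟨hT, u, hu⟩, rfl⟩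

/-- The supremum is not attained, since every bounded solution on a closed interval can be
continued. -/
theorem lt_maxTime (h : max P.p₁ P.p₂ ≤ P.q) (hφ : Measurable φ)
    (hφq : eLpNorm φ (ENNReal.ofReal P.q) volume ≠ ∞) {T : ℝ} (hT : 0 < T) {u : ℝ → Space N k → ℝ}
    (hu : P.BddSolves φ T u) : ENNReal.ofReal T < P.maxTime φ := by
  obtain ⟨M, hM, hb⟩ := hu.bounded
  obtain ⟨δ, hδ, hext⟩ := P.exists_extension h hφ hφq hM T
  obtain ⟨v, hv⟩ := hext T u hT le_rfl hu hb
  exact ((ENNReal.ofReal_lt_ofReal_iff (by linarith)).2 (lt_add_of_pos_right T hδ)).trans_le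
    (le_maxTime (by linarith) hv)

/-- A function that agrees with all bounded solutions. -/
theorem exists_maximal (h : max P.p₁ P.p₂ ≤ P.q) (hφ : Measurable φ)
    (hφq : eLpNorm φ (ENNReal.ofReal P.q) volume ≠ ∞) :
    ∃ w : ℝ → Space N k → ℝ, ∀ T : ℝ, 0 ≤ T → ENNReal.ofReal T < P.maxTime φ →
      P.BddSolves φ T w := by
  obtain ⟨T₀, hT₀, u₀, hu₀⟩ := exists_bddSolves (P := P) hφ hφq
  obtain ⟨s, -, hslim, hs⟩ := exists_seq_tendsto_sSup
    (S := ENNReal.ofReal '' {T | 0 < T ∧ ∃ u, P.BddSolves φ T u}) ⟨_, T₀, ⟨hT₀, u₀, hu₀⟩, rfl⟩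
    (OrderTop.bddAbove _)
  choose T hT hTs using hs
  choose hTpos U hU using hT
  have hex : ∀ a : ℝ × Space N k, ∃ n, a.1 ≤ T n ∨ ∀ m, T m < a.1 := fun a => by
    by_cases h : ∃ n, a.1 ≤ T n
    · exact h.imp fun n hn => Or.inl hn
    · exact ⟨0, Or.inr fun m => not_le.1 fun hm => h ⟨m, hm⟩⟩
  classical
  set w : ℝ → Space N k → ℝ := fun t z => U (Nat.find (hex (t, z))) t z with hw
  have hpm : ∀ n, MeasurableSet {a : ℝ × Space N k | a.1 ≤ T n ∨ ∀ m, T m < a.1} := fun n => by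
    rw [ofPred_or, ofPred_forall]
    exact (measurableSet_le measurable_fst measurable_const).union
      (MeasurableSet.iInter fun m => measurableSet_lt measurable_const measurable_fst)
  have hwm : Measurable fun a : ℝ × Space N k => w a.1 a.2 :=
    Measurable.find (f := fun n (a : ℝ × Space N k) => U n a.1 a.2) (fun n => (hU n).measurable)
      hpm hex
  refine ⟨w, fun T' hT' hlt => ?_⟩
  obtain ⟨n, hn⟩ := (hslim.eventually (lt_mem_nhds hlt)).exists
  rw [← hTs n, ENNReal.ofReal_lt_ofReal_iff (hTpos n)] at hn
  refine (hU n).congr hT' hn.le hwm fun t ht => ?_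
  have htn : t ≤ T n := ht.2.trans hn.le
  set m := Nat.find (hex (t, 0)) with hm
  have hwt : w t = U m t := rfl
  have htm : t ≤ T m := (Nat.find_spec (hex (t, 0))).resolve_right fun h => (h n).not_ge htn
  rw [hwt]
  have h1 := (hU m).mono (T' := min (T m) (T n)) (le_min (hTpos m).le (hTpos n).le) (min_le_left _ _)
  have h2 := (hU n).mono (T' := min (T m) (T n)) (le_min (hTpos m).le (hTpos n).le) (min_le_right _ _)
  exact h1.ae_eq h h2 t ⟨ht.1, le_min htm htn⟩

theorem exists_gt_of_lt_maxTime {t : ℝ} (ht : ENNReal.ofReal t < P.maxTime φ) :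
    ∃ T, t < T ∧ 0 < T ∧ ∃ u, P.BddSolves φ T u := by
  obtain ⟨-, ⟨T, ⟨hT, u, hu⟩, rfl⟩, hlt⟩ := lt_sSup_iff.1 ht
  exact ⟨T, (ENNReal.ofReal_lt_ofReal_iff hT).1 hlt, hT, u, hu⟩

theorem isMaximalSolution (h : max P.p₁ P.p₂ ≤ P.q) (hφ : Measurable φ)
    (hφq : eLpNorm φ (ENNReal.ofReal P.q) volume ≠ ∞) {w : ℝ → Space N k → ℝ}
    (hw : ∀ T : ℝ, 0 ≤ T → ENNReal.ofReal T < P.maxTime φ → P.BddSolves φ T w) :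
    IsMaximalSolution P.γ P.κ₁ P.κ₂ P.p₁ P.p₂ P.q φ (P.maxTime φ) w := by
  obtain ⟨T₀, hT₀, u₀, hu₀⟩ := exists_bddSolves (P := P) hφ hφq
  have hpos : 0 < P.maxTime φ := (ENNReal.ofReal_pos.2 hT₀).trans_le (le_maxTime hT₀ hu₀)
  refine ⟨hpos, (hw 0 le_rfl (by simpa using hpos)).initial, fun t ht => ?_, fun T hT hlt =>
    (hw T hT.le hlt).isMild h, fun T v hT hv _ => ?_⟩
  · obtain ⟨T, htT, hT, u, hu⟩ := exists_gt_of_lt_maxTime ht.2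
    obtain ⟨h1, h2⟩ := (hw T hT.le (lt_maxTime h hφ hφq hT hu)).continuousInLq h hφ hφq t
      ⟨ht.1, htT.le⟩
    refine ⟨h1, h2.mono_left (nhdsWithin_le_iff.2 ?_)⟩
    filter_upwards [self_mem_nhdsWithin, mem_nhdsWithin_of_mem_nhds (Iio_mem_nhds htT)] with s h1 h2
    exact ⟨h1.1, le_of_lt h2⟩
  · obtain ⟨v', hv', hvv⟩ := IsMild.exists_bddSolves (P := P) hT.le hφ hv
    have hlt := lt_maxTime h hφ hφq hT hv'
    exact ⟨hlt, fun t ht => (hvv t ht).trans (hv'.ae_eq h (hw T hT.le hlt) t ht)⟩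

/-- An essential bound is a bound for a continuous curve. -/
theorem eLpNorm_le_of_ae_le {q : ℝ} (hq : 1 ≤ q) {w : ℝ → Space N k → ℝ}
    (hw : Measurable fun a : ℝ × Space N k => w a.1 a.2) {T : ℝ}
    (hc : ContinuousInLq q (Icc 0 T) w) {x : ℝ≥0∞} (hx : ∀ᵐ s ∂(volume.restrict (Ioo 0 T)),
      eLpNorm (w s) (ENNReal.ofReal q) volume ≤ x) {s : ℝ} (hs : s ∈ Ioo 0 T) :
    eLpNorm (w s) (ENNReal.ofReal q) volume ≤ x := by
  have hq1 : (1 : ℝ≥0∞) ≤ ENNReal.ofReal q := by rwa [ENNReal.one_le_ofReal]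
  have hwm := fun t => (hw.comp (measurable_prodMk_left (x := t))).aestronglyMeasurable (μ := volume)
  have hdense := Measure.dense_of_ae ((ae_restrict_iff' measurableSet_Ioo).1 hx)
  refine ENNReal.le_of_forall_pos_le_add fun ε hε _ => ?_
  have hlim := (hc s (Ioo_subset_Icc_self hs)).2
  rw [nhdsWithin_eq_nhds.2 (Icc_mem_nhds hs.1 hs.2)] at hlim
  have hev := (hlim.eventually (ge_mem_nhds (ENNReal.coe_pos.2 hε))).and (Ioo_mem_nhds hs.1 hs.2)
  obtain ⟨V, hV, hVo, hsV⟩ := mem_nhds_iff.1 hev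
  obtain ⟨r, hrV, hr⟩ := hdense.inter_open_nonempty V hVo ⟨s, hsV⟩
  obtain ⟨h1, h2⟩ := hV hrV
  have e : w s = w r - (w r - w s) := by abel
  rw [e]
  exact (eLpNorm_sub_le (hwm r) ((hwm r).sub (hwm s)) hq1).trans (add_le_add (hr h2) h1)

/-- The blow-up alternative. -/
theorem tendsto_essSup (h : max P.p₁ P.p₂ ≤ P.q) (hφ : Measurable φ)
    (hφq : eLpNorm φ (ENNReal.ofReal P.q) volume ≠ ∞) {w : ℝ → Space N k → ℝ}
    (hw : ∀ T : ℝ, 0 ≤ T → ENNReal.ofReal T < P.maxTime φ → P.BddSolves φ T w)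
    (hfin : P.maxTime φ < ∞) :
    Tendsto (fun t : ℝ => essSup (fun s => eLpNorm (w s) (ENNReal.ofReal P.q) volume)
      (volume.restrict (Ioo 0 t))) (𝓝[<] (P.maxTime φ).toReal) (𝓝 ∞) := by
  set L := (P.maxTime φ).toReal with hL
  have hlt : ∀ {t : ℝ}, t < L → 0 ≤ t → ENNReal.ofReal t < P.maxTime φ := fun ht h0 =>
    (ENNReal.ofReal_lt_iff_lt_toReal h0 hfin.ne).2 ht
  have hpos : 0 < P.maxTime φ := (isMaximalSolution h hφ hφq hw).pos
  have hL0 : 0 < L := ENNReal.toReal_pos hpos.ne' hfin.ne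
  rw [ENNReal.tendsto_nhds_top_iff_nnreal]
  intro x
  -- The essential supremum increases with t, so exceeding x once is enough. If it never does, the
  -- solution is bounded on [0, L) and can be continued beyond L.
  by_cases hx : ∃ t₀ < L, (x : ℝ≥0∞) < essSup (fun s => eLpNorm (w s) (ENNReal.ofReal P.q) volume)
      (volume.restrict (Ioo 0 t₀))
  · obtain ⟨t₀, ht₀, hx⟩ := hx
    filter_upwards [Ioo_mem_nhdsLT ht₀] with t ht
    exact hx.trans_le (essSup_mono_measure
      (Measure.restrict_mono (Ioo_subset_Ioo_right ht.1.le) le_rfl).absolutelyContinuous)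
  push Not at hx
  exfalso
  set M : ℝ≥0∞ := max x (eLpNorm φ (ENNReal.ofReal P.q) volume) with hM
  have hMt : M ≠ ∞ := (max_lt ENNReal.coe_lt_top (lt_top_iff_ne_top.2 hφq)).ne
  have hb : ∀ t, 0 ≤ t → t < L → eLpNorm (w t) (ENNReal.ofReal P.q) volume ≤ M := by
    intro t h0 htL
    rcases h0.eq_or_lt with rfl | h0
    · rw [eLpNorm_congr_ae (hw 0 le_rfl (hlt htL le_rfl)).initial]
      exact le_max_right _ _
    obtain ⟨T, htT, hTL⟩ := exists_between htL
    have hwT := hw T (h0.trans htT).le (hlt hTL (h0.trans htT).le)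
    refine (eLpNorm_le_of_ae_le P.one_le_q hwT.measurable (hwT.continuousInLq h hφ hφq) ?_
      ⟨h0, htT⟩).trans (le_max_left _ _)
    filter_upwards [ae_le_essSup (f := fun s => eLpNorm (w s) (ENNReal.ofReal P.q) volume)] with s hs
    exact hs.trans (hx T hTL)
  obtain ⟨δ, hδ, hext⟩ := P.exists_extension h hφ hφq hMt L
  -- A positive time below L from which an extension by δ passes L.
  set T := max (L / 2) (L - δ / 2) with hT
  have hTL : T < L := max_lt (by linarith) (by linarith)
  have hT0 : 0 < T := lt_max_of_lt_left (by linarith)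
  have hTδ : L < T + δ := by linarith [le_max_right (L / 2) (L - δ / 2)]
  obtain ⟨v, hv⟩ := hext T w hT0 hTL.le (hw T hT0.le (hlt hTL hT0.le))
    fun t ht => hb t ht.1 (ht.2.trans_lt hTL)
  have hle := le_maxTime (by linarith : 0 < T + δ) hv
  rw [ENNReal.ofReal_le_iff_le_toReal hfin.ne] at hle
  exact hTδ.not_ge hle

end Problem

end

end Grushin

/-! ### Initial data in `Lp`, and the main theorem -/

namespace Grushin

noncomputable section

variable {N k : ℕ}

theorem eLpNorm_coeFn_Lp {q : ℝ} (u : Lp ℝ (ENNReal.ofReal q) (volume : Measure (Space N k))) :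
    eLpNorm u (ENNReal.ofReal q) volume = ENNReal.ofReal ‖u‖ := by
  rw [Lp.norm_def, ENNReal.ofReal_toReal (Lp.eLpNorm_ne_top u)]

theorem measurable_coeFn_Lp {q : ℝ} (u : Lp ℝ (ENNReal.ofReal q) (volume : Measure (Space N k))) :
    Measurable u := (Lp.stronglyMeasurable u).measurable

theorem eLpNorm_coeFn_sub_Lp {q : ℝ}
    (u v : Lp ℝ (ENNReal.ofReal q) (volume : Measure (Space N k))) :
    eLpNorm (⇑u - ⇑v) (ENNReal.ofReal q) volume = ENNReal.ofReal ‖u - v‖ := by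
  rw [← eLpNorm_coeFn_Lp, eLpNorm_congr_ae (Lp.coeFn_sub u v)]

theorem ContinuousInLq.congr {q : ℝ} {I : Set ℝ} {u v : ℝ → Space N k → ℝ}
    (hu : ContinuousInLq q I u)
    (h : ∀ t ∈ I, v t =ᵐ[volume] u t) : ContinuousInLq q I v := fun t ht => by
  obtain ⟨h1, h2⟩ := hu t ht
  refine ⟨h1.ae_eq (h t ht).symm, h2.congr' ?_⟩
  filter_upwards [self_mem_nhdsWithin] with s hs
  exact eLpNorm_congr_ae ((h s hs).symm.sub (h t ht).symm)

namespace Problem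

variable {P : Problem N k} {φ : Space N k → ℝ} {u v : ℝ → Space N k → ℝ} {T : ℝ}

theorem IsMild.ae_eq_of_memX (hT : 0 ≤ T) (hφ : Measurable φ) (hu : P.IsMild T φ u)
    (huX : MemX P.p₁ P.p₂ P.q T u) (hv : P.IsMild T φ v) (hvX : MemX P.p₁ P.p₂ P.q T v) :
    ∀ t ∈ Icc 0 T, u t =ᵐ[volume] v t := by
  obtain ⟨u', hu', huu, hbu⟩ := hu.exists_solves_wn_le hφ
  obtain ⟨v', hv', hvv, hbv⟩ := hv.exists_solves_wn_le hφ
  intro t ht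
  rcases ht.1.eq_or_lt with rfl | h0
  · exact (hu.initial hT).trans (hv.initial hT).symm
  · exact (huu t ht).trans ((hu'.ae_eq_of_weighted hv' huX.normX_lt_top.ne hvX.normX_lt_top.ne
      hbu hbv t ⟨h0, ht.2⟩).trans (hvv t ht).symm)

theorem IsMild.ae_eq (h : max P.p₁ P.p₂ ≤ P.q) (hT : 0 ≤ T) (hφ : Measurable φ)
    (hu : P.IsMild T φ u) (hv : P.IsMild T φ v) : ∀ t ∈ Icc 0 T, u t =ᵐ[volume] v t := by
  obtain ⟨u', hu', huu⟩ := hu.exists_bddSolves hT hφ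
  obtain ⟨v', hv', hvv⟩ := hv.exists_bddSolves hT hφ
  exact fun t ht => (huu t ht).trans ((hu'.ae_eq h hv' t ht).trans (hvv t ht).symm)

theorem IsMild.continuousInLq (h : max P.p₁ P.p₂ ≤ P.q) (hT : 0 ≤ T) (hφ : Measurable φ)
    (hφq : eLpNorm φ (ENNReal.ofReal P.q) volume ≠ ∞) (hu : P.IsMild T φ u) :
    ContinuousInLq P.q (Icc 0 T) u := by
  obtain ⟨u', hu', huu⟩ := hu.exists_bddSolves hT hφ
  exact (hu'.continuousInLq h hφ hφq).congr huu

end Problem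

end

end Grushin

theorem theorem3p1 (N k : ℕ) (hN : 1 ≤ N) (hk : 1 ≤ k) (γ κ₁ κ₂ p₁ p₂ q : ℝ)
    (hγ : γ < 1) (hp₁ : 1 < p₁) (hp₂ : 1 < p₂) (hq : 1 ≤ q)
    (hcrit : max (((N : ℝ) + 2 * k) / 2 * (p₁ - 1)) (((N : ℝ) + 2 * k) / 2 * (p₂ - 1)) < q) :
    ∃ C : ℝ, 0 < C ∧
    ∃ T : Lp ℝ (ENNReal.ofReal q) (volume : Measure (Grushin.Space N k)) → ℝ,
      -- existence, and the properties of the solution starting at `u₀`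
      (∀ u₀ : Lp ℝ (ENNReal.ofReal q) (volume : Measure (Grushin.Space N k)),
        0 < T u₀ ∧
        ∃ u : ℝ → Grushin.Space N k → ℝ,
          Grushin.IsMildSolution γ κ₁ κ₂ p₁ p₂ q (T u₀) u₀ u ∧
          Grushin.MemX p₁ p₂ q (T u₀) u ∧
          -- uniqueness in `X_T`
          (∀ v : ℝ → Grushin.Space N k → ℝ,
            Grushin.IsMildSolution γ κ₁ κ₂ p₁ p₂ q (T u₀) u₀ v →
            Grushin.MemX p₁ p₂ q (T u₀) v →
            ∀ t ∈ Icc 0 (T u₀), v t =ᵐ[volume] u t) ∧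
          -- decay at `t = 0`
          (Tendsto (fun t => Grushin.weightedNorm p₁ q t (u t)) (𝓝[>] 0) (𝓝 0) ∧
            Tendsto (fun t => Grushin.weightedNorm p₂ q t (u t)) (𝓝[>] 0) (𝓝 0)) ∧
          -- uniqueness in `C([0,T]; L^q)`, maximal solution, blow-up alternative
          (max p₁ p₂ ≤ q →
            Grushin.ContinuousInLq q (Icc 0 (T u₀)) u ∧
            (∀ v : ℝ → Grushin.Space N k → ℝ,
              Grushin.IsMildSolution γ κ₁ κ₂ p₁ p₂ q (T u₀) u₀ v →
              Grushin.ContinuousInLq q (Icc 0 (T u₀)) v →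
              ∀ t ∈ Icc 0 (T u₀), v t =ᵐ[volume] u t) ∧
            ∃ (Tmax : ℝ≥0∞) (w : ℝ → Grushin.Space N k → ℝ),
              Grushin.IsMaximalSolution γ κ₁ κ₂ p₁ p₂ q u₀ Tmax w ∧
              (Tmax = ∞ ∨
                (Tmax < ∞ ∧
                  Tendsto (fun t : ℝ =>
                      essSup (fun s => eLpNorm (w s) (ENNReal.ofReal q) volume)
                        (volume.restrict (Ioo 0 t)))
                    (𝓝[<] Tmax.toReal) (𝓝 ∞)))) ∧
          -- nonnegativity
          (0 ≤ᵐ[volume] (u₀ : Grushin.Space N k → ℝ) → 0 ≤ κ₁ → 0 ≤ κ₂ →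
            ∀ t ∈ Icc 0 (T u₀), 0 ≤ᵐ[volume] u t)) ∧
      -- Lipschitz continuous dependence on the initial condition
      (∀ (u₀ v₀ : Lp ℝ (ENNReal.ofReal q) (volume : Measure (Grushin.Space N k)))
        (u v : ℝ → Grushin.Space N k → ℝ),
        Grushin.IsMildSolution γ κ₁ κ₂ p₁ p₂ q (min (T u₀) (T v₀)) u₀ u →
        Grushin.MemX p₁ p₂ q (min (T u₀) (T v₀)) u →
        Grushin.IsMildSolution γ κ₁ κ₂ p₁ p₂ q (min (T u₀) (T v₀)) v₀ v →
        Grushin.MemX p₁ p₂ q (min (T u₀) (T v₀)) v →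
        (⨆ t ∈ Icc 0 (min (T u₀) (T v₀)),
            eLpNorm (u t - v t) (ENNReal.ofReal q) volume) +
          max
            (⨆ t ∈ Ioo 0 (min (T u₀) (T v₀)), Grushin.weightedNorm p₁ q t (u t - v t))
            (⨆ t ∈ Ioo 0 (min (T u₀) (T v₀)), Grushin.weightedNorm p₂ q t (u t - v t))
          ≤ ENNReal.ofReal (C * ‖u₀ - v₀‖)) := by
  have hcrit' := max_lt_iff.1 hcrit
  let P : Grushin.Problem N k := ⟨γ, κ₁, κ₂, p₁, p₂, q, hN, hk, hγ, hp₁, hp₂, hq, hcrit'.1, hcrit'.2⟩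
  have hlin : 1 ≤ P.linConst := Grushin.Problem.one_le_linConst
  -- The existence time depends on the datum only through its norm; the constant depends only on the
  -- linear flow.
  refine ⟨4 * P.linConst, by linarith, fun u₀ => P.time ‖u₀‖, fun u₀ => ?_, fun u₀ v₀ u v hu huX hv hvX => ?_⟩
  · have hT := Grushin.Problem.time_pos (P := P) ‖u₀‖
    have hφ := Grushin.measurable_coeFn_Lp u₀
    have hφn := Grushin.eLpNorm_coeFn_Lp u₀
    have hφq : eLpNorm u₀ (ENNReal.ofReal P.q) volume ≠ ∞ := Lp.eLpNorm_ne_top u₀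
    obtain ⟨u, hu, hu0, hb, hnonneg⟩ := Grushin.Problem.exists_solves (P := P) hφ hφn.le
    have hR := Grushin.Problem.radius_ne_top (P := P) ‖u₀‖
    have hmild := hu.isMild_of_weighted hu0.eventuallyEq hφq hR hb
    have hX := Grushin.Problem.memX_of_wn_le hu.measurable hR fun t ht => hb t (Ioo_subset_Ioc_self ht)
    have hdecay := hu.tendsto_wn hT hφ hφq hR fun τ hτ i => hb τ (Ioo_subset_Ioc_self hτ) i.succ
    refine ⟨hT, u, hmild, hX, fun v hv hvX => Grushin.Problem.IsMild.ae_eq_of_memX (P := P) hT.le hφ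
      hv hvX hmild hX, ⟨hdecay 0, hdecay 1⟩, fun h => ⟨hmild.continuousInLq h hT.le hφ hφq,
      fun v hv _ => Grushin.Problem.IsMild.ae_eq (P := P) h hT.le hφ hv hmild, ?_⟩,
      fun h0 h1 h2 t ht => ?_⟩
    · obtain ⟨w, hw⟩ := Grushin.Problem.exists_maximal (P := P) h hφ hφq
      refine ⟨P.maxTime u₀, w, Grushin.Problem.isMaximalSolution h hφ hφq hw, ?_⟩
      rcases eq_or_ne (P.maxTime u₀) ∞ with hinf | hfin
      · exact Or.inl hinf
      · have hlt := lt_top_iff_ne_top.2 hfin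
        exact Or.inr ⟨hlt, Grushin.Problem.tendsto_essSup h hφ hφq hw hlt⟩
    · rcases ht.1.eq_or_lt with rfl | ht0
      · rw [hu0]
        exact h0
      · exact ae_of_all _ (hnonneg h0 h1 h2 t ht0)
  · have hφ := Grushin.measurable_coeFn_Lp u₀
    have hψ := Grushin.measurable_coeFn_Lp v₀
    have hφn := (Grushin.eLpNorm_coeFn_Lp u₀).le
    have hψn := (Grushin.eLpNorm_coeFn_Lp v₀).le
    have hT := lt_min (Grushin.Problem.time_pos (P := P) ‖u₀‖) (Grushin.Problem.time_pos (P := P) ‖v₀‖)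
    rw [ENNReal.ofReal_mul (by linarith), ← Grushin.eLpNorm_coeFn_sub_Lp]
    -- Both data lie in the ball of the larger norm, and the minimum of the two times is at most the
    -- time chosen for that norm; monotonicity of the chosen time in the norm is not needed.
    rcases le_total ‖u₀‖ ‖v₀‖ with hle | hle
    · exact Grushin.Problem.dist_le (P := P) hφ hψ (hφn.trans (ENNReal.ofReal_le_ofReal hle)) hψn hT
        (min_le_right _ _) hu huX hv hvX
    · exact Grushin.Problem.dist_le (P := P) hφ hψ hφn (hψn.trans (ENNReal.ofReal_le_ofReal hle)) hT
        (min_le_left _ _) hu huX hv hvX
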